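/- Let $k$ be a field of characteristic zero, $A=(a_{ij})_{i,j\in I}$ a generalised Cartan matrix ($I$ finite, $a_{ii}=2$, $a_{ij}\in\mathbb Z_{\le 0}$ for $i\ne j$, $a_{ij}=0\Rightarrow a_{ji}=0$), and $d_i\in k^\times$ such that $a_{ij}d_j=a_{ji}d_i$. **Extended Kac–Moody algebra.** Let $\bar{\mathfrak h}$ be the vector space with basis $\{h_i,\lambda_i^\vee\}_{i\in I}$, let $\alpha_i\in\bar{\mathfrak h}^*$ be given by $\alpha_i(h_j)=a_{ji}$, $\alpha_i(\lambda_j^\vee)=\delta_{ij}$, and let $\bar{\mathfrak g}$ be the Lie algebra generated by $\bar{\mathfrak h}$, $e_i,f_i$ ($i\in I$) with relations $[h,h']=0$, $[h,e_i]=\alpha_i(h)e_i$, $[h,f_i]=-\alpha_i(h)f_i$, $[e_i,f_j]=\delta_{ij}h_i$, modulo the sum of all ideals intersecting $\bar{\mathfrak h}$ trivially. For $B\subseteq I$ let $\bar{\mathfrak h}_B=\langle h_i,\lambda_i^\vee\rangle_{i\in B}$, and let $\bar{\mathfrak b}_{B,-}$, $\bar{\mathfrak b}_{B,+}$, $\bar{\mathfrak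 g}_B$ be the subalgebras of $\bar{\mathfrak g}$ generated by $\bar{\mathfrak h}_B$ and, respectively, $\{f_i\}_{i\in B}$, $\{e_i\}_{i\in B}$, $\{e_i,f_i\}_{i\in B}$. Fix an invariant form on $\bar{\mathfrak h}$, that is, a symmetric bilinear form with $\langle h_i,\cdot\rangle=d_i\alpha_i$, whose restriction to $\bar{\mathfrak h}_B$ is nondegenerate for every $B\subseteq I$ (for example, the one with $\langle\lambda_i^\vee,\lambda_j^\vee\rangle=0$). **The diagram.** Let $D$ be the Dynkin diagram of $A$ (vertices $I$, and $i\neq j$ joined unless $a_{ij}=a_{ji}=0$) and let $m_{ij}\in\{1,2,\dots,\infty\}$ be the order of $s_is_j$, where $s_i(h)=h-\alpha_i(h)h_i$ are the simple reflections of $\bar{\mathfrak h}$. Then $\underline m=(m_{ij})$ is a labelling of $D$: for $i\ne j$, $m_{ij}=m_{ji}\ge2$, and $m_{ij}=2$ if $i,j$ are not joined. For $B'\subseteq B\subseteq I$, $\mathrm{Mns}(B,B')$ is the set of maximal nested sets on $B$ relative to $B'$: a nested set is a set $\mathcal F$ of connected subdiagrams of $B$, pairwise compatible (one contains the other or they are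 orthogonal, i.e. disjoint with no edge between them), containing the connected components of $B$ and those of $B'$, all of whose elements are compatible with, and not properly contained in, every component of $B'$ (the empty diagram has itself as its only component). A *braided Coxeter category of type $(D,\underline m)$* consists of braided monoidal categories $\mathcal C_B$ ($B\subseteq I$), monoidal functors $F_{\mathcal F}:\mathcal C_B\to\mathcal C_{B'}$ ($\mathcal F\in\mathrm{Mns}(B,B')$), with $F_{\mathcal F}=\mathrm{id}$ if $B=B'$, monoidal isomorphisms $\Upsilon_{\mathcal G\mathcal F}:F_{\mathcal F}\Rightarrow F_{\mathcal G}$ with $\Upsilon_{\mathcal H\mathcal G}\Upsilon_{\mathcal G\mathcal F}=\Upsilon_{\mathcal H\mathcal F}$, monoidal isomorphisms (associators) $F_{\mathcal G''}\circ F_{\mathcal G'}\Rightarrow F_{\mathcal F}$ for $\mathcal G'\in\mathrm{Mns}(B,B')$, $\mathcal G''\in\mathrm{Mns}(B',B'')$, $\mathcal F\in\mathrm{Mns}(B,B'')$, compatible with the $\Upsilon$'s, associative and normalised (this much is a *pre-Coxeter category*), and, for $i\in I$, isomorphisms $S_i$ (local monodromies) between the functors $F_{\mathcal K}:\mathcal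 C_{\{i\}}\to\mathcal C_\emptyset$, $\mathcal K\in\mathrm{Mns}(\{i\},\emptyset)$, compatible with the $\Upsilon$'s, which satisfy the braid relation $S_iS_jS_i\cdots=S_jS_iS_j\cdots$ ($m_{ij}$ factors), for $i\neq j$ in $B$ with $m_{ij}<\infty$, as automorphisms of each $F_{\mathcal F}$, $\mathcal F\in\mathrm{Mns}(B,\emptyset)$ (after conjugation with the associators), and the coproduct identity: on $F(X)\otimes F(Y)$, $S_i\otimes S_i$ followed by the opposite braiding of $\mathcal C_\emptyset$ agrees, through the tensor structure of $F=F_{\mathcal K}$, with $S_i$ on $X\otimes Y$ followed by $F$ of the opposite braiding of $\mathcal C_{\{i\}}$. It is *symmetric* if all $\mathcal C_B$ are. **Proposition.** (0) There are a unique nondegenerate invariant symmetric form on $\bar{\mathfrak g}$ extending that of $\bar{\mathfrak h}$ with $\langle e_i,f_j\rangle=\delta_{ij}d_i$; unique Lie bialgebra structures $\delta$ on all $\bar{\mathfrak b}_{B,-}$ with $\delta(h)=0$ for $h\in\bar{\mathfrak h}_B$ and $\delta(f_i)=\frac1{2d_i}(h_i\otimes f_i-f_i\otimes h_i)$; and,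 for $B'\subseteq B$, unique Lie algebra maps $p:\bar{\mathfrak b}_{B,-}\to\bar{\mathfrak b}_{B',-}$ equal to the orthogonal projection $\bar{\mathfrak h}_B\to\bar{\mathfrak h}_{B'}$ on $\bar{\mathfrak h}_B$, with $p(f_i)=f_i$ if $i\in B'$ and $p(f_i)=0$ if $i\in B\setminus B'$. With the inclusions, the $p$'s are functorial split pairs of Lie bialgebras, and $\langle p(x),y\rangle=\langle x,y\rangle$ for $x\in\bar{\mathfrak b}_{B,-}$, $y\in\bar{\mathfrak b}_{B',+}$. Hence Drinfeld–Yetter modules $(V,\pi,\pi^*)$ over $\bar{\mathfrak b}_{B,-}$ form symmetric monoidal categories $\mathrm{DY}_B$ with restriction functors $\mathrm{Res}_{B'B}(V,\pi,\pi^*)=(V,\pi\circ(i\otimes 1),(p\otimes1)\circ\pi^*)$. Let $e_i$ act on $V$ by $(\langle e_i,\cdot\rangle\otimes1)\pi^*$. Call $V\in\mathrm{DY}_B$ *integrable* if it is $\bar{\mathfrak h}_B$-diagonalisable, $f_i$ and $e_i$ are locally nilpotent for $i\in B$, and $h=2\,(\langle h,\cdot\rangle\otimes1)\pi^*$ on $V$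 for $h\in\bar{\mathfrak h}_B$. Let $\mathrm{DY}^{int}_B\subseteq\mathrm{DY}_B$ be the full subcategory of integrable modules, and $\mathcal O^{int}_{\infty,B}\subseteq \mathrm{DY}^{int}_B$ that of the integrable modules whose weights lie in finitely many sets $\lambda-\mathsf Q_+|_{\bar{\mathfrak h}_B}$, $\lambda\in\bar{\mathfrak h}_B^*$, $\mathsf Q_+=\sum_{i\in I}\mathbb Z_{\ge0}\alpha_i$. These are symmetric monoidal subcategories stable under restriction, and: 1. The categories $\mathrm{DY}_B$ form a symmetric pre-Coxeter category in which, for $\mathcal F\in\mathrm{Mns}(B,B')$, $F_{\mathcal F}=\mathrm{Res}_{B'B}$ with the trivial (identity) tensor structure, and all associators and all $\Upsilon_{\mathcal G\mathcal F}$ are the identity on the underlying vector spaces. 2. With the same functors, associators and $\Upsilon$'s, and with the local monodromies $S_i=\exp(e_i)\exp(-f_i)\exp(e_i)$, the categories $\mathrm{DY}^{int}_B$ form a symmetric Coxeter category of type $(D,\underline m)$. 3. This structure restricts to the categories $\mathcal O^{int}_{\infty,B}$: with the same functors, associators, $\Upsilon$'s and local monodromies, these form a symmetric Coxeter category of type $(D,\underline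 m)$. 4. Every $V\in\mathrm{DY}^{int}_B$ carries a unique action of $\bar{\mathfrak g}_B$ which extends that of $\bar{\mathfrak b}_{B,-}$ and in which $e_i$ ($i\in B$) acts as above; this is compatible with tensor products, and a linear map between integrable modules is a morphism of Drinfeld–Yetter modules if and only if it is $\bar{\mathfrak g}_B$-linear. The $\bar{\mathfrak g}_B$-modules which arise from $\mathcal O^{int}_{\infty,B}$ are exactly those in integrable category $\mathcal O_\infty$, that is, the $\bar{\mathfrak h}_B$-diagonalisable ones with weights as above and locally nilpotent $f_i$, $i\in B$; each arises from exactly one such Drinfeld–Yetter structure. -/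

import Mathlib

open CategoryTheory
open scoped TensorProduct

universe u v w w'

namespace CoxeterDY

/-! ### Diagrams and relative maximal nested sets -/

section Nested

variable {I : Type v} (D : SimpleGraph I)

/-- The full subgraph on `C` is connected or empty. -/
def IsConn (C : Set I) : Prop := (D.induce C).Preconnected

/-- The set of connected components of the subdiagram `B`; for `B = ∅` it is `{∅}`. -/
def components (B : Set I) : Set (Set I) :=
  {C | Maximal (fun C' => C' ⊆ B ∧ IsConn D C') C}

/-- Orthogonal subdiagrams: no common vertex and no edge between them. -/
def Orthogonal (B C : Set I) : Prop :=
  Disjoint B C ∧ ∀ i ∈ B, ∀ j ∈ C, ¬ D.Adj i j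

/-- Compatible subdiagrams: nested in one another, or orthogonal. -/
def Compatible (B C : Set I) : Prop := B ⊆ C ∨ C ⊆ B ∨ Orthogonal D B C

/-- `H` is a nested set on the subdiagram `B` relative to the subdiagram `B'`. -/
structure IsNestedSet (B B' : Set I) (H : Set (Set I)) : Prop where
  subset : ∀ C ∈ H, C ⊆ B
  conn : ∀ C ∈ H, IsConn D C
  compatible : ∀ C ∈ H, ∀ C' ∈ H, Compatible D C C'
  components_top : components D B ⊆ H
  components_bot : components D B' ⊆ H
  relative : ∀ C ∈ H, ∀ K ∈ components D B', Compatible D C K ∧ ¬ C ⊂ K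

/-- Maximal nested sets on `B` relative to `B'`. -/
def Mns (B B' : Set I) : Type v := {H : Set (Set I) // Maximal (IsNestedSet D B B') H}

/-- A labelling of the diagram `D`, where the value `0` stands for `∞`. -/
def IsLabelling (m : I → I → ℕ) : Prop :=
  ∀ i j, i ≠ j → m i j ≠ 1 ∧ m i j = m j i ∧ (¬ D.Adj i j → m i j = 2)

end Nested

/-! ### Braided Coxeter categories -/

section Coxeter

variable {I : Type v}

/-- The underlying data of a (pre-)Coxeter category: braided monoidal categories labelled by the
subdiagrams of `D`, and monoidal functors labelled by the relative maximal nested sets. -/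
structure DiagrammaticData (D : SimpleGraph I) where
  Cat : Set I → Type w
  [category : ∀ B, Category.{w'} (Cat B)]
  [monoidal : ∀ B, MonoidalCategory (Cat B)]
  [braided : ∀ B, BraidedCategory (Cat B)]
  F : ∀ {B B' : Set I}, B' ⊆ B → Mns D B B' → Cat B ⥤ Cat B'
  [monoidalF : ∀ {B B' : Set I} (h : B' ⊆ B) (𝓕 : Mns D B B'), (F h 𝓕).Monoidal]

attribute [instance] DiagrammaticData.category DiagrammaticData.monoidal
  DiagrammaticData.braided DiagrammaticData.monoidalF

open MonoidalCategory

/-- All the braided categories are symmetric. -/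
def DiagrammaticData.IsSymmetric {D : SimpleGraph I} (K : DiagrammaticData.{v, w, w'} D) : Prop :=
  ∀ (B : Set I) (X Y : K.Cat B), (β_ X Y).hom ≫ (β_ Y X).hom = 𝟙 (X ⊗ Y)

/-- A braided pre-Coxeter category with underlying data `K`. Thus `(K, Υ, α)` is a pre-Coxeter
object in the 2-category of monoidal categories: `Υ` makes `(K.F h 𝓕)_𝓕` a diagrammatic
1-morphism from `K.Cat B` to `K.Cat B'`, and `α` is a diagrammatic 2-isomorphism from the
composition of two of these to the third one, which is associative and normalised. -/
structure PreCoxeter {D : SimpleGraph I} (K : DiagrammaticData.{v, w, w'} D) where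
  Υ : ∀ {B B' : Set I} (h : B' ⊆ B) (𝓕 𝓖 : Mns D B B'), K.F h 𝓕 ≅ K.F h 𝓖
  Υ_monoidal : ∀ {B B' : Set I} (h : B' ⊆ B) (𝓕 𝓖 : Mns D B B'),
    NatTrans.IsMonoidal (Υ h 𝓕 𝓖).hom
  Υ_trans : ∀ {B B' : Set I} (h : B' ⊆ B) (𝓕 𝓖 𝓗 : Mns D B B'),
    Υ h 𝓕 𝓖 ≪≫ Υ h 𝓖 𝓗 = Υ h 𝓕 𝓗
  α : ∀ {B B' B'' : Set I} (h : B' ⊆ B) (h' : B'' ⊆ B') (𝓖' : Mns D B B') (𝓖'' : Mns D B' B'')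
    (𝓕 : Mns D B B''), K.F h 𝓖' ⋙ K.F h' 𝓖'' ≅ K.F (h'.trans h) 𝓕
  α_monoidal : ∀ {B B' B'' : Set I} (h : B' ⊆ B) (h' : B'' ⊆ B') (𝓖' : Mns D B B')
    (𝓖'' : Mns D B' B'') (𝓕 : Mns D B B''), NatTrans.IsMonoidal (α h h' 𝓖' 𝓖'' 𝓕).hom
  /-- `α` is compatible with `Υ` (in particular, `Υ` factorises vertically) -/
  α_natural : ∀ {B B' B'' : Set I} (h : B' ⊆ B) (h' : B'' ⊆ B') (𝓖' 𝓗' : Mns D B B')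
    (𝓖'' 𝓗'' : Mns D B' B'') (𝓕 𝓚 : Mns D B B''),
    ((Υ h 𝓖' 𝓗').hom ◫ (Υ h' 𝓖'' 𝓗'').hom) ≫ (α h h' 𝓗' 𝓗'' 𝓚).hom =
      (α h h' 𝓖' 𝓖'' 𝓕).hom ≫ (Υ (h'.trans h) 𝓕 𝓚).hom
  α_assoc : ∀ {B₀ B₁ B₂ B₃ : Set I} (h₁ : B₁ ⊆ B₀) (h₂ : B₂ ⊆ B₁) (h₃ : B₃ ⊆ B₂)
    (𝓖₁ : Mns D B₀ B₁) (𝓖₂ : Mns D B₁ B₂) (𝓖₃ : Mns D B₂ B₃)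
    (𝓗 : Mns D B₀ B₂) (𝓚 : Mns D B₁ B₃) (𝓕 : Mns D B₀ B₃) (X : K.Cat B₀),
    (K.F h₃ 𝓖₃).map ((α h₁ h₂ 𝓖₁ 𝓖₂ 𝓗).hom.app X) ≫
        (α (h₂.trans h₁) h₃ 𝓗 𝓖₃ 𝓕).hom.app X =
      (α h₂ h₃ 𝓖₂ 𝓖₃ 𝓚).hom.app ((K.F h₁ 𝓖₁).obj X) ≫
        (α h₁ (h₃.trans h₂) 𝓖₁ 𝓚 𝓕).hom.app X
  F_self : ∀ (B : Set I) (𝓕 : Mns D B B), K.F subset_rfl 𝓕 = 𝟭 (K.Cat B)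
  F_self_monoidal : ∀ (B : Set I) (𝓕 : Mns D B B), NatTrans.IsMonoidal (eqToHom (F_self B 𝓕))
  α_self_left : ∀ {B B' : Set I} (h : B' ⊆ B) (𝓖 : Mns D B B) (𝓖' 𝓕 : Mns D B B'),
    (α subset_rfl h 𝓖 𝓖' 𝓕).hom =
      Functor.whiskerRight (eqToHom (F_self B 𝓖)) (K.F h 𝓖') ≫
        (Functor.leftUnitor _).hom ≫ (Υ h 𝓖' 𝓕).hom
  α_self_right : ∀ {B B' : Set I} (h : B' ⊆ B) (𝓖' : Mns D B B') (𝓖 : Mns D B' B')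
    (𝓕 : Mns D B B'),
    (α h subset_rfl 𝓖' 𝓖 𝓕).hom =
      Functor.whiskerLeft (K.F h 𝓖') (eqToHom (F_self B' 𝓖)) ≫
        (Functor.rightUnitor _).hom ≫ (Υ h 𝓖' 𝓕).hom

/-- The alternating product `a * b * a * ⋯` with `n` factors. -/
def altProd {G : Type*} [Group G] (a b : G) : ℕ → G
  | 0 => 1
  | n + 1 => a * altProd b a n

/-- The automorphism of `K.F _ 𝓕 : K.Cat B ⥤ K.Cat ∅` obtained from a natural isomorphism on
`K.Cat {i}` by conjugating with `α`. -/
def PreCoxeter.conj {D : SimpleGraph I} {K : DiagrammaticData.{v, w, w'} D} (P : PreCoxeter K)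
    {B : Set I} {i : I} (hi : {i} ⊆ B) (𝓗 : Mns D B {i}) (𝓚 : Mns D {i} ∅) (𝓕 : Mns D B ∅)
    (s : K.F (Set.empty_subset {i}) 𝓚 ≅ K.F (Set.empty_subset {i}) 𝓚) :
    Aut (K.F (Set.empty_subset B) 𝓕) :=
  (P.α hi (Set.empty_subset {i}) 𝓗 𝓚 𝓕).symm ≪≫ Functor.isoWhiskerLeft (K.F hi 𝓗) s ≪≫
    P.α hi (Set.empty_subset {i}) 𝓗 𝓚 𝓕

/-- A braided Coxeter category of type `(D, m)` with underlying data `K` (`m i j = 0` stands for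
`m i j = ∞`, in which case there is no braid relation). The isomorphisms `S i 𝓚 𝓛` are the
components of a diagrammatic 2-isomorphism of `F_{∅ i}`, the local monodromy at `i`. -/
structure BraidedCoxeter {D : SimpleGraph I} (K : DiagrammaticData.{v, w, w'} D) (m : I → I → ℕ)
    extends PreCoxeter K where
  S : ∀ (i : I) (𝓚 𝓛 : Mns D {i} ∅),
    K.F (Set.empty_subset {i}) 𝓚 ≅ K.F (Set.empty_subset {i}) 𝓛
  S_natural : ∀ (i : I) (𝓚 𝓚' 𝓛 𝓛' : Mns D {i} ∅),
    toPreCoxeter.Υ (Set.empty_subset {i}) 𝓚 𝓚' ≪≫ S i 𝓚' 𝓛' =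
      S i 𝓚 𝓛 ≪≫ toPreCoxeter.Υ (Set.empty_subset {i}) 𝓛 𝓛'
  braid : ∀ (B : Set I) (i j : I) (hi : {i} ⊆ B) (hj : {j} ⊆ B), i ≠ j →
    ∀ (𝓕 : Mns D B ∅) (𝓗 : Mns D B {i}) (𝓚 : Mns D {i} ∅) (𝓗' : Mns D B {j}) (𝓚' : Mns D {j} ∅),
      altProd (toPreCoxeter.conj hi 𝓗 𝓚 𝓕 (S i 𝓚 𝓚)) (toPreCoxeter.conj hj 𝓗' 𝓚' 𝓕 (S j 𝓚' 𝓚'))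
          (m i j) =
        altProd (toPreCoxeter.conj hj 𝓗' 𝓚' 𝓕 (S j 𝓚' 𝓚')) (toPreCoxeter.conj hi 𝓗 𝓚 𝓕 (S i 𝓚 𝓚))
          (m i j)
  /-- the coproduct identity, with respect to the opposite braidings -/
  coproduct : ∀ (i : I) (𝓚 : Mns D {i} ∅) (X Y : K.Cat {i}),
    ((S i 𝓚 𝓚).hom.app X ⊗ₘ (S i 𝓚 𝓚).hom.app Y) ≫
        (β_ ((K.F (Set.empty_subset {i}) 𝓚).obj Y) ((K.F (Set.empty_subset {i}) 𝓚).obj X)).inv ≫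
        Functor.LaxMonoidal.μ (K.F (Set.empty_subset {i}) 𝓚) Y X =
      Functor.LaxMonoidal.μ (K.F (Set.empty_subset {i}) 𝓚) X Y ≫
        (S i 𝓚 𝓚).hom.app (X ⊗ Y) ≫
        (K.F (Set.empty_subset {i}) 𝓚).map (β_ Y X).inv

end Coxeter

/-! ### Lie bialgebras and Drinfeld-Yetter modules -/

section LieBialgebra

/-- The commutator bracket on endomorphisms. -/
instance endLieRing {R M : Type*} [CommRing R] [AddCommGroup M] [Module R M] :
    LieRing (Module.End R M) := LieRing.ofAssociativeRing

variable (k : Type u) [Field k] (L : Type w) [LieRing L] [LieAlgebra k L]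

/-- A Lie bialgebra structure on the Lie algebra `L`: a Lie cobracket which is a 1-cocycle. -/
@[ext]
structure LieBialgebraStructure where
  δ : L →ₗ[k] L ⊗[k] L
  antisymm : ∀ x, TensorProduct.comm k L L (δ x) = -δ x
  coJacobi : ∀ x,
    let σ := TensorProduct.assoc k L L L ≪≫ₗ TensorProduct.comm k L (L ⊗[k] L)
    let t := δ.rTensor L (δ x)
    t + σ t + σ (σ t) = 0
  cocycle : ∀ x y, δ ⁅x, y⁆ = ⁅x, δ y⁆ - ⁅y, δ x⁆

variable {k L}

/-- A Drinfeld-Yetter module structure on the vector space `V`. The sign in `comodule` is the one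
for which `φ ↦ (φ ⊗ id) ∘ coact` is an action of the Lie algebra dual to `(L, δ)`. -/
@[ext]
structure DYStructure (δ : LieBialgebraStructure k L) (V : Type u) [AddCommGroup V]
    [Module k V] where
  act : L →ₗ⁅k⁆ Module.End k V
  coact : V →ₗ[k] L ⊗[k] V
  comodule : ∀ v, TensorProduct.assoc k L L V (δ.δ.rTensor V (coact v)) =
    TensorProduct.leftComm k L L V (coact.lTensor L (coact v)) - coact.lTensor L (coact v)
  compat : ∀ x v, coact (act x v) - (act x).lTensor L (coact v) =
    (LieAlgebra.ad k L x).rTensor V (coact v) -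
      ((act : L →ₗ[k] Module.End k V).flip v).lTensor L (δ.δ x)

/-- Drinfeld-Yetter modules. -/
structure DY (δ : LieBialgebraStructure k L) where
  V : Type u
  [addCommGroup : AddCommGroup V]
  [module : Module k V]
  str : DYStructure δ V

attribute [instance] DY.addCommGroup DY.module

namespace DY

variable {δ : LieBialgebraStructure k L}

/-- The action of a Drinfeld-Yetter module. -/
abbrev act (X : DY δ) : L →ₗ⁅k⁆ Module.End k X.V := X.str.act

/-- The coaction of a Drinfeld-Yetter module. -/
abbrev coact (X : DY δ) : X.V →ₗ[k] L ⊗[k] X.V := X.str.coact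

/-- Morphisms of Drinfeld-Yetter modules. -/
@[ext]
structure Hom (X Y : DY δ) where
  lin : X.V →ₗ[k] Y.V
  act_comm : ∀ x v, lin (X.act x v) = Y.act x (lin v)
  coact_comm : ∀ v, Y.coact (lin v) = lin.lTensor L (X.coact v)

instance : Category (DY δ) where
  Hom := Hom
  id X := ⟨LinearMap.id, fun _ _ => rfl, fun v => by simp⟩
  comp f g := ⟨g.lin ∘ₗ f.lin, fun x v => by simp [f.act_comm, g.act_comm],
    fun v => by simp [f.coact_comm, g.coact_comm, LinearMap.lTensor_comp]⟩

@[simp] lemma id_lin (X : DY δ) : Hom.lin (𝟙 X) = LinearMap.id := rfl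

@[simp] lemma comp_lin {X Y Z : DY δ} (f : X ⟶ Y) (g : Y ⟶ Z) :
    Hom.lin (f ≫ g) = g.lin ∘ₗ f.lin := rfl

@[ext] lemma hom_ext {X Y : DY δ} {f g : X ⟶ Y} (h : f.lin = g.lin) : f = g := Hom.ext h

/-- An isomorphism from a linear equivalence commuting with actions and coactions. -/
def mkIso {X Y : DY δ} (e : X.V ≃ₗ[k] Y.V) (h : ∀ x v, e (X.act x v) = Y.act x (e v))
    (h' : ∀ v, Y.coact (e v) = (e : X.V →ₗ[k] Y.V).lTensor L (X.coact v)) : X ≅ Y where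
  hom := ⟨e, h, h'⟩
  inv := ⟨e.symm, fun x v => by
      apply e.injective; simp [h], fun v => by
      obtain ⟨v, rfl⟩ := e.surjective v
      have := congrArg ((e.symm : Y.V →ₗ[k] X.V).lTensor L) (h' v)
      rw [← LinearMap.lTensor_comp_apply] at this
      simpa using this.symm⟩
  hom_inv_id := by ext v; simp
  inv_hom_id := by ext v; simp

section Tensor

variable {V W : Type*} [AddCommGroup V] [Module k V] [AddCommGroup W] [Module k W]

/-- The action of `L` on a tensor product. -/
def tensorAct (a : L →ₗ⁅k⁆ Module.End k V) (b : L →ₗ⁅k⁆ Module.End k W) :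
    L →ₗ⁅k⁆ Module.End k (V ⊗[k] W) where
  toFun x := (a x).rTensor W + (b x).lTensor V
  map_add' x y := by ext; simp [TensorProduct.add_tmul, TensorProduct.tmul_add]; abel
  map_smul' c x := by ext; simp [TensorProduct.smul_tmul']
  map_lie' {x y} := by
    ext v w
    simp [LieRing.of_associative_ring_bracket, TensorProduct.sub_tmul, TensorProduct.tmul_sub]
    abel

/-- The coaction on a tensor product. -/
def tensorCoact (a : V →ₗ[k] L ⊗[k] V) (b : W →ₗ[k] L ⊗[k] W) : V ⊗[k] W →ₗ[k] L ⊗[k] (V ⊗[k] W) :=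
  (TensorProduct.assoc k L V W).toLinearMap ∘ₗ a.rTensor W +
    (TensorProduct.leftComm k V L W).toLinearMap ∘ₗ b.lTensor V

@[simp] lemma tensorAct_tmul (a : L →ₗ⁅k⁆ Module.End k V) (b : L →ₗ⁅k⁆ Module.End k W) (x : L)
    (v : V) (w : W) : tensorAct a b x (v ⊗ₜ w) = (a x v) ⊗ₜ w + v ⊗ₜ (b x w) := rfl

lemma assoc_tmul' (s : L ⊗[k] V) (w : W) : TensorProduct.assoc k L V W (s ⊗ₜ w) =
    ((TensorProduct.mk k V W).flip w).lTensor L s := by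
  induction s with
  | zero => simp
  | tmul x v => rfl
  | add s t hs ht => simp [TensorProduct.add_tmul, hs, ht]

lemma leftComm_tmul' (v : V) (t : L ⊗[k] W) : TensorProduct.leftComm k V L W (v ⊗ₜ t) =
    (TensorProduct.mk k V W v).lTensor L t := by
  induction t with
  | zero => simp
  | tmul x v => rfl
  | add s t hs ht => simp [TensorProduct.tmul_add, hs, ht]

@[simp] lemma tensorCoact_tmul (a : V →ₗ[k] L ⊗[k] V) (b : W →ₗ[k] L ⊗[k] W) (v : V) (w : W) :
    tensorCoact a b (v ⊗ₜ w) = ((TensorProduct.mk k V W).flip w).lTensor L (a v) +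
      (TensorProduct.mk k V W v).lTensor L (b w) := by
  simp [tensorCoact, assoc_tmul', leftComm_tmul']

lemma tensorCoact_comp_left (a : V →ₗ[k] L ⊗[k] V) (b : W →ₗ[k] L ⊗[k] W) (w : W) :
    tensorCoact a b ∘ₗ (TensorProduct.mk k V W).flip w =
      ((TensorProduct.mk k V W).flip w).lTensor L ∘ₗ a +
        (TensorProduct.leftComm k V L W).toLinearMap ∘ₗ
          (TensorProduct.mk k V (L ⊗[k] W)).flip (b w) := by
  ext v
  simp [leftComm_tmul']

lemma tensorCoact_comp_right (a : V →ₗ[k] L ⊗[k] V) (b : W →ₗ[k] L ⊗[k] W) (v : V) :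
    tensorCoact a b ∘ₗ TensorProduct.mk k V W v =
      (TensorProduct.mk k V W v).lTensor L ∘ₗ b +
        (TensorProduct.assoc k L V W).toLinearMap ∘ₗ
          TensorProduct.mk k (L ⊗[k] V) W (a v) := by
  ext v
  simp [assoc_tmul', add_comm]

lemma leftComm_cross (s : L ⊗[k] V) (t : L ⊗[k] W) :
    TensorProduct.leftComm k L L (V ⊗[k] W)
      (((TensorProduct.leftComm k V L W).toLinearMap ∘ₗ
          (TensorProduct.mk k V (L ⊗[k] W)).flip t).lTensor L s) =
      ((TensorProduct.assoc k L V W).toLinearMap ∘ₗ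
          TensorProduct.mk k (L ⊗[k] V) W s).lTensor L t := by
  induction s with
  | zero => simp
  | add s s' hs hs' =>
    simp only [map_add, hs, hs', LinearMap.comp_add, LinearMap.lTensor_add, LinearMap.add_apply]
  | tmul x v =>
    induction t with
    | zero => simp
    | add t t' ht ht' =>
      simp only [map_add, ht, ht', LinearMap.comp_add, LinearMap.lTensor_add, LinearMap.add_apply]
    | tmul y w => rfl

lemma leftComm_leftComm (z : L ⊗[k] (L ⊗[k] V)) :
    TensorProduct.leftComm k L L V (TensorProduct.leftComm k L L V z) = z := by
  have : (TensorProduct.leftComm k L L V).toLinearMap ∘ₗ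
      (TensorProduct.leftComm k L L V).toLinearMap = LinearMap.id := by
    ext x y v; rfl
  exact LinearMap.congr_fun this z

lemma leftComm_lTensor (f : V →ₗ[k] W) (z : L ⊗[k] (L ⊗[k] V)) :
    TensorProduct.leftComm k L L W ((f.lTensor L).lTensor L z) =
      (f.lTensor L).lTensor L (TensorProduct.leftComm k L L V z) := by
  have : (TensorProduct.leftComm k L L W).toLinearMap ∘ₗ (f.lTensor L).lTensor L =
      (f.lTensor L).lTensor L ∘ₗ (TensorProduct.leftComm k L L V).toLinearMap := by
    ext x y v; rfl
  exact LinearMap.congr_fun this z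

lemma assoc_rTensor_lTensor (g : L →ₗ[k] L ⊗[k] L) (f : V →ₗ[k] W) (z : L ⊗[k] V) :
    TensorProduct.assoc k L L W (g.rTensor W (f.lTensor L z)) =
      (f.lTensor L).lTensor L (TensorProduct.assoc k L L V (g.rTensor V z)) := by
  induction z with
  | zero => simp
  | add z z' hz hz' => simp only [map_add, hz, hz']
  | tmul x v =>
    simp only [LinearMap.lTensor_tmul, LinearMap.rTensor_tmul]
    induction g x with
    | zero => simp
    | add z z' hz hz' => simp only [TensorProduct.add_tmul, map_add, hz, hz']
    | tmul x y => rfl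

end Tensor

/-- The tensor product of two Drinfeld-Yetter structures. -/
def tensorStr {V W : Type u} [AddCommGroup V] [Module k V] [AddCommGroup W] [Module k W]
    (a : DYStructure δ V) (b : DYStructure δ W) : DYStructure δ (V ⊗[k] W) where
  act := tensorAct a.act b.act
  coact := tensorCoact a.coact b.coact
  comodule z := by
    induction z with
    | zero => simp
    | add z z' hz hz' => simp only [map_add, hz, hz']; abel
    | tmul v w =>
      have e₁ := a.comodule v
      have e₂ := b.comodule w
      have c := leftComm_cross (a.coact v) (b.coact w)
      simp only [tensorCoact_tmul, map_add, assoc_rTensor_lTensor, e₁, e₂, map_sub,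
        ← LinearMap.lTensor_comp_apply, tensorCoact_comp_left, tensorCoact_comp_right,
        LinearMap.lTensor_add, LinearMap.add_apply, c]
      simp only [LinearMap.lTensor_comp_apply, leftComm_lTensor]
      simp only [← LinearMap.lTensor_comp_apply, ← c, leftComm_leftComm]
      abel
  compat x z := by
    induction z with
    | zero => simp
    | add z z' hz hz' =>
      simp only [map_add, LinearMap.lTensor_add, LinearMap.add_apply] at hz hz' ⊢
      rw [add_sub_add_comm, hz, hz']; abel
    | tmul v w =>
      have e₁ := congrArg (((TensorProduct.mk k V W).flip w).lTensor L) (a.compat x v)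
      have e₂ := congrArg ((TensorProduct.mk k V W v).lTensor L) (b.compat x w)
      have f₁ : tensorAct a.act b.act x ∘ₗ (TensorProduct.mk k V W).flip w =
          (TensorProduct.mk k V W).flip w ∘ₗ a.act x +
            (TensorProduct.mk k V W).flip (b.act x w) := by ext; simp
      have f₂ : tensorAct a.act b.act x ∘ₗ TensorProduct.mk k V W v =
          TensorProduct.mk k V W v ∘ₗ b.act x + TensorProduct.mk k V W (a.act x v) := by
        ext; simp [add_comm]
      have f₃ : (tensorAct a.act b.act : L →ₗ[k] Module.End k (V ⊗[k] W)).flip (v ⊗ₜ w) =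
          (TensorProduct.mk k V W).flip w ∘ₗ (a.act : L →ₗ[k] Module.End k V).flip v +
            TensorProduct.mk k V W v ∘ₗ (b.act : L →ₗ[k] Module.End k W).flip w := by
        ext; simp
      have r : ∀ {U : Type u} [AddCommGroup U] [Module k U] (f : U →ₗ[k] V ⊗[k] W)
          (s : L ⊗[k] U), (LieAlgebra.ad k L x).rTensor _ (f.lTensor L s) =
          f.lTensor L ((LieAlgebra.ad k L x).rTensor _ s) := by
        intro U _ _ f s
        rw [← LinearMap.comp_apply, LinearMap.rTensor_comp_lTensor,
          ← LinearMap.comp_apply, LinearMap.lTensor_comp_rTensor]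
      simp only [map_sub] at e₁ e₂
      simp only [← LinearMap.lTensor_comp_apply] at e₁ e₂
      simp only [tensorAct_tmul, tensorCoact_tmul, map_add, ← LinearMap.lTensor_comp_apply,
        f₁, f₂, f₃, LinearMap.lTensor_add, LinearMap.add_apply, r]
      have e := congrArg₂ (· + ·) e₁ e₂
      beta_reduce at e
      refine Eq.trans ?_ (e.trans ?_) <;> abel

/-- The trivial Drinfeld-Yetter structure. -/
def trivialStr (V : Type u) [AddCommGroup V] [Module k V] : DYStructure δ V where
  act := 0
  coact := 0
  comodule v := by simp
  compat x v := by
    have : ((0 : L →ₗ⁅k⁆ Module.End k V) : L →ₗ[k] Module.End k V).flip v = 0 := by ext; rfl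
    simp [this]

lemma mk_act (V : Type u) [AddCommGroup V] [Module k V] (s : DYStructure δ V) :
    (DY.mk V s).act = s.act := rfl

lemma mk_coact (V : Type u) [AddCommGroup V] [Module k V] (s : DYStructure δ V) :
    (DY.mk V s).coact = s.coact := rfl

instance : MonoidalCategoryStruct (DY δ) where
  tensorObj X Y := ⟨X.V ⊗[k] Y.V, tensorStr X.str Y.str⟩
  tensorUnit := ⟨k, trivialStr k⟩
  tensorHom {X₁ Y₁ X₂ Y₂} f g := ⟨TensorProduct.map f.lin g.lin,
    fun x (z : X₁.V ⊗[k] X₂.V) => by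
      induction z with
      | zero => simp
      | add z z' hz hz' => simp only [map_add, hz, hz']
      | tmul v w => simp [tensorStr, mk_act, mk_coact, f.act_comm, g.act_comm],
    fun (z : X₁.V ⊗[k] X₂.V) => by
      induction z with
      | zero => simp
      | add z z' hz hz' => simp only [map_add, hz, hz']
      | tmul v w =>
        simp only [tensorStr, mk_act, mk_coact, TensorProduct.map_tmul, tensorCoact_tmul, f.coact_comm, g.coact_comm,
          map_add, ← LinearMap.lTensor_comp_apply]
        rfl⟩
  whiskerLeft X {Y₁ Y₂} f := ⟨f.lin.lTensor X.V,
    fun x (z : X.V ⊗[k] Y₁.V) => by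
      induction z with
      | zero => simp
      | add z z' hz hz' => simp only [map_add, hz, hz']
      | tmul v w => simp [tensorStr, mk_act, mk_coact, f.act_comm],
    fun (z : X.V ⊗[k] Y₁.V) => by
      induction z with
      | zero => simp
      | add z z' hz hz' => simp only [map_add, hz, hz']
      | tmul v w =>
        simp only [tensorStr, mk_act, mk_coact, LinearMap.lTensor_tmul, tensorCoact_tmul, f.coact_comm,
          map_add, ← LinearMap.lTensor_comp_apply]
        rfl⟩
  whiskerRight {X₁ X₂} f X := ⟨f.lin.rTensor X.V,
    fun x (z : X₁.V ⊗[k] X.V) => by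
      induction z with
      | zero => simp
      | add z z' hz hz' => simp only [map_add, hz, hz']
      | tmul v w => simp [tensorStr, mk_act, mk_coact, f.act_comm],
    fun (z : X₁.V ⊗[k] X.V) => by
      induction z with
      | zero => simp
      | add z z' hz hz' => simp only [map_add, hz, hz']
      | tmul v w =>
        simp only [tensorStr, mk_act, mk_coact, LinearMap.rTensor_tmul, tensorCoact_tmul, f.coact_comm,
          map_add, ← LinearMap.lTensor_comp_apply]
        rfl⟩
  associator X Y Z := mkIso (TensorProduct.assoc k X.V Y.V Z.V)
    (fun x (z : (X.V ⊗[k] Y.V) ⊗[k] Z.V) => by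
      induction z with
      | zero => simp
      | add z z' hz hz' => simp only [map_add, hz, hz']
      | tmul z w =>
        induction z with
        | zero => simp
        | add z z' hz hz' => simp only [map_add, hz, hz', TensorProduct.add_tmul]
        | tmul u v => simp [tensorStr, mk_act, mk_coact, TensorProduct.add_tmul, TensorProduct.tmul_add, add_assoc])
    (fun (z : (X.V ⊗[k] Y.V) ⊗[k] Z.V) => by
      induction z with
      | zero => simp
      | add z z' hz hz' => simp only [map_add, hz, hz']
      | tmul z w =>
        induction z with
        | zero => simp
        | add z z' hz hz' => simp only [map_add, hz, hz', TensorProduct.add_tmul]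
        | tmul u v =>
          simp only [tensorStr, mk_act, mk_coact, TensorProduct.assoc_tmul, tensorCoact_tmul, map_add,
            ← LinearMap.lTensor_comp_apply, add_assoc]
          rfl)
  leftUnitor X := mkIso (TensorProduct.lid k X.V)
    (fun x (z : k ⊗[k] X.V) => by
      induction z with
      | zero => simp
      | add z z' hz hz' => simp only [map_add, hz, hz']
      | tmul c v => simp [tensorStr, mk_act, mk_coact, trivialStr])
    (fun (z : k ⊗[k] X.V) => by
      induction z with
      | zero => simp
      | add z z' hz hz' => simp only [map_add, hz, hz']
      | tmul c v =>
        have : (TensorProduct.lid k X.V).toLinearMap ∘ₗ TensorProduct.mk k k X.V c =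
          c • LinearMap.id := by ext; simp
        simp [tensorStr, mk_act, mk_coact, trivialStr, ← LinearMap.lTensor_comp_apply, this])
  rightUnitor X := mkIso (TensorProduct.rid k X.V)
    (fun x (z : X.V ⊗[k] k) => by
      induction z with
      | zero => simp
      | add z z' hz hz' => simp only [map_add, hz, hz']
      | tmul v c => simp [tensorStr, mk_act, mk_coact, trivialStr])
    (fun (z : X.V ⊗[k] k) => by
      induction z with
      | zero => simp
      | add z z' hz hz' => simp only [map_add, hz, hz']
      | tmul v c =>
        have : (TensorProduct.rid k X.V).toLinearMap ∘ₗ (TensorProduct.mk k X.V k).flip c =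
          c • LinearMap.id := by ext; simp
        simp [tensorStr, mk_act, mk_coact, trivialStr, ← LinearMap.lTensor_comp_apply, this])

open MonoidalCategory

instance : MonoidalCategory (DY δ) where
  tensorHom_def f g := by
    apply hom_ext; apply TensorProduct.ext'; intro x y; rfl
  id_tensorHom_id X Y := by
    apply hom_ext; apply TensorProduct.ext'; intro x y; rfl
  tensorHom_comp_tensorHom f g f' g' := by
    apply hom_ext; apply TensorProduct.ext'; intro x y; rfl
  whiskerLeft_id X Y := by
    apply hom_ext; apply TensorProduct.ext'; intro x y; rfl
  id_whiskerRight X Y := by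
    apply hom_ext; apply TensorProduct.ext'; intro x y; rfl
  associator_naturality f g h := by
    apply hom_ext; apply TensorProduct.ext_threefold; intro x y z; rfl
  leftUnitor_naturality f := by
    apply hom_ext; apply TensorProduct.ext'; intro x y
    exact (map_smul f.lin _ _).symm
  rightUnitor_naturality f := by
    apply hom_ext; apply TensorProduct.ext'; intro x y
    exact (map_smul f.lin _ _).symm
  pentagon W X Y Z := by
    apply hom_ext; apply TensorProduct.ext_fourfold; intro w x y z; rfl
  triangle X Y := by
    apply hom_ext; apply TensorProduct.ext_threefold; intro x y z
    exact TensorProduct.tmul_smul y x z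

instance : SymmetricCategory (DY δ) where
  braiding X Y := mkIso (TensorProduct.comm k X.V Y.V)
    (fun x (z : X.V ⊗[k] Y.V) => by
      induction z with
      | zero => simp
      | add z z' hz hz' => simp only [map_add, hz, hz']
      | tmul v w =>
        change TensorProduct.comm k _ _ (tensorAct X.act Y.act x (v ⊗ₜ w)) =
          tensorAct Y.act X.act x (w ⊗ₜ v)
        simp [add_comm])
    (fun (z : X.V ⊗[k] Y.V) => by
      induction z with
      | zero => simp
      | add z z' hz hz' => simp only [map_add, hz, hz']
      | tmul v w =>
        change tensorCoact Y.coact X.coact (w ⊗ₜ v) =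
          LinearMap.lTensor L _ (tensorCoact X.coact Y.coact (v ⊗ₜ w))
        simp only [tensorCoact_tmul, map_add, ← LinearMap.lTensor_comp_apply]
        rw [add_comm]
        rfl)
  braiding_naturality_right X _ _ f := by
    apply hom_ext; apply TensorProduct.ext'; intro x y; rfl
  braiding_naturality_left f Z := by
    apply hom_ext; apply TensorProduct.ext'; intro x y; rfl
  hexagon_forward X Y Z := by
    apply hom_ext; apply TensorProduct.ext_threefold; intro x y z; rfl
  hexagon_reverse X Y Z := by
    apply (cancel_epi (α_ X Y Z).hom).1
    apply hom_ext; apply TensorProduct.ext_threefold; intro x y z; rfl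
  symmetry X Y := by
    apply hom_ext; apply TensorProduct.ext'; intro x y; rfl

end DY

/-! ### Split pairs of Lie bialgebras and restriction functors -/

variable {L' : Type w'} [LieRing L'] [LieAlgebra k L']

lemma rTensor_lTensor_comm {V W : Type*} [AddCommGroup V] [Module k V] [AddCommGroup W]
    [Module k W] (g : L →ₗ[k] L') (f : V →ₗ[k] W) (z : L ⊗[k] V) :
    g.rTensor W (f.lTensor L z) = f.lTensor L' (g.rTensor V z) := by
  rw [← LinearMap.comp_apply, LinearMap.rTensor_comp_lTensor, ← LinearMap.comp_apply,
    LinearMap.lTensor_comp_rTensor]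

/-- A split pair of Lie bialgebras. -/
structure SplitPair (δ : LieBialgebraStructure k L) (δ' : LieBialgebraStructure k L') where
  i : L' →ₗ⁅k⁆ L
  p : L →ₗ⁅k⁆ L'
  p_i : ∀ x, p (i x) = x
  i_δ : ∀ x, δ.δ (i x) = TensorProduct.map (i : L' →ₗ[k] L) (i : L' →ₗ[k] L) (δ'.δ x)
  p_δ : ∀ x, δ'.δ (p x) = TensorProduct.map (p : L →ₗ[k] L') (p : L →ₗ[k] L') (δ.δ x)

namespace SplitPair

variable {δ : LieBialgebraStructure k L} {δ' : LieBialgebraStructure k L'} (s : SplitPair δ δ')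

/-- Restriction of a Drinfeld-Yetter structure: `(π ∘ (i ⊗ id), (p ⊗ id) ∘ π*)`. -/
def resStr {V : Type u} [AddCommGroup V] [Module k V] (a : DYStructure δ V) :
    DYStructure δ' V where
  act := a.act.comp s.i
  coact := (s.p : L →ₗ[k] L').rTensor V ∘ₗ a.coact
  comodule v := by
    have e := congrArg (TensorProduct.map (s.p : L →ₗ[k] L') ((s.p : L →ₗ[k] L').rTensor V))
      (a.comodule v)
    rw [map_sub] at e
    have h₁ : ∀ z : L ⊗[k] V, TensorProduct.assoc k L' L' V (δ'.δ.rTensor V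
        ((s.p : L →ₗ[k] L').rTensor V z)) =
        TensorProduct.map (s.p : L →ₗ[k] L') ((s.p : L →ₗ[k] L').rTensor V)
          (TensorProduct.assoc k L L V (δ.δ.rTensor V z)) := by
      intro z
      induction z with
      | zero => simp
      | add z z' hz hz' => simp only [map_add, hz, hz']
      | tmul x v =>
        simp only [LinearMap.rTensor_tmul, LieHom.coe_toLinearMap, s.p_δ]
        induction δ.δ x with
        | zero => simp
        | add z z' hz hz' => simp only [TensorProduct.add_tmul, map_add, hz, hz']
        | tmul x y => rfl
    have h₂ : ∀ z : L ⊗[k] V, ((s.p : L →ₗ[k] L').rTensor V ∘ₗ a.coact).lTensor L'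
        ((s.p : L →ₗ[k] L').rTensor V z) =
        TensorProduct.map (s.p : L →ₗ[k] L') ((s.p : L →ₗ[k] L').rTensor V)
          (a.coact.lTensor L z) := by
      intro z
      induction z with
      | zero => simp
      | add z z' hz hz' => simp only [map_add, hz, hz']
      | tmul x v => rfl
    have h₃ : ∀ z : L ⊗[k] (L ⊗[k] V), TensorProduct.leftComm k L' L' V
        (TensorProduct.map (s.p : L →ₗ[k] L') ((s.p : L →ₗ[k] L').rTensor V) z) =
        TensorProduct.map (s.p : L →ₗ[k] L') ((s.p : L →ₗ[k] L').rTensor V)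
          (TensorProduct.leftComm k L L V z) := by
      intro z
      have : (TensorProduct.leftComm k L' L' V).toLinearMap ∘ₗ
          TensorProduct.map (s.p : L →ₗ[k] L') ((s.p : L →ₗ[k] L').rTensor V) =
          TensorProduct.map (s.p : L →ₗ[k] L') ((s.p : L →ₗ[k] L').rTensor V) ∘ₗ
            (TensorProduct.leftComm k L L V).toLinearMap := by ext x y v; rfl
      exact LinearMap.congr_fun this z
    rw [LinearMap.comp_apply, h₁, h₂, h₃, e]
  compat x v := by
    have e := congrArg ((s.p : L →ₗ[k] L').rTensor V) (a.compat (s.i x) v)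
    rw [map_sub, map_sub, s.i_δ] at e
    have h₁ : ∀ (f : Module.End k V) (z : L ⊗[k] V), f.lTensor L' ((s.p : L →ₗ[k] L').rTensor V z)
        = (s.p : L →ₗ[k] L').rTensor V (f.lTensor L z) := by
      intro f z
      rw [rTensor_lTensor_comm]
    have h₂ : ∀ z : L ⊗[k] V, (LieAlgebra.ad k L' x).rTensor V ((s.p : L →ₗ[k] L').rTensor V z) =
        (s.p : L →ₗ[k] L').rTensor V ((LieAlgebra.ad k L (s.i x)).rTensor V z) := by
      intro z
      rw [← LinearMap.rTensor_comp_apply, ← LinearMap.rTensor_comp_apply]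
      congr 2
      ext y
      simp [s.p_i]
    have h₃ : ∀ z : L' ⊗[k] L', (s.p : L →ₗ[k] L').rTensor V
        (((a.act : L →ₗ[k] Module.End k V).flip v).lTensor L
          (TensorProduct.map (s.i : L' →ₗ[k] L) (s.i : L' →ₗ[k] L) z)) =
        (((a.act.comp s.i : L' →ₗ⁅k⁆ Module.End k V) : L' →ₗ[k] Module.End k V).flip v).lTensor L' z
        := by
      intro z
      induction z with
      | zero => simp
      | add z z' hz hz' => simp only [map_add, hz, hz']
      | tmul x y => simp [s.p_i]
    simp only [LinearMap.comp_apply, h₁, h₂, ← h₃]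
    exact e

/-- The restriction functor of a split pair of Lie bialgebras. -/
def res : DY δ ⥤ DY δ' where
  obj X := ⟨X.V, s.resStr X.str⟩
  map f := ⟨f.lin, fun x v => f.act_comm (s.i x) v, fun v => by
    change (s.p : L →ₗ[k] L').rTensor _ _ = f.lin.lTensor L' ((s.p : L →ₗ[k] L').rTensor _ _)
    rw [f.coact_comm, rTensor_lTensor_comm]⟩
  map_id _ := rfl
  map_comp _ _ := rfl

/-- The identity map from the underlying vector space of a Drinfeld-Yetter module to that of its
restriction. -/
def idRes (X : DY δ) : X.V ≃ₗ[k] (s.res.obj X).V := LinearEquiv.refl k X.V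

open MonoidalCategory

/-- The tensor structure on the restriction functor is trivial (the identity). -/
def resCore : s.res.CoreMonoidal where
  εIso := DY.mkIso (LinearEquiv.refl k k) (fun _ _ => rfl) (fun v => by
    change _ = LinearMap.lTensor L' LinearMap.id _
    rw [LinearMap.lTensor_id]
    exact map_zero ((s.p : L →ₗ[k] L').rTensor k))
  μIso X Y := DY.mkIso (LinearEquiv.refl k (X.V ⊗[k] Y.V)) (fun _ _ => rfl) (fun (z : X.V ⊗[k] Y.V) => by
    change _ = LinearMap.lTensor L' LinearMap.id _
    rw [LinearMap.lTensor_id]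
    change (s.p : L →ₗ[k] L').rTensor _ (DY.tensorCoact X.coact Y.coact z) =
      DY.tensorCoact ((s.p : L →ₗ[k] L').rTensor X.V ∘ₗ X.coact)
        ((s.p : L →ₗ[k] L').rTensor Y.V ∘ₗ Y.coact) z
    induction z with
    | zero => simp
    | add z z' hz hz' => simp only [map_add, hz, hz']
    | tmul v w =>
      simp only [DY.tensorCoact_tmul, map_add, LinearMap.comp_apply, rTensor_lTensor_comm])
  μIso_hom_natural_left _ _ := by
    apply DY.hom_ext; apply TensorProduct.ext'; intro x y; rfl
  μIso_hom_natural_right _ _ := by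
    apply DY.hom_ext; apply TensorProduct.ext'; intro x y; rfl
  associativity _ _ _ := by
    apply DY.hom_ext; apply TensorProduct.ext_threefold; intro x y z; rfl
  left_unitality _ := by
    apply DY.hom_ext; apply TensorProduct.ext'; intro x y; rfl
  right_unitality _ := by
    apply DY.hom_ext; apply TensorProduct.ext'; intro x y; rfl

instance : s.res.Monoidal := s.resCore.toMonoidal

end SplitPair
end LieBialgebra

/-! ### Weight spaces and locally nilpotent operators -/

section Operators

variable {k : Type u} [Field k]

/-- The space of vectors of weight `χ` for the operators `T h`. -/
def weightSpace {H V : Type*} [AddCommMonoid H] [Module k H] [AddCommGroup V] [Module k V]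
    (T : H →ₗ[k] Module.End k V) (χ : Module.Dual k H) : Submodule k V :=
  ⨅ h, (T h).eigenspace (χ h)

/-- `V` is the direct sum of its weight spaces. -/
def IsDiagonalisable {H V : Type*} [AddCommMonoid H] [Module k H] [AddCommGroup V] [Module k V]
    (T : H →ₗ[k] Module.End k V) : Prop :=
  ⨆ χ : Module.Dual k H, weightSpace T χ = ⊤

/-- The set of weights. -/
def weights {H V : Type*} [AddCommMonoid H] [Module k H] [AddCommGroup V] [Module k V]
    (T : H →ₗ[k] Module.End k V) : Set (Module.Dual k H) :=
  {χ | weightSpace T χ ≠ ⊥}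

/-- Locally nilpotent operators. -/
def LocallyNilpotent {V : Type*} [AddCommGroup V] [Module k V] (T : Module.End k V) : Prop :=
  ∀ v, ∃ n : ℕ, (T ^ n) v = 0

/-- The exponential `∑ Tⁿ / n!` of a locally nilpotent operator. -/
noncomputable def locExp {V : Type*} [AddCommGroup V] [Module k V] (T : Module.End k V) (v : V) :
    V :=
  ∑ᶠ n : ℕ, ((n.factorial : k)⁻¹) • (T ^ n) v

/-- The triple exponential `exp(e) exp(-f) exp(e)`. -/
noncomputable def tripleExp {V : Type*} [AddCommGroup V] [Module k V] (e f : Module.End k V)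
    (v : V) : V :=
  locExp e (locExp (-f) (locExp e v))

variable {H V W : Type*} [AddCommMonoid H] [Module k H] [AddCommGroup V] [Module k V]
  [AddCommGroup W] [Module k W]

lemma mem_weightSpace {T : H →ₗ[k] Module.End k V} {χ : Module.Dual k H} {v : V} :
    v ∈ weightSpace T χ ↔ ∀ h, T h v = χ h • v := by
  simp [weightSpace]

lemma weightSpace_sum_eq_zero (T : H →ₗ[k] Module.End k V) (μ : Module.Dual k H)
    (t : Finset (Module.Dual k H)) (hμ : μ ∉ t) : ∀ u : Module.Dual k H → V,
    (∀ χ, u χ ∈ weightSpace T χ) → ∑ χ ∈ t, u χ ∈ weightSpace T μ → ∑ χ ∈ t, u χ = 0 := by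
  classical
  induction t using Finset.induction_on with
  | empty => simp
  | insert χ₀ t hχ₀ ih =>
    intro u hu hs
    simp only [Finset.mem_insert, not_or] at hμ
    obtain ⟨h, hh⟩ : ∃ h, μ h ≠ χ₀ h := by
      by_contra hc
      push Not at hc
      exact hμ.1 (LinearMap.ext hc)
    have key : ∑ χ ∈ t, (χ h - χ₀ h) • u χ = (μ h - χ₀ h) • ∑ χ ∈ insert χ₀ t, u χ := by
      rw [sub_smul, ← mem_weightSpace.1 hs h, map_sum, Finset.smul_sum, ← Finset.sum_sub_distrib,
        Finset.sum_insert hχ₀]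
      simp [fun χ => mem_weightSpace.1 (hu χ) h, sub_smul]
    have := ih hμ.2 (fun χ => (χ h - χ₀ h) • u χ) (fun χ => Submodule.smul_mem _ _ (hu χ))
      (by rw [key]; exact Submodule.smul_mem _ _ hs)
    rw [key, smul_eq_zero, sub_eq_zero] at this
    exact this.resolve_left hh

lemma mem_of_iSup_weightSpace_eq_top {T : H →ₗ[k] Module.End k V} {S : Set (Module.Dual k H)}
    (hS : ⨆ χ : S, weightSpace T χ = ⊤) {μ : Module.Dual k H} (hμ : μ ∈ weights T) : μ ∈ S := by
  classical
  by_contra hn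
  refine hμ ((Submodule.eq_bot_iff _).2 fun v hv => ?_)
  have hv' : v ∈ ⨆ χ : S, weightSpace T χ := by rw [hS]; trivial
  obtain ⟨f, hf, rfl⟩ := (Submodule.mem_iSup_iff_exists_finsupp _ _).1 hv'
  have e : (f.sum fun _ x => x) = ∑ χ ∈ f.support.map (Function.Embedding.subtype _),
      if h : χ ∈ S then f ⟨χ, h⟩ else 0 := by
    rw [Finset.sum_map]
    exact Finset.sum_congr rfl fun x _ => by simp
  rw [e] at hv ⊢
  refine weightSpace_sum_eq_zero T μ _ ?_ _ ?_ hv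
  · simp only [Finset.mem_map, Function.Embedding.subtype_apply, not_exists, not_and]
    rintro x - rfl
    exact hn x.2
  · intro χ
    split_ifs with h
    · exact hf ⟨χ, h⟩
    · exact Submodule.zero_mem _

lemma iSup_weights {T : H →ₗ[k] Module.End k V} (hT : IsDiagonalisable T) :
    ⨆ χ : weights T, weightSpace T χ = ⊤ := by
  rw [eq_top_iff, ← hT]
  refine iSup_le fun χ => ?_
  by_cases h : weightSpace T χ = ⊥
  · rw [h]; exact bot_le
  · exact le_iSup (fun χ : weights T => weightSpace T χ) ⟨χ, h⟩

lemma isDiagonalisable_of_iSup {T : H →ₗ[k] Module.End k V} {S : Set (Module.Dual k H)}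
    (hS : ⨆ χ : S, weightSpace T χ = ⊤) : IsDiagonalisable T :=
  eq_top_iff.2 (hS ▸ iSup_le fun χ => le_iSup (weightSpace T) χ.1)

/-- The operators `T ⊗ 1 + 1 ⊗ T'` on a tensor product. -/
def tensorOp (T : H →ₗ[k] Module.End k V) (T' : H →ₗ[k] Module.End k W) :
    H →ₗ[k] Module.End k (V ⊗[k] W) :=
  LinearMap.rTensorHom W ∘ₗ T + LinearMap.lTensorHom V ∘ₗ T'

lemma tensorOp_apply (T : H →ₗ[k] Module.End k V) (T' : H →ₗ[k] Module.End k W) (h : H) :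
    tensorOp T T' h = (T h).rTensor W + (T' h).lTensor V := rfl

lemma iSup_weightSpace_tensorOp {T : H →ₗ[k] Module.End k V} {T' : H →ₗ[k] Module.End k W}
    {S S' : Set (Module.Dual k H)} (hS : ⨆ χ : S, weightSpace T χ = ⊤)
    (hS' : ⨆ χ : S', weightSpace T' χ = ⊤) :
    ⨆ χ : Set.image2 (· + ·) S S', weightSpace (tensorOp T T') χ = ⊤ := by
  rw [eq_top_iff]
  rintro z -
  have key : ∀ v w, v ⊗ₜ[k] w ∈ ⨆ χ : Set.image2 (· + ·) S S', weightSpace (tensorOp T T') χ := by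
    intro v w
    have hv : v ∈ ⨆ χ : S, weightSpace T χ := by rw [hS]; trivial
    have hw : w ∈ ⨆ χ : S', weightSpace T' χ := by rw [hS']; trivial
    induction hv using Submodule.iSup_induction' with
    | zero => simp
    | add v v' _ _ hv hv' => rw [TensorProduct.add_tmul]; exact add_mem hv hv'
    | mem χ v hv =>
      induction hw using Submodule.iSup_induction' with
      | zero => simp
      | add w w' _ _ hw hw' => rw [TensorProduct.tmul_add]; exact add_mem hw hw'
      | mem χ' w hw =>
        refine Submodule.mem_iSup_of_mem ⟨χ + χ', Set.mem_image2_of_mem χ.2 χ'.2⟩ ?_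
        rw [mem_weightSpace] at hv hw ⊢
        intro h
        simp [tensorOp_apply, hv, hw, add_smul, TensorProduct.smul_tmul']
  induction z with
  | zero => exact zero_mem _
  | add z z' hz hz' => exact add_mem hz hz'
  | tmul v w => exact key v w

lemma iSup_weightSpace_comp {H' : Type*} [AddCommMonoid H'] [Module k H'] (j : H' →ₗ[k] H)
    {T : H →ₗ[k] Module.End k V} {S : Set (Module.Dual k H)}
    (hS : ⨆ χ : S, weightSpace T χ = ⊤) :
    ⨆ χ : (fun χ : Module.Dual k H => χ ∘ₗ j) '' S, weightSpace (T ∘ₗ j) χ = ⊤ := by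
  rw [eq_top_iff, ← hS]
  refine iSup_le fun χ => ?_
  refine le_trans ?_ (le_iSup (fun χ : (fun χ : Module.Dual k H => χ ∘ₗ j) '' S =>
    weightSpace (T ∘ₗ j) χ) ⟨χ.1 ∘ₗ j, Set.mem_image_of_mem _ χ.2⟩)
  intro v hv
  rw [mem_weightSpace] at hv ⊢
  exact fun h => hv (j h)

lemma iSup_weightSpace_zero : ⨆ χ : ({0} : Set (Module.Dual k H)),
    weightSpace (0 : H →ₗ[k] Module.End k V) χ = ⊤ := by
  rw [eq_top_iff]
  intro v _
  exact Submodule.mem_iSup_of_mem ⟨0, rfl⟩ (mem_weightSpace.2 fun h => by simp)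

lemma pow_apply_eq_zero_of_le (R : Module.End k V) (u : V) (n m : ℕ) (hn : (R ^ n) u = 0)
    (hm : n ≤ m) : (R ^ m) u = 0 := by
  obtain ⟨l, rfl⟩ := Nat.exists_eq_add_of_le hm
  rw [add_comm, pow_add, Module.End.mul_apply, hn, map_zero]

lemma LocallyNilpotent.tensor {T : Module.End k V} {T' : Module.End k W}
    (hT : LocallyNilpotent T) (hT' : LocallyNilpotent T') :
    LocallyNilpotent (T.rTensor W + T'.lTensor V) := by
  have hc : Commute (T.rTensor W) (T'.lTensor V) := by
    change T.rTensor W ∘ₗ T'.lTensor V = T'.lTensor V ∘ₗ T.rTensor W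
    rw [LinearMap.rTensor_comp_lTensor, LinearMap.lTensor_comp_rTensor]
  have key : ∀ v w, ∃ n : ℕ, ((T.rTensor W + T'.lTensor V) ^ n) (v ⊗ₜ[k] w) = 0 := by
    intro v w
    obtain ⟨n, hn⟩ := hT v
    obtain ⟨m, hm⟩ := hT' w
    refine ⟨n + m, ?_⟩
    rw [hc.add_pow, LinearMap.sum_apply]
    refine Finset.sum_eq_zero fun i _ => ?_
    have e : ((T.rTensor W) ^ i * (T'.lTensor V) ^ (n + m - i)) (v ⊗ₜ[k] w) =
        ((T ^ i) v) ⊗ₜ[k] ((T' ^ (n + m - i)) w) := by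
      rw [Module.End.mul_apply, LinearMap.lTensor_pow, LinearMap.rTensor_pow,
        LinearMap.lTensor_tmul, LinearMap.rTensor_tmul]
    have e' : ((T.rTensor W) ^ i * (T'.lTensor V) ^ (n + m - i)) (v ⊗ₜ[k] w) = 0 := by
      rw [e]
      rcases le_total n i with h | h
      · rw [pow_apply_eq_zero_of_le T v n i hn h, TensorProduct.zero_tmul]
      · rw [pow_apply_eq_zero_of_le T' w m _ hm (by omega), TensorProduct.tmul_zero]
    rw [((Nat.cast_commute _ _).eq.symm : (_ * ((_ : ℕ) : Module.End k (V ⊗[k] W))) = _),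
      Module.End.mul_apply, e', map_zero]
  intro z
  induction z with
  | zero => exact ⟨0, by simp⟩
  | tmul v w => exact key v w
  | add z z' hz hz' =>
    obtain ⟨n, hn⟩ := hz
    obtain ⟨m, hm⟩ := hz'
    exact ⟨n + m, by rw [map_add, pow_apply_eq_zero_of_le _ z n _ hn (by omega),
      pow_apply_eq_zero_of_le _ z' m _ hm (by omega), add_zero]⟩

lemma LocallyNilpotent.zero : LocallyNilpotent (0 : Module.End k V) := fun v => ⟨1, by simp⟩

end Operators

/-! ### Extended Kac-Moody algebras -/

/-- Generalised Cartan matrices. -/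
structure IsGCM {I : Type v} (A : Matrix I I ℤ) : Prop where
  diag : ∀ i, A i i = 2
  nonpos : ∀ i j, i ≠ j → A i j ≤ 0
  zero : ∀ i j, A i j = 0 → A j i = 0

/-- The Dynkin diagram: `i ≠ j` are joined by an edge unless `a i j = a j i = 0`. -/
def dynkin {I : Type v} (A : Matrix I I ℤ) : SimpleGraph I :=
  SimpleGraph.fromRel fun i j => A i j ≠ 0

section Cartan

variable (k : Type u) [Field k] {I : Type v}

/-- The Cartan subalgebra of the extended Kac-Moody algebra: the vector space with basis the simple
coroots `h_i` and the fundamental coweights `λ_i`. -/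
abbrev Cartan (I : Type v) := (I ⊕ I) →₀ k

/-- The simple coroot `h_i`. -/
noncomputable def coroot (i : I) : Cartan k I := Finsupp.single (Sum.inl i) 1

/-- The fundamental coweight `λ_i`. -/
noncomputable def coweight (i : I) : Cartan k I := Finsupp.single (Sum.inr i) 1

/-- The values of the simple root `α_i` on the basis: `α_i(h_j) = a j i` and `α_i(λ_j) = δ_{ij}`. -/
def rootValue [DecidableEq I] (A : Matrix I I ℤ) (i : I) : I ⊕ I → k :=
  Sum.elim (fun j => (A j i : k)) (fun j => if j = i then 1 else 0)

/-- The simple root `α_i`. -/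
noncomputable def simpleRoot [DecidableEq I] (A : Matrix I I ℤ) (i : I) :
    Module.Dual k (Cartan k I) :=
  Finsupp.linearCombination k (rootValue k A i)

/-- The order `m i j` of the product `s_i s_j` of simple reflections (`0` if it is infinite). -/
noncomputable def weylOrder [DecidableEq I] (A : Matrix I I ℤ) (i j : I) : ℕ :=
  orderOf (Module.preReflection (coroot k i) (simpleRoot k A i) *
    Module.preReflection (coroot k j) (simpleRoot k A j) : Module.End k (Cartan k I))

/-- The subspace of the Cartan subalgebra spanned by `h_i`, `λ_i`, `i ∈ B`. -/
noncomputable def cartanSub (B : Set I) : Submodule k (Cartan k I) :=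
  Submodule.span k {x | ∃ i ∈ B, x = coroot k i ∨ x = coweight k i}

/-- Invariant forms on the Cartan subalgebra, with respect to the symmetrising diagonal matrix
`d`, which are nondegenerate on all the subspaces corresponding to subdiagrams. -/
structure IsInvariantForm [DecidableEq I] (A : Matrix I I ℤ) (d : I → k)
    (form : LinearMap.BilinForm k (Cartan k I)) : Prop where
  symm : ∀ x y, form x y = form y x
  coroot : ∀ i x, form (coroot k i) x = d i * simpleRoot k A i x
  nondegenerate : ∀ B : Set I, ∀ x ∈ cartanSub k B, (∀ y ∈ cartanSub k B, form x y = 0) → x = 0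

end Cartan

section KacMoody

/-- Generators of the extended Kac-Moody algebra: the basis of the Cartan subalgebra and the
Chevalley generators. -/
inductive Gen (I : Type v)
  | t (a : I ⊕ I) : Gen I
  | e (i : I) : Gen I
  | f (i : I) : Gen I

variable (k : Type u) [Field k] {I : Type v} [DecidableEq I] (A : Matrix I I ℤ)

open FreeLieAlgebra in
/-- The elements of the free Lie algebra which are set equal to zero. -/
inductive Rel : FreeLieAlgebra k (Gen I) → Prop
  | tt (a b : I ⊕ I) : Rel ⁅of k (Gen.t a), of k (Gen.t b)⁆
  | te (a : I ⊕ I) (i : I) :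
      Rel (⁅of k (Gen.t a), of k (Gen.e i)⁆ - rootValue k A i a • of k (Gen.e i))
  | tf (a : I ⊕ I) (i : I) :
      Rel (⁅of k (Gen.t a), of k (Gen.f i)⁆ + rootValue k A i a • of k (Gen.f i))
  | ef (i j : I) (hij : i ≠ j) : Rel ⁅of k (Gen.e i), of k (Gen.f j)⁆
  | ef_self (i : I) : Rel (⁅of k (Gen.e i), of k (Gen.f i)⁆ - of k (Gen.t (Sum.inl i)))

/-- The Lie algebra `g̃` with the above generators and relations. -/
def PreKM : Type _ := FreeLieAlgebra k (Gen I) ⧸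
  (LieSubmodule.lieSpan k (FreeLieAlgebra k (Gen I)) {x | Rel k A x} :
    LieIdeal k (FreeLieAlgebra k (Gen I)))

noncomputable instance : LieRing (PreKM k A) := inferInstanceAs (LieRing (_ ⧸ _))

noncomputable instance : LieAlgebra k (PreKM k A) := inferInstanceAs (LieAlgebra k (_ ⧸ _))

/-- The generators of `g̃`. -/
noncomputable def PreKM.gen (x : Gen I) : PreKM k A :=
  LieSubmodule.Quotient.mk (N := (LieSubmodule.lieSpan k (FreeLieAlgebra k (Gen I)) {x | Rel k A x} :
    LieIdeal k (FreeLieAlgebra k (Gen I)))) (FreeLieAlgebra.of k x)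

/-- The map from the Cartan subalgebra to `g̃`. -/
noncomputable def PreKM.h : Cartan k I →ₗ[k] PreKM k A :=
  Finsupp.linearCombination k fun a => PreKM.gen k A (Gen.t a)

/-- The sum of all the ideals of `g̃` having trivial intersection with the Cartan subalgebra. -/
noncomputable def KMradical : LieIdeal k (PreKM k A) :=
  sSup {J | ∀ x, PreKM.h k A x ∈ J → PreKM.h k A x = 0}

/-- The extended Kac-Moody algebra. -/
def KM : Type _ := PreKM k A ⧸ KMradical k A

noncomputable instance : LieRing (KM k A) := inferInstanceAs (LieRing (_ ⧸ _))

noncomputable instance : LieAlgebra k (KM k A) := inferInstanceAs (LieAlgebra k (_ ⧸ _))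

namespace KM

/-- The generators of the extended Kac-Moody algebra. -/
noncomputable def gen (x : Gen I) : KM k A :=
  LieSubmodule.Quotient.mk (N := KMradical k A) (PreKM.gen k A x)

/-- The map from the Cartan subalgebra to the extended Kac-Moody algebra. -/
noncomputable def h : Cartan k I →ₗ[k] KM k A :=
  Finsupp.linearCombination k fun a => gen k A (Gen.t a)

/-- The Chevalley generator `e_i`. -/
noncomputable def e (i : I) : KM k A := gen k A (Gen.e i)

/-- The Chevalley generator `f_i`. -/
noncomputable def f (i : I) : KM k A := gen k A (Gen.f i)

/-- The subalgebra generated by `h_i`, `λ_i`, `f_i`, `i ∈ B`. -/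
noncomputable def bMinus (B : Set I) : LieSubalgebra k (KM k A) :=
  LieSubalgebra.lieSpan k _
    {x | ∃ i ∈ B, x = h k A (coroot k i) ∨ x = h k A (coweight k i) ∨ x = f k A i}

/-- The subalgebra generated by `h_i`, `λ_i`, `e_i`, `i ∈ B`. -/
noncomputable def bPlus (B : Set I) : LieSubalgebra k (KM k A) :=
  LieSubalgebra.lieSpan k _
    {x | ∃ i ∈ B, x = h k A (coroot k i) ∨ x = h k A (coweight k i) ∨ x = e k A i}

/-- The subalgebra corresponding to the subdiagram `B`. -/
noncomputable def sub (B : Set I) : LieSubalgebra k (KM k A) :=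
  LieSubalgebra.lieSpan k _ {x | ∃ i ∈ B, x = h k A (coroot k i) ∨ x = h k A (coweight k i) ∨
    x = e k A i ∨ x = f k A i}

variable {k A}

lemma bMinus_mono {B B' : Set I} (hB : B' ⊆ B) : bMinus k A B' ≤ bMinus k A B :=
  LieSubalgebra.lieSpan_mono fun _ ⟨i, hi, hx⟩ => ⟨i, hB hi, hx⟩

lemma bMinus_le_sub (B : Set I) : bMinus k A B ≤ sub k A B :=
  LieSubalgebra.lieSpan_mono fun _ ⟨i, hi, hx⟩ => ⟨i, hi, by tauto⟩

lemma h_mem_bMinus {B : Set I} {x : Cartan k I} (hx : x ∈ cartanSub k B) :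
    h k A x ∈ bMinus k A B := by
  induction hx using Submodule.span_induction with
  | mem x hx =>
    obtain ⟨i, hi, hx⟩ := hx
    exact LieSubalgebra.subset_lieSpan ⟨i, hi, by rcases hx with rfl | rfl <;> simp⟩
  | zero => simp
  | add x y _ _ hx hy => rw [map_add]; exact add_mem hx hy
  | smul c x _ hx => rw [map_smul]; exact LieSubalgebra.smul_mem _ c hx

lemma h_mem_bPlus {B : Set I} {x : Cartan k I} (hx : x ∈ cartanSub k B) :
    h k A x ∈ bPlus k A B := by
  induction hx using Submodule.span_induction with
  | mem x hx =>
    obtain ⟨i, hi, hx⟩ := hx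
    exact LieSubalgebra.subset_lieSpan ⟨i, hi, by rcases hx with rfl | rfl <;> simp⟩
  | zero => simp
  | add x y _ _ hx hy => rw [map_add]; exact add_mem hx hy
  | smul c x _ hx => rw [map_smul]; exact LieSubalgebra.smul_mem _ c hx

variable (k A)

/-- The inclusion of the Cartan subalgebra in the negative Borel subalgebra. -/
noncomputable def hB (B : Set I) : cartanSub k B →ₗ[k] bMinus k A B :=
  ((h k A).domRestrict (cartanSub k B)).codRestrict (bMinus k A B).toSubmodule
    fun x => h_mem_bMinus x.2

/-- The inclusion of the Cartan subalgebra in the subalgebra corresponding to `B`. -/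
noncomputable def hSub (B : Set I) : cartanSub k B →ₗ[k] sub k A B :=
  ((h k A).domRestrict (cartanSub k B)).codRestrict (sub k A B).toSubmodule
    fun x => bMinus_le_sub B (h_mem_bMinus x.2)

variable {k}

/-- The generator `f_i` of the negative Borel subalgebra. -/
noncomputable def fB {B : Set I} {i : I} (hi : i ∈ B) : bMinus k A B :=
  ⟨f k A i, LieSubalgebra.subset_lieSpan ⟨i, hi, by simp⟩⟩

lemma e_mem_bPlus {B : Set I} {i : I} (hi : i ∈ B) : e k A i ∈ bPlus k A B :=
  LieSubalgebra.subset_lieSpan ⟨i, hi, by simp⟩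

lemma e_mem_sub {B : Set I} {i : I} (hi : i ∈ B) : e k A i ∈ sub k A B :=
  LieSubalgebra.subset_lieSpan ⟨i, hi, by simp⟩

end KM

/-- The inclusion of negative Borel subalgebras. -/
noncomputable def bIncl {B B' : Set I} (hB : B' ⊆ B) :
    KM.bMinus k A B' →ₗ⁅k⁆ KM.bMinus k A B :=
  LieSubalgebra.inclusion (KM.bMinus_mono hB)

/-- The structure on the extended Kac-Moody algebra and its Borel subalgebras determined by an
invariant form on the Cartan subalgebra: the invariant form `Φ`, the cobrackets `δ` on the negative
Borel subalgebras given by `δ(h) = 0` and `δ(f_i) = d_i⁻¹ h_i ∧ f_i`, where `x ∧ y` stands for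
`(x ⊗ y - y ⊗ x) / 2`, and the orthogonal projections `p`. -/
@[ext]
structure Standard {k : Type u} [Field k] (A : Matrix I I ℤ) (d : I → k)
    (form : LinearMap.BilinForm k (Cartan k I)) where
  Φ : LinearMap.BilinForm k (KM k A)
  Φ_symm : ∀ x y, Φ x y = Φ y x
  Φ_invariant : ∀ x y z, Φ ⁅x, y⁆ z = Φ x ⁅y, z⁆
  Φ_nondegenerate : ∀ x, (∀ y, Φ x y = 0) → x = 0
  Φ_h : ∀ x y, Φ (KM.h k A x) (KM.h k A y) = form x y
  Φ_e_f : ∀ i j, Φ (KM.e k A i) (KM.f k A j) = if i = j then d i else 0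
  δ : ∀ B : Set I, LieBialgebraStructure k (KM.bMinus k A B)
  δ_h : ∀ B x, (δ B).δ (KM.hB k A B x) = 0
  δ_f : ∀ (B : Set I) (i : I) (hi : i ∈ B), (δ B).δ (KM.fB A hi) = (2 * d i)⁻¹ •
    (KM.hB k A B ⟨coroot k i, Submodule.subset_span ⟨i, hi, Or.inl rfl⟩⟩ ⊗ₜ KM.fB A hi -
      KM.fB A hi ⊗ₜ KM.hB k A B ⟨coroot k i, Submodule.subset_span ⟨i, hi, Or.inl rfl⟩⟩)
  p : ∀ {B B' : Set I}, B' ⊆ B → (KM.bMinus k A B →ₗ⁅k⁆ KM.bMinus k A B')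
  p_h : ∀ {B B' : Set I} (hB : B' ⊆ B) (x : cartanSub k B), ∃ y : cartanSub k B',
    p hB (KM.hB k A B x) = KM.hB k A B' y ∧ ∀ z ∈ cartanSub k B', form (x - y) z = 0
  p_f : ∀ {B B' : Set I} (hB : B' ⊆ B) {i : I} (hi : i ∈ B) (hi' : i ∈ B'),
    p hB (KM.fB A hi) = KM.fB A hi'
  p_f_eq_zero : ∀ {B B' : Set I} (hB : B' ⊆ B) {i : I} (hi : i ∈ B), i ∉ B' →
    p hB (KM.fB A hi) = 0
  /-- `p` is orthogonal projection with respect to the pairing of the Borel subalgebras -/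
  Φ_p : ∀ {B B' : Set I} (hB : B' ⊆ B) (x : KM.bMinus k A B), ∀ y ∈ KM.bPlus k A B',
    Φ y (p hB x) = Φ y x
  p_incl : ∀ {B B' : Set I} (hB : B' ⊆ B) (x : KM.bMinus k A B'), p hB (bIncl k A hB x) = x
  incl_δ : ∀ {B B' : Set I} (hB : B' ⊆ B) (x : KM.bMinus k A B'), (δ B).δ (bIncl k A hB x) =
    TensorProduct.map (bIncl k A hB : KM.bMinus k A B' →ₗ[k] KM.bMinus k A B)
      (bIncl k A hB : KM.bMinus k A B' →ₗ[k] KM.bMinus k A B) ((δ B').δ x)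
  p_δ : ∀ {B B' : Set I} (hB : B' ⊆ B) (x : KM.bMinus k A B), (δ B').δ (p hB x) =
    TensorProduct.map (p hB : KM.bMinus k A B →ₗ[k] KM.bMinus k A B')
      (p hB : KM.bMinus k A B →ₗ[k] KM.bMinus k A B') ((δ B).δ x)
  p_self : ∀ {B : Set I} (x : KM.bMinus k A B), p subset_rfl x = x
  p_comp : ∀ {B B' B'' : Set I} (hB : B' ⊆ B) (hB' : B'' ⊆ B') (x : KM.bMinus k A B),
    p hB' (p hB x) = p (hB'.trans hB) x

end KacMoody

/-! ### Restriction functors and categories of Drinfeld-Yetter modules -/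

section Contract

variable {k : Type u} [Field k] {L : Type w} [LieRing L] [LieAlgebra k L]

/-- The operator `(φ ⊗ id) ∘ c` on a vector space `V` with a coaction `c : V → L ⊗ V`. -/
noncomputable def contract {V : Type*} [AddCommGroup V] [Module k V] (c : V →ₗ[k] L ⊗[k] V) :
    Module.Dual k L →ₗ[k] Module.End k V where
  toFun φ := (TensorProduct.lid k V).toLinearMap ∘ₗ φ.rTensor V ∘ₗ c
  map_add' φ ψ := by ext v; simp [LinearMap.rTensor_add]
  map_smul' a φ := by ext v; simp [LinearMap.rTensor_smul]

lemma contract_apply {V : Type*} [AddCommGroup V] [Module k V] (c : V →ₗ[k] L ⊗[k] V)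
    (φ : Module.Dual k L) (v : V) : contract c φ v = TensorProduct.lid k V (φ.rTensor V (c v)) :=
  rfl

lemma lid_rTensor_lTensor {U U' : Type*} [AddCommGroup U] [Module k U] [AddCommGroup U']
    [Module k U'] (φ : Module.Dual k L) (g : U →ₗ[k] U') (s : L ⊗[k] U) :
    TensorProduct.lid k U' (φ.rTensor U' (g.lTensor L s)) =
      g (TensorProduct.lid k U (φ.rTensor U s)) := by
  induction s with
  | zero => simp
  | add s s' hs hs' => simp only [map_add, hs, hs']
  | tmul x u => simp

lemma contract_tensorCoact {V W : Type*} [AddCommGroup V] [Module k V] [AddCommGroup W] [Module k W]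
    (a : V →ₗ[k] L ⊗[k] V) (b : W →ₗ[k] L ⊗[k] W) (φ : Module.Dual k L) :
    contract (DY.tensorCoact a b) φ =
      (contract a φ).rTensor W + (contract b φ).lTensor V := by
  apply TensorProduct.ext'
  intro v w
  rw [contract_apply, DY.tensorCoact_tmul, map_add, map_add, lid_rTensor_lTensor,
    lid_rTensor_lTensor]
  rfl

lemma contract_rTensor {L' : Type*} [LieRing L'] [LieAlgebra k L'] {V : Type*} [AddCommGroup V]
    [Module k V] (c : V →ₗ[k] L ⊗[k] V) (p : L →ₗ[k] L') (φ : Module.Dual k L') :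
    contract (p.rTensor V ∘ₗ c) φ = contract c (φ ∘ₗ p) := by
  ext v
  simp only [contract_apply, LinearMap.comp_apply]
  rw [← LinearMap.rTensor_comp_apply]

namespace SplitPair

variable {L' : Type w'} [LieRing L'] [LieAlgebra k L'] {δ : LieBialgebraStructure k L}
  {δ' : LieBialgebraStructure k L'} (s : SplitPair δ δ') (X : DY δ)

lemma locallyNilpotent_act_res (x : L') (hx : LocallyNilpotent (X.act (s.i x))) :
    LocallyNilpotent ((s.res.obj X).act x) := hx

lemma contract_res (φ : Module.Dual k L') :
    contract (s.res.obj X).coact φ = contract X.coact (φ ∘ₗ (s.p : L →ₗ[k] L')) :=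
  contract_rTensor X.coact _ φ

lemma locallyNilpotent_contract_res {φ : Module.Dual k L'} {φ' : Module.Dual k L}
    (hφ : φ ∘ₗ (s.p : L →ₗ[k] L') = φ') (h : LocallyNilpotent (contract X.coact φ')) :
    LocallyNilpotent (contract (s.res.obj X).coact φ) := by
  rw [contract_res, hφ]; exact h

lemma act_res_eq_contract {c : k} {x : L'} {x' : L} {φ : Module.Dual k L'} {φ' : Module.Dual k L}
    (hx : s.i x = x') (hφ : φ ∘ₗ (s.p : L →ₗ[k] L') = φ') (h : X.act x' = c • contract X.coact φ') :
    (s.res.obj X).act x = c • contract (s.res.obj X).coact φ := by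
  subst hx; rw [contract_res, hφ]; exact h

lemma iSup_weightSpace_res {H H' : Type*} [AddCommMonoid H] [Module k H] [AddCommMonoid H']
    [Module k H'] (j : H →ₗ[k] L) (j' : H' →ₗ[k] L') (g : H' →ₗ[k] H)
    (hg : ∀ x, s.i (j' x) = j (g x)) {S : Set (Module.Dual k H)}
    (hS : ⨆ χ : S, weightSpace ((X.act : L →ₗ[k] Module.End k X.V) ∘ₗ j) χ = ⊤) :
    ⨆ χ : (fun χ : Module.Dual k H => χ ∘ₗ g) '' S, weightSpace
      (((s.res.obj X).act : L' →ₗ[k] Module.End k (s.res.obj X).V) ∘ₗ j') χ = ⊤ := by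
  have e : ((X.act : L →ₗ[k] Module.End k X.V) ∘ₗ j) ∘ₗ g =
      (((s.res.obj X).act : L' →ₗ[k] Module.End k (s.res.obj X).V) ∘ₗ j') := by
    refine LinearMap.ext fun x => ?_
    change X.act (j (g x)) = X.act (s.i (j' x))
    rw [hg]
  rw [← e]
  exact iSup_weightSpace_comp g hS

end SplitPair

end Contract

section Families

variable {k : Type u} [Field k] {I : Type v} [DecidableEq I] {A : Matrix I I ℤ} {d : I → k}
  {form : LinearMap.BilinForm k (Cartan k I)} (S : Standard A d form)

namespace Standard

/-- The split pair of Lie bialgebras given by two nested subdiagrams. -/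
noncomputable def split {B B' : Set I} (hB : B' ⊆ B) : SplitPair (S.δ B) (S.δ B') where
  i := bIncl k A hB
  p := S.p hB
  p_i := S.p_incl hB
  i_δ := S.incl_δ hB
  p_δ := S.p_δ hB

/-- The linear form `Φ(y, ·)` on the negative Borel subalgebra. -/
noncomputable def dual (B : Set I) : KM k A →ₗ[k] Module.Dual k (KM.bMinus k A B) :=
  LinearMap.lcomp k k (KM.bMinus k A B).toSubmodule.subtype ∘ₗ S.Φ

/-- The operator `(Φ(y, ·) ⊗ id) ∘ π*` on a Drinfeld-Yetter module. If `y = e_i`, it is the action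
of `e_i`. -/
noncomputable def dualAct {B : Set I} (y : KM k A) (X : DY (S.δ B)) : Module.End k X.V :=
  contract X.coact (S.dual B y)

/-- The action of the Cartan subalgebra on a Drinfeld-Yetter module. -/
noncomputable def cartanAct {B : Set I} (X : DY (S.δ B)) : cartanSub k B →ₗ[k] Module.End k X.V :=
  (X.act : KM.bMinus k A B →ₗ[k] Module.End k X.V) ∘ₗ KM.hB k A B

/-- The simple roots, restricted to the Cartan subalgebra of a subdiagram. -/
noncomputable def _root_.CoxeterDY.rootRestrict (k : Type u) [Field k] (A : Matrix I I ℤ)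
    (B : Set I) (i : I) : Module.Dual k (cartanSub k B) :=
  simpleRoot k A i ∘ₗ (cartanSub k B).subtype

/-- The set of weights is contained in a finite union of sets `λ - Q_+`, where `Q_+` is spanned by
the simple roots. -/
def _root_.CoxeterDY.IsBoundedAbove [Fintype I] (A : Matrix I I ℤ) (B : Set I)
    (P : Set (Module.Dual k (cartanSub k B))) : Prop :=
  ∃ Λ : Set (Module.Dual k (cartanSub k B)), Λ.Finite ∧
    ∀ μ ∈ P, ∃ l ∈ Λ, ∃ n : I → ℕ, μ = l - ∑ i, n i • rootRestrict k A B i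

/-- Integrable Drinfeld-Yetter modules: the Cartan subalgebra is diagonalisable, the operators
`f_i` and `e_i` are locally nilpotent, and the action and the coaction of the Cartan subalgebra
coincide, that is, `h = (2 (h, ·) ⊗ id) ∘ π*`. The pairing of the negative and the positive Borel
subalgebras which is used here to let the latter act is `Φ` on the nilpotent parts, and `2 (·,·)` on
the Cartan subalgebras. -/
structure IsIntegrable {B : Set I} (X : DY (S.δ B)) : Prop where
  diagonalisable : IsDiagonalisable (S.cartanAct X)
  f_nilpotent : ∀ i (hi : i ∈ B), LocallyNilpotent (X.act (KM.fB A hi))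
  e_nilpotent : ∀ i ∈ B, LocallyNilpotent (S.dualAct (KM.e k A i) X)
  cartan : ∀ x : cartanSub k B, S.cartanAct X x = (2 : k) • S.dualAct (KM.h k A x) X

/-- The Drinfeld-Yetter modules in integrable category `O_∞`. -/
structure IsIntegrableO [Fintype I] {B : Set I} (X : DY (S.δ B)) : Prop
    extends S.IsIntegrable X where
  bounded : IsBoundedAbove A B (weights (S.cartanAct X))

open MonoidalCategory

variable {S}

lemma cartanAct_tensor {B : Set I} (X Y : DY (S.δ B)) :
    S.cartanAct (X ⊗ Y) = tensorOp (S.cartanAct X) (S.cartanAct Y) := rfl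

lemma dualAct_tensor {B : Set I} (y : KM k A) (X Y : DY (S.δ B)) :
    S.dualAct y (X ⊗ Y) = (S.dualAct y X).rTensor Y.V + (S.dualAct y Y).lTensor X.V :=
  contract_tensorCoact X.coact Y.coact _

lemma dualAct_unit {B : Set I} (y : KM k A) : S.dualAct y (𝟙_ (DY (S.δ B))) = 0 := by
  apply LinearMap.ext
  intro v
  change TensorProduct.lid k k ((S.dual B y).rTensor k 0) = 0
  simp

lemma cartanAct_unit {B : Set I} : S.cartanAct (𝟙_ (DY (S.δ B))) = 0 := rfl

/-- The inclusion of Cartan subalgebras. -/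
noncomputable def cartanIncl {B B' : Set I} (hB : B' ⊆ B) : cartanSub k B' →ₗ[k] cartanSub k B :=
  Submodule.inclusion (Submodule.span_mono fun _ ⟨i, hi, hx⟩ => ⟨i, hB hi, hx⟩)

lemma dual_comp_p {B B' : Set I} (hB : B' ⊆ B) {y : KM k A} (hy : y ∈ KM.bPlus k A B') :
    S.dual B' y ∘ₗ (S.p hB : KM.bMinus k A B →ₗ[k] KM.bMinus k A B') = S.dual B y :=
  LinearMap.ext fun x => S.Φ_p hB x y hy

lemma IsIntegrable.unit (B : Set I) : S.IsIntegrable (𝟙_ (DY (S.δ B))) where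
  diagonalisable := by
    rw [cartanAct_unit]
    exact isDiagonalisable_of_iSup iSup_weightSpace_zero
  f_nilpotent i hi := LocallyNilpotent.zero
  e_nilpotent i hi := by rw [dualAct_unit]; exact LocallyNilpotent.zero
  cartan x := by rw [dualAct_unit, cartanAct_unit]; simp

lemma IsIntegrable.tensor {B : Set I} {X Y : DY (S.δ B)} (hX : S.IsIntegrable X)
    (hY : S.IsIntegrable Y) : S.IsIntegrable (X ⊗ Y) where
  diagonalisable := by
    rw [cartanAct_tensor]
    exact isDiagonalisable_of_iSup (iSup_weightSpace_tensorOp (iSup_weights hX.diagonalisable)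
      (iSup_weights hY.diagonalisable))
  f_nilpotent i hi := (hX.f_nilpotent i hi).tensor (hY.f_nilpotent i hi)
  e_nilpotent i hi := by
    rw [dualAct_tensor]
    exact (hX.e_nilpotent i hi).tensor (hY.e_nilpotent i hi)
  cartan x := by
    rw [dualAct_tensor, cartanAct_tensor, tensorOp_apply, hX.cartan, hY.cartan,
      LinearMap.rTensor_smul, LinearMap.lTensor_smul, smul_add]

lemma iSup_weightSpace_res {B B' : Set I} (hB : B' ⊆ B) (X : DY (S.δ B))
    {P : Set (Module.Dual k (cartanSub k B))}
    (hP : ⨆ χ : P, weightSpace (S.cartanAct X) χ = ⊤) :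
    ⨆ χ : (fun χ : Module.Dual k (cartanSub k B) => χ ∘ₗ cartanIncl hB) '' P, weightSpace
      (S.cartanAct ((S.split hB).res.obj X)) χ = ⊤ :=
  (S.split hB).iSup_weightSpace_res X (KM.hB k A B) (KM.hB k A B') (cartanIncl hB)
    (fun _ => rfl) hP

lemma IsIntegrable.res {B B' : Set I} (hB : B' ⊆ B) {X : DY (S.δ B)} (hX : S.IsIntegrable X) :
    S.IsIntegrable ((S.split hB).res.obj X) where
  diagonalisable :=
    isDiagonalisable_of_iSup (iSup_weightSpace_res hB X (iSup_weights hX.diagonalisable))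
  f_nilpotent i hi := (S.split hB).locallyNilpotent_act_res X _ (hX.f_nilpotent i (hB hi))
  e_nilpotent i hi := (S.split hB).locallyNilpotent_contract_res X
    (dual_comp_p hB (KM.e_mem_bPlus A hi)) (hX.e_nilpotent i (hB hi))
  cartan x := (S.split hB).act_res_eq_contract X (x := KM.hB k A B' x) rfl
    (dual_comp_p hB (KM.h_mem_bPlus x.2)) (hX.cartan (cartanIncl hB x))

lemma IsIntegrableO.unit [Fintype I] (B : Set I) : S.IsIntegrableO (𝟙_ (DY (S.δ B))) where
  toIsIntegrable := IsIntegrable.unit B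
  bounded := by
    refine ⟨{0}, Set.finite_singleton _, fun μ hμ => ⟨0, rfl, 0, ?_⟩⟩
    rw [cartanAct_unit] at hμ
    have := mem_of_iSup_weightSpace_eq_top iSup_weightSpace_zero hμ
    simpa using this

lemma IsIntegrableO.tensor [Fintype I] {B : Set I} {X Y : DY (S.δ B)} (hX : S.IsIntegrableO X)
    (hY : S.IsIntegrableO Y) : S.IsIntegrableO (X ⊗ Y) where
  toIsIntegrable := hX.toIsIntegrable.tensor hY.toIsIntegrable
  bounded := by
    obtain ⟨Λ, hΛ, h⟩ := hX.bounded
    obtain ⟨Λ', hΛ', h'⟩ := hY.bounded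
    refine ⟨Set.image2 (· + ·) Λ Λ', hΛ.image2 _ hΛ', fun μ hμ => ?_⟩
    rw [cartanAct_tensor] at hμ
    obtain ⟨χ, hχ, χ', hχ', rfl⟩ := mem_of_iSup_weightSpace_eq_top (iSup_weightSpace_tensorOp
      (iSup_weights hX.diagonalisable) (iSup_weights hY.diagonalisable)) hμ
    obtain ⟨l, hl, n, rfl⟩ := h χ hχ
    obtain ⟨l', hl', n', rfl⟩ := h' χ' hχ'
    refine ⟨_, Set.mem_image2_of_mem hl hl', n + n', ?_⟩
    simp only [Pi.add_apply, add_smul, Finset.sum_add_distrib]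
    abel

lemma IsIntegrableO.res [Fintype I] {B B' : Set I} (hB : B' ⊆ B) {X : DY (S.δ B)}
    (hX : S.IsIntegrableO X) : S.IsIntegrableO ((S.split hB).res.obj X) where
  toIsIntegrable := hX.toIsIntegrable.res hB
  bounded := by
    obtain ⟨Λ, hΛ, h⟩ := hX.bounded
    refine ⟨(fun χ => χ ∘ₗ cartanIncl hB) '' Λ, hΛ.image _, fun μ hμ => ?_⟩
    obtain ⟨χ, hχ, rfl⟩ := mem_of_iSup_weightSpace_eq_top (iSup_weightSpace_res hB X
      (iSup_weights hX.diagonalisable)) hμ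
    obtain ⟨l, hl, n, rfl⟩ := h χ hχ
    refine ⟨_, Set.mem_image_of_mem _ hl, n, ?_⟩
    ext x
    simp [rootRestrict, cartanIncl]
    rfl

variable (S)

/-- A family of full monoidal subcategories of the categories of Drinfeld-Yetter modules, labelled
by the subdiagrams, which is stable under the restriction functors. -/
structure Family where
  P : ∀ B : Set I, ObjectProperty (DY (S.δ B))
  monoidal : ∀ B, (P B).IsMonoidal
  res : ∀ {B B' : Set I} (hB : B' ⊆ B) (X : DY (S.δ B)), P B X → P B' ((S.split hB).res.obj X)

/-- All Drinfeld-Yetter modules. -/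
def all : S.Family where
  P _ _ := True
  monoidal _ := { prop_unit := trivial, prop_tensor := fun _ _ _ _ => trivial }
  res _ _ _ := trivial

/-- Integrable Drinfeld-Yetter modules. -/
def int : S.Family where
  P _ X := S.IsIntegrable X
  monoidal B := { prop_unit := IsIntegrable.unit B, prop_tensor := fun _ _ => IsIntegrable.tensor }
  res hB _ hX := hX.res hB

/-- Integrable category `O_∞`. -/
def intO [Fintype I] : S.Family where
  P _ X := S.IsIntegrableO X
  monoidal B :=
    { prop_unit := IsIntegrableO.unit B, prop_tensor := fun _ _ => IsIntegrableO.tensor }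
  res hB _ hX := hX.res hB

namespace Family

variable {S} (Q : S.Family)

instance (B : Set I) : (Q.P B).IsMonoidal := Q.monoidal B

/-- The restriction functors. -/
noncomputable def resFun {B B' : Set I} (hB : B' ⊆ B) : (Q.P B).FullSubcategory ⥤ (Q.P B').FullSubcategory :=
  (Q.P B').lift ((Q.P B).ι ⋙ (S.split hB).res) fun X => Q.res hB X.obj X.property

/-- The identity map from the underlying vector space of a module to that of its restriction. -/
noncomputable def idRes {B B' : Set I} (hB : B' ⊆ B) (X : (Q.P B).FullSubcategory) :
    X.obj.V ≃ₗ[k] ((Q.resFun hB).obj X).obj.V :=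
  (S.split hB).idRes X.obj

/-- The tensor structure on the restriction functors is trivial (the identity). -/
noncomputable def resCore {B B' : Set I} (hB : B' ⊆ B) : (Q.resFun hB).CoreMonoidal where
  εIso := (Q.P B').isoMk ((S.split hB).resCore.εIso)
  μIso X Y := (Q.P B').isoMk ((S.split hB).resCore.μIso X.obj Y.obj)
  μIso_hom_natural_left f X :=
    ObjectProperty.hom_ext _ ((S.split hB).resCore.μIso_hom_natural_left f.hom X.obj)
  μIso_hom_natural_right X f :=
    ObjectProperty.hom_ext _ ((S.split hB).resCore.μIso_hom_natural_right X.obj f.hom)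
  associativity X Y Z :=
    ObjectProperty.hom_ext _ ((S.split hB).resCore.associativity X.obj Y.obj Z.obj)
  left_unitality X := ObjectProperty.hom_ext _ ((S.split hB).resCore.left_unitality X.obj)
  right_unitality X := ObjectProperty.hom_ext _ ((S.split hB).resCore.right_unitality X.obj)

noncomputable instance {B B' : Set I} (hB : B' ⊆ B) : (Q.resFun hB).Monoidal := (Q.resCore hB).toMonoidal

/-- The symmetric monoidal categories in the family, and the restriction functors between them, with
their trivial tensor structure. -/
noncomputable def data : DiagrammaticData (dynkin A) where
  Cat B := (Q.P B).FullSubcategory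
  F hB _ := Q.resFun hB

/-- All the isomorphisms `Υ` and `α` are identities. -/
def IsTrivial (P : PreCoxeter Q.data) : Prop :=
  (∀ (B B' : Set I) (hB : B' ⊆ B) (𝓕 𝓖 : Mns (dynkin A) B B') (X : (Q.P B).FullSubcategory)
    (v : X.obj.V), ((P.Υ hB 𝓕 𝓖).hom.app X).hom.lin (Q.idRes hB X v) = Q.idRes hB X v) ∧
  ∀ (B B' B'' : Set I) (hB : B' ⊆ B) (hB' : B'' ⊆ B') (𝓖' : Mns (dynkin A) B B')
    (𝓖'' : Mns (dynkin A) B' B'') (𝓕 : Mns (dynkin A) B B'') (X : (Q.P B).FullSubcategory)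
    (v : X.obj.V), ((P.α hB hB' 𝓖' 𝓖'' 𝓕).hom.app X).hom.lin
      (Q.idRes hB' _ (Q.idRes hB X v)) = Q.idRes (hB'.trans hB) X v

/-- The local monodromy at `i` is the triple exponential `exp(e_i) exp(-f_i) exp(e_i)`. -/
def IsTripleExp {m : I → I → ℕ} (C : BraidedCoxeter Q.data m) : Prop :=
  ∀ (i : I) (𝓚 𝓛 : Mns (dynkin A) {i} ∅) (X : (Q.P {i}).FullSubcategory) (v : X.obj.V),
    ((C.S i 𝓚 𝓛).hom.app X).hom.lin (Q.idRes (Set.empty_subset {i}) X v) =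
      Q.idRes (Set.empty_subset {i}) X (tripleExp (S.dualAct (KM.e k A i) X.obj)
        (X.obj.act (KM.fB A (Set.mem_singleton i))) v)

end Family

/-- The structure of a module over the subalgebra of the extended Kac-Moody algebra corresponding to
`B` given by a Drinfeld-Yetter structure. -/
def Corresponds {B : Set I} {M : Type u} [AddCommGroup M] [Module k M]
    (ρ : KM.sub k A B →ₗ⁅k⁆ Module.End k M) (s : DYStructure (S.δ B) M) : Prop :=
  (∀ x : KM.bMinus k A B, ρ ⟨x, KM.bMinus_le_sub B x.2⟩ = s.act x) ∧
  ∀ (i : I) (hi : i ∈ B), ρ ⟨KM.e k A i, KM.e_mem_sub A hi⟩ = S.dualAct (KM.e k A i) ⟨M, s⟩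

end Standard

/-- The modules over the subalgebra of the extended Kac-Moody algebra corresponding to `B` in
integrable category `O_∞`: the Cartan subalgebra is diagonalisable, the set of weights is bounded
above, and the operators `f_i` are locally nilpotent. -/
structure IsIntegrableOModule {k : Type u} [Field k] [Fintype I] (A : Matrix I I ℤ) (B : Set I)
    {M : Type u} [AddCommGroup M] [Module k M] (ρ : KM.sub k A B →ₗ⁅k⁆ Module.End k M) : Prop where
  diagonalisable : IsDiagonalisable
    ((ρ : KM.sub k A B →ₗ[k] Module.End k M) ∘ₗ KM.hSub k A B)
  bounded : IsBoundedAbove A B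
    (weights ((ρ : KM.sub k A B →ₗ[k] Module.End k M) ∘ₗ KM.hSub k A B))
  f_nilpotent : ∀ (i : I) (hi : i ∈ B), LocallyNilpotent
    (ρ ⟨KM.f k A i, KM.bMinus_le_sub B (KM.fB A hi).2⟩)

end Families

end CoxeterDY

open CoxeterDY MonoidalCategory

set_option linter.unusedSectionVars false


namespace CoxeterDY

/-! ### Gradings by eigenvectors, and words in a family of operators -/

section Words

variable {k : Type u} [Field k] {M : Type*} [AddCommGroup M] [Module k M]

/-! Let ρ^∨ be the sum of the fundamental coweights, so that α_i(ρ^∨) = 1 for all i. In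
characteristic zero the eigenvalues of ad ρ^∨ grade any Lie algebra with Chevalley generators
(`IsChev`): degree zero is the Cartan part, the other degrees are spanned by words in the e_i or in
the f_i, and subspaces stable under ad ρ^∨ are graded. A module on words, with an arbitrary highest
weight, shows that the Cartan subalgebra embeds in `PreKM`; gradedness shows that the radical meets
it trivially, so that `KM` has Chevalley generators as well.

The invariant form is constructed through its graph, the submodule of the sum of the adjoint and the
coadjoint representation generated by the pairs (x, (x, ·)) for x a generator. It is a graph because
its fibre over 0 consists of linear forms vanishing on generators, and the common kernel of these
forms is stable under brackets (`eq_zero_of_mem_graph`). Nondegeneracy holds since the kernel of the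
form is an ideal which meets the Cartan subalgebra trivially.

The Lie bialgebra structures come from a Manin triple. In g ⊕ h, with Φ minus the form of h, the
Borel subalgebras embed by (x, x₀) and (y, -y₀), with x₀, y₀ the Cartan parts. Both images are
isotropic, and they pair by Φ(x, y) + (x₀, y₀): this is `borelPairing`, and it explains the factors
2. The cobracket of the negative Borel subalgebra is the transpose of the bracket of the positive
one; it is an honest tensor on generators and therefore everywhere, and its axioms are dual to those
of a Lie algebra. The projections p are orthogonal projections, and they are Lie maps because the
orthogonal of a smaller opposite Borel subalgebra is an ideal (`lie_mem_orth`).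

Evaluated on linear forms, the comodule axiom says that the positive Borel subalgebra acts, and the
compatibility axiom is the mixed commutator in the double. The condition on the Cartan part of an
integrable module identifies the two actions of h, so that the actions glue to one of g_B
(`exists_sub_hom`). Conversely, in category O only finitely many degrees of the positive Borel
subalgebra act on a given weight vector, so its action arises from a coaction with values in the
algebraic tensor product.

All structural isomorphisms of the Coxeter categories are identities on vectors, which settles
coherence. As the Borel subalgebra of the empty diagram is zero, the local monodromies need only be
natural linear automorphisms. Triple exponentials are natural and multiplicative on tensor products.
For the braid relations, a triple exponential intertwines the action with its own version in the
adjoint representation (`tripleExp_act`); in rank two of finite type the product of the first m - 1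
factors carries one pair (e, f) to another, which gives the relation with m factors. The finite
orders are 2, 3, 4, 6, for a_ij a_ji = 0, 1, 2, 3; when the product is at least 4, a recursion on
coordinates shows that the order is infinite. -/

/-- If a sum of eigenvectors with distinct integral eigenvalues lies in a stable subspace, then so
do the summands. -/
lemma eigenvector_mem_of_sum_mem [CharZero k] (D : Module.End k M) (P : Submodule k M)
    (hP : ∀ x ∈ P, D x ∈ P) (s : Finset ℤ) : ∀ x : ℤ → M, (∀ z, D (x z) = (z : k) • x z) →
    ∑ z ∈ s, x z ∈ P → ∀ z ∈ s, x z ∈ P := by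
  induction s using Finset.induction_on with
  | empty => simp
  | insert z₀ s hz₀ ih =>
    intro x hx hs
    -- Applying D - z₀ removes the z₀-component and multiplies the others by scalars which are
    -- nonzero in characteristic zero.
    have key : ∑ z ∈ s, ((z : k) - z₀) • x z ∈ P := by
      have : ∑ z ∈ s, ((z : k) - z₀) • x z =
          D (∑ z ∈ insert z₀ s, x z) - (z₀ : k) • ∑ z ∈ insert z₀ s, x z := by
        rw [map_sum, Finset.smul_sum, ← Finset.sum_sub_distrib, Finset.sum_insert hz₀]
        simp [hx, sub_smul]
      rw [this]
      exact sub_mem (hP _ hs) (P.smul_mem _ hs)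
    have h' := ih (fun z => ((z : k) - z₀) • x z)
      (fun z => by rw [map_smul, hx, smul_comm]) key
    have h'' : ∀ z ∈ s, x z ∈ P := by
      intro z hz
      have hne : (z : k) - z₀ ≠ 0 := by
        rw [sub_ne_zero]
        intro h
        exact hz₀ (Int.cast_injective h ▸ hz)
      exact (P.smul_mem_iff hne).1 (h' z hz)
    intro z hz
    rcases Finset.mem_insert.1 hz with rfl | hz
    · rw [Finset.sum_insert hz₀] at hs
      exact (P.add_mem_iff_left (P.sum_mem h'')).1 hs
    · exact h'' z hz

lemma apply_mem_iSup_of_forall {G : ℤ → Submodule k M} {T : Module.End k M}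
    (h : ∀ z, ∀ m ∈ G z, T m ∈ ⨆ z, G z) {m : M} (hm : m ∈ ⨆ z, G z) : T m ∈ ⨆ z, G z := by
  have : ⨆ z, G z ≤ (⨆ z, G z).comap T := iSup_le h
  exact this hm

/-- A vector in a sum of subspaces is a finite sum of vectors of these. -/
lemma exists_sum_of_mem_iSup {G : ℤ → Submodule k M} {x : M} (hx : x ∈ ⨆ z, G z) :
    ∃ (s : Finset ℤ) (y : ℤ → M), (∀ z, y z ∈ G z) ∧ ∑ z ∈ s, y z = x := by
  obtain ⟨f, hf, rfl⟩ := (Submodule.mem_iSup_iff_exists_finsupp _ _).1 hx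
  exact ⟨f.support, f, hf, rfl⟩

/-- A vector in a sum of eigenspaces is a finite sum, over an index set containing `z₀`. -/
lemma exists_sum_of_mem_iSup_insert {G : ℤ → Submodule k M} {x : M} (hx : x ∈ ⨆ z, G z) (z₀ : ℤ) :
    ∃ (s : Finset ℤ) (y : ℤ → M), z₀ ∈ s ∧ (∀ z, y z ∈ G z) ∧ ∑ z ∈ s, y z = x := by
  classical
  obtain ⟨s, y, hy, rfl⟩ := exists_sum_of_mem_iSup hx
  refine ⟨insert z₀ s, fun z => if z ∈ s then y z else 0, by simp, fun z => ?_, ?_⟩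
  · beta_reduce
    split_ifs
    · exact hy z
    · exact zero_mem _
  · rw [Finset.sum_ite, Finset.sum_const_zero, add_zero]
    congr 1
    ext z
    simp only [Finset.mem_filter, Finset.mem_insert]
    tauto

/-- If the subspaces `G z` consist of eigenvectors with eigenvalue `z`, then an eigenvector with
eigenvalue `z` in the sum of these subspaces lies in `G z`. -/
lemma mem_of_eigenvector_of_mem_iSup [CharZero k] {D : Module.End k M} {G : ℤ → Submodule k M}
    (hG : ∀ z, ∀ x ∈ G z, D x = (z : k) • x) {x : M} (hx : x ∈ ⨆ z, G z) {z₀ : ℤ}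
    (hz : D x = (z₀ : k) • x) : x ∈ G z₀ := by
  obtain ⟨s, y, hs, hy, rfl⟩ := exists_sum_of_mem_iSup_insert hx z₀
  -- With the z₀-eigenspace as stable subspace, each component lies in two eigenspaces, so it
  -- vanishes unless z = z₀.
  have h := eigenvector_mem_of_sum_mem D (D.eigenspace z₀)
    (fun x hx => Module.End.mem_eigenspace_iff.2 (by
      rw [Module.End.mem_eigenspace_iff.1 hx, map_smul, Module.End.mem_eigenspace_iff.1 hx]))
    s y (fun z => hG z _ (hy z)) (Module.End.mem_eigenspace_iff.2 hz)
  rw [Finset.sum_eq_single_of_mem z₀ hs]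
  · exact hy z₀
  · intro z hz hne
    have e := Module.End.mem_eigenspace_iff.1 (h z hz)
    rw [hG z _ (hy z), ← sub_eq_zero, ← sub_smul, smul_eq_zero, sub_eq_zero] at e
    exact e.resolve_left fun h => hne (Int.cast_injective h)

/-- A stable subspace of a sum of eigenspaces is the sum of its homogeneous parts. -/
lemma mem_iSup_inf_of_stable [CharZero k] {D : Module.End k M} {G : ℤ → Submodule k M}
    (hG : ∀ z, ∀ x ∈ G z, D x = (z : k) • x) {P : Submodule k M} (hP : ∀ x ∈ P, D x ∈ P)
    {x : M} (hx : x ∈ ⨆ z, G z) (hxP : x ∈ P) : x ∈ ⨆ z, P ⊓ G z := by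
  obtain ⟨s, y, hy, rfl⟩ := exists_sum_of_mem_iSup hx
  have h := eigenvector_mem_of_sum_mem D P hP s y (fun z => hG z _ (hy z)) hxP
  exact Submodule.sum_mem _ fun z hz => Submodule.mem_iSup_of_mem z ⟨h z hz, hy z⟩

/-- The span of the vectors obtained by `n` applications of operators `T i`, `i ∈ B`, from
vectors in `W`. -/
def wordSpan {I : Type v} (T : I → Module.End k M) (B : Set I) (W : Submodule k M) :
    ℕ → Submodule k M
  | 0 => W
  | n + 1 => ⨆ i ∈ B, (wordSpan T B W n).map (T i)

variable {I : Type v} {T : I → Module.End k M} {B : Set I} {W : Submodule k M}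

lemma apply_mem_wordSpan {i : I} (hi : i ∈ B) {n : ℕ} {m : M} (hm : m ∈ wordSpan T B W n) :
    T i m ∈ wordSpan T B W (n + 1) :=
  Submodule.mem_iSup_of_mem i (Submodule.mem_iSup_of_mem hi (Submodule.mem_map_of_mem hm))

lemma wordSpan_succ_le {n : ℕ} {Q : Submodule k M}
    (h : ∀ i ∈ B, ∀ m ∈ wordSpan T B W n, T i m ∈ Q) : wordSpan T B W (n + 1) ≤ Q := by
  refine iSup_le fun i => iSup_le fun hi => ?_
  rintro _ ⟨m, hm, rfl⟩
  exact h i hi m hm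

lemma wordSpan_le {Q : Submodule k M} (h₀ : W ≤ Q) (h : ∀ i ∈ B, ∀ m ∈ Q, T i m ∈ Q) (n : ℕ) :
    wordSpan T B W n ≤ Q := by
  induction n with
  | zero => exact h₀
  | succ n ih => exact wordSpan_succ_le fun i hi m hm => h i hi m (ih hm)

lemma iSup_wordSpan_le {Q : Submodule k M} (h₀ : W ≤ Q) (h : ∀ i ∈ B, ∀ m ∈ Q, T i m ∈ Q) :
    ⨆ n, wordSpan T B W n ≤ Q :=
  iSup_le fun n => wordSpan_le h₀ h n

lemma wordSpan_mono {B' : Set I} {W' : Submodule k M} (hB : B ⊆ B') (hW : W ≤ W') (n : ℕ) :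
    wordSpan T B W n ≤ wordSpan T B' W' n := by
  induction n with
  | zero => exact hW
  | succ n ih => exact wordSpan_succ_le fun i hi m hm => apply_mem_wordSpan (hB hi) (ih hm)

lemma apply_mem_iSup_wordSpan {i : I} (hi : i ∈ B) {m : M} (hm : m ∈ ⨆ n, wordSpan T B W n) :
    T i m ∈ ⨆ n, wordSpan T B W n := by
  have : ⨆ n, wordSpan T B W n ≤ (⨆ n, wordSpan T B W n).comap (T i) :=
    iSup_le fun n m hm => Submodule.mem_iSup_of_mem (n + 1) (apply_mem_wordSpan hi hm)
  exact this hm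

lemma finiteDimensional_wordSpan [Finite I] [FiniteDimensional k W] (n : ℕ) :
    FiniteDimensional k (wordSpan T B W n) := by
  induction n with
  | zero => assumption
  | succ n ih =>
    change FiniteDimensional k ↥(⨆ i ∈ B, (wordSpan T B W n).map (T i))
    infer_instance

variable {E F : I → Module.End k M} {Z : Submodule k M} {K : Cartan k I →ₗ[k] Module.End k M}

/-- The graded subspace with parts `Z` in degree zero, words in the raising operators in positive
degrees, and words in the lowering operators in negative degrees. -/
def triSpan (E F : I → Module.End k M) (B : Set I) (Wn Z Wp : Submodule k M) : ℤ → Submodule k M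
  | Int.ofNat 0 => Z
  | Int.ofNat (n + 1) => wordSpan E B Wp n
  | Int.negSucc n => wordSpan F B Wn n

variable {Wn Wp : Submodule k M}

/-- Exchanging the two families of operators reverses the grading. Degree -(n+1) is encoded as
`Int.negSucc n` and degree n+1 as its mirror image, so both are words of n further letters and the
identity is definitional in each case. -/
lemma triSpan_swap (z : ℤ) : triSpan F E B Wp Z Wn z = triSpan E F B Wn Z Wp (-z) := by
  rcases z with (_ | n) | n <;> rfl

lemma iSup_triSpan : ⨆ z, triSpan E F B Wn Z Wp z =
    (⨆ n, wordSpan F B Wn n) ⊔ Z ⊔ ⨆ n, wordSpan E B Wp n := by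
  apply le_antisymm
  · refine iSup_le fun z => ?_
    rcases z with (_ | n) | n
    · exact le_sup_of_le_left le_sup_right
    · exact le_sup_of_le_right (le_iSup (wordSpan E B Wp) n)
    · exact le_sup_of_le_left (le_sup_of_le_left (le_iSup (wordSpan F B Wn) n))
  · refine sup_le (sup_le (iSup_le fun n => ?_) (le_iSup (triSpan E F B Wn Z Wp) 0))
      (iSup_le fun n => ?_)
    · exact le_iSup (triSpan E F B Wn Z Wp) (Int.negSucc n)
    · exact le_iSup (triSpan E F B Wn Z Wp) (Int.ofNat (n + 1))

/-- Starting data for a graded subspace which is stable under the Chevalley generators. -/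
structure IsTriSeed (K : Cartan k I →ₗ[k] Module.End k M) (E F : I → Module.End k M) (B : Set I)
    (Wn Z Wp : Submodule k M) : Prop where
  kn : ∀ x, ∀ m ∈ Wn, K x m ∈ Wn
  kz : ∀ x, ∀ m ∈ Z, K x m = 0
  kp : ∀ x, ∀ m ∈ Wp, K x m ∈ Wp
  ez : ∀ i ∈ B, ∀ m ∈ Z, E i m ∈ Wp
  fz : ∀ i ∈ B, ∀ m ∈ Z, F i m ∈ Wn
  en : ∀ i, ∀ m ∈ Wn, E i m ∈ Z
  fp : ∀ i, ∀ m ∈ Wp, F i m ∈ Z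

/-- The Chevalley involution. It allows every statement to be proved for one sign only. -/
lemma IsTriSeed.swap (s : IsTriSeed K E F B Wn Z Wp) : IsTriSeed (-K) F E B Wp Z Wn where
  kn x m hm := by simpa using neg_mem (s.kp x m hm)
  kz x m hm := by simpa using s.kz x m hm
  kp x m hm := by simpa using neg_mem (s.kn x m hm)
  ez := s.fz
  fz := s.ez
  en := s.fp
  fp := s.en

end Words

/-! ### Operators satisfying the relations of the Chevalley generators -/

section Triangular

variable {k : Type u} [Field k] {I : Type v} [DecidableEq I] {A : Matrix I I ℤ}
  {M : Type*} [AddCommGroup M] [Module k M]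

variable (A) in
/-- Operators satisfying the defining relations of the algebra `g̃`. -/
structure IsTriRep (K : Cartan k I →ₗ[k] Module.End k M) (E F : I → Module.End k M) : Prop where
  kk : ∀ x y m, K x (K y m) = K y (K x m)
  ke : ∀ x i m, K x (E i m) = E i (K x m) + simpleRoot k A i x • E i m
  kf : ∀ x i m, K x (F i m) = F i (K x m) - simpleRoot k A i x • F i m
  ef : ∀ i j m, E i (F j m) = F j (E i m) + if i = j then K (coroot k i) m else 0

variable {K : Cartan k I →ₗ[k] Module.End k M} {E F : I → Module.End k M}

lemma IsTriRep.swap (t : IsTriRep A K E F) : IsTriRep A (-K) F E where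
  kk x y m := by simp [t.kk x y m]
  ke x i m := by simpa [t.kf x i m] using sub_eq_neg_add _ _
  kf x i m := by simp [t.ke x i m]; abel
  ef i j m := by
    rw [t.ef j i m]
    by_cases h : i = j
    · subst h; simp
    · simp [h, Ne.symm h]

variable {B : Set I} {W Z : Submodule k M}

lemma IsTriRep.cartan_wordSpan (t : IsTriRep A K E F) (x : Cartan k I)
    (hW : ∀ m ∈ W, K x m ∈ W) (n : ℕ) : ∀ m ∈ wordSpan E B W n, K x m ∈ wordSpan E B W n := by
  induction n with
  | zero => exact hW
  | succ n ih =>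
    refine wordSpan_succ_le (Q := (wordSpan E B W (n + 1)).comap (K x)) fun i hi m hm => ?_
    rw [Submodule.mem_comap, t.ke]
    exact add_mem (apply_mem_wordSpan hi (ih m hm))
      (Submodule.smul_mem _ _ (apply_mem_wordSpan hi hm))

/-- Lowering operators shorten words in the raising operators. -/
lemma IsTriRep.lower_wordSpan (t : IsTriRep A K E F) (j : I) (hK : ∀ x, ∀ m ∈ W, K x m ∈ W)
    (hZ : ∀ i ∈ B, ∀ m ∈ Z, E i m ∈ W) (hW : ∀ m ∈ W, F j m ∈ Z) (n : ℕ) :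
    ∀ m ∈ wordSpan E B W (n + 1), F j m ∈ wordSpan E B W n := by
  induction n with
  | zero =>
    refine wordSpan_succ_le (Q := W.comap (F j)) fun i hi m hm => ?_
    -- Moving F_j past E_i costs only a Cartan operator, which preserves the length of words.
    have e := t.ef i j m
    rw [Submodule.mem_comap, ← sub_eq_of_eq_add e]
    refine sub_mem (hZ i hi _ (hW m hm)) ?_
    split_ifs
    · exact hK _ _ hm
    · exact zero_mem _
  | succ n ih =>
    refine wordSpan_succ_le (Q := (wordSpan E B W (n + 1)).comap (F j)) fun i hi m hm => ?_
    have e := t.ef i j m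
    rw [Submodule.mem_comap, ← sub_eq_of_eq_add e]
    refine sub_mem (apply_mem_wordSpan hi (ih m hm)) ?_
    split_ifs
    · exact t.cartan_wordSpan _ (hK _) _ _ hm
    · exact zero_mem _

/-- The sum of the fundamental coweights. -/
noncomputable def rhoCheck (k : Type u) [Field k] (I : Type v) [Fintype I] : Cartan k I :=
  ∑ i, coweight k i

lemma simpleRoot_coroot (i j : I) : simpleRoot k A i (coroot k j) = A j i := by
  simp [simpleRoot, coroot, rootValue]

lemma simpleRoot_coweight (i j : I) :
    simpleRoot k A i (coweight k j) = if j = i then 1 else 0 := by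
  simp [simpleRoot, coweight, rootValue]

lemma simpleRoot_rhoCheck [Fintype I] (i : I) : simpleRoot k A i (rhoCheck k I) = 1 := by
  simp [rhoCheck, simpleRoot_coweight]

/-- Each E_i raises the eigenvalue by α_i(ρ^∨) = 1. The shift by one is the degree of the starting
vectors. -/
lemma IsTriRep.rhoCheck_wordSpan [Fintype I] (t : IsTriRep A K E F)
    (hW : ∀ m ∈ W, K (rhoCheck k I) m = m) (n : ℕ) :
    ∀ m ∈ wordSpan E B W n, K (rhoCheck k I) m = ((n : k) + 1) • m := by
  induction n with
  | zero => intro m hm; simpa using hW m hm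
  | succ n ih =>
    intro m hm
    rw [← Module.End.mem_eigenspace_iff]
    refine wordSpan_succ_le (fun i _ m hm => ?_) hm
    rw [Module.End.mem_eigenspace_iff, t.ke, ih m hm, simpleRoot_rhoCheck, map_smul, ← add_smul]
    push_cast
    rfl

variable {Wn Wp : Submodule k M}

/-- In degrees 0 and -1 this is part of the seed, and in positive degrees it is the definition of
words. Only degrees at most -2 need an argument: there E_i shortens a word in the lowering
operators. -/
lemma IsTriSeed.raise (t : IsTriRep A K E F) (s : IsTriSeed K E F B Wn Z Wp) {i : I} (hi : i ∈ B)
    (z : ℤ) {m : M} (hm : m ∈ triSpan E F B Wn Z Wp z) : E i m ∈ triSpan E F B Wn Z Wp (z + 1) := by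
  rcases z with (_ | n) | _ | n
  · exact s.ez i hi m hm
  · exact apply_mem_wordSpan hi hm
  · exact s.en i m hm
  · exact t.swap.lower_wordSpan i (fun x m hm => by simpa using neg_mem (s.kn x m hm))
      (Z := Z) s.fz (s.en i) n m hm

lemma IsTriSeed.lower (t : IsTriRep A K E F) (s : IsTriSeed K E F B Wn Z Wp) {i : I} (hi : i ∈ B)
    (z : ℤ) {m : M} (hm : m ∈ triSpan E F B Wn Z Wp z) : F i m ∈ triSpan E F B Wn Z Wp (z - 1) := by
  have := s.swap.raise t.swap hi (-z) (m := m) (by rw [triSpan_swap, neg_neg]; exact hm)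
  rw [triSpan_swap] at this
  convert this using 2
  ring

lemma IsTriSeed.cartan (t : IsTriRep A K E F) (s : IsTriSeed K E F B Wn Z Wp) (x : Cartan k I)
    (z : ℤ) {m : M} (hm : m ∈ triSpan E F B Wn Z Wp z) : K x m ∈ triSpan E F B Wn Z Wp z := by
  rcases z with (_ | n) | n
  · rw [s.kz x m hm]; exact zero_mem _
  · exact t.cartan_wordSpan x (s.kp x) n m hm
  · have := t.swap.cartan_wordSpan (B := B) x (s.swap.kp x) n m hm
    rw [LinearMap.neg_apply, LinearMap.neg_apply, neg_mem_iff] at this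
    exact this

lemma IsTriSeed.raise_iSup (t : IsTriRep A K E F) (s : IsTriSeed K E F B Wn Z Wp) {i : I}
    (hi : i ∈ B) {m : M} (hm : m ∈ ⨆ z, triSpan E F B Wn Z Wp z) :
    E i m ∈ ⨆ z, triSpan E F B Wn Z Wp z :=
  apply_mem_iSup_of_forall (fun z _ hm => Submodule.mem_iSup_of_mem _ (s.raise t hi z hm)) hm

lemma IsTriSeed.lower_iSup (t : IsTriRep A K E F) (s : IsTriSeed K E F B Wn Z Wp) {i : I}
    (hi : i ∈ B) {m : M} (hm : m ∈ ⨆ z, triSpan E F B Wn Z Wp z) :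
    F i m ∈ ⨆ z, triSpan E F B Wn Z Wp z :=
  apply_mem_iSup_of_forall (fun z _ hm => Submodule.mem_iSup_of_mem _ (s.lower t hi z hm)) hm

lemma IsTriSeed.cartan_iSup (t : IsTriRep A K E F) (s : IsTriSeed K E F B Wn Z Wp)
    (x : Cartan k I) {m : M} (hm : m ∈ ⨆ z, triSpan E F B Wn Z Wp z) :
    K x m ∈ ⨆ z, triSpan E F B Wn Z Wp z :=
  apply_mem_iSup_of_forall (fun z _ hm => Submodule.mem_iSup_of_mem _ (s.cartan t x z hm)) hm

/-- This makes the grading intrinsic: it is read off from one operator, so the sum is direct and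
subspaces stable under that operator are graded. -/
lemma IsTriSeed.rhoCheck_triSpan [Fintype I] (t : IsTriRep A K E F)
    (s : IsTriSeed K E F B Wn Z Wp) (hp : ∀ m ∈ Wp, K (rhoCheck k I) m = m)
    (hn : ∀ m ∈ Wn, K (rhoCheck k I) m = -m) (z : ℤ) {m : M}
    (hm : m ∈ triSpan E F B Wn Z Wp z) : K (rhoCheck k I) m = (z : k) • m := by
  rcases z with (_ | n) | n
  · rw [s.kz _ m hm]; simp
  · rw [t.rhoCheck_wordSpan hp n m hm]; simp
  · have := t.swap.rhoCheck_wordSpan (B := B) (fun m hm => by simp [hn m hm]) n m hm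
    rw [LinearMap.neg_apply, LinearMap.neg_apply, neg_eq_iff_eq_neg] at this
    rw [this, ← neg_smul]
    simp

end Triangular


/-! ### The triangular decomposition -/

section Chev

variable {k : Type u} [Field k] {I : Type v}

/-- A subspace which contains a set `S` and is stable under bracketing with elements of `S`
contains the Lie subalgebra generated by `S`. -/
lemma lieSpan_le_submodule {L : Type*} [LieRing L] [LieAlgebra k L] {S : Set L}
    {Q : Submodule k L} (hS : S ⊆ Q) (hQ : ∀ s ∈ S, ∀ x ∈ Q, ⁅s, x⁆ ∈ Q) {x : L}
    (hx : x ∈ LieSubalgebra.lieSpan k L S) : x ∈ Q := by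
  -- The induction needs both properties at once: the elements of Q which normalise Q form a Lie
  -- subalgebra.
  have key : x ∈ Q ∧ ∀ y ∈ Q, ⁅x, y⁆ ∈ Q := by
    induction hx using LieSubalgebra.lieSpan_induction with
    | mem x hx => exact ⟨hS hx, hQ x hx⟩
    | zero => exact ⟨zero_mem _, fun y _ => by simp⟩
    | add x y _ _ hx hy => exact ⟨add_mem hx.1 hy.1, fun z hz => by
        rw [add_lie]; exact add_mem (hx.2 z hz) (hy.2 z hz)⟩
    | smul c x _ hx => exact ⟨Q.smul_mem c hx.1, fun z hz => by
        rw [smul_lie]; exact Q.smul_mem c (hx.2 z hz)⟩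
    | lie x y _ _ hx hy => exact ⟨hx.2 y hy.1, fun z hz => by
        rw [lie_lie]; exact sub_mem (hx.2 _ (hy.2 z hz)) (hy.2 _ (hx.2 z hz))⟩
  exact key.1

lemma mem_top_of_lieSpan {L : Type*} [LieRing L] [LieAlgebra k L] {S : Set L}
    (hgen : LieSubalgebra.lieSpan k L S = ⊤) {Q : Submodule k L} (hS : S ⊆ Q)
    (hQ : ∀ s ∈ S, ∀ x ∈ Q, ⁅s, x⁆ ∈ Q) (x : L) : x ∈ Q :=
  lieSpan_le_submodule hS hQ (hgen ▸ LieSubalgebra.mem_top x)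

variable {L : Type*} [LieRing L] [LieAlgebra k L]

lemma coroot_mem {B : Set I} {i : I} (hi : i ∈ B) : coroot k i ∈ cartanSub k B :=
  Submodule.subset_span ⟨i, hi, Or.inl rfl⟩

lemma coweight_mem {B : Set I} {i : I} (hi : i ∈ B) : coweight k i ∈ cartanSub k B :=
  Submodule.subset_span ⟨i, hi, Or.inr rfl⟩

lemma cartanSub_univ : cartanSub k (Set.univ : Set I) = ⊤ := by
  rw [eq_top_iff, ← (Finsupp.basisSingleOne (R := k) (ι := I ⊕ I)).span_eq, Submodule.span_le]
  rintro _ ⟨i | i, rfl⟩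
  · simpa [coroot] using coroot_mem (k := k) (Set.mem_univ i)
  · simpa [coweight] using coweight_mem (k := k) (Set.mem_univ i)

/-- The graded pieces of the subalgebra generated by the Chevalley generators labelled by `B`. -/
noncomputable def chevGr (h : Cartan k I →ₗ[k] L) (e f : I → L) (B : Set I) : ℤ → Submodule k L :=
  triSpan (fun i => LieAlgebra.ad k L (e i)) (fun i => LieAlgebra.ad k L (f i)) B
    (Submodule.span k (f '' B)) ((cartanSub k B).map h) (Submodule.span k (e '' B))

section

variable {h : Cartan k I →ₗ[k] L} {e f : I → L}

lemma h_mem_gr {B : Set I} {x : Cartan k I} (hx : x ∈ cartanSub k B) : h x ∈ chevGr h e f B 0 :=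
  Submodule.mem_map_of_mem hx

lemma e_mem_gr {B : Set I} {i : I} (hi : i ∈ B) : e i ∈ chevGr h e f B 1 :=
  Submodule.subset_span (Set.mem_image_of_mem _ hi)

lemma f_mem_gr {B : Set I} {i : I} (hi : i ∈ B) : f i ∈ chevGr h e f B (-1) :=
  Submodule.subset_span (Set.mem_image_of_mem _ hi)

lemma gr_le_univ (B : Set I) (z : ℤ) : chevGr h e f B z ≤ chevGr h e f Set.univ z := by
  rcases z with (_ | n) | n
  · exact Submodule.map_mono (by rw [cartanSub_univ]; exact le_top)
  · exact wordSpan_mono (Set.subset_univ _)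
      (Submodule.span_mono (Set.image_mono (Set.subset_univ _))) n
  · exact wordSpan_mono (Set.subset_univ _)
      (Submodule.span_mono (Set.image_mono (Set.subset_univ _))) n

end

variable [DecidableEq I]

/-- Chevalley generators of a Lie algebra. -/
structure IsChev (A : Matrix I I ℤ) (h : Cartan k I →ₗ[k] L) (e f : I → L) : Prop where
  hh : ∀ x y, ⁅h x, h y⁆ = 0
  he : ∀ x i, ⁅h x, e i⁆ = simpleRoot k A i x • e i
  hf : ∀ x i, ⁅h x, f i⁆ = -(simpleRoot k A i x • f i)
  ef : ∀ i j, ⁅e i, f j⁆ = if i = j then h (coroot k i) else 0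
  gen : LieSubalgebra.lieSpan k L (Set.range h ∪ Set.range e ∪ Set.range f) = ⊤
  inj : Function.Injective h

namespace IsChev

variable {A : Matrix I I ℤ} {h : Cartan k I →ₗ[k] L} {e f : I → L} (C : IsChev A h e f)
include C

lemma eh (x : Cartan k I) (i : I) : ⁅e i, h x⁆ = -(simpleRoot k A i x • e i) := by
  rw [← lie_skew, C.he]

lemma fh (x : Cartan k I) (i : I) : ⁅f i, h x⁆ = simpleRoot k A i x • f i := by
  rw [← lie_skew, C.hf, neg_neg]

lemma fe (i j : I) : ⁅f i, e j⁆ = if i = j then -h (coroot k i) else 0 := by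
  rw [← lie_skew, C.ef]
  by_cases hij : i = j
  · subst hij; simp
  · simp [hij, Ne.symm hij]

/-- The sign of h is forced by [f_i, e_i] = -h_i. -/
lemma swap : IsChev A (-h) f e where
  hh x y := by simp [C.hh]
  he x i := by simp [C.hf]
  hf x i := by simp [C.he]
  ef i j := by rw [C.fe]; rfl
  gen := by
    rw [← C.gen]
    have : Set.range (-h) = Set.range h := by
      ext y
      constructor
      · rintro ⟨x, rfl⟩; exact ⟨-x, by simp⟩
      · rintro ⟨x, rfl⟩; exact ⟨-x, by simp⟩
    rw [this, Set.union_right_comm]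
  inj x y hxy := C.inj (neg_injective hxy)

lemma rep : IsTriRep A ((LieAlgebra.ad k L : L →ₗ[k] Module.End k L) ∘ₗ h)
    (fun i => LieAlgebra.ad k L (e i)) (fun i => LieAlgebra.ad k L (f i)) where
  kk x y m := by simp [leibniz_lie (h x) (h y), C.hh]
  ke x i m := by simp [leibniz_lie (h x) (e i), C.he, add_comm]
  kf x i m := by simp [leibniz_lie (h x) (f i), C.hf, sub_eq_neg_add]
  ef i j m := by
    simp only [LieAlgebra.ad_apply, leibniz_lie (e i) (f j), C.ef]
    split_ifs <;> simp [add_comm]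

lemma seed (B : Set I) : IsTriSeed ((LieAlgebra.ad k L : L →ₗ[k] Module.End k L) ∘ₗ h)
    (fun i => LieAlgebra.ad k L (e i)) (fun i => LieAlgebra.ad k L (f i)) B
    (Submodule.span k (f '' B)) ((cartanSub k B).map h) (Submodule.span k (e '' B)) where
  kn x m hm := by
    refine (Submodule.span_le (p := (Submodule.span k (f '' B)).comap _)).2 ?_ hm
    rintro _ ⟨i, hi, rfl⟩
    simp only [Submodule.comap_coe, Set.mem_preimage, LinearMap.comp_apply, SetLike.mem_coe]
    change ⁅h x, f i⁆ ∈ _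
    rw [C.hf]
    exact neg_mem (Submodule.smul_mem _ _ (Submodule.subset_span ⟨i, hi, rfl⟩))
  kp x m hm := by
    refine (Submodule.span_le (p := (Submodule.span k (e '' B)).comap _)).2 ?_ hm
    rintro _ ⟨i, hi, rfl⟩
    simp only [Submodule.comap_coe, Set.mem_preimage, LinearMap.comp_apply, SetLike.mem_coe]
    change ⁅h x, e i⁆ ∈ _
    rw [C.he]
    exact Submodule.smul_mem _ _ (Submodule.subset_span ⟨i, hi, rfl⟩)
  kz x m hm := by
    obtain ⟨y, _, rfl⟩ := hm
    exact C.hh x y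
  ez i hi m hm := by
    obtain ⟨y, _, rfl⟩ := hm
    change ⁅e i, h y⁆ ∈ _
    rw [C.eh]
    exact neg_mem (Submodule.smul_mem _ _ (Submodule.subset_span ⟨i, hi, rfl⟩))
  fz i hi m hm := by
    obtain ⟨y, _, rfl⟩ := hm
    change ⁅f i, h y⁆ ∈ _
    rw [C.fh]
    exact Submodule.smul_mem _ _ (Submodule.subset_span ⟨i, hi, rfl⟩)
  en i m hm := by
    refine (Submodule.span_le (p := ((cartanSub k B).map h).comap (LieAlgebra.ad k L (e i)))).2
      ?_ hm
    rintro _ ⟨j, hj, rfl⟩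
    simp only [Submodule.comap_coe, Set.mem_preimage, SetLike.mem_coe, LieAlgebra.ad_apply, C.ef]
    split_ifs with hij
    · exact Submodule.mem_map_of_mem (coroot_mem (hij ▸ hj))
    · exact zero_mem _
  fp i m hm := by
    refine (Submodule.span_le (p := ((cartanSub k B).map h).comap (LieAlgebra.ad k L (f i)))).2
      ?_ hm
    rintro _ ⟨j, hj, rfl⟩
    simp only [Submodule.comap_coe, Set.mem_preimage, SetLike.mem_coe, LieAlgebra.ad_apply, C.fe]
    split_ifs with hij
    · exact neg_mem (Submodule.mem_map_of_mem (coroot_mem (hij ▸ hj)))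
    · exact zero_mem _

lemma rhoCheck_gr [Fintype I] (B : Set I) (z : ℤ) {x : L} (hx : x ∈ chevGr h e f B z) :
    LieAlgebra.ad k L (h (rhoCheck k I)) x = (z : k) • x := by
  refine (C.seed B).rhoCheck_triSpan C.rep (fun m hm => ?_) (fun m hm => ?_) z hx
  · suffices m ∈ Module.End.eigenspace (LieAlgebra.ad k L (h (rhoCheck k I))) 1 by
      simpa using Module.End.mem_eigenspace_iff.1 this
    refine (Submodule.span_le (p := Module.End.eigenspace _ _)).2 ?_ hm
    rintro _ ⟨i, _, rfl⟩
    rw [SetLike.mem_coe, Module.End.mem_eigenspace_iff]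
    change ⁅h _, e i⁆ = _
    rw [C.he, simpleRoot_rhoCheck]
  · suffices m ∈ Module.End.eigenspace (LieAlgebra.ad k L (h (rhoCheck k I))) (-1) by
      simpa using Module.End.mem_eigenspace_iff.1 this
    refine (Submodule.span_le (p := Module.End.eigenspace _ _)).2 ?_ hm
    rintro _ ⟨i, _, rfl⟩
    rw [SetLike.mem_coe, Module.End.mem_eigenspace_iff]
    change ⁅h _, f i⁆ = _
    rw [C.hf, simpleRoot_rhoCheck, neg_smul]

/-- The sum of the graded pieces contains the generators and is stable under bracketing with them.
-/
lemma iSup_gr : ⨆ z, chevGr h e f Set.univ z = ⊤ := by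
  rw [eq_top_iff]
  intro x _
  refine mem_top_of_lieSpan C.gen ?_ ?_ x
  · rintro _ ((⟨x, rfl⟩ | ⟨i, rfl⟩) | ⟨i, rfl⟩)
    · exact Submodule.mem_iSup_of_mem 0 (h_mem_gr (by rw [cartanSub_univ]; trivial))
    · exact Submodule.mem_iSup_of_mem 1 (e_mem_gr trivial)
    · exact Submodule.mem_iSup_of_mem (-1) (f_mem_gr trivial)
  · rintro _ ((⟨x, rfl⟩ | ⟨i, rfl⟩) | ⟨i, rfl⟩) y hy
    · exact (C.seed _).cartan_iSup C.rep x hy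
    · exact (C.seed Set.univ).raise_iSup C.rep (Set.mem_univ i) hy
    · exact (C.seed Set.univ).lower_iSup C.rep (Set.mem_univ i) hy

variable [Fintype I] [CharZero k]

lemma isCompl_gr : IsCompl (LinearMap.range h)
    (⨆ z : {z : ℤ // z ≠ 0}, chevGr h e f Set.univ z) := by
  have e0 : LinearMap.range h = chevGr h e f Set.univ 0 := by
    rw [LinearMap.range_eq_map]
    change _ = (cartanSub k Set.univ).map h
    rw [cartanSub_univ]
  -- The sum over nonzero degrees is reindexed by all integers with ⊥ in degree zero; an eigenvector
  -- with eigenvalue 0 in it then lies in ⊥.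
  have hle : (⨆ z : {z : ℤ // z ≠ 0}, chevGr h e f Set.univ z) =
      ⨆ z : ℤ, if z ≠ 0 then chevGr h e f Set.univ z else ⊥ := by
    apply le_antisymm
    · refine iSup_le fun z => le_trans (le_of_eq ?_)
        (le_iSup (fun z : ℤ => if z ≠ 0 then chevGr h e f Set.univ z else ⊥) z)
      rw [if_pos z.2]
    · refine iSup_le fun z => ?_
      split_ifs with hz
      · exact le_iSup (fun z : {z : ℤ // z ≠ 0} => chevGr h e f Set.univ z) ⟨z, hz⟩
      · exact bot_le
  constructor
  · rw [Submodule.disjoint_def]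
    intro x hx hx'
    rw [e0] at hx
    rw [hle] at hx'
    have := mem_of_eigenvector_of_mem_iSup (D := LieAlgebra.ad k L (h (rhoCheck k I)))
      (fun z y hy => ?_) hx' (C.rhoCheck_gr _ _ hx)
    · simpa using this
    · split_ifs at hy with hz
      · exact C.rhoCheck_gr _ _ hy
      · rw [(Submodule.mem_bot k).1 hy]; simp
  · rw [codisjoint_iff, eq_top_iff, ← C.iSup_gr]
    refine iSup_le fun z => ?_
    by_cases hz : z = 0
    · subst hz; rw [← e0]; exact le_sup_left
    · exact le_sup_of_le_right
        (le_iSup (fun z : {z : ℤ // z ≠ 0} => chevGr h e f Set.univ z) ⟨z, hz⟩)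

/-- The projection to the Cartan subalgebra. -/
noncomputable def proj : L →ₗ[k] Cartan k I :=
  (LinearEquiv.ofInjective h C.inj).symm.toLinearMap ∘ₗ
    (LinearMap.range h).projectionOnto _ C.isCompl_gr

lemma proj_h (x : Cartan k I) : C.proj (h x) = x := by
  have : (LinearMap.range h).projectionOnto _ C.isCompl_gr (h x) = ⟨h x, x, rfl⟩ :=
    Submodule.projectionOnto_apply_left C.isCompl_gr ⟨h x, x, rfl⟩
  rw [proj, LinearMap.comp_apply, this]
  exact (LinearEquiv.ofInjective h C.inj).symm_apply_apply x

lemma proj_gr {B : Set I} {z : ℤ} (hz : z ≠ 0) {x : L} (hx : x ∈ chevGr h e f B z) :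
    C.proj x = 0 := by
  have : (LinearMap.range h).projectionOnto _ C.isCompl_gr x = 0 :=
    (Submodule.projectionOnto_apply_eq_zero_iff C.isCompl_gr).2
      (Submodule.mem_iSup_of_mem (⟨z, hz⟩ : {z : ℤ // z ≠ 0}) (gr_le_univ B z hx))
  rw [proj, LinearMap.comp_apply, this, map_zero]

lemma h_proj {B : Set I} {x : L} (hx : x ∈ chevGr h e f B 0) : h (C.proj x) = x := by
  obtain ⟨y, _, rfl⟩ := hx
  rw [C.proj_h]

lemma proj_eq_zero_of_eigenvector {z : ℤ} (hz : z ≠ 0) {x : L}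
    (hx : ⁅h (rhoCheck k I), x⁆ = (z : k) • x) : C.proj x = 0 := by
  refine C.proj_gr (B := Set.univ) hz (mem_of_eigenvector_of_mem_iSup
    (fun z x hx => C.rhoCheck_gr Set.univ z hx) ?_ hx)
  rw [C.iSup_gr]; trivial

/-- Ideals with trivial intersection with the Cartan subalgebra have trivial projection to it. -/
lemma proj_ideal {J : LieIdeal k L} (hJ : ∀ x, h x ∈ J → h x = 0) {x : L} (hx : x ∈ J) :
    C.proj x = 0 := by
  -- An ideal is stable under ad ρ^∨, hence graded, and its part of degree zero lies in the Cartan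
  -- subalgebra.
  have hx' := mem_iSup_inf_of_stable (fun z x hx => C.rhoCheck_gr Set.univ z hx)
    (P := J.toSubmodule) (fun x hx => J.lie_mem hx) (x := x)
    (by rw [C.iSup_gr]; trivial) hx
  rw [← LinearMap.mem_ker]
  refine (iSup_le fun z => ?_ : (⨆ z, J.toSubmodule ⊓ chevGr h e f Set.univ z) ≤ _) hx'
  rintro x ⟨hxJ, hx⟩
  rw [LinearMap.mem_ker]
  by_cases hz : z = 0
  · subst hz
    apply C.inj
    rw [map_zero]
    exact hJ _ (by rw [C.h_proj hx]; exact hxJ)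
  · exact C.proj_gr hz hx

end IsChev

end Chev

/-! ### The Cartan subalgebra embeds -/

section WordRep

variable {k : Type u} [Field k] {I : Type v} [DecidableEq I] (A : Matrix I I ℤ)
  (l : Module.Dual k (Cartan k I))

/-- The weight of a word in the lowering operators applied to a vector of weight `l`. -/
noncomputable def wordWeight : List I → Module.Dual k (Cartan k I)
  | [] => l
  | j :: w => wordWeight w - simpleRoot k A j

/-- The lowering operators on the vector space spanned by words. -/
noncomputable def wordLower (k : Type u) [Field k] {I : Type v} (j : I) :
    Module.End k (List I →₀ k) :=
  Finsupp.lmapDomain k k (List.cons j)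

/-- The image of a word under a raising operator. -/
noncomputable def wordRaiseVec (i : I) : List I → (List I →₀ k)
  | [] => 0
  | j :: w => wordLower k j (wordRaiseVec i w) +
      if i = j then Finsupp.single w (wordWeight A l w (coroot k i)) else 0

/-- The raising operators on the vector space spanned by words. -/
noncomputable def wordRaise (i : I) : Module.End k (List I →₀ k) :=
  Finsupp.linearCombination k (wordRaiseVec A l i)

/-- The action of the Cartan subalgebra on the vector space spanned by words. -/
noncomputable def wordCartan : Cartan k I →ₗ[k] Module.End k (List I →₀ k) where
  toFun x := Finsupp.linearCombination k fun w => Finsupp.single w (wordWeight A l w x)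
  map_add' x y := by ext w; simp
  map_smul' c x := by ext w; simp

lemma wordCartan_single (x : Cartan k I) (w : List I) (c : k) :
    wordCartan A l x (Finsupp.single w c) = wordWeight A l w x • Finsupp.single w c := by
  simp [wordCartan, mul_comm]

omit [DecidableEq I] in
lemma wordLower_single (j : I) (w : List I) (c : k) :
    wordLower k j (Finsupp.single w c) = Finsupp.single (j :: w) c := by
  simp [wordLower]

lemma wordCartan_lower (x : Cartan k I) (j : I) (m : List I →₀ k) :
    wordCartan A l x (wordLower k j m) =
      wordLower k j (wordCartan A l x m) - simpleRoot k A j x • wordLower k j m := by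
  induction m using Finsupp.induction_linear with
  | zero => simp
  | add m m' hm hm' => simp only [map_add, hm, hm', smul_add]; abel
  | single w c =>
    rw [wordLower_single, wordCartan_single, wordCartan_single, map_smul, wordLower_single,
      wordWeight, LinearMap.sub_apply, sub_smul]

lemma wordCartan_raiseVec (x : Cartan k I) (i : I) (w : List I) :
    wordCartan A l x (wordRaiseVec A l i w) =
      (wordWeight A l w x + simpleRoot k A i x) • wordRaiseVec A l i w := by
  induction w with
  | nil => simp [wordRaiseVec]
  | cons j w ih =>
    rw [wordRaiseVec, map_add, wordCartan_lower, ih, map_smul, smul_add, wordWeight,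
      LinearMap.sub_apply]
    split_ifs with h
    · subst h
      rw [wordCartan_single]
      module
    · rw [map_zero, smul_zero]
      module

/-- This is the analogue of a Verma module, free over the associative algebra on the lowering
operators. The recursion for the raising operators is the commutator of e_i and f_j, started by
letting e_i annihilate the empty word. -/
lemma isTriRep_word : IsTriRep A (wordCartan A l) (wordRaise A l) (wordLower k) where
  kk x y m := by
    induction m using Finsupp.induction_linear with
    | zero => simp
    | add m m' hm hm' => simp only [map_add, hm, hm']
    | single w c => simp only [wordCartan_single, map_smul]; rw [smul_comm]
  ke x i m := by
    induction m using Finsupp.induction_linear with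
    | zero => simp
    | add m m' hm hm' => simp only [map_add, hm, hm', smul_add]; abel
    | single w c =>
      rw [wordCartan_single, map_smul, wordRaise, Finsupp.linearCombination_single, map_smul,
        wordCartan_raiseVec]
      module
  kf := wordCartan_lower A l
  ef i j m := by
    induction m using Finsupp.induction_linear with
    | zero => simp
    | add m m' hm hm' =>
      simp only [map_add, hm, hm']
      split_ifs
      · abel
      · abel
    | single w c =>
      rw [wordLower_single, wordRaise, Finsupp.linearCombination_single,
        Finsupp.linearCombination_single, wordRaiseVec, smul_add, map_smul]
      split_ifs
      · rw [wordCartan_single]; simp [mul_comm]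
      · rw [smul_zero]

end WordRep

/-! ### The algebra given by generators and relations -/

section PreKM

variable (k : Type u) [Field k] {I : Type v} [DecidableEq I] (A : Matrix I I ℤ)

/-- The quotient map to `g̃`. -/
noncomputable def PreKM.mk : FreeLieAlgebra k (Gen I) →ₗ⁅k⁆ PreKM k A where
  toFun x := LieSubmodule.Quotient.mk (N := (LieSubmodule.lieSpan k (FreeLieAlgebra k (Gen I))
    {x | Rel k A x} : LieIdeal k (FreeLieAlgebra k (Gen I)))) x
  map_add' _ _ := rfl
  map_smul' _ _ := rfl
  map_lie' := rfl

lemma PreKM.mk_surjective : Function.Surjective (PreKM.mk k A) :=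
  LieSubmodule.Quotient.surjective_mk' _

lemma PreKM.mk_eq_zero {x : FreeLieAlgebra k (Gen I)} : PreKM.mk k A x = 0 ↔
    x ∈ (LieSubmodule.lieSpan k (FreeLieAlgebra k (Gen I)) {x | Rel k A x} :
      LieIdeal k (FreeLieAlgebra k (Gen I))) :=
  LieSubmodule.Quotient.mk_eq_zero'

lemma PreKM.mk_rel {x : FreeLieAlgebra k (Gen I)} (hx : Rel k A x) : PreKM.mk k A x = 0 :=
  (PreKM.mk_eq_zero k A).2 (LieSubmodule.subset_lieSpan hx)

lemma PreKM.mk_of (x : Gen I) : PreKM.mk k A (FreeLieAlgebra.of k x) = PreKM.gen k A x := rfl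

/-- A free Lie algebra is generated by its generators. -/
lemma lieSpan_range_of (X : Type*) :
    LieSubalgebra.lieSpan k (FreeLieAlgebra k X) (Set.range (FreeLieAlgebra.of k)) = ⊤ := by
  set K := LieSubalgebra.lieSpan k (FreeLieAlgebra k X) (Set.range (FreeLieAlgebra.of k))
  have hK : ∀ x, FreeLieAlgebra.of k x ∈ K := fun x => LieSubalgebra.subset_lieSpan ⟨x, rfl⟩
  let φ : FreeLieAlgebra k X →ₗ⁅k⁆ K := FreeLieAlgebra.lift k fun x => ⟨_, hK x⟩
  have : K.incl.comp φ = LieHom.id := by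
    apply FreeLieAlgebra.hom_ext
    intro x
    simp [φ]
  rw [eq_top_iff]
  intro x _
  have e := LieHom.congr_fun this x
  simp only [LieHom.comp_apply, LieHom.id_apply] at e
  rw [← e]
  exact (φ x).2

lemma PreKM.h_single (a : I ⊕ I) (c : k) :
    PreKM.h k A (Finsupp.single a c) = c • PreKM.gen k A (Gen.t a) := by
  simp [PreKM.h]

lemma simpleRoot_single (i : I) (a : I ⊕ I) (c : k) :
    simpleRoot k A i (Finsupp.single a c) = c * rootValue k A i a := by
  simp [simpleRoot]

/-- In the module on words of highest weight l, the element x acts on the empty word by l(x). If x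
maps to zero then l(x) = 0 for every l, whence x = 0. -/
lemma PreKM.h_injective : Function.Injective (PreKM.h k A) := by
  rw [injective_iff_map_eq_zero]
  intro x hx
  refine (Module.forall_dual_apply_eq_zero_iff k x).1 fun l => ?_
  let φ : FreeLieAlgebra k (Gen I) →ₗ⁅k⁆ Module.End k (List I →₀ k) :=
    FreeLieAlgebra.lift k fun g => match g with
      | Gen.t a => wordCartan A l (Finsupp.single a 1)
      | Gen.e i => wordRaise A l i
      | Gen.f i => wordLower k i
  have ht : ∀ a, φ (FreeLieAlgebra.of k (Gen.t a)) = wordCartan A l (Finsupp.single a 1) :=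
    fun a => FreeLieAlgebra.lift_of_apply ..
  have he : ∀ i, φ (FreeLieAlgebra.of k (Gen.e i)) = wordRaise A l i :=
    fun a => FreeLieAlgebra.lift_of_apply ..
  have hf : ∀ i, φ (FreeLieAlgebra.of k (Gen.f i)) = wordLower k i :=
    fun a => FreeLieAlgebra.lift_of_apply ..
  have T := isTriRep_word A l
  have hle : (LieSubmodule.lieSpan k (FreeLieAlgebra k (Gen I)) {x | Rel k A x} :
      LieIdeal k (FreeLieAlgebra k (Gen I))) ≤ φ.ker := by
    rw [LieSubmodule.lieSpan_le]
    intro y hy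
    rw [SetLike.mem_coe, LieHom.mem_ker]
    refine LinearMap.ext fun m => ?_
    rcases hy with ⟨a, b⟩ | ⟨a, i⟩ | ⟨a, i⟩ | ⟨i, j, hij⟩ | i
    · rw [LieHom.map_lie, ht, ht, LieRing.of_associative_ring_bracket]
      simp [T.kk (Finsupp.single a 1) (Finsupp.single b 1)]
    · rw [map_sub, LieHom.map_lie, map_smul, ht, he, LieRing.of_associative_ring_bracket]
      simp [T.ke (Finsupp.single a 1) i, simpleRoot_single]
    · rw [map_add, LieHom.map_lie, map_smul, ht, hf, LieRing.of_associative_ring_bracket]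
      simp [T.kf (Finsupp.single a 1) i, simpleRoot_single]
    · rw [LieHom.map_lie, he, hf, LieRing.of_associative_ring_bracket]
      simp [T.ef i j, hij]
    · rw [map_sub, LieHom.map_lie, he, hf, ht, LieRing.of_associative_ring_bracket]
      simp [T.ef i i, coroot]
  -- A lift of `PreKM.h k A x` to the free Lie algebra; it lies in the ideal of relations, which
  -- acts by zero on words.
  let X : FreeLieAlgebra k (Gen I) := x.sum fun a c => c • FreeLieAlgebra.of k (Gen.t a)
  have hX : PreKM.mk k A X = PreKM.h k A x := by
    simp [X, PreKM.h, Finsupp.linearCombination_apply, Finsupp.sum, PreKM.mk_of]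
  have hφ : φ X = wordCartan A l x := by
    conv_rhs => rw [← x.sum_single]
    simp only [X, Finsupp.sum, map_sum, map_smul, ht]
    refine Finset.sum_congr rfl fun a _ => ?_
    rw [← map_smul]; simp
  rw [hx, PreKM.mk_eq_zero] at hX
  have := hle hX
  rw [LieHom.mem_ker, hφ] at this
  have := congrArg (fun T => T (Finsupp.single [] 1) []) this
  simpa [wordCartan_single, wordWeight] using this

lemma PreKM.isChev : IsChev A (PreKM.h k A) (fun i => PreKM.gen k A (Gen.e i))
    (fun i => PreKM.gen k A (Gen.f i)) where
  hh x y := by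
    induction x using Finsupp.induction_linear with
    | zero => simp
    | add x x' hx hx' => rw [map_add, add_lie, hx, hx', add_zero]
    | single a c =>
      induction y using Finsupp.induction_linear with
      | zero => simp
      | add y y' hy hy' => rw [map_add, lie_add, hy, hy', add_zero]
      | single b c' =>
        have := PreKM.mk_rel k A (Rel.tt a b)
        rw [LieHom.map_lie, PreKM.mk_of, PreKM.mk_of] at this
        rw [PreKM.h_single, PreKM.h_single, smul_lie, lie_smul, this, smul_zero, smul_zero]
  he x i := by
    induction x using Finsupp.induction_linear with
    | zero => simp
    | add x x' hx hx' => rw [map_add, add_lie, hx, hx', map_add, add_smul]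
    | single a c =>
      have := PreKM.mk_rel k A (Rel.te a i)
      rw [map_sub, LieHom.map_lie, map_smul, PreKM.mk_of, PreKM.mk_of, sub_eq_zero] at this
      rw [PreKM.h_single, smul_lie, this, simpleRoot_single, mul_smul]
  hf x i := by
    induction x using Finsupp.induction_linear with
    | zero => simp
    | add x x' hx hx' => rw [map_add, add_lie, hx, hx', map_add, add_smul, neg_add]
    | single a c =>
      have := PreKM.mk_rel k A (Rel.tf a i)
      rw [map_add, LieHom.map_lie, map_smul, PreKM.mk_of, PreKM.mk_of,
        add_eq_zero_iff_eq_neg] at this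
      rw [PreKM.h_single, smul_lie, this, simpleRoot_single, mul_smul, smul_neg]
  ef i j := by
    split_ifs with hij
    · subst hij
      have := PreKM.mk_rel k A (Rel.ef_self (A := A) i)
      rw [map_sub, LieHom.map_lie, PreKM.mk_of, PreKM.mk_of, PreKM.mk_of, sub_eq_zero] at this
      rw [this, coroot, PreKM.h_single, one_smul]
    · have := PreKM.mk_rel k A (Rel.ef (A := A) i j hij)
      rwa [LieHom.map_lie, PreKM.mk_of, PreKM.mk_of] at this
  gen := by
    have e := congrArg (LieSubalgebra.map (PreKM.mk k A)) (lieSpan_range_of k (Gen I))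
    rw [LieSubalgebra.map_lieSpan] at e
    rw [eq_top_iff]
    intro x _
    obtain ⟨y, rfl⟩ := PreKM.mk_surjective k A x
    have hy : PreKM.mk k A y ∈ LieSubalgebra.map (PreKM.mk k A) ⊤ := ⟨y, trivial, rfl⟩
    rw [← e] at hy
    refine LieSubalgebra.lieSpan_mono ?_ hy
    rintro _ ⟨_, ⟨a | i | i, rfl⟩, rfl⟩
    · exact Or.inl (Or.inl ⟨Finsupp.single a 1, by rw [PreKM.h_single, one_smul]; rfl⟩)
    · exact Or.inl (Or.inr ⟨i, rfl⟩)
    · exact Or.inr ⟨i, rfl⟩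
  inj := PreKM.h_injective k A

end PreKM

/-! ### The quotient by the radical -/

section KM

variable (k : Type u) [Field k] {I : Type v} [DecidableEq I] (A : Matrix I I ℤ)

namespace KM

/-- The quotient map to the extended Kac-Moody algebra. -/
noncomputable def mk : PreKM k A →ₗ⁅k⁆ KM k A where
  toFun x := LieSubmodule.Quotient.mk (N := KMradical k A) x
  map_add' _ _ := rfl
  map_smul' _ _ := rfl
  map_lie' := rfl

lemma mk_surjective : Function.Surjective (mk k A) :=
  LieSubmodule.Quotient.surjective_mk' _

lemma mk_eq_zero {x : PreKM k A} : mk k A x = 0 ↔ x ∈ KMradical k A :=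
  LieSubmodule.Quotient.mk_eq_zero'

lemma mk_h (x : Cartan k I) : mk k A (PreKM.h k A x) = h k A x := by
  simp only [PreKM.h, h, Finsupp.linearCombination_apply, Finsupp.sum, map_sum, map_smul]
  rfl

lemma mk_e (i : I) : mk k A (PreKM.gen k A (Gen.e i)) = e k A i := rfl

lemma mk_f (i : I) : mk k A (PreKM.gen k A (Gen.f i)) = f k A i := rfl

variable [Fintype I] [CharZero k]

/-- Each ideal meeting the Cartan subalgebra trivially is killed by the projection to it
(`proj_ideal`). Being killed by a linear map passes to sums, whereas trivial intersection alone
would not. -/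
lemma h_injective : Function.Injective (h k A) := by
  rw [injective_iff_map_eq_zero]
  intro x hx
  rw [← mk_h, mk_eq_zero] at hx
  have hs : (KMradical k A).toSubmodule ≤ LinearMap.ker (PreKM.isChev k A).proj := by
    rw [KMradical, LieSubmodule.sSup_toSubmodule]
    refine sSup_le ?_
    rintro _ ⟨J, hJ, rfl⟩ y hy
    exact (PreKM.isChev k A).proj_ideal hJ hy
  have := hs hx
  rwa [LinearMap.mem_ker, IsChev.proj_h] at this

lemma isChev : IsChev A (h k A) (e k A) (f k A) where
  hh x y := by rw [← mk_h, ← mk_h, ← LieHom.map_lie, (PreKM.isChev k A).hh, map_zero]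
  he x i := by
    rw [← mk_h, ← mk_e, ← LieHom.map_lie, (PreKM.isChev k A).he, map_smul]
  hf x i := by
    rw [← mk_h, ← mk_f, ← LieHom.map_lie, (PreKM.isChev k A).hf, map_neg, map_smul]
  ef i j := by
    rw [← mk_e, ← mk_f, ← LieHom.map_lie, (PreKM.isChev k A).ef]
    split_ifs
    · rw [mk_h]
    · rw [map_zero]
  gen := by
    have e := congrArg (LieSubalgebra.map (mk k A)) (PreKM.isChev k A).gen
    rw [LieSubalgebra.map_lieSpan] at e
    rw [eq_top_iff]
    intro x _
    obtain ⟨y, rfl⟩ := mk_surjective k A x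
    have hy : mk k A y ∈ LieSubalgebra.map (mk k A) ⊤ := ⟨y, trivial, rfl⟩
    rw [← e] at hy
    refine LieSubalgebra.lieSpan_mono ?_ hy
    rintro _ ⟨_, ((⟨x, rfl⟩ | ⟨i, rfl⟩) | ⟨i, rfl⟩), rfl⟩
    · exact Or.inl (Or.inl ⟨x, (mk_h k A x).symm⟩)
    · exact Or.inl (Or.inr ⟨i, rfl⟩)
    · exact Or.inr ⟨i, rfl⟩
  inj := h_injective k A

variable {k A}

omit [Fintype I] [CharZero k] in
/-- Ideals of the extended Kac-Moody algebra with trivial intersection with the Cartan subalgebra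
are zero. -/
lemma eq_zero_of_mem_ideal {J : LieIdeal k (KM k A)} (hJ : ∀ x, h k A x ∈ J → x = 0)
    {x : KM k A} (hx : x ∈ J) : x = 0 := by
  obtain ⟨y, rfl⟩ := mk_surjective k A x
  rw [mk_eq_zero]
  have hmem : J.comap (mk k A) ∈
      {J : LieIdeal k (PreKM k A) | ∀ x, PreKM.h k A x ∈ J → PreKM.h k A x = 0} := by
    intro z hz
    rw [LieIdeal.mem_comap, mk_h] at hz
    rw [hJ z hz, map_zero]
  exact (le_sSup hmem : J.comap (mk k A) ≤ KMradical k A) (LieIdeal.mem_comap.2 hx)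

end KM
end KM

/-! ### The invariant form -/

section Form

variable {k : Type u} [Field k] {I : Type v} [DecidableEq I] [Fintype I] [CharZero k]
  {A : Matrix I I ℤ} {L : Type*} [LieRing L] [LieAlgebra k L]

/-- The action on the sum of the adjoint and the coadjoint representation. -/
def adCoad (k : Type u) [Field k] (L : Type*) [LieRing L] [LieAlgebra k L] :
    L →ₗ[k] Module.End k (L × Module.Dual k L) where
  toFun y := (LieAlgebra.ad k L y).prodMap (-(LieAlgebra.ad k L y).dualMap)
  map_add' x y := by ext <;> simp; abel
  map_smul' c x := by ext <;> simp

lemma adCoad_apply (y : L) (γ : L × Module.Dual k L) :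
    adCoad k L y γ = (⁅y, γ.1⁆, -(γ.2 ∘ₗ LieAlgebra.ad k L y)) := rfl

lemma adCoad_lie (x y : L) (γ : L × Module.Dual k L) :
    adCoad k L ⁅x, y⁆ γ = adCoad k L x (adCoad k L y γ) - adCoad k L y (adCoad k L x γ) := by
  apply Prod.ext
  · simp [adCoad_apply, lie_lie]
  · ext z
    simp [adCoad_apply, lie_lie]

namespace IsChev

variable {h : Cartan k I →ₗ[k] L} {e f : I → L} (C : IsChev A h e f)
include C

lemma adCoad_rep : IsTriRep A (adCoad k L ∘ₗ h) (fun i => adCoad k L (e i))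
    (fun i => adCoad k L (f i)) where
  kk x y m := by
    have := adCoad_lie (k := k) (h x) (h y) m
    rw [C.hh, map_zero, LinearMap.zero_apply, eq_comm, sub_eq_zero] at this
    exact this
  ke x i m := by
    have := adCoad_lie (k := k) (h x) (e i) m
    rw [C.he, map_smul, LinearMap.smul_apply, eq_sub_iff_add_eq'] at this
    exact this.symm
  kf x i m := by
    have := adCoad_lie (k := k) (h x) (f i) m
    rw [C.hf, map_neg, map_smul, LinearMap.neg_apply, LinearMap.smul_apply,
      eq_sub_iff_add_eq', ← sub_eq_add_neg] at this
    exact this.symm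
  ef i j m := by
    have := adCoad_lie (k := k) (e i) (f j) m
    rw [C.ef, eq_sub_iff_add_eq'] at this
    rw [← this]
    split_ifs <;> simp

lemma hom_ext_gr {U : Type*} [AddCommGroup U] [Module k U] {S T : L →ₗ[k] U}
    (hST : ∀ z, ∀ x ∈ chevGr h e f Set.univ z, S x = T x) : S = T := by
  ext x
  have hx : x ∈ ⨆ z, chevGr h e f Set.univ z := by rw [C.iSup_gr]; trivial
  have : ⨆ z, chevGr h e f Set.univ z ≤ LinearMap.eqLocus S T := iSup_le hST
  exact this hx

lemma proj_swap (x : L) : C.swap.proj x = -C.proj x := by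
  have : C.swap.proj = -C.proj := by
    refine C.hom_ext_gr fun z x hx => ?_
    by_cases hz : z = 0
    · subst hz
      obtain ⟨y, _, rfl⟩ := hx
      rw [LinearMap.neg_apply, C.proj_h]
      have := C.swap.proj_h (-y)
      simpa using this
    · rw [LinearMap.neg_apply, C.proj_gr hz hx, neg_zero]
      refine C.swap.proj_eq_zero_of_eigenvector (neg_ne_zero.2 hz) ?_
      have := C.rhoCheck_gr _ _ hx
      rw [LieAlgebra.ad_apply] at this
      rw [LinearMap.neg_apply, neg_lie, this]
      push_cast
      rw [neg_smul]
  rw [this]; rfl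

lemma proj_lie_h (x : Cartan k I) (y : L) : C.proj ⁅h x, y⁆ = 0 := by
  have : C.proj ∘ₗ LieAlgebra.ad k L (h x) = 0 := by
    refine C.hom_ext_gr fun z y hy => ?_
    by_cases hz : z = 0
    · subst hz
      obtain ⟨y, _, rfl⟩ := hy
      simp [C.hh]
    · exact C.proj_gr hz ((C.seed Set.univ).cartan C.rep x z hy)
  exact LinearMap.congr_fun this y

lemma proj_e (i : I) : C.proj (e i) = 0 :=
  C.proj_gr one_ne_zero (e_mem_gr (Set.mem_univ i))

lemma proj_f (i : I) : C.proj (f i) = 0 :=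
  C.proj_gr (by decide) (f_mem_gr (Set.mem_univ i))

/-- Only the component of y in degree -1 contributes; it is a combination of the f_j, and [e_i, f_j]
= δ_ij h_i. -/
lemma proj_lie_e (i : I) (y : L) : C.proj ⁅e i, y⁆ ∈ Submodule.span k {coroot k i} := by
  have hy : y ∈ ⨆ z, chevGr h e f Set.univ z := by rw [C.iSup_gr]; trivial
  have : ⨆ z, chevGr h e f Set.univ z ≤
      (Submodule.span k {coroot k i}).comap (C.proj ∘ₗ LieAlgebra.ad k L (e i)) := by
    refine iSup_le fun z y hy => ?_
    by_cases hz : z = -1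
    · subst hz
      refine Submodule.span_le.2 ?_ hy
      rintro _ ⟨j, _, rfl⟩
      simp only [Submodule.comap_coe, Set.mem_preimage, SetLike.mem_coe, LinearMap.comp_apply,
        LieAlgebra.ad_apply, C.ef]
      split_ifs
      · rw [C.proj_h]; exact Submodule.mem_span_singleton_self _
      · rw [map_zero]; exact zero_mem _
    · rw [Submodule.mem_comap, LinearMap.comp_apply, C.proj_gr (z := z + 1) (by omega)
        ((C.seed Set.univ).raise C.rep (Set.mem_univ i) z hy)]
      exact zero_mem _
  exact this hy

lemma proj_lie_e_f (i j : I) (y : L) : C.proj ⁅e i, ⁅f j, y⁆⁆ =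
    if i = j then simpleRoot k A i (C.proj y) • coroot k i else 0 := by
  have : C.proj ∘ₗ LieAlgebra.ad k L (e i) ∘ₗ LieAlgebra.ad k L (f j) =
      if i = j then ((simpleRoot k A i).smulRight (coroot k i)) ∘ₗ C.proj else 0 := by
    refine C.hom_ext_gr fun z y hy => ?_
    by_cases hz : z = 0
    · subst hz
      obtain ⟨y, _, rfl⟩ := hy
      change C.proj ⁅e i, ⁅f j, h y⁆⁆ = _
      rw [C.fh, lie_smul, C.ef]
      split_ifs with hij
      · subst hij; simp [C.proj_h]
      · simp
    · have h₁ := (C.seed Set.univ).raise C.rep (Set.mem_univ i) _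
        ((C.seed Set.univ).lower C.rep (Set.mem_univ j) z hy)
      rw [sub_add_cancel] at h₁
      refine (C.proj_gr hz h₁).trans ?_
      split_ifs
      · simp [C.proj_gr hz hy]
      · rfl
  refine (LinearMap.congr_fun this y).trans ?_
  split_ifs <;> rfl

variable (form : LinearMap.BilinForm k (Cartan k I))

/-- The linear forms `(x, ·)` on `L` which vanish in nonzero degrees. -/
noncomputable def cartanForm : Cartan k I →ₗ[k] Module.Dual k L :=
  LinearMap.lcomp k k C.proj ∘ₗ form

lemma cartanForm_apply (x : Cartan k I) (y : L) : C.cartanForm form x y = form x (C.proj y) := rfl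

/-- A candidate for the linear form `(e_i, ·)`; linear in `e_i`. -/
noncomputable def raiseForm : L →ₗ[k] Module.Dual k L :=
  (LinearMap.llcomp k L L k (C.cartanForm form (rhoCheck k I))) ∘ₗ
    (LieAlgebra.ad k L : L →ₗ[k] Module.End k L)

/-- The formula is forced by invariance: e_i = [ρ^∨, e_i], so (e_i, y) = (ρ^∨, [e_i, y]). Since
[ρ^∨, f_i] = -f_i, the form (f_i, ·) is minus `raiseForm`. -/
lemma raiseForm_apply (x y : L) :
    C.raiseForm form x y = form (rhoCheck k I) (C.proj ⁅x, y⁆) := rfl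

lemma cartanForm_swap (x : Cartan k I) : C.swap.cartanForm form x = -C.cartanForm form x := by
  ext y
  simp [cartanForm_apply, C.proj_swap]

lemma raiseForm_swap (x : L) : C.swap.raiseForm form x = -C.raiseForm form x := by
  ext y
  simp [raiseForm_apply, C.proj_swap]

variable {form} {d : I → k} (hf : IsInvariantForm k A d form)
include hf

/-- The Cartan part of [e_i, y] is a multiple of h_i, on which x and ρ^∨ take the values d_i α_i(x)
and d_i; the two forms are therefore proportional with ratio α_i(x). -/
lemma adCoad_e_h (i : I) (x : Cartan k I) : adCoad k L (e i) (h x, C.cartanForm form x) =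
    -(simpleRoot k A i x • (e i, C.raiseForm form (e i))) := by
  apply Prod.ext
  · exact C.eh x i
  · ext y
    obtain ⟨c, hc⟩ := Submodule.mem_span_singleton.1 (C.proj_lie_e i y)
    simp only [adCoad_apply, Prod.smul_snd, Prod.snd_neg, LinearMap.neg_apply, LinearMap.comp_apply,
      LieAlgebra.ad_apply, cartanForm_apply, LinearMap.smul_apply, raiseForm_apply, ← hc, map_smul,
      hf.symm _ (coroot k i), hf.coroot, simpleRoot_rhoCheck, smul_eq_mul]
    ring

omit hf in
lemma adCoad_h_e (i : I) (x : Cartan k I) : adCoad k L (h x) (e i, C.raiseForm form (e i)) =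
    simpleRoot k A i x • (e i, C.raiseForm form (e i)) := by
  apply Prod.ext
  · exact C.he x i
  · ext y
    simp only [adCoad_apply, Prod.smul_snd, LinearMap.neg_apply, LinearMap.comp_apply,
      LieAlgebra.ad_apply, LinearMap.smul_apply, raiseForm_apply, leibniz_lie (e i) (h x) y,
      C.eh, map_add, C.proj_lie_h]
    simp

lemma adCoad_f_e (i j : I) : adCoad k L (f j) (e i, C.raiseForm form (e i)) =
    if i = j then -(h (coroot k i), C.cartanForm form (coroot k i)) else 0 := by
  apply Prod.ext
  · simp only [adCoad_apply, C.fe]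
    by_cases hij : i = j
    · subst hij; simp
    · simp [hij, Ne.symm hij]
  · ext y
    simp only [adCoad_apply, LinearMap.neg_apply, LinearMap.comp_apply,
      LieAlgebra.ad_apply, raiseForm_apply, C.proj_lie_e_f]
    split_ifs
    · simp [cartanForm_apply, hf.coroot, hf.symm _ (coroot k i), simpleRoot_rhoCheck, mul_comm]
    · simp

/-- The initial part of the graph of the invariant form. -/
lemma graphSeed : IsTriSeed (adCoad k L ∘ₗ h) (fun i => adCoad k L (e i))
    (fun i => adCoad k L (f i)) Set.univ
    (Submodule.span k (Set.range fun i => (f i, -C.raiseForm form (f i))))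
    (LinearMap.range (h.prod (C.cartanForm form)))
    (Submodule.span k (Set.range fun i => (e i, C.raiseForm form (e i)))) where
  kn x m hm := by
    refine (Submodule.span_le (p := (Submodule.span k _).comap _)).2 ?_ hm
    rintro _ ⟨i, rfl⟩
    have := C.swap.adCoad_h_e (form := form) i x
    rw [C.raiseForm_swap, LinearMap.neg_apply, map_neg, LinearMap.neg_apply, neg_eq_iff_eq_neg]
      at this
    simp only [Submodule.comap_coe, Set.mem_preimage, LinearMap.comp_apply, SetLike.mem_coe, this]
    exact neg_mem (Submodule.smul_mem _ _ (Submodule.subset_span ⟨i, rfl⟩))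
  kz x m hm := by
    obtain ⟨y, rfl⟩ := hm
    apply Prod.ext
    · exact C.hh x y
    · ext z
      simp [adCoad_apply, cartanForm_apply, C.proj_lie_h]
  kp x m hm := by
    refine (Submodule.span_le (p := (Submodule.span k _).comap _)).2 ?_ hm
    rintro _ ⟨i, rfl⟩
    simp only [Submodule.comap_coe, Set.mem_preimage, LinearMap.comp_apply, SetLike.mem_coe,
      C.adCoad_h_e]
    exact Submodule.smul_mem _ _ (Submodule.subset_span ⟨i, rfl⟩)
  ez i _ m hm := by
    obtain ⟨y, rfl⟩ := hm
    change adCoad k L (e i) (h y, C.cartanForm form y) ∈ _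
    rw [C.adCoad_e_h hf]
    exact neg_mem (Submodule.smul_mem _ _ (Submodule.subset_span ⟨i, rfl⟩))
  fz i _ m hm := by
    obtain ⟨y, rfl⟩ := hm
    have := C.swap.adCoad_e_h hf i (-y)
    rw [C.raiseForm_swap, map_neg, C.cartanForm_swap, map_neg, LinearMap.neg_apply, neg_neg,
      neg_neg] at this
    change adCoad k L (f i) (h y, C.cartanForm form y) ∈ _
    rw [this]
    exact neg_mem (Submodule.smul_mem _ _ (Submodule.subset_span ⟨i, rfl⟩))
  en j m hm := by
    refine (Submodule.span_le (p := (LinearMap.range _).comap _)).2 ?_ hm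
    rintro _ ⟨i, rfl⟩
    have := C.swap.adCoad_f_e hf i j
    rw [C.raiseForm_swap, C.cartanForm_swap] at this
    simp only [Submodule.comap_coe, Set.mem_preimage, SetLike.mem_coe, this]
    split_ifs
    · exact ⟨coroot k i, by simp⟩
    · exact zero_mem _
  fp j m hm := by
    refine (Submodule.span_le (p := (LinearMap.range _).comap _)).2 ?_ hm
    rintro _ ⟨i, rfl⟩
    simp only [Submodule.comap_coe, Set.mem_preimage, SetLike.mem_coe, C.adCoad_f_e hf i j]
    split_ifs
    · exact neg_mem (LinearMap.mem_range_self (h.prod (C.cartanForm form)) (coroot k i))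
    · exact zero_mem _

omit hf

variable (form) in
/-- The graded pieces of the graph of the invariant form. -/
noncomputable def graphGr : ℤ → Submodule k (L × Module.Dual k L) :=
  triSpan (fun i => adCoad k L (e i)) (fun i => adCoad k L (f i)) Set.univ
    (Submodule.span k (Set.range fun i => (f i, -C.raiseForm form (f i))))
    (LinearMap.range (h.prod (C.cartanForm form)))
    (Submodule.span k (Set.range fun i => (e i, C.raiseForm form (e i))))

variable (form) in
/-- The graph of the invariant form. -/
noncomputable def graph : Submodule k (L × Module.Dual k L) := ⨆ z, C.graphGr form z

lemma h_mem_graph (x : Cartan k I) : (h x, C.cartanForm form x) ∈ C.graph form :=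
  Submodule.mem_iSup_of_mem 0 ⟨x, rfl⟩

lemma e_mem_graph (i : I) : (e i, C.raiseForm form (e i)) ∈ C.graph form :=
  Submodule.mem_iSup_of_mem 1 (Submodule.subset_span (Set.mem_range_self i))

lemma f_mem_graph (i : I) : (f i, -C.raiseForm form (f i)) ∈ C.graph form :=
  Submodule.mem_iSup_of_mem (-1) (Submodule.subset_span (Set.mem_range_self i))

include hf

lemma adCoad_mem_graph (y : L) {γ : L × Module.Dual k L} (hγ : γ ∈ C.graph form) :
    adCoad k L y γ ∈ C.graph form := by
  have hy : y ∈ LieSubalgebra.lieSpan k L (Set.range h ∪ Set.range e ∪ Set.range f) := by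
    rw [C.gen]; trivial
  induction hy using LieSubalgebra.lieSpan_induction generalizing γ with
  | mem y hy =>
    obtain ((⟨x, rfl⟩ | ⟨i, rfl⟩) | ⟨i, rfl⟩) := hy
    · exact (C.graphSeed hf).cartan_iSup C.adCoad_rep x hγ
    · exact (C.graphSeed hf).raise_iSup C.adCoad_rep (Set.mem_univ i) hγ
    · exact (C.graphSeed hf).lower_iSup C.adCoad_rep (Set.mem_univ i) hγ
  | zero => rw [map_zero]; exact zero_mem _
  | add x y _ _ hx hy => rw [map_add]; exact add_mem (hx hγ) (hy hγ)
  | smul c x _ hx => rw [map_smul]; exact Submodule.smul_mem _ _ (hx hγ)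
  | lie x y _ _ hx hy => rw [adCoad_lie]; exact sub_mem (hx (hy hγ)) (hy (hx hγ))

lemma rhoCheck_graphGr (z : ℤ) {γ : L × Module.Dual k L} (hγ : γ ∈ C.graphGr form z) :
    adCoad k L (h (rhoCheck k I)) γ = (z : k) • γ := by
  refine (C.graphSeed hf).rhoCheck_triSpan C.adCoad_rep (fun m hm => ?_) (fun m hm => ?_) z hγ
  · suffices m ∈ Module.End.eigenspace (adCoad k L (h (rhoCheck k I))) 1 by
      simpa using Module.End.mem_eigenspace_iff.1 this
    refine (Submodule.span_le (p := Module.End.eigenspace _ _)).2 ?_ hm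
    rintro _ ⟨i, rfl⟩
    rw [SetLike.mem_coe, Module.End.mem_eigenspace_iff, C.adCoad_h_e, simpleRoot_rhoCheck]
  · suffices m ∈ Module.End.eigenspace (adCoad k L (h (rhoCheck k I))) (-1) by
      simpa using Module.End.mem_eigenspace_iff.1 this
    refine (Submodule.span_le (p := Module.End.eigenspace _ _)).2 ?_ hm
    rintro _ ⟨i, rfl⟩
    have := C.swap.adCoad_h_e (form := form) i (rhoCheck k I)
    rw [C.raiseForm_swap, LinearMap.neg_apply, map_neg, LinearMap.neg_apply, neg_eq_iff_eq_neg,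
      simpleRoot_rhoCheck] at this
    rw [SetLike.mem_coe, Module.End.mem_eigenspace_iff, this, neg_smul]

/-- The linear forms in the graph vanish locally. -/
lemma graph_local {φ : Module.Dual k L} (hφ : ((0 : L), φ) ∈ C.graph form) :
    (∀ x, φ (h x) = 0) ∧ (∀ i, φ (e i) = 0) ∧ ∀ i, φ (f i) = 0 := by
  let P : Submodule k (L × Module.Dual k L) := LinearMap.ker (LinearMap.fst k L (Module.Dual k L))
  let V : Submodule k L := Submodule.span k (Set.range h ∪ Set.range e ∪ Set.range f)
  let Q : Submodule k (L × Module.Dual k L) :=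
    V.dualAnnihilator.comap (LinearMap.snd k L (Module.Dual k L))
  -- The fibre over 0 is stable under ρ^∨, so an element of it in the graph splits into homogeneous
  -- ones with first component 0.
  have hP : ∀ γ ∈ P, adCoad k L (h (rhoCheck k I)) γ ∈ P := by
    intro γ hγ
    have : γ.1 = 0 := hγ
    change ⁅_, γ.1⁆ = 0
    rw [this, lie_zero]
  have hmem := mem_iSup_inf_of_stable (fun z γ hγ => C.rhoCheck_graphGr hf z hγ) hP hφ
    (show ((0 : L), φ).1 = 0 from rfl)
  have hle : ⨆ z, P ⊓ C.graphGr form z ≤ Q := by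
    refine iSup_le fun z => ?_
    rintro ⟨x, ψ⟩ ⟨hx, hγ⟩
    replace hx : x = 0 := hx
    subst hx
    -- In degrees 0, 1 and -1 the graph is its seed, and each part of the seed lies on the graph of
    -- a linear map (using injectivity of h in degree 0); so first component 0 forces second
    -- component 0.
    by_cases hz : z = 0
    · subst hz
      obtain ⟨y, hy⟩ := hγ
      have h₁ : h y = 0 := congrArg Prod.fst hy
      have h₂ : C.cartanForm form y = ψ := congrArg Prod.snd hy
      rw [C.inj (h₁.trans (map_zero h).symm), map_zero] at h₂
      subst h₂
      exact zero_mem Q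
    by_cases hz₁ : z = 1
    · subst hz₁
      have : Submodule.span k (Set.range fun i => (e i, C.raiseForm form (e i))) ≤
          (C.raiseForm form).graph := by
        rw [Submodule.span_le]
        rintro _ ⟨i, rfl⟩
        rfl
      have h₁ : ψ = C.raiseForm form 0 := this hγ
      rw [map_zero] at h₁
      subst h₁
      exact zero_mem Q
    by_cases hz₂ : z = -1
    · subst hz₂
      have : Submodule.span k (Set.range fun i => (f i, -C.raiseForm form (f i))) ≤
          (-C.raiseForm form).graph := by
        rw [Submodule.span_le]
        rintro _ ⟨i, rfl⟩
        rfl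
      have h₁ : ψ = (-C.raiseForm form) 0 := this hγ
      rw [map_zero] at h₁
      subst h₁
      exact zero_mem Q
    -- A form of degree z is an eigenvector of the coadjoint action of ρ^∨, so it vanishes on all
    -- degrees other than -z. As z is not 0, 1 or -1, it vanishes on all generators.
    have hr := congrArg Prod.snd (C.rhoCheck_graphGr hf z hγ)
    have hr' : ∀ v, -ψ ⁅h (rhoCheck k I), v⁆ = z * ψ v := fun v => LinearMap.congr_fun hr v
    change ψ ∈ V.dualAnnihilator
    rw [Submodule.mem_dualAnnihilator]
    intro v hv
    refine (Submodule.span_le (p := LinearMap.ker ψ)).2 ?_ hv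
    rintro _ ((⟨x, rfl⟩ | ⟨i, rfl⟩) | ⟨i, rfl⟩)
    · have := hr' (h x)
      rw [C.hh, map_zero, neg_zero, eq_comm, mul_eq_zero] at this
      exact this.resolve_left (by exact_mod_cast hz)
    · have := hr' (e i)
      rw [C.he, simpleRoot_rhoCheck, one_smul] at this
      have : ((z + 1 : ℤ) : k) * ψ (e i) = 0 := by push_cast; linear_combination -this
      exact (mul_eq_zero.1 this).resolve_left (Int.cast_ne_zero.2 (by omega))
    · have := hr' (f i)
      rw [C.hf, simpleRoot_rhoCheck, one_smul, map_neg] at this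
      have : ((z - 1 : ℤ) : k) * ψ (f i) = 0 := by push_cast; linear_combination -this
      exact (mul_eq_zero.1 this).resolve_left (Int.cast_ne_zero.2 (by omega))
  have hann := (Submodule.mem_dualAnnihilator φ).1 (hle hmem)
  exact ⟨fun x => hann _ (Submodule.subset_span (Or.inl (Or.inl ⟨x, rfl⟩))),
    fun i => hann _ (Submodule.subset_span (Or.inl (Or.inr ⟨i, rfl⟩))),
    fun i => hann _ (Submodule.subset_span (Or.inr ⟨i, rfl⟩))⟩

/-- The fibre over 0 is stable under the coadjoint action, so the common kernel of its forms is
stable under brackets. It contains the generators by `graph_local`, hence it is everything. -/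
lemma eq_zero_of_mem_graph {φ : Module.Dual k L} (hφ : ((0 : L), φ) ∈ C.graph form) : φ = 0 := by
  let N : Submodule k L :=
    { carrier := {v | ∀ ψ, ((0 : L), ψ) ∈ C.graph form → ψ v = 0}
      add_mem' := fun ha hb ψ hψ => by rw [map_add, ha ψ hψ, hb ψ hψ, add_zero]
      zero_mem' := fun ψ _ => map_zero ψ
      smul_mem' := fun c v hv ψ hψ => by rw [map_smul, hv ψ hψ, smul_zero] }
  ext v
  refine (mem_top_of_lieSpan C.gen (Q := N) ?_ ?_ v) φ hφ
  · rintro _ ((⟨x, rfl⟩ | ⟨i, rfl⟩) | ⟨i, rfl⟩) ψ hψ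
    · exact (C.graph_local hf hψ).1 x
    · exact (C.graph_local hf hψ).2.1 i
    · exact (C.graph_local hf hψ).2.2 i
  · intro y _ v hv ψ hψ
    have := C.adCoad_mem_graph hf y hψ
    rw [adCoad_apply, lie_zero] at this
    have := hv _ this
    simpa using this

/-- The existence of an invariant form. -/
lemma exists_form : ∃ Φ : LinearMap.BilinForm k L, (∀ x y z, Φ ⁅x, y⁆ z = Φ x ⁅y, z⁆) ∧
    (∀ x y, Φ (h x) (h y) = form x y) ∧ (∀ i j, Φ (e i) (f j) = if i = j then d i else 0) ∧
    ∀ i j, Φ (f i) (e j) = if i = j then d i else 0 := by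
  -- The projection of the graph to L is injective by the vanishing of the fibre over 0, and
  -- surjective since its image contains the generators and is stable under brackets.
  let p : C.graph form →ₗ[k] L := LinearMap.fst k _ _ ∘ₗ (C.graph form).subtype
  have hp : Function.Bijective p := by
    constructor
    · rw [injective_iff_map_eq_zero]
      rintro ⟨⟨x, φ⟩, hγ⟩ hx
      replace hx : x = 0 := hx
      subst hx
      exact Subtype.ext (Prod.ext rfl (C.eq_zero_of_mem_graph hf hγ))
    · rw [← LinearMap.range_eq_top, eq_top_iff]
      intro x _
      refine mem_top_of_lieSpan C.gen ?_ ?_ x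
      · rintro _ ((⟨x, rfl⟩ | ⟨i, rfl⟩) | ⟨i, rfl⟩)
        · exact ⟨⟨_, C.h_mem_graph x⟩, rfl⟩
        · exact ⟨⟨_, C.e_mem_graph i⟩, rfl⟩
        · exact ⟨⟨_, C.f_mem_graph i⟩, rfl⟩
      · rintro y _ _ ⟨⟨γ, hγ⟩, rfl⟩
        exact ⟨⟨_, C.adCoad_mem_graph hf y hγ⟩, rfl⟩
  let E := LinearEquiv.ofBijective p hp
  let Φ : LinearMap.BilinForm k L :=
    LinearMap.snd k _ _ ∘ₗ (C.graph form).subtype ∘ₗ E.symm.toLinearMap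
  have key : ∀ x φ, (x, φ) ∈ C.graph form → Φ x = φ := by
    intro x φ hγ
    have : E.symm x = ⟨(x, φ), hγ⟩ := by rw [LinearEquiv.symm_apply_eq]; rfl
    simp [Φ, this]
  have hΦ : ∀ x, (x, Φ x) ∈ C.graph form := by
    intro x
    obtain ⟨⟨⟨x, φ⟩, hγ⟩, rfl⟩ := hp.2 x
    change (x, Φ x) ∈ _
    rw [key x φ hγ]
    exact hγ
  refine ⟨Φ, fun x y z => ?_, fun x y => ?_, fun i j => ?_, fun i j => ?_⟩
  -- Stability of the graph under L is exactly invariance of the form.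
  · have : Φ ⁅y, x⁆ = -(Φ x ∘ₗ LieAlgebra.ad k L y) :=
      key _ _ (C.adCoad_mem_graph hf y (hΦ x))
    rw [← lie_skew, map_neg, this]
    simp
  · rw [key _ _ (C.h_mem_graph x), cartanForm_apply, C.proj_h]
  · rw [key _ _ (C.e_mem_graph i), raiseForm_apply, C.ef]
    split_ifs
    · rw [C.proj_h, hf.symm, hf.coroot, simpleRoot_rhoCheck, mul_one]
    · simp
  · rw [key _ _ (C.f_mem_graph i), LinearMap.neg_apply, raiseForm_apply, C.fe]
    split_ifs
    · rw [map_neg, C.proj_h, map_neg, hf.symm, hf.coroot, simpleRoot_rhoCheck, mul_one, neg_neg]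
    · simp

omit hf in
/-- Invariant forms pair pieces of different degrees trivially. -/
lemma form_gr_gr {Φ : LinearMap.BilinForm k L} (hΦ : ∀ x y z, Φ ⁅x, y⁆ z = Φ x ⁅y, z⁆)
    {B B' : Set I} {z z' : ℤ} (hz : z + z' ≠ 0) {x y : L} (hx : x ∈ chevGr h e f B z)
    (hy : y ∈ chevGr h e f B' z') : Φ x y = 0 := by
  have hx' := C.rhoCheck_gr _ _ hx
  have hy' := C.rhoCheck_gr _ _ hy
  rw [LieAlgebra.ad_apply] at hx' hy'
  have := hΦ x (h (rhoCheck k I)) y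
  rw [← lie_skew, hx', hy', map_neg, map_smul, map_smul, LinearMap.neg_apply,
    LinearMap.smul_apply, smul_eq_mul, smul_eq_mul] at this
  have : ((z + z' : ℤ) : k) * Φ x y = 0 := by push_cast; linear_combination -this
  exact (mul_eq_zero.1 this).resolve_left (Int.cast_ne_zero.2 hz)

omit hf in
/-- An invariant form is determined by its values on Chevalley generators. -/
lemma form_eq_zero {Φ : LinearMap.BilinForm k L} (hΦ : ∀ x y z, Φ ⁅x, y⁆ z = Φ x ⁅y, z⁆)
    (hh : ∀ x y, Φ (h x) (h y) = 0) (hef : ∀ i j, Φ (e i) (f j) = 0)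
    (hfe : ∀ i j, Φ (f i) (e j) = 0) : Φ = 0 := by
  ext x y
  refine mem_top_of_lieSpan C.gen (Q := LinearMap.ker Φ) ?_ ?_ x ▸ rfl
  · rintro _ ((⟨x, rfl⟩ | ⟨i, rfl⟩) | ⟨i, rfl⟩)
    · refine LinearMap.mem_ker.2 (C.hom_ext_gr fun z y hy => ?_)
      by_cases hz : z = 0
      · subst hz
        obtain ⟨y, _, rfl⟩ := hy
        exact hh x y
      · exact C.form_gr_gr hΦ (z := 0) (by omega)
          (h_mem_gr (B := Set.univ) (by rw [cartanSub_univ]; trivial)) hy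
    · refine LinearMap.mem_ker.2 (C.hom_ext_gr fun z y hy => ?_)
      by_cases hz : z = -1
      · subst hz
        refine (Submodule.span_le (p := LinearMap.ker (Φ (e i)))).2 ?_ hy
        rintro _ ⟨j, _, rfl⟩
        exact hef i j
      · exact C.form_gr_gr hΦ (z := 1) (by omega) (e_mem_gr (Set.mem_univ i)) hy
    · refine LinearMap.mem_ker.2 (C.hom_ext_gr fun z y hy => ?_)
      by_cases hz : z = 1
      · subst hz
        refine (Submodule.span_le (p := LinearMap.ker (Φ (f i)))).2 ?_ hy
        rintro _ ⟨j, _, rfl⟩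
        exact hfe i j
      · exact C.form_gr_gr hΦ (z := -1) (by omega) (f_mem_gr (Set.mem_univ i)) hy
  · intro y _ x hx
    rw [LinearMap.mem_ker] at hx ⊢
    ext z
    rw [← lie_skew, map_neg, LinearMap.neg_apply, hΦ, hx]
    simp

end IsChev

end Form

namespace KM

variable {k : Type u} [Field k] {I : Type v} [DecidableEq I] [Fintype I] [CharZero k]
  {A : Matrix I I ℤ} {d : I → k} {form : LinearMap.BilinForm k (Cartan k I)}

/-- The existence and the properties of the standard invariant form. -/
lemma exists_form (hf : IsInvariantForm k A d form) : ∃ Φ : LinearMap.BilinForm k (KM k A),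
    (∀ x y, Φ x y = Φ y x) ∧ (∀ x y z, Φ ⁅x, y⁆ z = Φ x ⁅y, z⁆) ∧
    (∀ x, (∀ y, Φ x y = 0) → x = 0) ∧ (∀ x y, Φ (h k A x) (h k A y) = form x y) ∧
    ∀ i j, Φ (e k A i) (f k A j) = if i = j then d i else 0 := by
  obtain ⟨Φ, hinv, hh, hef, hfe⟩ := (isChev k A).exists_form hf
  refine ⟨Φ, fun x y => ?_, hinv, fun x hx => ?_, hh, hef⟩
  -- The antisymmetric part is invariant and vanishes on pairs of generators.
  · have : Φ - Φ.flip = 0 := by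
      refine (isChev k A).form_eq_zero (fun x y z => ?_) (fun x y => ?_) (fun i j => ?_)
        fun i j => ?_
      · have h₁ : Φ z ⁅x, y⁆ = Φ ⁅y, z⁆ x := by
          rw [← lie_skew y z, map_neg, LinearMap.neg_apply, hinv, ← lie_skew, map_neg]
        simp [hinv x y z, h₁]
      · simp [hh, hf.symm x y]
      · simp [hef, hfe, eq_comm (a := i)]
        split_ifs with h
        · rw [h, sub_self]
        · rw [sub_zero]
      · simp [hef, hfe, eq_comm (a := i)]
        split_ifs with h
        · rw [h, sub_self]
        · rw [sub_zero]
    have := LinearMap.congr_fun₂ this x y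
    simpa [sub_eq_zero] using this
  -- The kernel of Φ is an ideal. It meets the Cartan subalgebra trivially, as the form there is
  -- nondegenerate, and such ideals have been divided out.
  · let J : LieIdeal k (KM k A) :=
      { LinearMap.ker Φ with
        lie_mem := fun {y x} hx => by
          have hx : Φ x = 0 := hx
          change Φ ⁅y, x⁆ = 0
          ext z
          rw [← lie_skew, map_neg, LinearMap.neg_apply, hinv, hx]
          simp }
    refine eq_zero_of_mem_ideal (J := J) (fun y hy => ?_) (LinearMap.ext hx : Φ x = 0)
    have hy : Φ (h k A y) = 0 := hy
    refine hf.nondegenerate Set.univ y (by rw [cartanSub_univ]; trivial) fun z _ => ?_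
    rw [← hh, hy]; rfl

end KM


/-! ### Borel subalgebras -/

section Borel

variable {k : Type u} [Field k] {I : Type v} [DecidableEq I]
  {A : Matrix I I ℤ} {L : Type*} [LieRing L] [LieAlgebra k L]

/-- The span of the iterated brackets of the elements `e i`, `i ∈ B`. -/
noncomputable def nil (k : Type u) [Field k] {L : Type*} [LieRing L] [LieAlgebra k L]
    (e : I → L) (B : Set I) : Submodule k L :=
  ⨆ n, wordSpan (fun i => LieAlgebra.ad k L (e i)) B (Submodule.span k (e '' B)) n

/-- The span of the Cartan subalgebra and of the iterated brackets of the elements `e i`, `i ∈ B`. -/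
noncomputable def borel (h : Cartan k I →ₗ[k] L) (e : I → L) (B : Set I) : Submodule k L :=
  (cartanSub k B).map h ⊔ nil k e B

variable {h : Cartan k I →ₗ[k] L} {e f : I → L} {B B' : Set I}

/-- Lets the Chevalley involution, which negates h, be applied to Borel subalgebras. -/
lemma borel_neg : borel (-h) e B = borel h e B := by
  have : (cartanSub k B).map (-h) = (cartanSub k B).map h := Submodule.map_neg _ _
  rw [borel, borel, this]

lemma nil_le_borel : nil k e B ≤ borel h e B := le_sup_right

lemma h_mem_borel {x : Cartan k I} (hx : x ∈ cartanSub k B) : h x ∈ borel h e B :=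
  Submodule.mem_sup_left (Submodule.mem_map_of_mem hx)

lemma e_mem_nil {i : I} (hi : i ∈ B) : e i ∈ nil k e B :=
  Submodule.mem_iSup_of_mem 0 (Submodule.subset_span (Set.mem_image_of_mem _ hi))

lemma e_mem_borel {i : I} (hi : i ∈ B) : e i ∈ borel h e B := nil_le_borel (e_mem_nil hi)

lemma lie_e_mem_nil {i : I} (hi : i ∈ B) {x : L} (hx : x ∈ nil k e B) : ⁅e i, x⁆ ∈ nil k e B :=
  apply_mem_iSup_wordSpan (T := fun i => LieAlgebra.ad k L (e i)) hi hx

lemma cartanSub_mono (hB : B' ⊆ B) : cartanSub k B' ≤ cartanSub k B :=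
  Submodule.span_mono fun _ ⟨i, hi, hx⟩ => ⟨i, hB hi, hx⟩

lemma nil_induction {Q : Submodule k L} (h₀ : ∀ i ∈ B, e i ∈ Q)
    (h : ∀ i ∈ B, ∀ x ∈ Q, ⁅e i, x⁆ ∈ Q) : nil k e B ≤ Q :=
  iSup_wordSpan_le (Submodule.span_le.2 (by rintro _ ⟨i, hi, rfl⟩; exact h₀ i hi)) h

/-- A statement on `nil` can be checked on homogeneous elements. -/
lemma nil_le_of_gr (h : Cartan k I →ₗ[k] L) (e f : I → L) {Q : Submodule k L}
    (hQ : ∀ z : ℤ, 0 < z → chevGr h e f B z ≤ Q) : nil k e B ≤ Q :=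
  iSup_le fun n => (hQ (n + 1) (by omega) : chevGr h e f B (n + 1) ≤ Q)

namespace IsChev

variable (C : IsChev A h e f)
include C

lemma lie_h_mem_nil (x : Cartan k I) {y : L} (hy : y ∈ nil k e B) : ⁅h x, y⁆ ∈ nil k e B := by
  refine (iSup_le fun n => ?_ : nil k e B ≤ (nil k e B).comap (LieAlgebra.ad k L (h x))) hy
  intro y hy
  exact Submodule.mem_iSup_of_mem n (C.rep.cartan_wordSpan x ((C.seed B).kp x) n y hy)

lemma lie_h_mem_borel (x : Cartan k I) {y : L} (hy : y ∈ borel h e B) :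
    ⁅h x, y⁆ ∈ nil k e B := by
  obtain ⟨_, ⟨a, _, rfl⟩, n, hn, rfl⟩ := Submodule.mem_sup.1 hy
  rw [lie_add, C.hh, zero_add]
  exact C.lie_h_mem_nil x hn

lemma lie_e_mem_borel {i : I} (hi : i ∈ B) {y : L} (hy : y ∈ borel h e B) :
    ⁅e i, y⁆ ∈ nil k e B := by
  obtain ⟨_, ⟨a, _, rfl⟩, n, hn, rfl⟩ := Submodule.mem_sup.1 hy
  rw [lie_add, C.eh]
  exact add_mem (neg_mem (Submodule.smul_mem _ _ (e_mem_nil hi))) (lie_e_mem_nil hi hn)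

/-- The Borel subalgebra as a subspace. -/
lemma mem_lieSpan_iff_mem_borel {S : Set L} (hS : S ⊆ h '' (cartanSub k B) ∪ e '' B)
    (hc : ∀ i ∈ B, h (coroot k i) ∈ LieSubalgebra.lieSpan k L S)
    (hc' : ∀ i ∈ B, h (coweight k i) ∈ LieSubalgebra.lieSpan k L S)
    (he : ∀ i ∈ B, e i ∈ LieSubalgebra.lieSpan k L S) {x : L} :
    x ∈ LieSubalgebra.lieSpan k L S ↔ x ∈ borel h e B := by
  constructor
  · refine lieSpan_le_submodule (fun s hs => ?_) fun s hs x hx => ?_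
    · obtain ⟨x, hx, rfl⟩ | ⟨i, hi, rfl⟩ := hS hs
      · exact h_mem_borel hx
      · exact e_mem_borel hi
    · obtain ⟨y, hy, rfl⟩ | ⟨i, hi, rfl⟩ := hS hs
      · exact nil_le_borel (C.lie_h_mem_borel y hx)
      · exact nil_le_borel (C.lie_e_mem_borel hi hx)
  · have : borel h e B ≤ (LieSubalgebra.lieSpan k L S).toSubmodule := by
      refine sup_le ?_ (nil_induction he fun i hi x hx => LieSubalgebra.lie_mem _ (he i hi) hx)
      rw [Submodule.map_le_iff_le_comap, cartanSub, Submodule.span_le]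
      rintro _ ⟨i, hi, rfl | rfl⟩
      · exact hc i hi
      · exact hc' i hi
    exact fun hx => this hx

lemma mem_lieSpan_borel {x : L} : x ∈ LieSubalgebra.lieSpan k L
    (h '' (cartanSub k B) ∪ e '' B) ↔ x ∈ borel h e B :=
  C.mem_lieSpan_iff_mem_borel le_rfl
    (fun _ hi => LieSubalgebra.subset_lieSpan (Or.inl ⟨_, coroot_mem hi, rfl⟩))
    (fun _ hi => LieSubalgebra.subset_lieSpan (Or.inl ⟨_, coweight_mem hi, rfl⟩))
    (fun _ hi => LieSubalgebra.subset_lieSpan (Or.inr ⟨_, hi, rfl⟩))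

lemma lie_borel_borel {x y : L} (hx : x ∈ borel h e B) (hy : y ∈ borel h e B) :
    ⁅x, y⁆ ∈ nil k e B := by
  rw [← C.mem_lieSpan_borel] at hx
  induction hx using LieSubalgebra.lieSpan_induction generalizing y with
  | mem x hx =>
    obtain ⟨x, hx, rfl⟩ | ⟨i, hi, rfl⟩ := hx
    · exact C.lie_h_mem_borel x hy
    · exact C.lie_e_mem_borel hi hy
  | zero => rw [zero_lie]; exact zero_mem _
  | add x x' _ _ hx hx' => rw [add_lie]; exact add_mem (hx hy) (hx' hy)
  | smul c x _ hx => rw [smul_lie]; exact Submodule.smul_mem _ _ (hx hy)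
  | lie x x' _ _ hx hx' =>
    rw [lie_lie]
    exact sub_mem (hx (nil_le_borel (hx' hy))) (hx' (nil_le_borel (hx hy)))

/-- f_j shortens words in the e_i by one letter; a single letter becomes a Cartan element. There is
no condition on j, as letters other than j are annihilated. -/
lemma lie_f_mem_borel (j : I) {y : L} (hy : y ∈ nil k e B) : ⁅f j, y⁆ ∈ borel h e B := by
  refine (iSup_le fun n => ?_ : nil k e B ≤ (borel h e B).comap (LieAlgebra.ad k L (f j))) hy
  intro y hy
  rcases n with _ | n
  · exact Submodule.mem_sup_left ((C.seed B).fp j y hy)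
  · exact nil_le_borel (Submodule.mem_iSup_of_mem n (C.rep.lower_wordSpan j (C.seed B).kp
      (C.seed B).ez ((C.seed B).fp j) n y hy))

lemma lie_f_mem_sup (j : I) {y : L} (hy : y ∈ borel h e B) :
    ⁅f j, y⁆ ∈ Submodule.span k {f j} ⊔ borel h e B := by
  obtain ⟨_, ⟨a, _, rfl⟩, n, hn, rfl⟩ := Submodule.mem_sup.1 hy
  rw [lie_add, C.fh]
  exact Submodule.add_mem_sup (Submodule.smul_mem _ _ (Submodule.mem_span_singleton_self _))
    (C.lie_f_mem_borel j hn)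

lemma nil_swap_sup : nil k f B ⊔ (cartanSub k B).map h ⊔ nil k e B =
    ⨆ z, chevGr h e f B z := iSup_triSpan.symm

variable [Fintype I] [CharZero k]

lemma proj_nil {x : L} (hx : x ∈ nil k e B) : C.proj x = 0 :=
  (nil_le_of_gr h e f (Q := LinearMap.ker C.proj)
    fun _ hz _ hx => C.proj_gr hz.ne' hx) hx

lemma proj_borel {x : L} (hx : x ∈ borel h e B) :
    C.proj x ∈ cartanSub k B ∧ x - h (C.proj x) ∈ nil k e B := by
  obtain ⟨_, ⟨a, ha, rfl⟩, n, hn, rfl⟩ := Submodule.mem_sup.1 hx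
  rw [map_add, C.proj_h, C.proj_nil hn, add_zero, add_sub_cancel_left]
  exact ⟨ha, hn⟩

/-- After subtraction of the Cartan part, the element is a sum of ρ^∨-eigenvectors of positive
eigenvalues and also of negative ones, hence zero. -/
lemma borel_inf_borel {x : L} (hx : x ∈ borel h e B) (hx' : x ∈ borel h f B) :
    x = h (C.proj x) := by
  have h₁ := (C.proj_borel hx).2
  have h₂ := (C.swap.proj_borel (by rwa [borel_neg])).2
  rw [C.proj_swap, map_neg, LinearMap.neg_apply, neg_neg] at h₂
  set y := x - h (C.proj x)
  suffices y = 0 by exact sub_eq_zero.1 this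
  let D := LieAlgebra.ad k L (h (rhoCheck k I))
  -- The positive pieces padded by ⊥; `G'` below is the negative counterpart. A component in degree
  -- z > 0 that lies in the sum of the `G'` lies in `G' z` = ⊥.
  let G : ℤ → Submodule k L := fun z => if 0 < z then chevGr h e f B z else ⊥
  have hG : ∀ z, ∀ x ∈ G z, D x = (z : k) • x := by
    intro z x hx
    simp only [G] at hx
    split_ifs at hx
    · exact C.rhoCheck_gr _ _ hx
    · rw [(Submodule.mem_bot k).1 hx]; simp
  have h₃ : nil k e B ≤ ⨆ z, G z := nil_le_of_gr h e f fun z hz => by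
    refine le_trans ?_ (le_iSup G z)
    simp [G, hz]
  have h₄ : nil k f B ≤ ⨆ z, chevGr h e f B (-z) ⊓ nil k f B := iSup_le fun n => by
    refine le_trans ?_ (le_iSup _ ((n : ℤ) + 1))
    refine le_inf ?_ (le_iSup (wordSpan (fun i => LieAlgebra.ad k L (f i)) B
      (Submodule.span k (f '' B))) n)
    exact le_of_eq (by rw [← Int.negSucc_eq]; rfl)
  have h₅ : nil k f B ≤ ⨆ z, nil k f B ⊓ chevGr h e f B z := by
    refine h₄.trans (iSup_le fun z => ?_)
    rw [inf_comm]
    exact le_iSup (fun z => nil k f B ⊓ chevGr h e f B z) (-z)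
  obtain ⟨s, t, ht, hs⟩ := exists_sum_of_mem_iSup (h₃ h₁)
  have hmem := eigenvector_mem_of_sum_mem D (nil k f B)
    (fun x hx => by
      have := C.swap.lie_h_mem_nil (rhoCheck k I) hx
      rw [LinearMap.neg_apply, neg_lie] at this
      exact neg_mem_iff.1 this) s t (fun z => hG z _ (ht z)) (by rwa [hs])
  rw [← hs]
  refine Finset.sum_eq_zero fun z hz => ?_
  have h₆ := hmem z hz
  have h₇ := ht z
  simp only [G] at h₇
  split_ifs at h₇ with hz0
  · let G' : ℤ → Submodule k L := fun z => if z < 0 then chevGr h e f B z else ⊥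
    have hG' : ∀ z, ∀ x ∈ G' z, D x = (z : k) • x := by
      intro z x hx
      simp only [G'] at hx
      split_ifs at hx
      · exact C.rhoCheck_gr _ _ hx
      · rw [(Submodule.mem_bot k).1 hx]; simp
    have h₈ : nil k f B ≤ ⨆ z, G' z := iSup_le fun n => by
      refine le_trans ?_ (le_iSup G' (Int.negSucc n))
      simp only [G', Int.negSucc_lt_zero, if_true]
      exact le_rfl
    have := mem_of_eigenvector_of_mem_iSup hG' (h₈ h₆) (C.rhoCheck_gr _ _ h₇)
    simp only [G'] at this
    rw [if_neg (by omega)] at this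
    exact (Submodule.mem_bot k).1 this
  · exact (Submodule.mem_bot k).1 h₇

end IsChev

/-! ### Standard forms -/

/-- Standard invariant forms. -/
structure IsStdForm (h : Cartan k I →ₗ[k] L) (e f : I → L) (d : I → k)
    (form : LinearMap.BilinForm k (Cartan k I)) (Φ : LinearMap.BilinForm k L) : Prop where
  symm : ∀ x y, Φ x y = Φ y x
  inv : ∀ x y z, Φ ⁅x, y⁆ z = Φ x ⁅y, z⁆
  nondeg : ∀ x, (∀ y, Φ x y = 0) → x = 0
  hh : ∀ x y, Φ (h x) (h y) = form x y
  ef : ∀ i j, Φ (e i) (f j) = if i = j then d i else 0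

variable {d : I → k} {form : LinearMap.BilinForm k (Cartan k I)} {Φ : LinearMap.BilinForm k L}

/-- Nondegeneracy on W represents the form φ(x, ·) restricted to W by a vector of W. The form on V
itself may be degenerate. -/
lemma exists_orthogonal_projection {V : Type*} [AddCommGroup V] [Module k V]
    [FiniteDimensional k V] {φ : LinearMap.BilinForm k V} (hφ : ∀ x y, φ x y = φ y x)
    {W : Submodule k V} (hW : ∀ x ∈ W, (∀ y ∈ W, φ x y = 0) → x = 0) (x : V) :
    ∃ y ∈ W, ∀ z ∈ W, φ (x - y) z = 0 := by
  have hT : (φ.restrict W).Nondegenerate :=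
    φ.nondegenerate_restrict_of_disjoint_orthogonal (fun x y h => by rw [hφ, h])
      (Submodule.disjoint_def.2 fun y hy hy' => hW y hy fun z hz => by
        rw [hφ]; exact hy' z hz)
  obtain ⟨y, hy⟩ := ((φ.restrict W).toDual hT).surjective ((φ x).domRestrict W)
  refine ⟨y, y.2, fun z hz => ?_⟩
  have := LinearMap.congr_fun hy ⟨z, hz⟩
  change φ y z = φ x z at this
  rw [map_sub, LinearMap.sub_apply, this, sub_self]

lemma IsInvariantForm.exists_orthogonal_projection [Finite I] (hf : IsInvariantForm k A d form)
    (B : Set I) (x : Cartan k I) :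
    ∃ y ∈ cartanSub k B, ∀ z ∈ cartanSub k B, form (x - y) z = 0 :=
  CoxeterDY.exists_orthogonal_projection hf.symm (hf.nondegenerate B) x

namespace IsStdForm

variable (F : IsStdForm h e f d form Φ)
include F

lemma swap : IsStdForm (-h) f e d form Φ where
  symm := F.symm
  inv := F.inv
  nondeg := F.nondeg
  hh x y := by simp [F.hh]
  ef i j := by
    rw [F.symm, F.ef]
    by_cases hij : i = j
    · subst hij; simp
    · simp [hij, Ne.symm hij]

lemma lie_left (x y z : L) : Φ ⁅x, y⁆ z = -Φ y ⁅x, z⁆ := by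
  rw [← lie_skew, map_neg, LinearMap.neg_apply, F.inv]

variable (C : IsChev A h e f) [Fintype I] [CharZero k]
include C

lemma h_right (x : L) (y : Cartan k I) : Φ x (h y) = form (C.proj x) y := by
  have : Φ.flip (h y) = form.flip y ∘ₗ C.proj := by
    refine C.hom_ext_gr fun z x hx => ?_
    by_cases hz : z = 0
    · subst hz
      obtain ⟨x, _, rfl⟩ := hx
      simp [F.hh, C.proj_h]
    · simp only [LinearMap.comp_apply, C.proj_gr hz hx, map_zero]
      exact C.form_gr_gr F.inv (z' := 0) (by omega) hx
        (h_mem_gr (B := Set.univ) (by rw [cartanSub_univ]; trivial))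
  exact LinearMap.congr_fun this x

lemma h_left (hf : IsInvariantForm k A d form) (x : L) (y : Cartan k I) :
    Φ (h y) x = form y (C.proj x) := by
  rw [F.symm, F.h_right C, hf.symm]

lemma nil_nil {x y : L} (hx : x ∈ nil k e B) (hy : y ∈ nil k e B') : Φ x y = 0 := by
  refine (nil_le_of_gr h e f (Q := LinearMap.ker (Φ x)) fun z hz y hy => ?_) hy
  refine (nil_le_of_gr h e f (Q := LinearMap.ker (Φ.flip y)) fun z' hz' x hx => ?_) hx
  exact C.form_gr_gr F.inv (by omega) hx hy

/-- Degrees of the same sign never add up to zero, so only the Cartan parts pair. This is the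
isotropy of the Borel subalgebras in the Manin triple. -/
lemma borel_borel {x y : L} (hx : x ∈ borel h e B) (hy : y ∈ borel h e B') :
    Φ x y = form (C.proj x) (C.proj y) := by
  have h₁ := C.proj_borel hx
  have h₂ := C.proj_borel hy
  have e₁ : Φ x y = Φ x (h (C.proj y)) + Φ (h (C.proj x)) (y - h (C.proj y)) +
      Φ (x - h (C.proj x)) (y - h (C.proj y)) := by simp
  rw [e₁, F.nil_nil C h₁.2 h₂.2, F.symm (h _) (y - _), F.h_right C, F.h_right C,
    C.proj_nil h₂.2]
  simp

lemma borel_nil {x y : L} (hx : x ∈ borel h e B) (hy : y ∈ nil k e B') : Φ x y = 0 := by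
  rw [F.borel_borel C hx (nil_le_borel hy), C.proj_nil hy, map_zero]

/-- e_i pairs only with degree -1, where the Borel subalgebra of B is spanned by the f_j with j in
B, hence j ≠ i. -/
lemma e_borel {i : I} (hi : i ∉ B) {y : L} (hy : y ∈ borel h f B) : Φ (e i) y = 0 := by
  obtain ⟨_, ⟨a, ha, rfl⟩, n, hn, rfl⟩ := Submodule.mem_sup.1 hy
  rw [map_add, F.h_right C, C.proj_e, map_zero, LinearMap.zero_apply, zero_add]
  refine (iSup_le fun n => ?_ : nil k f B ≤ LinearMap.ker (Φ (e i))) hn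
  intro y hy
  rcases n with _ | n
  · refine (Submodule.span_le (p := LinearMap.ker (Φ (e i)))).2 ?_ hy
    rintro _ ⟨j, hj, rfl⟩
    have hij : i ≠ j := fun h => hi (h ▸ hj)
    simp [F.ef, hij]
  · exact C.form_gr_gr F.inv (z' := Int.negSucc (n + 1)) (by omega)
      (e_mem_gr (Set.mem_univ i)) hy

/-- The elements of a Borel subalgebra which are orthogonal to a smaller opposite one. -/
def orth (Φ : LinearMap.BilinForm k L) (h : Cartan k I →ₗ[k] L) (e f : I → L) (B B' : Set I) :
    Submodule k L where
  carrier := {u | u ∈ borel h e B ∧ ∀ y ∈ borel h f B', Φ u y = 0}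
  add_mem' ha hb := ⟨add_mem ha.1 hb.1, fun y hy => by
    rw [map_add, LinearMap.add_apply, ha.2 y hy, hb.2 y hy, add_zero]⟩
  zero_mem' := ⟨zero_mem _, fun y _ => by simp⟩
  smul_mem' c x hx := ⟨Submodule.smul_mem _ _ hx.1, fun y hy => by
    rw [map_smul, LinearMap.smul_apply, hx.2 y hy, smul_zero]⟩

/-- The orthogonal is an ideal of the Borel subalgebra. For generators the bracket is moved to the
other argument: [e_i, y] lies in the smaller opposite Borel subalgebra up to a multiple of e_i, and
e_i is orthogonal to u because both lie on the same side. This makes the orthogonal projections Lie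
maps. -/
lemma lie_mem_orth {x u : L} (hx : x ∈ borel h e B) (hu : u ∈ orth Φ h e f B B') :
    ⁅x, u⁆ ∈ orth Φ h e f B B' := by
  refine ⟨nil_le_borel (C.lie_borel_borel hx hu.1), ?_⟩
  rw [← C.mem_lieSpan_borel] at hx
  have key : ∀ u ∈ orth Φ h e f B B', ⁅x, u⁆ ∈ orth Φ h e f B B' := by
    induction hx using LieSubalgebra.lieSpan_induction with
    | mem x hx =>
      intro u hu
      refine ⟨nil_le_borel (C.lie_borel_borel
        (C.mem_lieSpan_borel.1 (LieSubalgebra.subset_lieSpan hx)) hu.1), fun y hy => ?_⟩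
      rw [F.lie_left, neg_eq_zero]
      obtain ⟨x, _, rfl⟩ | ⟨i, hi, rfl⟩ := hx
      · have := nil_le_borel (h := -h) (C.swap.lie_h_mem_borel (-x) (by rwa [borel_neg]))
        rw [borel_neg, map_neg, LinearMap.neg_apply, neg_neg] at this
        exact hu.2 _ this
      · have := C.swap.lie_f_mem_sup i (B := B') (y := y) (by rwa [borel_neg])
        rw [borel_neg] at this
        obtain ⟨a, ha, b, hb, hab⟩ := Submodule.mem_sup.1 this
        obtain ⟨c, rfl⟩ := Submodule.mem_span_singleton.1 ha
        rw [← hab, map_add, hu.2 b hb, map_smul, F.borel_nil C hu.1 (e_mem_nil hi)]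
        simp
    | zero => intro u _; rw [zero_lie]; exact zero_mem _
    | add x x' _ _ hx hx' => intro u hu; rw [add_lie]; exact add_mem (hx u hu) (hx' u hu)
    | smul c x _ hx => intro u hu; rw [smul_lie]; exact Submodule.smul_mem _ _ (hx u hu)
    | lie x x' _ _ hx hx' =>
      intro u hu
      rw [lie_lie]
      exact sub_mem (hx _ (hx' u hu)) (hx' _ (hx u hu))
  exact (key u hu).2

variable (hf : IsInvariantForm k A d form)
include hf

/-- The sum of the smaller Borel subalgebra and the orthogonal is preserved by every e_i: for i in
B' this is clear from the ideal property, while for i not in B' the element e_i is itself in the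
orthogonal, and so are all its brackets. -/
lemma exists_borel_add_orth (hB : B' ⊆ B) {x : L} (hx : x ∈ borel h e B) :
    ∃ a ∈ borel h e B', x - a ∈ orth Φ h e f B B' := by
  suffices x ∈ borel h e B' ⊔ orth Φ h e f B B' by
    obtain ⟨a, ha, u, hu, rfl⟩ := Submodule.mem_sup.1 this
    exact ⟨a, ha, by rwa [add_sub_cancel_left]⟩
  refine (sup_le ?_ ?_ : borel h e B ≤ borel h e B' ⊔ orth Φ h e f B B') hx
  · rintro _ ⟨x, hx, rfl⟩
    obtain ⟨y, hy, hxy⟩ := hf.exists_orthogonal_projection B' x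
    rw [← add_sub_cancel y x, map_add]
    refine Submodule.add_mem_sup (h_mem_borel hy)
      ⟨h_mem_borel (sub_mem hx (cartanSub_mono hB hy)), fun z hz => ?_⟩
    rw [F.h_left C hf]
    have := (C.swap.proj_borel (B := B') (by rwa [borel_neg])).1
    rw [C.proj_swap] at this
    exact hxy _ (neg_mem_iff.1 this)
  · have : nil k e B ≤ borel h e B ⊓ (borel h e B' ⊔ orth Φ h e f B B') := by
      refine nil_induction (fun i hi => ⟨e_mem_borel hi, ?_⟩) fun i hi x hx =>
        ⟨nil_le_borel (C.lie_e_mem_borel hi hx.1), ?_⟩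
      · by_cases hi' : i ∈ B'
        · exact Submodule.mem_sup_left (e_mem_borel hi')
        · exact Submodule.mem_sup_right ⟨e_mem_borel hi, fun y hy => F.e_borel C hi' hy⟩
      · by_cases hi' : i ∈ B'
        · obtain ⟨a, ha, u, hu, rfl⟩ := Submodule.mem_sup.1 hx.2
          rw [lie_add]
          exact Submodule.add_mem_sup (nil_le_borel (C.lie_e_mem_borel hi' ha))
            (F.lie_mem_orth C (e_mem_borel hi) hu)
        · refine Submodule.mem_sup_right ?_
          rw [← lie_skew]
          exact neg_mem (F.lie_mem_orth C hx.1
            ⟨e_mem_borel hi, fun y hy => F.e_borel C hi' hy⟩)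
    exact this.trans inf_le_right

/-- Every element of the full opposite Borel subalgebra differs from one labelled by B by something
orthogonal to x. As x is also orthogonal to the nilpotent part on its own side, it is orthogonal to
the whole algebra. -/
lemma borel_nondeg {x : L} (hx : x ∈ borel h e B) (h₀ : ∀ y ∈ borel h f B, Φ x y = 0) :
    x = 0 := by
  have h₁ : ∀ y ∈ borel h f Set.univ, Φ x y = 0 := by
    intro y hy
    obtain ⟨a, ha, hu⟩ := F.swap.exists_borel_add_orth C.swap hf (Set.subset_univ B)
      (by rwa [borel_neg])
    rw [borel_neg] at ha
    have h₂ := hu.2 x (by rwa [borel_neg])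
    rw [map_sub, LinearMap.sub_apply, F.symm a, h₀ a ha, sub_zero] at h₂
    rw [F.symm, h₂]
  have h₂ : ∀ y ∈ nil k e Set.univ, Φ x y = 0 := fun y hy => F.borel_nil C hx hy
  refine F.nondeg x fun y => ?_
  have hy : y ∈ ⨆ z, chevGr h e f Set.univ z := by rw [C.iSup_gr]; trivial
  rw [← C.nil_swap_sup] at hy
  refine (sup_le (sup_le ?_ ?_) h₂ : _ ≤ LinearMap.ker (Φ x)) hy
  · exact fun y hy => h₁ y (nil_le_borel hy)
  · exact fun y hy => h₁ y (Submodule.mem_sup_left hy)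

/-- The pairing of opposite Borel subalgebras with doubled Cartan part. -/
lemma pair_nondeg {x : L} (hx : x ∈ borel h e B)
    (h₀ : ∀ y ∈ borel h f B, Φ x y + form (C.proj x) (C.proj y) = 0) : x = 0 := by
  -- Against Cartan elements the pairing is twice the form, so the Cartan part of x dies first and
  -- the pairing reduces to Φ.
  have h₁ : C.proj x = 0 := by
    refine hf.nondegenerate B _ (C.proj_borel hx).1 fun y hy => ?_
    have := h₀ (h y) (h_mem_borel hy)
    rw [F.h_right C, C.proj_h, ← two_mul, mul_eq_zero] at this
    exact this.resolve_left two_ne_zero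
  refine F.borel_nondeg C hf hx fun y hy => ?_
  have := h₀ y hy
  rwa [h₁, map_zero, LinearMap.zero_apply, add_zero] at this

end IsStdForm

end Borel

/-! ### Separating families of linear forms -/

section Separating

variable {k : Type u} [Field k] {V W U : Type*} [AddCommGroup V] [Module k V] [AddCommGroup W]
  [Module k W] [AddCommGroup U] [Module k U]

/-- The linear forms `φ i` separate the vectors. -/
def Separating {ι : Type*} (φ : ι → Module.Dual k V) : Prop :=
  ∀ x, (∀ i, φ i x = 0) → x = 0

/-- In a basis of W, the tensor is a finite family of coordinates in V, and each of them is killed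
by all φ i. No finiteness of the dimension is needed. -/
lemma Separating.eq_zero {ι : Type*} {φ : ι → Module.Dual k V} (hφ : Separating φ)
    (t : V ⊗[k] W) (ht : ∀ i, TensorProduct.lid k W ((φ i).rTensor W t) = 0) : t = 0 := by
  classical
  let b := Module.Basis.ofVectorSpace k W
  let c := TensorProduct.equivFinsuppOfBasisRight (M := V) b
  have key : ∀ (i : ι) (s : V ⊗[k] W) j,
      b.repr (TensorProduct.lid k W ((φ i).rTensor W s)) j = φ i (c s j) := by
    intro i s j
    induction s with
    | zero => simp
    | add s s' hs hs' => simp only [map_add, Finsupp.add_apply, hs, hs']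
    | tmul x w => simp [c, TensorProduct.equivFinsuppOfBasisRight_apply_tmul, mul_comm]
  rw [← c.map_eq_zero_iff]
  ext j
  exact hφ _ fun i => by rw [← key, ht]; simp

lemma Separating.ext {ι : Type*} {φ : ι → Module.Dual k V} (hφ : Separating φ)
    {s t : V ⊗[k] W} (h : ∀ i, TensorProduct.lid k W ((φ i).rTensor W s) =
      TensorProduct.lid k W ((φ i).rTensor W t)) : s = t :=
  sub_eq_zero.1 (hφ.eq_zero _ fun i => by rw [map_sub, map_sub, h, sub_self])

lemma Separating.dualDistrib {ι κ : Type*} {φ : ι → Module.Dual k V} {ψ : κ → Module.Dual k W}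
    (hφ : Separating φ) (hψ : Separating ψ) :
    Separating fun p : ι × κ => TensorProduct.dualDistrib k V W (φ p.1 ⊗ₜ ψ p.2) := by
  intro t ht
  refine hφ.eq_zero t fun i => hψ _ fun j => ?_
  rw [← ht (i, j)]
  induction t with
  | zero => simp
  | add s s' hs hs' =>
    have hc : ∀ s : V ⊗[k] W, ψ j (TensorProduct.lid k W ((φ i).rTensor W s)) =
        TensorProduct.dualDistrib k V W (φ i ⊗ₜ ψ j) s := by
      intro s
      induction s with
      | zero => simp
      | add s s' hs hs' => simp only [map_add, hs, hs']
      | tmul x y => simp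
    exact hc _
  | tmul x y => simp

end Separating

/-! ### Lie bialgebra structures -/

section Bialgebra

variable {k : Type u} [Field k]

lemma map_lie_tensor {L L' : Type*} [LieRing L] [LieAlgebra k L] [LieRing L'] [LieAlgebra k L']
    (g : L' →ₗ⁅k⁆ L) (x : L') (t : L' ⊗[k] L') :
    TensorProduct.map (g : L' →ₗ[k] L) (g : L' →ₗ[k] L) ⁅x, t⁆ =
      ⁅g x, TensorProduct.map (g : L' →ₗ[k] L) (g : L' →ₗ[k] L) t⁆ := by
  induction t with
  | zero => simp
  | add s s' hs hs' => simp only [map_add, lie_add, hs, hs']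
  | tmul x y => simp [TensorProduct.LieModule.lie_tmul_right]

/-- The elements at which a map of Lie algebras is compatible with the cobrackets. -/
def LieBialgebraStructure.compatible {L : Type w} {L' : Type w'} [LieRing L] [LieAlgebra k L]
    [LieRing L'] [LieAlgebra k L'] (δ : LieBialgebraStructure k L)
    (δ' : LieBialgebraStructure k L') (g : L' →ₗ⁅k⁆ L) : LieSubalgebra k L' where
  carrier := {x | δ.δ (g x) =
    TensorProduct.map (g : L' →ₗ[k] L) (g : L' →ₗ[k] L) (δ'.δ x)}
  add_mem' hx hy := by
    simp only [Set.mem_ofPred_eq, map_add] at hx hy ⊢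
    rw [hx, hy]
  zero_mem' := by simp
  smul_mem' c x hx := by
    simp only [Set.mem_ofPred_eq, map_smul] at hx ⊢
    rw [hx]
  lie_mem' {x y} hx hy := by
    simp only [Set.mem_ofPred_eq] at hx hy
    change δ.δ (g ⁅x, y⁆) = _
    rw [LieHom.map_lie, δ.cocycle, δ'.cocycle, hx, hy, map_sub, map_lie_tensor, map_lie_tensor]

end Bialgebra

/-! ### The Borel subalgebras of the extended Kac-Moody algebra -/

namespace KM

variable {k : Type u} [Field k] [CharZero k] {I : Type v} [DecidableEq I] [Fintype I]
  {A : Matrix I I ℤ} {B B' : Set I}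

lemma mem_bPlus {x : KM k A} : x ∈ bPlus k A B ↔ x ∈ borel (h k A) (e k A) B := by
  refine (isChev k A).mem_lieSpan_iff_mem_borel ?_ ?_ ?_ ?_
  · rintro _ ⟨i, hi, rfl | rfl | rfl⟩
    · exact Or.inl ⟨_, coroot_mem hi, rfl⟩
    · exact Or.inl ⟨_, coweight_mem hi, rfl⟩
    · exact Or.inr ⟨i, hi, rfl⟩
  · exact fun i hi => LieSubalgebra.subset_lieSpan ⟨i, hi, Or.inl rfl⟩
  · exact fun i hi => LieSubalgebra.subset_lieSpan ⟨i, hi, Or.inr (Or.inl rfl)⟩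
  · exact fun i hi => LieSubalgebra.subset_lieSpan ⟨i, hi, Or.inr (Or.inr rfl)⟩

lemma mem_bMinus {x : KM k A} : x ∈ bMinus k A B ↔ x ∈ borel (h k A) (f k A) B := by
  rw [← borel_neg]
  refine (isChev k A).swap.mem_lieSpan_iff_mem_borel ?_ ?_ ?_ ?_
  · rintro _ ⟨i, hi, rfl | rfl | rfl⟩
    · exact Or.inl ⟨-_, neg_mem (coroot_mem hi), by simp⟩
    · exact Or.inl ⟨-_, neg_mem (coweight_mem hi), by simp⟩
    · exact Or.inr ⟨i, hi, rfl⟩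
  · exact fun i hi => neg_mem (LieSubalgebra.subset_lieSpan ⟨i, hi, Or.inl rfl⟩)
  · exact fun i hi => neg_mem (LieSubalgebra.subset_lieSpan ⟨i, hi, Or.inr (Or.inl rfl)⟩)
  · exact fun i hi => LieSubalgebra.subset_lieSpan ⟨i, hi, Or.inr (Or.inr rfl)⟩

lemma h_mem_sub {x : Cartan k I} (hx : x ∈ cartanSub k B) : h k A x ∈ sub k A B :=
  bMinus_le_sub B (h_mem_bMinus hx)

lemma f_mem_sub {i : I} (hi : i ∈ B) : f k A i ∈ sub k A B :=
  bMinus_le_sub B (fB A hi).2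

lemma bPlus_le_sub (B : Set I) : bPlus k A B ≤ sub k A B :=
  LieSubalgebra.lieSpan_mono fun _ ⟨i, hi, hx⟩ => ⟨i, hi, by tauto⟩

/-- The triangular decomposition: the sum of the graded pieces labelled by B contains the generators
and is stable under them. The two summands overlap in the Cartan part. -/
lemma mem_sub {x : KM k A} :
    x ∈ sub k A B ↔ ∃ a ∈ bMinus k A B, ∃ c ∈ bPlus k A B, x = a + c := by
  constructor
  · intro hx
    have key : x ∈ ⨆ z, chevGr (h k A) (e k A) (f k A) B z := by
      refine lieSpan_le_submodule ?_ ?_ hx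
      · rintro _ ⟨i, hi, rfl | rfl | rfl | rfl⟩
        · exact Submodule.mem_iSup_of_mem 0 (h_mem_gr (coroot_mem hi))
        · exact Submodule.mem_iSup_of_mem 0 (h_mem_gr (coweight_mem hi))
        · exact Submodule.mem_iSup_of_mem 1 (e_mem_gr hi)
        · exact Submodule.mem_iSup_of_mem (-1) (f_mem_gr hi)
      · rintro _ ⟨i, hi, rfl | rfl | rfl | rfl⟩ x hx
        · exact ((isChev k A).seed B).cartan_iSup (isChev k A).rep _ hx
        · exact ((isChev k A).seed B).cartan_iSup (isChev k A).rep _ hx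
        · exact ((isChev k A).seed B).raise_iSup (isChev k A).rep hi hx
        · exact ((isChev k A).seed B).lower_iSup (isChev k A).rep hi hx
    rw [← (isChev k A).nil_swap_sup] at key
    obtain ⟨a, ha, c, hc, rfl⟩ := Submodule.mem_sup.1 key
    refine ⟨a, mem_bMinus.2 ?_, c, mem_bPlus.2 (nil_le_borel hc), rfl⟩
    rwa [borel, sup_comm]
  · rintro ⟨a, ha, c, hc, rfl⟩
    exact add_mem (bMinus_le_sub B ha) (bPlus_le_sub B hc)

/-- The negative Borel subalgebra is generated by the Cartan subalgebra and the `f_i`. -/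
lemma mem_of_generators_bMinus {Q : LieSubalgebra k (bMinus k A B)} (hQ : ∀ x, hB k A B x ∈ Q)
    (fQ : ∀ i (hi : i ∈ B), fB A hi ∈ Q) (x : bMinus k A B) : x ∈ Q := by
  have key : bMinus k A B ≤ Q.map (bMinus k A B).incl := by
    refine LieSubalgebra.lieSpan_le.2 ?_
    rintro _ ⟨i, hi, rfl | rfl | rfl⟩
    · exact ⟨_, hQ ⟨_, coroot_mem hi⟩, rfl⟩
    · exact ⟨_, hQ ⟨_, coweight_mem hi⟩, rfl⟩
    · exact ⟨_, fQ i hi, rfl⟩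
  obtain ⟨y, hy, hyx⟩ := key x.2
  have : y = x := Subtype.ext hyx
  exact this ▸ hy

variable (k A) in
/-- The projection to the Cartan subalgebra. -/
noncomputable def proj : KM k A →ₗ[k] Cartan k I := (isChev k A).proj

lemma proj_h (x : Cartan k I) : proj k A (h k A x) = x := (isChev k A).proj_h x

lemma proj_e (i : I) : proj k A (e k A i) = 0 := (isChev k A).proj_e i

lemma proj_f (i : I) : proj k A (f k A i) = 0 := (isChev k A).proj_f i

lemma proj_bPlus {x : KM k A} (hx : x ∈ bPlus k A B) : proj k A x ∈ cartanSub k B :=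
  ((isChev k A).proj_borel (mem_bPlus.1 hx)).1

lemma proj_bMinus {x : KM k A} (hx : x ∈ bMinus k A B) : proj k A x ∈ cartanSub k B := by
  have := ((isChev k A).swap.proj_borel (B := B) (by rw [borel_neg]; exact mem_bMinus.1 hx)).1
  rw [(isChev k A).proj_swap] at this
  exact neg_mem_iff.1 this

lemma proj_lie_bPlus {x y : KM k A} (hx : x ∈ bPlus k A B) (hy : y ∈ bPlus k A B) :
    proj k A ⁅x, y⁆ = 0 :=
  (isChev k A).proj_nil ((isChev k A).lie_borel_borel (mem_bPlus.1 hx) (mem_bPlus.1 hy))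

lemma proj_lie_bMinus {x y : KM k A} (hx : x ∈ bMinus k A B) (hy : y ∈ bMinus k A B) :
    proj k A ⁅x, y⁆ = 0 := by
  have := (isChev k A).swap.proj_nil ((isChev k A).swap.lie_borel_borel (B := B)
    (by rw [borel_neg]; exact mem_bMinus.1 hx) (by rw [borel_neg]; exact mem_bMinus.1 hy))
  rw [(isChev k A).proj_swap] at this
  exact neg_eq_zero.1 this

/-- Elements of `sub` are sums of elements of the Borel subalgebras with the same Cartan part. -/
lemma exists_split {x : KM k A} (hx : x ∈ sub k A B) :
    ∃ a ∈ bMinus k A B, ∃ c ∈ bPlus k A B, x = a + c ∧ proj k A a = proj k A c := by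
  obtain ⟨a, ha, c, hc, rfl⟩ := mem_sub.1 hx
  -- Half the difference of the Cartan parts is shifted from one summand to the other.
  let u := (2 : k)⁻¹ • (proj k A c - proj k A a)
  have hu : u ∈ cartanSub k B :=
    Submodule.smul_mem _ _ (sub_mem (proj_bPlus hc) (proj_bMinus ha))
  refine ⟨a + h k A u, add_mem ha (h_mem_bMinus hu), c - h k A u,
    sub_mem hc (h_mem_bPlus hu), by abel, ?_⟩
  rw [map_add, map_sub, proj_h]
  have : u + u = proj k A c - proj k A a := by
    rw [← two_smul k u, smul_smul, mul_inv_cancel₀ two_ne_zero, one_smul]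
  rw [eq_sub_iff_add_eq, add_assoc, this, add_sub_cancel]

lemma bMinus_inf_bPlus {x : KM k A} (hx : x ∈ bMinus k A B) (hx' : x ∈ bPlus k A B) :
    x = h k A (proj k A x) :=
  (isChev k A).borel_inf_borel (mem_bPlus.1 hx') (mem_bMinus.1 hx)

end KM


/-! ### The pairing of the Borel subalgebras, and the standard structure -/

section StandardExistence

variable {k : Type u} [Field k] [CharZero k] {I : Type v} [DecidableEq I] [Fintype I]
  {A : Matrix I I ℤ} {d : I → k} {form : LinearMap.BilinForm k (Cartan k I)} {B B' : Set I}

variable (k A) in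
/-- Standard invariant forms on the extended Kac-Moody algebra. -/
abbrev KM.IsStdForm (d : I → k) (form : LinearMap.BilinForm k (Cartan k I))
    (Φ : LinearMap.BilinForm k (KM k A)) : Prop :=
  CoxeterDY.IsStdForm (KM.h k A) (KM.e k A) (KM.f k A) d form Φ

lemma Standard.isStdForm (S : Standard A d form) : KM.IsStdForm k A d form S.Φ where
  symm := S.Φ_symm
  inv := S.Φ_invariant
  nondeg := S.Φ_nondegenerate
  hh := S.Φ_h
  ef := S.Φ_e_f

variable (A) in
/-- The bilinear form which pairs the two Borel subalgebras: `Φ` with doubled Cartan part. -/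
noncomputable def borelPairing (form : LinearMap.BilinForm k (Cartan k I))
    (Φ : LinearMap.BilinForm k (KM k A)) : LinearMap.BilinForm k (KM k A) :=
  Φ + form.compl₁₂ (KM.proj k A) (KM.proj k A)

lemma borelPairing_apply (Φ : LinearMap.BilinForm k (KM k A)) (x y : KM k A) :
    borelPairing A form Φ x y = Φ x y + form (KM.proj k A x) (KM.proj k A y) := rfl

/-- The linear form on the negative Borel subalgebra which is given by the pairing. -/
noncomputable def pairDual (form : LinearMap.BilinForm k (Cartan k I))
    (Φ : LinearMap.BilinForm k (KM k A)) (B : Set I) :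
    KM k A →ₗ[k] Module.Dual k (KM.bMinus k A B) :=
  LinearMap.lcomp k k (KM.bMinus k A B).toSubmodule.subtype ∘ₗ borelPairing A form Φ

lemma pairDual_apply (Φ : LinearMap.BilinForm k (KM k A)) (y : KM k A) (x : KM.bMinus k A B) :
    pairDual form Φ B y x = borelPairing A form Φ y x := rfl

namespace KM.IsStdForm

variable {Φ : LinearMap.BilinForm k (KM k A)} (F : KM.IsStdForm k A d form Φ)
  (hf : IsInvariantForm k A d form)

include F

lemma bPlus_bPlus {x y : KM k A} (hx : x ∈ KM.bPlus k A B) (hy : y ∈ KM.bPlus k A B') :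
    Φ x y = form (KM.proj k A x) (KM.proj k A y) :=
  CoxeterDY.IsStdForm.borel_borel F (KM.isChev k A) (KM.mem_bPlus.1 hx) (KM.mem_bPlus.1 hy)

lemma bMinus_bMinus {x y : KM k A} (hx : x ∈ KM.bMinus k A B) (hy : y ∈ KM.bMinus k A B') :
    Φ x y = form (KM.proj k A x) (KM.proj k A y) := by
  have := CoxeterDY.IsStdForm.borel_borel F.swap (KM.isChev k A).swap (B := B) (B' := B')
    (by rw [borel_neg]; exact KM.mem_bMinus.1 hx) (by rw [borel_neg]; exact KM.mem_bMinus.1 hy)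
  rw [(KM.isChev k A).proj_swap, (KM.isChev k A).proj_swap] at this
  simpa [KM.proj] using this

/-- Invariance of the form in the Manin triple: [x, y] = a + c with equal Cartan parts is the
decomposition of the bracket in the double, and the minus part a pairs to zero with u there. -/
lemma borelPairing_lie_left {u x y a c : KM k A} (hu : u ∈ KM.bMinus k A B)
    (hx : x ∈ KM.bMinus k A B) (ha : a ∈ KM.bMinus k A B) (hac : ⁅x, y⁆ = a + c)
    (hp : KM.proj k A a = KM.proj k A c) :
    borelPairing A form Φ ⁅u, x⁆ y = borelPairing A form Φ u c := by
  rw [borelPairing_apply, KM.proj_lie_bMinus hu hx, map_zero, LinearMap.zero_apply, add_zero,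
    F.inv, hac, map_add, bMinus_bMinus F hu ha, hp, borelPairing_apply, add_comm]

lemma borelPairing_lie_right {x y z a c : KM k A} (hy : y ∈ KM.bPlus k A B)
    (hz : z ∈ KM.bPlus k A B) (hc : c ∈ KM.bPlus k A B) (hac : ⁅x, y⁆ = a + c)
    (hp : KM.proj k A a = KM.proj k A c) :
    borelPairing A form Φ x ⁅y, z⁆ = borelPairing A form Φ a z := by
  rw [borelPairing_apply, KM.proj_lie_bPlus hy hz, map_zero, add_zero,
    ← F.inv, hac, map_add, LinearMap.add_apply, bPlus_bPlus F hc hz, ← hp, borelPairing_apply]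

include hf

lemma borelPairing_symm (x y : KM k A) :
    borelPairing A form Φ x y = borelPairing A form Φ y x := by
  rw [borelPairing_apply, borelPairing_apply, F.symm, hf.symm]

/-- The nondegeneracy on the negative side through which every identity of tensors below is tested.
-/
lemma separating_bPlus :
    Separating fun y : KM.bPlus k A B => pairDual form Φ B y := by
  intro x hx
  refine Subtype.ext (CoxeterDY.IsStdForm.pair_nondeg F.swap (KM.isChev k A).swap hf (B := B)
    (by rw [borel_neg]; exact KM.mem_bMinus.1 x.2) fun y hy => ?_)
  rw [borel_neg] at hy
  have := hx ⟨y, KM.mem_bPlus.2 hy⟩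
  rw [pairDual_apply, borelPairing_symm F hf, borelPairing_apply] at this
  rw [(KM.isChev k A).proj_swap, (KM.isChev k A).proj_swap]
  simpa [KM.proj] using this

lemma pairDual_lie {u x : KM.bMinus k A B} {y a c : KM k A}
    (ha : a ∈ KM.bMinus k A B) (hac : ⁅(x : KM k A), y⁆ = a + c)
    (hp : KM.proj k A a = KM.proj k A c) :
    pairDual form Φ B y ⁅x, u⁆ = -pairDual form Φ B c u := by
  rw [← lie_skew, map_neg, pairDual_apply, pairDual_apply, borelPairing_symm F hf,
    borelPairing_symm F hf c]
  exact congrArg Neg.neg (borelPairing_lie_left F u.2 x.2 ha hac hp)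

lemma pairDual_lie_tensor {x : KM.bMinus k A B} {y z a c a' c' : KM k A}
    (t : KM.bMinus k A B ⊗[k] KM.bMinus k A B)
    (ha : a ∈ KM.bMinus k A B) (hac : ⁅(x : KM k A), y⁆ = a + c)
    (hp : KM.proj k A a = KM.proj k A c)
    (ha' : a' ∈ KM.bMinus k A B) (hac' : ⁅(x : KM k A), z⁆ = a' + c')
    (hp' : KM.proj k A a' = KM.proj k A c') :
    TensorProduct.dualDistrib k _ _ (pairDual form Φ B y ⊗ₜ pairDual form Φ B z) ⁅x, t⁆ =
      -TensorProduct.dualDistrib k _ _ (pairDual form Φ B c ⊗ₜ pairDual form Φ B z) t -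
      TensorProduct.dualDistrib k _ _ (pairDual form Φ B y ⊗ₜ pairDual form Φ B c') t := by
  induction t with
  | zero => simp
  | add s s' hs hs' => simp only [lie_add, map_add, hs, hs']; ring
  | tmul p q =>
    rw [TensorProduct.LieModule.lie_tmul_right, map_add]
    simp only [TensorProduct.dualDistrib_apply, pairDual_lie F hf ha hac hp,
      pairDual_lie F hf ha' hac' hp']
    ring

end KM.IsStdForm

/-- The tensor `t` is dual to the bracket of the positive Borel subalgebra at `x`. -/
def IsCobracket (form : LinearMap.BilinForm k (Cartan k I)) (Φ : LinearMap.BilinForm k (KM k A))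
    (B : Set I) (x : KM.bMinus k A B) (t : KM.bMinus k A B ⊗[k] KM.bMinus k A B) : Prop :=
  ∀ y ∈ KM.bPlus k A B, ∀ z ∈ KM.bPlus k A B, TensorProduct.dualDistrib k _ _
    (pairDual form Φ B y ⊗ₜ pairDual form Φ B z) t = borelPairing A form Φ x ⁅y, z⁆

namespace IsCobracket

variable {Φ : LinearMap.BilinForm k (KM k A)} (F : KM.IsStdForm k A d form Φ)
  (hf : IsInvariantForm k A d form)

lemma zero : IsCobracket form Φ B 0 0 := fun y _ z _ => by simp

lemma add {x x' : KM.bMinus k A B} {t t' : KM.bMinus k A B ⊗[k] KM.bMinus k A B}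
    (h : IsCobracket form Φ B x t) (h' : IsCobracket form Φ B x' t') :
    IsCobracket form Φ B (x + x') (t + t') := fun y hy z hz => by
  simp [h y hy z hz, h' y hy z hz]

lemma smul {x : KM.bMinus k A B} {t : KM.bMinus k A B ⊗[k] KM.bMinus k A B} (c : k)
    (h : IsCobracket form Φ B x t) : IsCobracket form Φ B (c • x) (c • t) := fun y hy z hz => by
  simp [h y hy z hz]

include F hf

lemma unique {x : KM.bMinus k A B} {t t' : KM.bMinus k A B ⊗[k] KM.bMinus k A B}
    (h : IsCobracket form Φ B x t) (h' : IsCobracket form Φ B x t') : t = t' := by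
  have hs := F.separating_bPlus hf (B := B)
  refine sub_eq_zero.1 (hs.dualDistrib hs _ fun p => ?_)
  rw [map_sub, h _ p.1.2 _ p.2.2, h' _ p.1.2 _ p.2.2, sub_self]

/-- Brackets in the positive Borel subalgebra have no Cartan part, so they are orthogonal to h. -/
lemma hB (x : cartanSub k B) : IsCobracket form Φ B (KM.hB k A B x) 0 := by
  intro y hy z hz
  rw [map_zero, borelPairing_apply]
  change 0 = Φ (KM.h k A x) _ + _
  rw [F.h_left (KM.isChev k A) hf]
  change 0 = form x (KM.proj k A _) + _
  rw [KM.proj_lie_bPlus hy hz]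
  simp

/-- Write y = y₀ + m and z = z₀ + n with Cartan and nilpotent parts. Then Φ(f_i, [y, z]) =
α_i(y₀)Φ(f_i, n) - α_i(z₀)Φ(f_i, m); the term [m, n] drops out because [f_i, m] lies in the positive
Borel subalgebra, which is orthogonal to n. As h_i pairs with y to 2 d_i α_i(y₀), the factor (2
d_i)⁻¹ results. -/
lemma fB (hd : ∀ i, d i ≠ 0) {i : I} (hi : i ∈ B) : IsCobracket form Φ B (KM.fB A hi)
    ((2 * d i)⁻¹ • (KM.hB k A B ⟨coroot k i, coroot_mem hi⟩ ⊗ₜ KM.fB A hi -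
      KM.fB A hi ⊗ₜ KM.hB k A B ⟨coroot k i, coroot_mem hi⟩)) := by
  intro y hy z hz
  have C := KM.isChev k A
  have e₁ : ∀ y : KM k A, pairDual form Φ B y (KM.hB k A B ⟨coroot k i, coroot_mem hi⟩) =
      2 * d i * simpleRoot k A i (KM.proj k A y) := by
    intro y
    rw [pairDual_apply, F.borelPairing_symm hf, borelPairing_apply]
    change Φ (KM.h k A (coroot k i)) y + form (KM.proj k A (KM.h k A (coroot k i))) _ = _
    rw [F.h_left C hf, KM.proj_h, hf.coroot, hf.coroot]
    simp only [KM.proj]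
    ring
  have e₂ : ∀ y : KM k A, pairDual form Φ B y (KM.fB A hi) = Φ (KM.f k A i) y := by
    intro y
    rw [pairDual_apply, F.borelPairing_symm hf, borelPairing_apply]
    change Φ (KM.f k A i) y + form (KM.proj k A (KM.f k A i)) _ = _
    rw [KM.proj_f]
    simp
  have e₃ : ∀ (u : Cartan k I) (x : KM k A), Φ (KM.f k A i) ⁅KM.h k A u, x⁆ =
      simpleRoot k A i u * Φ (KM.f k A i) x := by
    intro u x
    rw [← F.inv, C.fh]
    simp
  have e₄ : ∀ x ∈ nil k (KM.e k A) B, ∀ y ∈ nil k (KM.e k A) B, Φ (KM.f k A i) ⁅x, y⁆ = 0 := by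
    intro x hx y hy
    rw [← F.inv, F.borel_nil C (C.lie_f_mem_borel i hx) hy]
  obtain ⟨m, hm, ym⟩ : ∃ m ∈ nil k (KM.e k A) B, y = KM.h k A (KM.proj k A y) + m :=
    ⟨_, (C.proj_borel (KM.mem_bPlus.1 hy)).2, by simp [KM.proj]⟩
  obtain ⟨n, hn, zn⟩ : ∃ n ∈ nil k (KM.e k A) B, z = KM.h k A (KM.proj k A z) + n :=
    ⟨_, (C.proj_borel (KM.mem_bPlus.1 hz)).2, by simp [KM.proj]⟩
  have e₅ : ∀ x, Φ (KM.f k A i) (KM.h k A x) = 0 := by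
    intro x
    rw [F.h_right C, C.proj_f]
    simp
  have e₆ : Φ (KM.f k A i) y = Φ (KM.f k A i) m := by
    conv_lhs => rw [ym]
    rw [map_add, e₅, zero_add]
  have e₇ : Φ (KM.f k A i) z = Φ (KM.f k A i) n := by
    conv_lhs => rw [zn]
    rw [map_add, e₅, zero_add]
  have e₈ : Φ (KM.f k A i) ⁅y, z⁆ = simpleRoot k A i (KM.proj k A y) * Φ (KM.f k A i) n -
      simpleRoot k A i (KM.proj k A z) * Φ (KM.f k A i) m := by
    conv_lhs => rw [ym, zn]
    rw [add_lie, lie_add, lie_add, C.hh, zero_add, ← lie_skew m, map_add, map_add, map_neg,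
      e₃, e₃, e₄ m hm n hn]
    ring
  rw [map_smul, map_sub, TensorProduct.dualDistrib_apply, TensorProduct.dualDistrib_apply,
    e₁, e₁, e₂, e₂, e₆, e₇, borelPairing_apply]
  change _ = Φ (KM.f k A i) _ + form (KM.proj k A (KM.f k A i)) _
  rw [KM.proj_f, map_zero, LinearMap.zero_apply, add_zero, e₈, smul_eq_mul]
  have := hd i
  field_simp

/-- The cocycle rule is the Jacobi identity in the double. The four mixed brackets are split into
minus and plus parts, and Φ(⁅x, x'⁆, ⁅y, z⁆) is expanded in two ways. -/
lemma lie {x x' : KM.bMinus k A B} {t t' : KM.bMinus k A B ⊗[k] KM.bMinus k A B}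
    (h : IsCobracket form Φ B x t) (h' : IsCobracket form Φ B x' t') :
    IsCobracket form Φ B ⁅x, x'⁆ (⁅x, t'⁆ - ⁅x', t⁆) := by
  intro y hy z hz
  have hs : ∀ (x : KM.bMinus k A B), ∀ y ∈ KM.bPlus k A B, ∃ a ∈ KM.bMinus k A B,
      ∃ c ∈ KM.bPlus k A B, ⁅(x : KM k A), y⁆ = a + c ∧ KM.proj k A a = KM.proj k A c :=
    fun x y hy => KM.exists_split
      (LieSubalgebra.lie_mem _ (KM.bMinus_le_sub B x.2) (KM.bPlus_le_sub B hy))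
  obtain ⟨a₁, ha₁, c₁, hc₁, hac₁, hp₁⟩ := hs x y hy
  obtain ⟨a₂, ha₂, c₂, hc₂, hac₂, hp₂⟩ := hs x z hz
  obtain ⟨a₃, ha₃, c₃, hc₃, hac₃, hp₃⟩ := hs x' y hy
  obtain ⟨a₄, ha₄, c₄, hc₄, hac₄, hp₄⟩ := hs x' z hz
  have key : ∀ (x : KM.bMinus k A B), ∀ y ∈ KM.bPlus k A B, ∀ z ∈ KM.bPlus k A B,
      borelPairing A form Φ x ⁅y, z⁆ = Φ x ⁅y, z⁆ := by
    intro x y hy z hz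
    rw [borelPairing_apply, KM.proj_lie_bPlus hy hz, map_zero, add_zero]
  rw [map_sub, F.pairDual_lie_tensor hf t' ha₁ hac₁ hp₁ ha₂ hac₂ hp₂,
    F.pairDual_lie_tensor hf t ha₃ hac₃ hp₃ ha₄ hac₄ hp₄, h' c₁ hc₁ z hz, h' y hy c₂ hc₂,
    h c₃ hc₃ z hz, h y hy c₄ hc₄, key _ _ hc₁ _ hz, key _ _ hy _ hc₂, key _ _ hc₃ _ hz,
    key _ _ hy _ hc₄, key _ _ hy _ hz]
  have e₀ : Φ (⁅x, x'⁆ : KM.bMinus k A B) ⁅y, z⁆ = Φ x ⁅a₃, z⁆ + Φ x ⁅c₃, z⁆ +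
      (Φ x ⁅y, a₄⁆ + Φ x ⁅y, c₄⁆) := by
    rw [LieSubalgebra.coe_bracket, F.inv, leibniz_lie, hac₃, hac₄]
    simp only [lie_add, add_lie, map_add]
  have e₁ : Φ x ⁅a₃, z⁆ = -(Φ a₂ a₃ + Φ c₂ a₃) := by
    rw [← lie_skew, map_neg, ← F.inv, hac₂, map_add, LinearMap.add_apply]
  have e₂ : Φ x ⁅y, a₄⁆ = Φ a₁ a₄ + Φ c₁ a₄ := by
    rw [← F.inv, hac₁, map_add, LinearMap.add_apply]
  have e₃ : Φ x' ⁅c₁, z⁆ = -(Φ a₄ c₁ + Φ c₄ c₁) := by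
    rw [← lie_skew, map_neg, ← F.inv, hac₄, map_add, LinearMap.add_apply]
  have e₄ : Φ x' ⁅y, c₂⁆ = Φ a₃ c₂ + Φ c₃ c₂ := by
    rw [← F.inv, hac₃, map_add, LinearMap.add_apply]
  -- Minus-minus and plus-plus terms both reduce to the form on Cartan parts, which agree by the
  -- choice of the splittings.
  have e₅ : Φ a₂ a₃ = Φ c₃ c₂ := by
    rw [F.bMinus_bMinus ha₂ ha₃, F.symm, F.bPlus_bPlus hc₂ hc₃, hp₂, hp₃]
  have e₆ : Φ a₁ a₄ = Φ c₄ c₁ := by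
    rw [F.bMinus_bMinus ha₁ ha₄, F.symm, F.bPlus_bPlus hc₁ hc₄, hp₁, hp₄]
  rw [e₀, e₁, e₂, e₃, e₄, e₅, e₆, F.symm c₂ a₃, F.symm c₁ a₄]
  ring

/-- A priori the transpose of the bracket takes values in a completion only. The elements for which
it is a genuine tensor form a subalgebra by the cocycle rule, and the generators belong to it. -/
lemma exists_tensor (hd : ∀ i, d i ≠ 0) (x : KM.bMinus k A B) : ∃ t, IsCobracket form Φ B x t := by
  let Q : LieSubalgebra k (KM.bMinus k A B) :=
    { carrier := {x | ∃ t, IsCobracket form Φ B x t}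
      add_mem' := fun ⟨t, ht⟩ ⟨t', ht'⟩ => ⟨_, ht.add ht'⟩
      zero_mem' := ⟨0, zero⟩
      smul_mem' := fun c _ ⟨t, ht⟩ => ⟨_, ht.smul c⟩
      lie_mem' := fun ⟨t, ht⟩ ⟨t', ht'⟩ => ⟨_, lie F hf ht ht'⟩ }
  exact KM.mem_of_generators_bMinus (Q := Q) (fun x => ⟨0, hB F hf x⟩)
    (fun i hi => ⟨_, fB F hf hd hi⟩) x

end IsCobracket

/-- A linear map which is dual to the bracket. -/
lemma exists_cobracket {Φ : LinearMap.BilinForm k (KM k A)} (F : KM.IsStdForm k A d form Φ)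
    (hf : IsInvariantForm k A d form) (hd : ∀ i, d i ≠ 0) (B : Set I) :
    ∃ δ : KM.bMinus k A B →ₗ[k] KM.bMinus k A B ⊗[k] KM.bMinus k A B,
      ∀ x, IsCobracket form Φ B x (δ x) := by
  choose δ hδ using IsCobracket.exists_tensor F hf hd (B := B)
  exact ⟨{ toFun := δ
           map_add' := fun x y => (hδ (x + y)).unique F hf ((hδ x).add (hδ y))
           map_smul' := fun c x => (hδ (c • x)).unique F hf ((hδ x).smul c) }, hδ⟩

lemma lie_jacobi_left {L : Type*} [LieRing L] (x y z : L) :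
    ⁅⁅x, y⁆, z⁆ + ⁅⁅z, x⁆, y⁆ + ⁅⁅y, z⁆, x⁆ = 0 := by
  rw [← lie_skew ⁅x, y⁆ z, ← lie_skew ⁅z, x⁆ y, ← lie_skew ⁅y, z⁆ x, ← neg_add, ← neg_add,
    neg_eq_zero,
    ← lie_jacobi x y z]
  abel

lemma dualDistrib_comm {V : Type*} [AddCommGroup V] [Module k V] (φ ψ : Module.Dual k V)
    (t : V ⊗[k] V) : TensorProduct.dualDistrib k V V (φ ⊗ₜ ψ) (TensorProduct.comm k V V t) =
      TensorProduct.dualDistrib k V V (ψ ⊗ₜ φ) t := by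
  induction t with
  | zero => simp
  | add s s' hs hs' => simp only [map_add, hs, hs']
  | tmul x y => simp [mul_comm]

/-- The permutation in the co-Jacobi identity rotates the three linear forms, which turns it into
the cyclic Jacobi identity. -/
lemma dualDistrib_rotate {V : Type*} [AddCommGroup V] [Module k V] (φ ψ χ : Module.Dual k V)
    (t : (V ⊗[k] V) ⊗[k] V) : TensorProduct.dualDistrib k (V ⊗[k] V) V
      (TensorProduct.dualDistrib k V V (φ ⊗ₜ ψ) ⊗ₜ χ)
      ((TensorProduct.assoc k V V V ≪≫ₗ TensorProduct.comm k V (V ⊗[k] V)) t) =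
      TensorProduct.dualDistrib k (V ⊗[k] V) V
        (TensorProduct.dualDistrib k V V (χ ⊗ₜ φ) ⊗ₜ ψ) t := by
  induction t with
  | zero => simp
  | add s s' hs hs' => simp only [map_add, hs, hs']
  | tmul s z =>
    induction s with
    | zero => simp
    | add s s' hs hs' => simp only [map_add, TensorProduct.add_tmul, hs, hs']
    | tmul x y =>
      simp only [LinearEquiv.trans_apply, TensorProduct.assoc_tmul, TensorProduct.comm_tmul,
        TensorProduct.dualDistrib_apply]
      ring

/-- The standard Lie bialgebra structure on a negative Borel subalgebra. -/
lemma exists_lieBialgebraStructure {Φ : LinearMap.BilinForm k (KM k A)}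
    (F : KM.IsStdForm k A d form Φ) (hf : IsInvariantForm k A d form) (hd : ∀ i, d i ≠ 0)
    (B : Set I) : ∃ δ : LieBialgebraStructure k (KM.bMinus k A B),
      ∀ x, IsCobracket form Φ B x (δ.δ x) := by
  obtain ⟨δ, hδ⟩ := exists_cobracket F hf hd B
  have hs := F.separating_bPlus hf (B := B)
  refine ⟨⟨δ, fun x => ?_, fun x => ?_, fun x y => ?_⟩, hδ⟩
  · rw [← sub_eq_zero, sub_neg_eq_add]
    refine hs.dualDistrib hs _ fun p => ?_
    rw [map_add, dualDistrib_comm, hδ x _ p.2.2 _ p.1.2, hδ x _ p.1.2 _ p.2.2, ← map_add,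
      ← lie_skew, neg_add_cancel, map_zero]
  · intro σ t
    -- Tested on three elements of the positive Borel subalgebra, the co-Jacobi identity becomes the
    -- Jacobi identity of their iterated brackets.
    refine (hs.dualDistrib hs).dualDistrib hs _ fun p => ?_
    have key : ∀ y ∈ KM.bPlus k A B, ∀ z ∈ KM.bPlus k A B, ∀ w ∈ KM.bPlus k A B,
        TensorProduct.dualDistrib k _ _ (TensorProduct.dualDistrib k _ _
          (pairDual form Φ B y ⊗ₜ pairDual form Φ B z) ⊗ₜ pairDual form Φ B w) t =
        borelPairing A form Φ x ⁅⁅y, z⁆, w⁆ := by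
      intro y hy z hz w hw
      rw [← hδ x _ (LieSubalgebra.lie_mem _ hy hz) _ hw]
      simp only [t]
      generalize δ x = u
      induction u with
      | zero => simp
      | add s s' hs hs' => simp only [map_add, hs, hs']
      | tmul a b =>
        rw [LinearMap.rTensor_tmul, TensorProduct.dualDistrib_apply,
          TensorProduct.dualDistrib_apply, hδ a y hy z hz,
          F.borelPairing_symm hf]
        rfl
    obtain ⟨⟨y, z⟩, w⟩ := p
    simp only [map_add, σ, dualDistrib_rotate]
    rw [key y y.2 z z.2 w w.2, key w w.2 y y.2 z z.2, key z z.2 w w.2 y y.2, ← map_add,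
      ← map_add, lie_jacobi_left, map_zero]
  · exact (hδ _).unique F hf ((hδ x).lie F hf (hδ y))

end StandardExistence

/-! ### Projections of Borel subalgebras; existence and uniqueness of the standard structure -/

section StandardUniqueness

variable {k : Type u} [Field k] [CharZero k] {I : Type v} [DecidableEq I] [Fintype I]
  {A : Matrix I I ℤ} {d : I → k} {form : LinearMap.BilinForm k (Cartan k I)} {B B' : Set I}
  {Φ : LinearMap.BilinForm k (KM k A)}

namespace KM

/-- Equalities in a negative Borel subalgebra are tested on the positive one. Linearity,
functoriality and splitting of the projections all follow in this way from their adjunction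
property. -/
lemma eq_of_form_bPlus (F : KM.IsStdForm k A d form Φ) (hf : IsInvariantForm k A d form)
    {x y : bMinus k A B} (h : ∀ z ∈ bPlus k A B, Φ x z = Φ y z) : x = y := by
  have := CoxeterDY.IsStdForm.borel_nondeg F.swap (isChev k A).swap hf (B := B)
    (x := (x - y : bMinus k A B)) (by rw [borel_neg]; exact mem_bMinus.1 (x - y).2)
    fun z hz => by
      rw [borel_neg] at hz
      change Φ ((x : KM k A) - y) z = 0
      rw [map_sub, LinearMap.sub_apply, h z (mem_bPlus.2 hz), sub_self]
  exact sub_eq_zero.1 (Subtype.ext this)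

/-- The orthogonal projections of the Borel subalgebras. -/
lemma exists_borelProjection (F : KM.IsStdForm k A d form Φ) (hf : IsInvariantForm k A d form)
    (hB : B' ⊆ B) : ∃ p : bMinus k A B →ₗ⁅k⁆ bMinus k A B',
      ∀ x, ∀ y ∈ bPlus k A B', Φ (p x) y = Φ x y := by
  have C := isChev k A
  -- The projection is characterised by the requirement that x - p(x) be orthogonal to the smaller
  -- positive Borel subalgebra.
  have key : ∀ x : bMinus k A B, ∃ a : bMinus k A B',
      (x - a : KM k A) ∈ IsStdForm.orth Φ (-h k A) (f k A) (e k A) B B' := by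
    intro x
    obtain ⟨a, ha, hx⟩ := CoxeterDY.IsStdForm.exists_borel_add_orth F.swap C.swap hf hB
      (x := x) (by rw [borel_neg]; exact mem_bMinus.1 x.2)
    rw [borel_neg] at ha
    exact ⟨⟨a, mem_bMinus.2 ha⟩, hx⟩
  choose p hp using key
  have hp' : ∀ x, ∀ y ∈ bPlus k A B', Φ (p x) y = Φ x y := by
    intro x y hy
    have := (hp x).2 y (by rw [borel_neg]; exact mem_bPlus.1 hy)
    rw [map_sub, LinearMap.sub_apply] at this
    exact (sub_eq_zero.1 this).symm
  refine ⟨{ toFun := p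
            map_add' := fun x y => eq_of_form_bPlus F hf fun z hz => by simp [hp' _ _ hz]
            map_smul' := fun c x => eq_of_form_bPlus F hf fun z hz => by simp [hp' _ _ hz]
            map_lie' := fun {x y} => eq_of_form_bPlus F hf fun z hz => ?_ }, hp'⟩
  rw [hp' _ _ hz]
  -- The difference [x, y] - [p x, p y] equals [x - p x, y] + [p x, y - p y], and both terms are in
  -- the orthogonal, which is an ideal.
  have h₁ := (CoxeterDY.IsStdForm.lie_mem_orth F.swap C.swap (x := y)
    (by rw [borel_neg]; exact mem_bMinus.1 y.2) (hp x)).2 z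
    (by rw [borel_neg]; exact mem_bPlus.1 hz)
  have h₂ := (CoxeterDY.IsStdForm.lie_mem_orth F.swap C.swap (x := p x)
    (by rw [borel_neg]; exact mem_bMinus.1 (bMinus_mono hB (p x).2)) (hp y)).2 z
    (by rw [borel_neg]; exact mem_bPlus.1 hz)
  rw [lie_sub, map_sub, LinearMap.sub_apply, ← lie_skew (y : KM k A), ← lie_skew (y : KM k A),
    map_neg, map_neg, LinearMap.neg_apply, LinearMap.neg_apply] at h₁
  rw [lie_sub, map_sub, LinearMap.sub_apply] at h₂
  rw [LieSubalgebra.coe_bracket, LieSubalgebra.coe_bracket]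
  linear_combination h₂ - h₁

end KM

/-- The existence of the standard structure. -/
lemma exists_standard (hd : ∀ i, d i ≠ 0) (hf : IsInvariantForm k A d form) :
    Nonempty (Standard A d form) := by
  obtain ⟨Φ, hs, hi, hn, hh, hef⟩ := KM.exists_form hf
  have F : KM.IsStdForm k A d form Φ := ⟨hs, hi, hn, hh, hef⟩
  choose δ hδ using exists_lieBialgebraStructure F hf hd
  have hp := fun B B' hB => KM.exists_borelProjection F hf (B := B) (B' := B') hB
  choose p hp using hp
  have δ_h : ∀ B x, (δ B).δ (KM.hB k A B x) = 0 := fun B x =>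
    (hδ B _).unique F hf (IsCobracket.hB F hf x)
  have δ_f : ∀ (B : Set I) (i : I) (hi : i ∈ B), (δ B).δ (KM.fB A hi) = (2 * d i)⁻¹ •
      (KM.hB k A B ⟨coroot k i, coroot_mem hi⟩ ⊗ₜ KM.fB A hi -
        KM.fB A hi ⊗ₜ KM.hB k A B ⟨coroot k i, coroot_mem hi⟩) := fun B i hi =>
    (hδ B _).unique F hf (IsCobracket.fB F hf hd hi)
  have p_h : ∀ {B B' : Set I} (hB : B' ⊆ B) (x : cartanSub k B), ∃ y : cartanSub k B',
      p B B' hB (KM.hB k A B x) = KM.hB k A B' y ∧ ∀ z ∈ cartanSub k B', form (x - y) z = 0 := by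
    intro B B' hB x
    obtain ⟨y, hy, hxy⟩ := hf.exists_orthogonal_projection B' x
    refine ⟨⟨y, hy⟩, KM.eq_of_form_bPlus F hf fun z hz => ?_, hxy⟩
    rw [hp _ _ hB _ _ hz]
    change Φ (KM.h k A x) z = Φ (KM.h k A y) z
    rw [F.h_left (KM.isChev k A) hf, F.h_left (KM.isChev k A) hf, ← sub_eq_zero,
      ← LinearMap.sub_apply, ← map_sub]
    exact hxy _ (KM.proj_bPlus hz)
  have p_f : ∀ {B B' : Set I} (hB : B' ⊆ B) {i : I} (hi : i ∈ B) (hi' : i ∈ B'),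
      p B B' hB (KM.fB A hi) = KM.fB A hi' := fun hB i hi hi' =>
    KM.eq_of_form_bPlus F hf fun z hz => hp _ _ hB _ _ hz
  have p_f_zero : ∀ {B B' : Set I} (hB : B' ⊆ B) {i : I} (hi : i ∈ B), i ∉ B' →
      p B B' hB (KM.fB A hi) = 0 := fun {B B'} hB i hi hi' =>
    KM.eq_of_form_bPlus F hf fun z hz => by
      rw [hp _ _ hB _ _ hz]
      have := CoxeterDY.IsStdForm.e_borel F.swap (KM.isChev k A).swap (B := B') hi' (y := z)
        (by rw [borel_neg]; exact KM.mem_bPlus.1 hz)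
      refine this.trans ?_
      simp
  have p_incl : ∀ {B B' : Set I} (hB : B' ⊆ B) (x : KM.bMinus k A B'),
      p B B' hB (bIncl k A hB x) = x := fun hB x =>
    KM.eq_of_form_bPlus F hf fun z hz => hp _ _ hB _ _ hz
  -- Compatibility with cobrackets holds on a subalgebra, by the cocycle rule, so it suffices to
  -- check generators; likewise for the projections.
  have incl_δ : ∀ {B B' : Set I} (hB : B' ⊆ B) (x : KM.bMinus k A B'),
      x ∈ (δ B).compatible (δ B') (bIncl k A hB) := by
    intro B B' hB
    refine KM.mem_of_generators_bMinus (fun x => ?_) fun i hi => ?_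
    · have e : bIncl k A hB (KM.hB k A B' x) = KM.hB k A B (Standard.cartanIncl hB x) := rfl
      change (δ B).δ (bIncl k A hB (KM.hB k A B' x)) = TensorProduct.map _ _ ((δ B').δ _)
      rw [e, δ_h, δ_h, map_zero]
    · have e : bIncl k A hB (KM.fB A hi) = KM.fB A (hB hi) := rfl
      change (δ B).δ (bIncl k A hB (KM.fB A hi)) = TensorProduct.map _ _ ((δ B').δ _)
      rw [e, δ_f _ _ (hB hi), δ_f _ _ hi]
      rw [map_smul, map_sub]
      rfl
  have p_δ : ∀ {B B' : Set I} (hB : B' ⊆ B) (x : KM.bMinus k A B),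
      x ∈ (δ B').compatible (δ B) (p B B' hB) := by
    intro B B' hB
    refine KM.mem_of_generators_bMinus (fun x => ?_) fun i hi => ?_
    · obtain ⟨y, hy, -⟩ := p_h hB x
      change (δ B').δ (p B B' hB (KM.hB k A B x)) = TensorProduct.map _ _ ((δ B).δ _)
      rw [hy, δ_h, δ_h, map_zero]
    · change (δ B').δ (p B B' hB (KM.fB A hi)) = TensorProduct.map _ _ ((δ B).δ _)
      by_cases hi' : i ∈ B'
      · have e : p B B' hB (KM.hB k A B ⟨coroot k i, coroot_mem hi⟩) =
            KM.hB k A B' ⟨coroot k i, coroot_mem hi'⟩ :=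
          p_incl hB (KM.hB k A B' ⟨coroot k i, coroot_mem hi'⟩)
        rw [p_f hB hi hi', δ_f _ _ hi', δ_f _ _ hi, map_smul, map_sub, TensorProduct.map_tmul,
          TensorProduct.map_tmul, LieHom.coe_toLinearMap, p_f hB hi hi', e]
      · rw [p_f_zero hB hi hi', δ_f _ _ hi, map_smul, map_sub, TensorProduct.map_tmul,
          TensorProduct.map_tmul, LieHom.coe_toLinearMap, p_f_zero hB hi hi']
        simp
  exact ⟨{
    Φ := Φ
    Φ_symm := hs
    Φ_invariant := hi
    Φ_nondegenerate := hn
    Φ_h := hh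
    Φ_e_f := hef
    δ := δ
    δ_h := δ_h
    δ_f := δ_f
    p := fun {B B'} hB => p B B' hB
    p_h := p_h
    p_f := p_f
    p_f_eq_zero := p_f_zero
    Φ_p := fun hB x y hy => by rw [hs, hp _ _ hB _ _ hy, hs]
    p_incl := p_incl
    incl_δ := incl_δ
    p_δ := p_δ
    p_self := fun x => KM.eq_of_form_bPlus F hf fun z hz => hp _ _ _ _ _ hz
    p_comp := fun {B B' B''} hB hB' x => KM.eq_of_form_bPlus F hf fun z hz => by
      rw [hp _ _ _ _ _ hz, hp _ _ _ _ _ hz, hp _ _ _ _ _ (by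
        refine LieSubalgebra.lieSpan_mono ?_ hz
        rintro _ ⟨i, hi, hx⟩
        exact ⟨i, hB' hi, hx⟩)] }⟩

/-- The uniqueness of the standard structure. -/
lemma standard_unique (hf : IsInvariantForm k A d form) (S S' : Standard A d form) : S' = S := by
  refine Standard.ext ?_ ?_ ?_
  · refine sub_eq_zero.1 ((KM.isChev k A).form_eq_zero (fun x y z => ?_) (fun x y => ?_)
      (fun i j => ?_) fun i j => ?_)
    · simp only [LinearMap.sub_apply, S.Φ_invariant, S'.Φ_invariant]
    · simp only [LinearMap.sub_apply, S.Φ_h, S'.Φ_h, sub_self]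
    · simp only [LinearMap.sub_apply, S.Φ_e_f, S'.Φ_e_f, sub_self]
    · simp only [LinearMap.sub_apply, S.Φ_symm (KM.f k A i), S'.Φ_symm (KM.f k A i), S.Φ_e_f,
        S'.Φ_e_f, sub_self]
  · funext B
    have : ∀ x, x ∈ (S'.δ B).compatible (S.δ B) LieHom.id := by
      refine KM.mem_of_generators_bMinus (fun x => ?_) fun i hi => ?_
      · change (S'.δ B).δ (KM.hB k A B x) = TensorProduct.map _ _ ((S.δ B).δ _)
        rw [S.δ_h, S'.δ_h, map_zero]
      · change (S'.δ B).δ (KM.fB A hi) = TensorProduct.map _ _ ((S.δ B).δ _)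
        rw [S.δ_f _ _ hi, S'.δ_f _ _ hi, map_smul, map_sub]
        rfl
    refine LieBialgebraStructure.ext (LinearMap.ext fun x => (this x).trans ?_)
    have e : TensorProduct.map ((LieHom.id : KM.bMinus k A B →ₗ⁅k⁆ KM.bMinus k A B) :
        KM.bMinus k A B →ₗ[k] KM.bMinus k A B) ((LieHom.id : KM.bMinus k A B →ₗ⁅k⁆ KM.bMinus k A B) :
        KM.bMinus k A B →ₗ[k] KM.bMinus k A B) = LinearMap.id := TensorProduct.map_id
    rw [e]
    rfl
  · funext B B' hB
    refine LieHom.ext fun x => ?_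
    let Q : LieSubalgebra k (KM.bMinus k A B) :=
      { carrier := {x | S'.p hB x = S.p hB x}
        add_mem' := fun {x y} hx hy => by
          change S'.p hB (x + y) = _
          rw [map_add, map_add, hx.out, hy.out]
        zero_mem' := by
          change S'.p hB 0 = _
          rw [map_zero, map_zero]
        smul_mem' := fun c x hx => by
          change S'.p hB (c • x) = _
          rw [map_smul, map_smul, hx.out]
        lie_mem' := fun {x y} hx hy => by
          change S'.p hB ⁅x, y⁆ = _
          rw [LieHom.map_lie, LieHom.map_lie, hx.out, hy.out] }
    refine KM.mem_of_generators_bMinus (Q := Q) (fun x => ?_) (fun i hi => ?_) x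
    · obtain ⟨y, hy, hxy⟩ := S.p_h hB x
      obtain ⟨y', hy', hxy'⟩ := S'.p_h hB x
      change S'.p hB _ = S.p hB _
      rw [hy, hy']
      congr 1
      -- Both Cartan components are orthogonal projections of x, so their difference is a vector of
      -- `cartanSub k B'` orthogonal to that subspace, on which the form is nondegenerate.
      refine Subtype.ext (sub_eq_zero.1 (hf.nondegenerate B' _ (sub_mem y'.2 y.2) fun z hz => ?_))
      have h₁ := hxy z hz
      have h₂ := hxy' z hz
      simp only [map_sub, LinearMap.sub_apply] at h₁ h₂ ⊢
      linear_combination h₁ - h₂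
    · change S'.p hB _ = S.p hB _
      by_cases hi' : i ∈ B'
      · rw [S.p_f hB hi hi', S'.p_f hB hi hi']
      · rw [S.p_f_eq_zero hB hi hi', S'.p_f_eq_zero hB hi hi']

end StandardUniqueness

/-! ### Compositions of restriction functors -/

namespace SplitPair

variable {k : Type u} [Field k] {L₀ L₁ L₂ L₃ : Type*} [LieRing L₀] [LieAlgebra k L₀]
  [LieRing L₁] [LieAlgebra k L₁] [LieRing L₂] [LieAlgebra k L₂] [LieRing L₃] [LieAlgebra k L₃]
  {δ₀ : LieBialgebraStructure k L₀} {δ₁ : LieBialgebraStructure k L₁}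
  {δ₂ : LieBialgebraStructure k L₂} {δ₃ : LieBialgebraStructure k L₃}

/-- The split pair `s''` is the composition of `s` and `s'`. -/
structure IsComp (s : SplitPair δ₀ δ₁) (s' : SplitPair δ₁ δ₂) (s'' : SplitPair δ₀ δ₂) : Prop where
  i : ∀ x, s.i (s'.i x) = s''.i x
  p : ∀ x, s'.p (s.p x) = s''.p x

/-- The identity, as an isomorphism from an iterated restriction to the restriction. -/
def compIso {s : SplitPair δ₀ δ₁} {s' : SplitPair δ₁ δ₂} {s'' : SplitPair δ₀ δ₂}
    (c : IsComp s s' s'') (X : DY δ₀) : s'.res.obj (s.res.obj X) ≅ s''.res.obj X :=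
  DY.mkIso (LinearEquiv.refl k X.V)
    (fun x v => LinearMap.congr_fun (congrArg X.act (c.i x)) v) fun v => by
      change (s''.p : L₀ →ₗ[k] L₂).rTensor X.V (X.coact v) = LinearMap.lTensor L₂ LinearMap.id
        ((s'.p : L₁ →ₗ[k] L₂).rTensor X.V ((s.p : L₀ →ₗ[k] L₁).rTensor X.V (X.coact v)))
      rw [LinearMap.lTensor_id, LinearMap.id_apply, ← LinearMap.rTensor_comp_apply]
      congr 2
      exact LinearMap.ext fun x => (c.p x).symm

section

variable {s : SplitPair δ₀ δ₁} {s' : SplitPair δ₁ δ₂} {s'' : SplitPair δ₀ δ₂}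
    (c : IsComp s s' s'')

/-- The underlying linear maps are identities. So this and the coherence statements after it hold
definitionally once they are evaluated on vectors or pure tensors. -/
lemma compIso_naturality {X Y : DY δ₀} (f : X ⟶ Y) :
    s'.res.map (s.res.map f) ≫ (compIso c Y).hom = (compIso c X).hom ≫ s''.res.map f :=
  DY.hom_ext (LinearMap.ext fun _ => rfl)

lemma compIso_unit : (s'.resCore.εIso.hom ≫ s'.res.map s.resCore.εIso.hom) ≫
    (compIso c (𝟙_ (DY δ₀))).hom = s''.resCore.εIso.hom :=
  DY.hom_ext (LinearMap.ext fun _ => rfl)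

lemma compIso_tensor (X Y : DY δ₀) :
    ((s'.resCore.μIso (s.res.obj X) (s.res.obj Y)).hom ≫ s'.res.map (s.resCore.μIso X Y).hom) ≫
      (compIso c (X ⊗ Y)).hom =
    ((compIso c X).hom ⊗ₘ (compIso c Y).hom) ≫ (s''.resCore.μIso X Y).hom :=
  DY.hom_ext (TensorProduct.ext' fun _ _ => rfl)

lemma compIso_assoc {s₀ : SplitPair δ₀ δ₁} {s₁ : SplitPair δ₁ δ₂} {s₂ : SplitPair δ₂ δ₃}
    {t : SplitPair δ₀ δ₂} {t' : SplitPair δ₁ δ₃} {r : SplitPair δ₀ δ₃} (c : IsComp s₀ s₁ t)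
    (c' : IsComp t s₂ r) (b : IsComp s₁ s₂ t') (b' : IsComp s₀ t' r) (X : DY δ₀) :
    s₂.res.map (compIso c X).hom ≫ (compIso c' X).hom =
      (compIso b (s₀.res.obj X)).hom ≫ (compIso b' X).hom :=
  DY.hom_ext (LinearMap.ext fun _ => rfl)

end

/-- The split pair is the identity. -/
structure IsId (s : SplitPair δ₀ δ₀) : Prop where
  i : ∀ x, s.i x = x
  p : ∀ x, s.p x = x

section

variable {s : SplitPair δ₀ δ₀} (c : IsId s)

include c in
lemma resStr_self {V : Type u} [AddCommGroup V] [Module k V] (a : DYStructure δ₀ V) :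
    s.resStr a = a := by
  refine DYStructure.ext (LieHom.ext fun x => congrArg a.act (c.i x)) ?_
  have : (s.p : L₀ →ₗ[k] L₀) = LinearMap.id := LinearMap.ext c.p
  change (s.p : L₀ →ₗ[k] L₀).rTensor V ∘ₗ a.coact = _
  rw [this, LinearMap.rTensor_id, LinearMap.id_comp]

include c in
lemma res_obj_self (X : DY δ₀) : s.res.obj X = X := by
  obtain ⟨V, a⟩ := X
  change (⟨V, s.resStr a⟩ : DY δ₀) = _
  rw [resStr_self c]

/-- The identity, as an isomorphism from the restriction of a module along the identity. -/
def selfIso (X : DY δ₀) : s.res.obj X ≅ X :=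
  DY.mkIso (LinearEquiv.refl k X.V)
    (fun x v => LinearMap.congr_fun (congrArg X.act (c.i x)) v) fun v => by
      change X.coact v = LinearMap.lTensor L₀ LinearMap.id
        ((s.p : L₀ →ₗ[k] L₀).rTensor X.V (X.coact v))
      have : (s.p : L₀ →ₗ[k] L₀) = LinearMap.id := LinearMap.ext c.p
      rw [this, LinearMap.rTensor_id, LinearMap.lTensor_id]
      rfl

/-- The normalisation of a pre-Coxeter category is an equality of functors, hence the need to
identify the resulting `eqToHom` with the identity of V. -/
lemma eqToHom_lin {V : Type u} [AddCommGroup V] [Module k V] {a a' : DYStructure δ₀ V}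
    (ha : a' = a) (h : (⟨V, a'⟩ : DY δ₀) = ⟨V, a⟩) :
    (eqToHom h).lin = (LinearMap.id : V →ₗ[k] V) := by
  subst ha
  rw [eqToHom_refl]
  rfl

lemma eqToHom_res_obj_self (X : DY δ₀) (h : s.res.obj X = X) :
    eqToHom h = (selfIso c X).hom := by
  obtain ⟨V, a⟩ := X
  exact DY.hom_ext (eqToHom_lin (resStr_self c a) h)

lemma eqToHom_self_res_obj (X : DY δ₀) (h : X = s.res.obj X) :
    eqToHom h = (selfIso c X).inv := by
  rw [← cancel_epi (selfIso c X).hom, Iso.hom_inv_id, ← eqToHom_res_obj_self c X h.symm,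
    eqToHom_trans, eqToHom_refl]

lemma selfIso_naturality {X Y : DY δ₀} (f : X ⟶ Y) :
    s.res.map f = (selfIso c X).hom ≫ f ≫ (selfIso c Y).inv :=
  DY.hom_ext (LinearMap.ext fun _ => rfl)

lemma selfIso_unit : s.resCore.εIso.hom ≫ (selfIso c (𝟙_ (DY δ₀))).hom = 𝟙 (𝟙_ (DY δ₀)) :=
  DY.hom_ext (LinearMap.ext fun _ => rfl)

lemma selfIso_tensor (X Y : DY δ₀) : (s.resCore.μIso X Y).hom ≫ (selfIso c (X ⊗ Y)).hom =
    ((selfIso c X).hom ⊗ₘ (selfIso c Y).hom) :=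
  DY.hom_ext (TensorProduct.ext' fun _ _ => rfl)

lemma compIso_self_left {s' : SplitPair δ₀ δ₁} (b : IsComp s s' s') (X : DY δ₀) :
    (compIso b X).hom = s'.res.map (selfIso c X).hom :=
  DY.hom_ext (LinearMap.ext fun _ => rfl)

lemma compIso_self_right {s' : SplitPair δ₁ δ₀} (b : IsComp s' s s') (X : DY δ₁) :
    (compIso b X).hom = (selfIso c (s'.res.obj X)).hom :=
  DY.hom_ext (LinearMap.ext fun _ => rfl)

end

end SplitPair

/-! ### Pre-Coxeter structures -/

namespace Standard

variable {k : Type u} [Field k] {I : Type v} [DecidableEq I] {A : Matrix I I ℤ} {d : I → k}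
  {form : LinearMap.BilinForm k (Cartan k I)} {S : Standard A d form} {B B' B'' : Set I}

lemma isComp_split (hB : B' ⊆ B) (hB' : B'' ⊆ B') :
    SplitPair.IsComp (S.split hB) (S.split hB') (S.split (hB'.trans hB)) where
  i _ := rfl
  p := S.p_comp hB hB'

lemma isId_split (B : Set I) : SplitPair.IsId (S.split (subset_refl B)) where
  i _ := rfl
  p := S.p_self

namespace Family

variable (Q : S.Family)

lemma eqToHom_hom {X Y : (Q.P B).FullSubcategory} (h : X = Y) :
    (eqToHom h).hom = eqToHom (congrArg ObjectProperty.FullSubcategory.obj h) := by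
  subst h
  rfl

lemma resFun_self (B : Set I) : Q.resFun (subset_refl B) = 𝟭 (Q.P B).FullSubcategory := by
  have key : ∀ X : (Q.P B).FullSubcategory, (Q.resFun (subset_refl B)).obj X = X := by
    rintro ⟨X, hX⟩
    have h := SplitPair.res_obj_self (S.isId_split B) X
    -- The object is generalised so that the equality can be substituted together with the proof of
    -- membership.
    have : ∀ (Y : DY (S.δ B)) (_ : Y = X) (hY : Q.P B Y),
        (⟨Y, hY⟩ : (Q.P B).FullSubcategory) = ⟨X, hX⟩ := by
      rintro Y rfl hY
      rfl
    exact this _ h (Q.res _ X hX)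
  refine CategoryTheory.Functor.ext key fun X Y f => ObjectProperty.hom_ext _ ?_
  rw [ObjectProperty.FullSubcategory.comp_hom, ObjectProperty.FullSubcategory.comp_hom,
    eqToHom_hom, eqToHom_hom]
  have e₁ := SplitPair.eqToHom_res_obj_self (S.isId_split B) X.obj
    (congrArg ObjectProperty.FullSubcategory.obj (key X))
  have e₂ := SplitPair.eqToHom_self_res_obj (S.isId_split B) Y.obj
    (congrArg ObjectProperty.FullSubcategory.obj (key Y)).symm
  refine (SplitPair.selfIso_naturality (S.isId_split B) f.hom).trans ?_
  rw [← e₁, ← e₂]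
  rfl

/-- The composition of two restriction functors. -/
noncomputable def resComp (hB : B' ⊆ B) (hB' : B'' ⊆ B') :
    Q.resFun hB ⋙ Q.resFun hB' ≅ Q.resFun (hB'.trans hB) :=
  NatIso.ofComponents
    (fun X => (Q.P B'').isoMk (SplitPair.compIso (S.isComp_split hB hB') X.obj))
    fun f => ObjectProperty.hom_ext _
      (SplitPair.compIso_naturality (S.isComp_split hB hB') f.hom)

lemma resComp_isMonoidal (hB : B' ⊆ B) (hB' : B'' ⊆ B') :
    NatTrans.IsMonoidal (Q.resComp hB hB').hom where
  unit := ObjectProperty.hom_ext _ (SplitPair.compIso_unit (S.isComp_split hB hB'))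
  tensor X Y := ObjectProperty.hom_ext _
    (SplitPair.compIso_tensor (S.isComp_split hB hB') X.obj Y.obj)

lemma eqToHom_resFun_self_app (X : (Q.P B).FullSubcategory) :
    ((eqToHom (Q.resFun_self B)).app X).hom = (SplitPair.selfIso (S.isId_split B) X.obj).hom := by
  rw [eqToHom_app, eqToHom_hom]
  exact SplitPair.eqToHom_res_obj_self (S.isId_split B) X.obj _

lemma eqToHom_resFun_self_isMonoidal (B : Set I) :
    NatTrans.IsMonoidal (eqToHom (Q.resFun_self B)) where
  unit := by
    refine ObjectProperty.hom_ext _ ?_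
    rw [ObjectProperty.FullSubcategory.comp_hom, eqToHom_resFun_self_app]
    exact SplitPair.selfIso_unit (S.isId_split B)
  tensor X Y := by
    refine ObjectProperty.hom_ext _ ?_
    rw [ObjectProperty.FullSubcategory.comp_hom, eqToHom_resFun_self_app]
    refine (SplitPair.selfIso_tensor (S.isId_split B) X.obj Y.obj).trans ?_
    rw [← eqToHom_resFun_self_app, ← eqToHom_resFun_self_app]
    exact (Category.comp_id _).symm

lemma resComp_self_left (hB : B' ⊆ B) (X : (Q.P B).FullSubcategory) :
    (Q.resComp (subset_refl B) hB).hom.app X =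
      (Q.resFun hB).map ((eqToHom (Q.resFun_self B)).app X) := by
  refine ObjectProperty.hom_ext _ ?_
  refine (SplitPair.compIso_self_left (S.isId_split B) (S.isComp_split _ hB) X.obj).trans ?_
  rw [← eqToHom_resFun_self_app]
  rfl

lemma resComp_self_right (hB : B' ⊆ B) (X : (Q.P B).FullSubcategory) :
    (Q.resComp hB (subset_refl B')).hom.app X =
      (eqToHom (Q.resFun_self B')).app ((Q.resFun hB).obj X) := by
  refine ObjectProperty.hom_ext _ ?_
  refine (SplitPair.compIso_self_right (S.isId_split B') (S.isComp_split hB _) X.obj).trans ?_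
  rw [eqToHom_resFun_self_app]
  rfl

lemma resComp_assoc {B₀ B₁ B₂ B₃ : Set I} (h₁ : B₁ ⊆ B₀) (h₂ : B₂ ⊆ B₁) (h₃ : B₃ ⊆ B₂)
    (X : (Q.P B₀).FullSubcategory) :
    (Q.resFun h₃).map ((Q.resComp h₁ h₂).hom.app X) ≫ (Q.resComp (h₂.trans h₁) h₃).hom.app X =
      (Q.resComp h₂ h₃).hom.app ((Q.resFun h₁).obj X) ≫
        (Q.resComp h₁ (h₃.trans h₂)).hom.app X :=
  ObjectProperty.hom_ext _ (SplitPair.compIso_assoc (S.isComp_split h₁ h₂)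
    (S.isComp_split (h₂.trans h₁) h₃) (S.isComp_split h₂ h₃)
    (S.isComp_split h₁ (h₃.trans h₂)) X.obj)

lemma resComp_hom_self_left (hB : B' ⊆ B) : (Q.resComp (subset_refl B) hB).hom =
    Functor.whiskerRight (eqToHom (Q.resFun_self B)) (Q.resFun hB) ≫
      (Functor.leftUnitor (Q.resFun hB)).hom ≫ 𝟙 (Q.resFun hB) := by
  ext X : 2
  simp [resComp_self_left]

lemma resComp_hom_self_right (hB : B' ⊆ B) : (Q.resComp hB (subset_refl B')).hom =
    Functor.whiskerLeft (Q.resFun hB) (eqToHom (Q.resFun_self B')) ≫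
      (Functor.rightUnitor (Q.resFun hB)).hom ≫ 𝟙 (Q.resFun hB) := by
  ext X : 2
  simp [resComp_self_right]

lemma resComp_natural (hB : B' ⊆ B) (hB' : B'' ⊆ B') :
    (𝟙 (Q.resFun hB) ◫ 𝟙 (Q.resFun hB')) ≫ (Q.resComp hB hB').hom =
      (Q.resComp hB hB').hom ≫ 𝟙 (Q.resFun (hB'.trans hB)) := by
  ext X : 2
  simp

/-- The pre-Coxeter structure in which all structural isomorphisms are identities. -/
noncomputable def preCoxeter : PreCoxeter Q.data where
  Υ h _ _ := Iso.refl (Q.resFun h)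
  Υ_monoidal h _ _ := inferInstanceAs (NatTrans.IsMonoidal (𝟙 (Q.resFun h)))
  Υ_trans h _ _ _ := Iso.refl_trans (Iso.refl (Q.resFun h))
  α h h' _ _ _ := Q.resComp h h'
  α_monoidal h h' _ _ _ := Q.resComp_isMonoidal h h'
  α_natural h h' _ _ _ _ _ _ := Q.resComp_natural h h'
  α_assoc h₁ h₂ h₃ _ _ _ _ _ _ X := Q.resComp_assoc h₁ h₂ h₃ X
  F_self B _ := Q.resFun_self B
  F_self_monoidal B _ := Q.eqToHom_resFun_self_isMonoidal B
  α_self_left h _ _ _ := Q.resComp_hom_self_left h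
  α_self_right h _ _ _ := Q.resComp_hom_self_right h

lemma isTrivial_preCoxeter : Q.IsTrivial Q.preCoxeter :=
  ⟨fun _ _ _ _ _ _ _ => rfl, fun _ _ _ _ _ _ _ _ _ _ => rfl⟩

lemma isSymmetric_data : Q.data.IsSymmetric := fun _ X Y =>
  ObjectProperty.hom_ext _ (SymmetricCategory.symmetry X.obj Y.obj)

end Family
end Standard

/-! ### Exponentials of locally nilpotent operators -/

section Exponential

variable {k : Type u} [Field k] {V W : Type*} [AddCommGroup V] [Module k V] [AddCommGroup W]
  [Module k W]

/-- `finsum` has the default value 0 on infinite supports; nilpotency on v makes the support finite.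
-/
lemma locExp_eq_sum {T : Module.End k V} {v : V} {N : ℕ} (h : (T ^ N) v = 0) :
    locExp T v = ∑ n ∈ Finset.range N, ((n.factorial : k)⁻¹) • (T ^ n) v := by
  refine finsum_eq_sum_of_support_subset _ fun n hn => ?_
  rw [Function.mem_support] at hn
  rw [Finset.coe_range, Set.mem_Iio]
  by_contra hc
  exact hn (by rw [pow_apply_eq_zero_of_le T v N n h (not_lt.1 hc), smul_zero])

lemma locExp_zero (v : V) : locExp (0 : Module.End k V) v = v := by
  rw [locExp_eq_sum (N := 1) (by simp)]
  simp

lemma locExp_of_apply_eq_zero {T : Module.End k V} {v : V} (h : T v = 0) : locExp T v = v := by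
  rw [locExp_eq_sum (N := 1) (by simpa using h)]
  simp

lemma locExp_four {T : Module.End k V} {v : V} (h : T (T (T (T v))) = 0) :
    locExp T v = v + T v + (2⁻¹ : k) • T (T v) + (6⁻¹ : k) • T (T (T v)) := by
  rw [locExp_eq_sum (N := 4) (by simpa [pow_succ] using h)]
  simp only [Finset.sum_range_succ, Finset.sum_range_zero, Nat.factorial, pow_succ, pow_zero,
    one_mul, Module.End.mul_apply, Module.End.one_apply]
  norm_num

lemma map_locExp {T : Module.End k V} {T' : Module.End k W} (φ : V →ₗ[k] W)
    (hφ : ∀ v, φ (T v) = T' (φ v)) {v : V} {N : ℕ} (h : (T ^ N) v = 0) :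
    φ (locExp T v) = locExp T' (φ v) := by
  have key : ∀ n, φ ((T ^ n) v) = (T' ^ n) (φ v) := by
    intro n
    induction n with
    | zero => rfl
    | succ n ih => rw [pow_succ', pow_succ', Module.End.mul_apply, Module.End.mul_apply, hφ, ih]
  rw [locExp_eq_sum h, locExp_eq_sum (N := N) (by rw [← key, h, map_zero]), map_sum]
  exact Finset.sum_congr rfl fun n _ => by rw [map_smul, key]

variable [CharZero k]

/-- The binomial theorem divided by n!. This is where characteristic zero enters the exponentials.
-/
lemma locExp_add_of_commute {T T' : Module.End k V} (hc : Commute T T') {v : V} {N M : ℕ}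
    (hN : (T ^ N) v = 0) (hM : (T' ^ M) v = 0) :
    locExp (T + T') v = locExp T (locExp T' v) := by
  let g : ℕ × ℕ → V := fun x =>
    ((x.1.factorial : k)⁻¹ * (x.2.factorial : k)⁻¹) • (T ^ x.1) ((T' ^ x.2) v)
  have hc' : ∀ p q, (T ^ p) ((T' ^ q) v) = (T' ^ q) ((T ^ p) v) := fun p q =>
    LinearMap.congr_fun (hc.pow_pow p q).eq v
  have hg : ∀ p q, N ≤ p ∨ M ≤ q → (T ^ p) ((T' ^ q) v) = 0 := by
    rintro p q (h | h)
    · rw [hc', pow_apply_eq_zero_of_le T v N p hN h, map_zero]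
    · rw [pow_apply_eq_zero_of_le T' v M q hM h, map_zero]
  have e₁ : ∀ n, ((n.factorial : k)⁻¹) • ((T + T') ^ n) v =
      ∑ x ∈ Finset.HasAntidiagonal.antidiagonal n, g x := by
    intro n
    rw [hc.add_pow', LinearMap.sum_apply, Finset.smul_sum]
    refine Finset.sum_congr rfl fun x hx => ?_
    rw [Finset.HasAntidiagonal.mem_antidiagonal] at hx
    rw [LinearMap.smul_apply, Module.End.mul_apply, ← Nat.cast_smul_eq_nsmul k, smul_smul]
    congr 1
    subst hx
    have h := Nat.add_choose_mul_factorial_mul_factorial x.1 x.2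
    rw [← Nat.choose_symm_add] at h
    have h' : (((x.1 + x.2).choose x.1 : ℕ) : k) * x.1.factorial * x.2.factorial =
        ((x.1 + x.2).factorial : k) := by exact_mod_cast h
    have h₁ : (x.1.factorial : k) ≠ 0 := Nat.cast_ne_zero.2 (Nat.factorial_ne_zero _)
    have h₂ : (x.2.factorial : k) ≠ 0 := Nat.cast_ne_zero.2 (Nat.factorial_ne_zero _)
    have h₃ : ((x.1 + x.2).factorial : k) ≠ 0 := Nat.cast_ne_zero.2 (Nat.factorial_ne_zero _)
    field_simp
    rw [← h']
  have e₂ : ((T + T') ^ (N + M)) v = 0 := by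
    have h := e₁ (N + M)
    rw [Finset.sum_eq_zero, smul_eq_zero] at h
    · exact h.resolve_left (inv_ne_zero (Nat.cast_ne_zero.2 (Nat.factorial_ne_zero _)))
    · intro x hx
      rw [Finset.HasAntidiagonal.mem_antidiagonal] at hx
      simp only [g]
      rw [hg _ _ (by omega), smul_zero]
  have e₃ : (T ^ N) (locExp T' v) = 0 := by
    rw [locExp_eq_sum hM, map_sum]
    exact Finset.sum_eq_zero fun q _ => by rw [map_smul, hg _ _ (Or.inl le_rfl), smul_zero]
  rw [locExp_eq_sum e₂, locExp_eq_sum e₃, locExp_eq_sum hM]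
  have e₄ : ∑ n ∈ Finset.range N, ((n.factorial : k)⁻¹) • (T ^ n)
      (∑ q ∈ Finset.range M, ((q.factorial : k)⁻¹) • (T' ^ q) v) =
      ∑ x ∈ Finset.range N ×ˢ Finset.range M, g x := by
    rw [Finset.sum_product]
    refine Finset.sum_congr rfl fun p _ => ?_
    rw [map_sum, Finset.smul_sum]
    exact Finset.sum_congr rfl fun q _ => by rw [map_smul, smul_smul]
  -- The double sum over a rectangle is regrouped by total degree; on an antidiagonal, the terms
  -- outside the rectangle vanish.
  rw [e₄, ← Finset.sum_fiberwise_of_maps_to (s := Finset.range N ×ˢ Finset.range M)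
    (t := Finset.range (N + M)) (g := fun x => x.1 + x.2)
    (fun x hx => by
      rw [Finset.mem_product, Finset.mem_range, Finset.mem_range] at hx
      rw [Finset.mem_range]
      omega)]
  refine Finset.sum_congr rfl fun n _ => ?_
  rw [e₁]
  symm
  refine Finset.sum_subset (fun x hx => ?_) fun x hx hx' => ?_
  · rw [Finset.mem_filter] at hx
    exact Finset.HasAntidiagonal.mem_antidiagonal.2 hx.2
  · rw [Finset.HasAntidiagonal.mem_antidiagonal] at hx
    simp only [g]
    rw [hg, smul_zero]
    by_contra hcon
    push Not at hcon
    exact hx' (by simp [hcon.1, hcon.2, hx])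

lemma LocallyNilpotent.neg {T : Module.End k V} (hT : LocallyNilpotent T) :
    LocallyNilpotent (-T) := by
  intro v
  obtain ⟨n, hn⟩ := hT v
  refine ⟨n, ?_⟩
  rw [neg_pow, Module.End.mul_apply, hn, map_zero]

lemma locExp_neg_locExp {T : Module.End k V} (hT : LocallyNilpotent T) (v : V) :
    locExp (-T) (locExp T v) = v := by
  obtain ⟨n, hn⟩ := hT v
  obtain ⟨m, hm⟩ := hT.neg v
  rw [← locExp_add_of_commute (Commute.neg_left (Commute.refl T)) hm hn, neg_add_cancel,
    locExp_zero]

/-- The exponential of a locally nilpotent operator. -/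
noncomputable def expEquiv {T : Module.End k V} (hT : LocallyNilpotent T) : V ≃ₗ[k] V where
  toFun := locExp T
  invFun := locExp (-T)
  map_add' v w := by
    obtain ⟨n, hn⟩ := hT v
    obtain ⟨m, hm⟩ := hT w
    have hn' := pow_apply_eq_zero_of_le T v n (n + m) hn (by omega)
    have hm' := pow_apply_eq_zero_of_le T w m (n + m) hm (by omega)
    rw [locExp_eq_sum hn', locExp_eq_sum hm', locExp_eq_sum (N := n + m) (v := v + w)
      (by rw [map_add, hn', hm', add_zero]), ← Finset.sum_add_distrib]
    simp
  map_smul' c v := by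
    obtain ⟨n, hn⟩ := hT v
    rw [locExp_eq_sum hn, locExp_eq_sum (N := n) (v := c • v)
      (by rw [map_smul, hn, smul_zero]), RingHom.id_apply, Finset.smul_sum]
    exact Finset.sum_congr rfl fun _ _ => by rw [map_smul, smul_comm]
  left_inv := locExp_neg_locExp hT
  right_inv v := by
    have := locExp_neg_locExp hT.neg v
    rwa [neg_neg] at this

lemma locExp_tensor {T : Module.End k V} {T' : Module.End k W} (hT : LocallyNilpotent T)
    (hT' : LocallyNilpotent T') (v : V) (w : W) :
    locExp (T.rTensor W + T'.lTensor V) (v ⊗ₜ[k] w) = locExp T v ⊗ₜ locExp T' w := by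
  obtain ⟨n, hn⟩ := hT v
  obtain ⟨m, hm⟩ := hT' w
  have hc : Commute (T.rTensor W) (T'.lTensor V) := by
    change T.rTensor W ∘ₗ T'.lTensor V = T'.lTensor V ∘ₗ T.rTensor W
    rw [LinearMap.rTensor_comp_lTensor, LinearMap.lTensor_comp_rTensor]
  have e₁ : ∀ w, locExp (T.rTensor W) (v ⊗ₜ[k] w) = locExp T v ⊗ₜ w := fun w =>
    (map_locExp (T' := T.rTensor W) ((TensorProduct.mk k V W).flip w) (fun _ => rfl) hn).symm
  have e₂ : locExp (T'.lTensor V) (v ⊗ₜ[k] w) = v ⊗ₜ locExp T' w :=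
    (map_locExp (T' := T'.lTensor V) (TensorProduct.mk k V W v) (fun _ => rfl) hm).symm
  rw [locExp_add_of_commute hc (N := n) (M := m), e₂, e₁]
  · rw [LinearMap.rTensor_pow, LinearMap.rTensor_tmul, hn, TensorProduct.zero_tmul]
  · rw [LinearMap.lTensor_pow, LinearMap.lTensor_tmul, hm, TensorProduct.tmul_zero]

/-- The triple exponential as a linear automorphism. -/
noncomputable def tripleEquiv {e f : Module.End k V} (he : LocallyNilpotent e)
    (hf : LocallyNilpotent f) : V ≃ₗ[k] V :=
  expEquiv he * expEquiv hf.neg * expEquiv he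

lemma tripleEquiv_apply {e f : Module.End k V} (he : LocallyNilpotent e)
    (hf : LocallyNilpotent f) (v : V) : tripleEquiv he hf v = tripleExp e f v := rfl

lemma tripleExp_tensor {e f : Module.End k V} {e' f' : Module.End k W} (he : LocallyNilpotent e)
    (hf : LocallyNilpotent f) (he' : LocallyNilpotent e') (hf' : LocallyNilpotent f') (v : V)
    (w : W) : tripleExp (e.rTensor W + e'.lTensor V) (f.rTensor W + f'.lTensor V) (v ⊗ₜ[k] w) =
      tripleExp e f v ⊗ₜ tripleExp e' f' w := by
  have h : -(f.rTensor W + f'.lTensor V) = (-f).rTensor W + (-f').lTensor V := by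
    rw [LinearMap.rTensor_neg, LinearMap.lTensor_neg, neg_add]
  rw [tripleExp, locExp_tensor he he', h, locExp_tensor hf.neg hf'.neg, locExp_tensor he he']
  rfl

lemma map_tripleExp {e f : Module.End k V} {e' f' : Module.End k W} (he : LocallyNilpotent e)
    (hf : LocallyNilpotent f) (φ : V →ₗ[k] W) (hφe : ∀ v, φ (e v) = e' (φ v))
    (hφf : ∀ v, φ (f v) = f' (φ v)) (v : V) :
    φ (tripleExp e f v) = tripleExp e' f' (φ v) := by
  have h₁ : ∀ v, φ (locExp e v) = locExp e' (φ v) := fun v =>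
    map_locExp φ hφe (he v).choose_spec
  have h₂ : ∀ v, φ (locExp (-f) v) = locExp (-f') (φ v) := fun v =>
    map_locExp φ (fun v => by simp [hφf]) (hf.neg v).choose_spec
  rw [tripleExp, h₁, h₂, h₁]
  rfl

/-- Operators satisfying the relations of `sl₂`. -/
structure IsSl2 (e f h : Module.End k V) : Prop where
  ef : ∀ v, e (f v) = f (e v) + h v
  he : ∀ v, h (e v) = e (h v) + (2 : k) • e v
  hf : ∀ v, h (f v) = f (h v) - (2 : k) • f v

namespace IsSl2

variable {e f h : Module.End k V} (s : IsSl2 e f h)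
include s

lemma h_pow {v : V} {c : k} (hv : h v = c • v) (m : ℕ) :
    h ((e ^ m) v) = (c + 2 * m) • (e ^ m) v := by
  induction m with
  | zero => simp [hv]
  | succ m ih =>
    rw [pow_succ', Module.End.mul_apply, s.he, ih, map_smul, ← add_smul]
    congr 1
    push_cast
    ring

/-- The standard formula in a lowest weight module. Its coefficient vanishes at m = n when c = -n,
which gives both the dimension of the string and the Serre relations. -/
lemma f_pow {v : V} {c : k} (hf : f v = 0) (hv : h v = c • v) (m : ℕ) :
    f ((e ^ (m + 1)) v) = -((m + 1) * (c + m)) • (e ^ m) v := by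
  induction m with
  | zero =>
    have := s.ef v
    rw [hf, map_zero, hv] at this
    simp only [zero_add, pow_one, pow_zero, Module.End.one_apply, Nat.cast_zero, add_zero,
      one_mul, neg_smul]
    exact eq_neg_of_add_eq_zero_left this.symm
  | succ m ih =>
    have := s.ef ((e ^ (m + 1)) v)
    rw [ih, s.h_pow hv, map_smul, ← Module.End.mul_apply e (e ^ m), ← pow_succ',
      ← sub_eq_iff_eq_add, ← sub_smul] at this
    rw [pow_succ' e (m + 1), Module.End.mul_apply, ← this]
    congr 1
    push_cast
    ring

/-- If e^(m+1) v = 0 with m + 1 minimal, applying f gives (m+1)(m-n) = 0, so m = n. Hence the string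
has the expected length as soon as it is finite. -/
lemma pow_eq_zero {v : V} {n : ℕ} (hf : f v = 0) (hv : h v = (-n : k) • v)
    (hN : ∃ N : ℕ, (e ^ N) v = 0) : (e ^ (n + 1)) v = 0 := by
  classical
  have h₁ := Nat.find_spec hN
  by_cases hn : Nat.find hN ≤ n + 1
  · exact pow_apply_eq_zero_of_le e v _ _ h₁ hn
  · obtain ⟨m, hm⟩ : ∃ m, Nat.find hN = m + 1 := ⟨Nat.find hN - 1, by omega⟩
    have h₂ := s.f_pow hf hv m
    rw [← hm, h₁, map_zero, eq_comm, smul_eq_zero, neg_eq_zero, mul_eq_zero] at h₂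
    have h₃ : (e ^ m) v ≠ 0 := Nat.find_min hN (by omega)
    rcases h₂ with (h₂ | h₂) | h₂
    · exact absurd h₂ (by exact_mod_cast Nat.succ_ne_zero m)
    · have : (m : k) = n := by linear_combination h₂
      have : m = n := by exact_mod_cast this
      omega
    · exact absurd h₂ h₃

lemma tripleExp_of_zero {v : V} (hf : f v = 0) (hv : h v = 0) (he : LocallyNilpotent e) :
    tripleExp e f v = v := by
  have h₁ : e v = 0 := by simpa using s.pow_eq_zero (n := 0) hf (by simpa using hv) (he v)
  have h₂ : (-f) v = 0 := by simpa using hf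
  rw [tripleExp, locExp_of_apply_eq_zero h₁, locExp_of_apply_eq_zero h₂,
    locExp_of_apply_eq_zero h₁]

/-- A computation in the two-dimensional module with basis v, e v: `a` and `b` are the matrices of
exp(e) and exp(-f). The lemmas for weights -2 and -3 are analogous; longer strings do not occur in
finite types of rank two. -/
lemma tripleExp_of_one {v : V} (hf : f v = 0) (hv : h v = -v) (he : e (e v) = 0) :
    tripleExp e f v = e v ∧ tripleExp e f (e v) = -v := by
  have h₁ : f (e v) = v := by
    have := s.f_pow (c := -1) hf (by simpa using hv) 0
    simpa using this
  have a : ∀ x y : k, locExp e (x • v + y • e v) = x • v + (x + y) • e v := fun x y => by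
    rw [locExp_four (by simp [he])]
    simp only [map_add, map_smul, he, smul_zero, add_zero, map_zero]
    module
  have b : ∀ x y : k, locExp (-f) (x • v + y • e v) = (x - y) • v + y • e v := fun x y => by
    rw [locExp_four (by simp [h₁, hf])]
    simp only [map_add, map_smul, LinearMap.neg_apply, h₁, hf, map_neg, smul_zero, map_zero,
      neg_zero, add_zero]
    module
  constructor
  · have : v = (1 : k) • v + (0 : k) • e v := by module
    conv_lhs => rw [this]
    rw [tripleExp, a, b, a]
    module
  · have : e v = (0 : k) • v + (1 : k) • e v := by module
    conv_lhs => rw [this]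
    rw [tripleExp, a, b, a]
    module

lemma tripleExp_of_two {v : V} (hf : f v = 0) (hv : h v = (-2 : k) • v)
    (he : e (e (e v)) = 0) : tripleExp e f v = (2⁻¹ : k) • e (e v) ∧
      tripleExp e f ((2⁻¹ : k) • e (e v)) = v := by
  have h₁ : f (e v) = (2 : k) • v := by
    have := s.f_pow hf hv 0
    simpa using this
  have h₂ : f (e (e v)) = (2 : k) • e v := by
    have := s.f_pow hf hv 1
    norm_num [pow_succ] at this
    exact this
  have a : ∀ x y z : k, locExp e (x • v + y • e v + z • e (e v)) =
      x • v + (x + y) • e v + (2⁻¹ * x + y + z) • e (e v) := fun x y z => by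
    rw [locExp_four (by simp [he])]
    simp only [map_add, map_smul, he, smul_zero, add_zero]
    module
  have b : ∀ x y z : k, locExp (-f) (x • v + y • e v + z • e (e v)) =
      (x - 2 * y + 2 * z) • v + (y - 2 * z) • e v + z • e (e v) := fun x y z => by
    rw [locExp_four (by simp [h₁, h₂, hf])]
    simp only [map_add, map_smul, LinearMap.neg_apply, h₁, h₂, hf, map_neg, smul_zero, map_zero,
      neg_zero, add_zero]
    module
  constructor
  · have : v = (1 : k) • v + (0 : k) • e v + (0 : k) • e (e v) := by module
    conv_lhs => rw [this]
    rw [tripleExp, a, b, a]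
    module
  · have : (2⁻¹ : k) • e (e v) = (0 : k) • v + (0 : k) • e v + (2⁻¹ : k) • e (e v) := by module
    conv_lhs => rw [this]
    rw [tripleExp, a, b, a]
    module

lemma tripleExp_of_three {v : V} (hf : f v = 0) (hv : h v = (-3 : k) • v)
    (he : e (e (e (e v))) = 0) : tripleExp e f v = (6⁻¹ : k) • e (e (e v)) ∧
      tripleExp e f ((6⁻¹ : k) • e (e (e v))) = -v ∧
      f ((6⁻¹ : k) • e (e (e v))) = (2⁻¹ : k) • e (e v) := by
  have h₁ : f (e v) = (3 : k) • v := by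
    have := s.f_pow hf hv 0
    simpa using this
  have h₂ : f (e (e v)) = (4 : k) • e v := by
    have := s.f_pow hf hv 1
    norm_num [pow_succ] at this
    exact this
  have h₃ : f (e (e (e v))) = (3 : k) • e (e v) := by
    have := s.f_pow hf hv 2
    norm_num [pow_succ] at this
    exact this
  have a : ∀ x y z w : k, locExp e (x • v + y • e v + z • e (e v) + w • e (e (e v))) =
      x • v + (x + y) • e v + (2⁻¹ * x + y + z) • e (e v) +
        (6⁻¹ * x + 2⁻¹ * y + z + w) • e (e (e v)) := fun x y z w => by
    rw [locExp_four (by simp [he])]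
    simp only [map_add, map_smul, he, smul_zero, add_zero]
    module
  have b : ∀ x y z w : k, locExp (-f) (x • v + y • e v + z • e (e v) + w • e (e (e v))) =
      (x - 3 * y + 6 * z - 6 * w) • v + (y - 4 * z + 6 * w) • e v + (z - 3 * w) • e (e v) +
        w • e (e (e v)) := fun x y z w => by
    rw [locExp_four (by simp [h₁, h₂, h₃, hf])]
    simp only [map_add, map_smul, LinearMap.neg_apply, h₁, h₂, h₃, hf, map_neg, smul_zero,
      map_zero, neg_zero, add_zero]
    module
  refine ⟨?_, ?_, ?_⟩
  · have : v = (1 : k) • v + (0 : k) • e v + (0 : k) • e (e v) + (0 : k) • e (e (e v)) := by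
      module
    conv_lhs => rw [this]
    rw [tripleExp, a, b, a]
    module
  · have : (6⁻¹ : k) • e (e (e v)) = (0 : k) • v + (0 : k) • e v + (0 : k) • e (e v) +
        (6⁻¹ : k) • e (e (e v)) := by module
    conv_lhs => rw [this]
    rw [tripleExp, a, b, a]
    module
  · rw [map_smul, h₃]
    module

end IsSl2

end Exponential

/-! ### Braid relations for triple exponentials -/

section Braid

variable {k : Type u} [Field k] [CharZero k] {L V : Type*} [LieRing L] [LieAlgebra k L]
  [AddCommGroup V] [Module k V]

/-- The action map L ⊗ V → V intertwines ad e ⊗ 1 + 1 ⊗ e with e, and the exponential of the former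
factors. -/
lemma locExp_act (ρ : L →ₗ⁅k⁆ Module.End k V) {e : L}
    (hL : LocallyNilpotent (LieAlgebra.ad k L e : Module.End k L)) (hV : LocallyNilpotent (ρ e))
    (x : L) (v : V) :
    locExp (ρ e) (ρ x v) = ρ (locExp (LieAlgebra.ad k L e : Module.End k L) x) (locExp (ρ e) v) := by
  let m : L ⊗[k] V →ₗ[k] V := TensorProduct.lift (ρ : L →ₗ[k] Module.End k V)
  have hm : ∀ t, m (((LieAlgebra.ad k L e).rTensor V + (ρ e).lTensor L) t) = ρ e (m t) := by
    intro t
    induction t with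
    | zero => simp
    | add s s' hs hs' => simp only [map_add, hs, hs']
    | tmul x v =>
      change ρ ⁅e, x⁆ v + ρ x (ρ e v) = ρ e (ρ x v)
      rw [LieHom.map_lie, LieRing.of_associative_ring_bracket]
      simp
  have h := map_locExp m hm ((hL.tensor hV) (x ⊗ₜ v)).choose_spec
  rw [locExp_tensor hL hV] at h
  exact h.symm

lemma tripleExp_act (ρ : L →ₗ⁅k⁆ Module.End k V) {e f : L}
    (heL : LocallyNilpotent (LieAlgebra.ad k L e : Module.End k L))
    (hfL : LocallyNilpotent (LieAlgebra.ad k L f : Module.End k L))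
    (heV : LocallyNilpotent (ρ e)) (hfV : LocallyNilpotent (ρ f)) (x : L) (v : V) :
    tripleExp (ρ e) (ρ f) (ρ x v) = ρ (tripleExp (LieAlgebra.ad k L e : Module.End k L)
      (LieAlgebra.ad k L f : Module.End k L) x) (tripleExp (ρ e) (ρ f) v) := by
  have h₁ := locExp_act ρ heL heV
  have h₂ := locExp_act ρ (e := -f) (by rw [map_neg]; exact hfL.neg) (by rw [map_neg]; exact hfV.neg)
  rw [map_neg, map_neg] at h₂
  rw [tripleExp, h₁, h₂, h₁]
  rfl

variable (k) in
/-- Two pairs of Chevalley generators with Cartan integers `a`, `b`. -/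
structure IsPair (e₁ f₁ h₁ e₂ f₂ h₂ : L) (a b : k) : Prop where
  ef₁ : ⁅e₁, f₁⁆ = h₁
  ef₂ : ⁅e₂, f₂⁆ = h₂
  he₁ : ⁅h₁, e₁⁆ = (2 : k) • e₁
  he₂ : ⁅h₂, e₂⁆ = (2 : k) • e₂
  hf₁ : ⁅h₁, f₁⁆ = -((2 : k) • f₁)
  hf₂ : ⁅h₂, f₂⁆ = -((2 : k) • f₂)
  ef₁₂ : ⁅e₁, f₂⁆ = 0
  ef₂₁ : ⁅e₂, f₁⁆ = 0
  he₁₂ : ⁅h₁, e₂⁆ = a • e₂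
  he₂₁ : ⁅h₂, e₁⁆ = b • e₁
  hf₁₂ : ⁅h₁, f₂⁆ = -(a • f₂)
  hf₂₁ : ⁅h₂, f₁⁆ = -(b • f₁)
  ne₁ : LocallyNilpotent (LieAlgebra.ad k L e₁ : Module.End k L)
  nf₁ : LocallyNilpotent (LieAlgebra.ad k L f₁ : Module.End k L)
  ne₂ : LocallyNilpotent (LieAlgebra.ad k L e₂ : Module.End k L)
  nf₂ : LocallyNilpotent (LieAlgebra.ad k L f₂ : Module.End k L)

namespace IsPair

variable {e₁ f₁ h₁ e₂ f₂ h₂ : L} {a b : k} (P : IsPair k e₁ f₁ h₁ e₂ f₂ h₂ a b)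
include P

lemma symm : IsPair k e₂ f₂ h₂ e₁ f₁ h₁ b a :=
  ⟨P.ef₂, P.ef₁, P.he₂, P.he₁, P.hf₂, P.hf₁, P.ef₂₁, P.ef₁₂, P.he₂₁, P.he₁₂, P.hf₂₁, P.hf₁₂,
    P.ne₂, P.nf₂, P.ne₁, P.nf₁⟩

/-- The Chevalley involution of the pair: what is proved for the e's becomes a statement on the f's,
as soon as τ is known to be unchanged. -/
lemma neg : IsPair k (-f₁) (-e₁) (-h₁) (-f₂) (-e₂) (-h₂) a b where
  ef₁ := by rw [neg_lie, lie_neg, neg_neg, ← lie_skew, P.ef₁]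
  ef₂ := by rw [neg_lie, lie_neg, neg_neg, ← lie_skew, P.ef₂]
  he₁ := by rw [neg_lie, lie_neg, neg_neg, P.hf₁, smul_neg]
  he₂ := by rw [neg_lie, lie_neg, neg_neg, P.hf₂, smul_neg]
  hf₁ := by rw [neg_lie, lie_neg, neg_neg, P.he₁, smul_neg, neg_neg]
  hf₂ := by rw [neg_lie, lie_neg, neg_neg, P.he₂, smul_neg, neg_neg]
  ef₁₂ := by rw [neg_lie, lie_neg, neg_neg, ← lie_skew, P.ef₂₁, neg_zero]
  ef₂₁ := by rw [neg_lie, lie_neg, neg_neg, ← lie_skew, P.ef₁₂, neg_zero]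
  he₁₂ := by rw [neg_lie, lie_neg, neg_neg, P.hf₁₂, smul_neg]
  he₂₁ := by rw [neg_lie, lie_neg, neg_neg, P.hf₂₁, smul_neg]
  hf₁₂ := by rw [neg_lie, lie_neg, neg_neg, P.he₁₂, smul_neg, neg_neg]
  hf₂₁ := by rw [neg_lie, lie_neg, neg_neg, P.he₂₁, smul_neg, neg_neg]
  ne₁ := by rw [map_neg]; exact P.nf₁.neg
  nf₁ := by rw [map_neg]; exact P.ne₁.neg
  ne₂ := by rw [map_neg]; exact P.nf₂.neg
  nf₂ := by rw [map_neg]; exact P.ne₂.neg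

lemma isSl2 : IsSl2 (LieAlgebra.ad k L e₁ : Module.End k L) (LieAlgebra.ad k L f₁)
    (LieAlgebra.ad k L h₁) where
  ef v := by
    simp only [LieAlgebra.ad_apply]
    rw [leibniz_lie, P.ef₁, add_comm]
  he v := by
    simp only [LieAlgebra.ad_apply]
    rw [leibniz_lie, P.he₁, smul_lie, add_comm]
  hf v := by
    simp only [LieAlgebra.ad_apply]
    rw [leibniz_lie, P.hf₁, neg_lie, smul_lie]
    abel

/-- The triple exponential in the adjoint representation. -/
noncomputable def τ : L ≃ₗ[k] L := tripleEquiv P.ne₁ P.nf₁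

lemma τ_apply (x : L) : P.τ x = tripleExp (LieAlgebra.ad k L e₁ : Module.End k L)
    (LieAlgebra.ad k L f₁) x := rfl

/-- In the adjoint triple f₁ is a lowest weight vector of weight -2 and ½ ad(e₁)² f₁ = -e₁, so
`tripleExp_of_two` sends -e₁ to f₁. -/
lemma τ_e : P.τ e₁ = -f₁ := by
  have h := P.isSl2.tripleExp_of_two (v := f₁) (lie_self f₁)
    (by rw [LieAlgebra.ad_apply, P.hf₁, neg_smul])
    (by
      have h₁ : ⁅e₁, h₁⁆ = -((2 : k) • e₁) := by rw [← lie_skew, P.he₁]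
      simp only [LieAlgebra.ad_apply]
      rw [P.ef₁, h₁, lie_neg, lie_smul, lie_self]
      simp)
  have h₁ : (2⁻¹ : k) • (LieAlgebra.ad k L e₁) ((LieAlgebra.ad k L e₁) f₁) = -e₁ := by
    simp only [LieAlgebra.ad_apply]
    rw [P.ef₁, ← lie_skew, P.he₁, smul_neg, smul_smul, inv_mul_cancel₀ two_ne_zero, one_smul]
  rw [h₁] at h
  have h₂ : P.τ (-e₁) = f₁ := h.2
  exact neg_eq_iff_eq_neg.1 ((map_neg P.τ e₁).symm.trans h₂)

/-- From τ(e) = -f follows τ exp(ad e) = exp(-ad f) τ, hence exp(e) exp(-f) exp(e) = exp(-f) exp(e)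
exp(-f) in the adjoint representation; the right side is the triple exponential of the negated pair.
-/
lemma τ_neg : P.neg.τ = P.τ := by
  have key : ∀ x, P.τ (locExp (LieAlgebra.ad k L e₁ : Module.End k L) x) =
      locExp (-(LieAlgebra.ad k L f₁) : Module.End k L) (P.τ x) := by
    intro x
    refine map_locExp (P.τ : L →ₗ[k] L) (fun v => ?_) (P.ne₁ x).choose_spec
    change P.τ _ = _
    rw [P.τ_apply]
    refine (tripleExp_act (LieAlgebra.ad k L) P.ne₁ P.nf₁ P.ne₁ P.nf₁ e₁ v).trans ?_
    rw [← P.τ_apply, P.τ_e, map_neg]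
    rfl
  refine LinearEquiv.ext fun x => ?_
  have h := key (locExp (-(LieAlgebra.ad k L e₁) : Module.End k L) x)
  have h' := locExp_neg_locExp P.ne₁.neg x
  rw [neg_neg] at h'
  rw [h'] at h
  rw [h, τ_apply, τ_apply, map_neg, map_neg, tripleExp, tripleExp, neg_neg, h']

lemma fe₁₂ : ⁅f₁, e₂⁆ = 0 := by rw [← lie_skew, P.ef₂₁, neg_zero]

lemma τ_e_of_zero (ha : a = 0) : P.τ e₂ = e₂ := by
  refine P.isSl2.tripleExp_of_zero P.fe₁₂ ?_ P.ne₁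
  rw [LieAlgebra.ad_apply, P.he₁₂, ha, zero_smul]

lemma serre {n : ℕ} (ha : a = -n) : ((LieAlgebra.ad k L e₁ : Module.End k L) ^ (n + 1)) e₂ = 0 :=
  P.isSl2.pow_eq_zero P.fe₁₂ (by rw [LieAlgebra.ad_apply, P.he₁₂, ha]) (P.ne₁ e₂)

lemma τ_e_of_one (ha : a = -1) : P.τ e₂ = ⁅e₁, e₂⁆ ∧ P.τ ⁅e₁, e₂⁆ = -e₂ := by
  refine P.isSl2.tripleExp_of_one P.fe₁₂ ?_ ?_
  · rw [LieAlgebra.ad_apply, P.he₁₂, ha, neg_smul, one_smul]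
  · exact P.serre (n := 1) (by simpa using ha)

/-- Type A₂: e₁ is sent to [e₂, e₁] = -[e₁, e₂], and then to e₂. -/
lemma ττ_e (ha : a = -1) (hb : b = -1) : P.τ (P.symm.τ e₁) = e₂ := by
  rw [(P.symm.τ_e_of_one hb).1, ← lie_skew, map_neg, (P.τ_e_of_one ha).2, neg_neg]

/-- The Serre relation of degree two in `e₂` implies a relation of degree two in both. -/
lemma lie_lie_lie (hb : b = -1) : ⁅e₂, ⁅e₁, ⁅e₁, e₂⁆⁆⁆ = 0 := by
  have h₁ : ⁅e₂, ⁅e₂, e₁⁆⁆ = 0 := P.symm.serre (n := 1) (by simpa using hb)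
  have h₂ : ⁅e₂, ⁅e₁, e₂⁆⁆ = 0 := by rw [← lie_skew e₁ e₂, lie_neg, h₁, neg_zero]
  rw [leibniz_lie, h₂, lie_zero, add_zero, ← lie_skew e₂ e₁, neg_lie, lie_self, neg_zero]

lemma lie_f₂_lie_e₂ : ⁅f₂, ⁅e₁, e₂⁆⁆ = b • e₁ := by
  rw [leibniz_lie, P.symm.fe₁₂, zero_lie, zero_add, ← lie_skew f₂ e₂, P.ef₂, lie_neg,
    lie_skew, P.he₂₁]

lemma lie_f₂_lie_lie : ⁅f₂, ⁅e₁, ⁅e₁, e₂⁆⁆⁆ = 0 := by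
  rw [leibniz_lie, P.symm.fe₁₂, zero_lie, zero_add, P.lie_f₂_lie_e₂, lie_smul, lie_self,
    smul_zero]

lemma lie_h₂_lie : ⁅h₂, ⁅e₁, e₂⁆⁆ = (b + 2) • ⁅e₁, e₂⁆ := by
  rw [leibniz_lie, P.he₂₁, P.he₂, lie_smul, smul_lie, add_smul]

lemma lie_h₂_lie_lie : ⁅h₂, ⁅e₁, ⁅e₁, e₂⁆⁆⁆ = (2 * b + 2) • ⁅e₁, ⁅e₁, e₂⁆⁆ := by
  rw [leibniz_lie, P.he₂₁, P.lie_h₂_lie, lie_smul, smul_lie, ← add_smul]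
  congr 1
  ring

/-- Type B₂: ½[e₁, [e₁, e₂]] has h₂-weight 2b + 2 = 0 and is killed by f₂, so the middle factor
fixes it. The outer factors exchange it with e₂. -/
lemma τττ_e (ha : a = -2) (hb : b = -1) : P.τ (P.symm.τ (P.τ e₂)) = e₂ := by
  have h := P.isSl2.tripleExp_of_two (v := e₂) P.fe₁₂
    (by rw [LieAlgebra.ad_apply, P.he₁₂, ha]) (P.serre (n := 2) (by simpa using ha))
  simp only [LieAlgebra.ad_apply] at h
  have h₁ : P.τ e₂ = (2⁻¹ : k) • ⁅e₁, ⁅e₁, e₂⁆⁆ := h.1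
  have h₂ : P.symm.τ ((2⁻¹ : k) • ⁅e₁, ⁅e₁, e₂⁆⁆) = (2⁻¹ : k) • ⁅e₁, ⁅e₁, e₂⁆⁆ := by
    rw [map_smul]
    congr 1
    refine P.symm.isSl2.tripleExp_of_zero P.lie_f₂_lie_lie ?_ P.ne₂
    rw [LieAlgebra.ad_apply, P.lie_h₂_lie_lie, hb]
    simp
  rw [h₁, h₂]
  exact h.2

/-- Type G₂: e₂ passes to x, then to [e₂, x], which the middle factor fixes, then to -x, and back to
e₂. -/
lemma τττττ_e (ha : a = -3) (hb : b = -1) :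
    P.τ (P.symm.τ (P.τ (P.symm.τ (P.τ e₂)))) = e₂ := by
  have h := P.isSl2.tripleExp_of_three (v := e₂) P.fe₁₂
    (by rw [LieAlgebra.ad_apply, P.he₁₂, ha]) (P.serre (n := 3) (by simpa using ha))
  simp only [LieAlgebra.ad_apply] at h
  -- The factor 1/6 makes x the image of e₂ itself, at the top of the string of length four.
  set x : L := (6⁻¹ : k) • ⁅e₁, ⁅e₁, ⁅e₁, e₂⁆⁆⁆ with hx
  clear_value x
  have g₁ : P.τ e₂ = x := h.1
  have g₂ : P.τ x = -e₂ := h.2.1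
  have g₃ : ⁅f₂, x⁆ = 0 := by
    rw [hx, lie_smul, leibniz_lie, P.symm.fe₁₂, zero_lie, zero_add, P.lie_f₂_lie_lie, lie_zero,
      smul_zero]
  have g₄ : ⁅h₂, x⁆ = -x := by
    rw [hx, lie_smul, leibniz_lie, P.he₂₁, P.lie_h₂_lie_lie, lie_smul, smul_lie, ← add_smul, hb,
      smul_smul, ← neg_smul]
    congr 1
    ring
  have g₅ := P.symm.isSl2.tripleExp_of_one (v := x) g₃ g₄ (by
    refine P.symm.isSl2.pow_eq_zero (n := 1) g₃ ?_ (P.ne₂ x)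
    rw [LieAlgebra.ad_apply, g₄]
    simp)
  have g₆ : P.symm.τ x = ⁅e₂, x⁆ := g₅.1
  have g₇ : P.symm.τ ⁅e₂, x⁆ = -x := g₅.2
  -- The h₁-weight is -3 + 3 = 0, and f₁ kills the vector by the degree-two relation in both
  -- generators.
  have g₈ : P.τ ⁅e₂, x⁆ = ⁅e₂, x⁆ := by
    refine P.isSl2.tripleExp_of_zero ?_ ?_ P.ne₁
    · rw [LieAlgebra.ad_apply, leibniz_lie, P.fe₁₂, zero_lie, zero_add, h.2.2, lie_smul,
        P.lie_lie_lie hb, smul_zero]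
    · have g₉ : ⁅h₁, x⁆ = (3 : k) • x := by
        have := P.isSl2.h_pow (v := e₂) (c := -3) (by rw [LieAlgebra.ad_apply, P.he₁₂, ha]) 3
        simp only [pow_succ, pow_zero, one_mul, Module.End.mul_apply, LieAlgebra.ad_apply] at this
        rw [hx, lie_smul, this, smul_comm]
        norm_num
      rw [LieAlgebra.ad_apply, leibniz_lie, P.he₁₂, g₉, lie_smul, smul_lie, ha, ← add_smul]
      simp
  rw [g₁, g₆, g₈, g₇, map_neg, g₂, neg_neg]

variable {ρ : L →ₗ⁅k⁆ Module.End k V} (he₁ : LocallyNilpotent (ρ e₁))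
  (hf₁ : LocallyNilpotent (ρ f₁)) (he₂ : LocallyNilpotent (ρ e₂)) (hf₂ : LocallyNilpotent (ρ f₂))

lemma tripleEquiv_act (x : L) (v : V) :
    tripleEquiv he₁ hf₁ (ρ x v) = ρ (P.τ x) (tripleEquiv he₁ hf₁ v) :=
  tripleExp_act ρ P.ne₁ P.nf₁ he₁ hf₁ x v

-- An operator intertwining the action up to σ carries the exponentials of one pair to those of its
-- image. With g the product of the first m - 1 factors, this is the braid relation.
omit P in
lemma mul_tripleEquiv {g : V ≃ₗ[k] V} {σ : L ≃ₗ[k] L} (hg : ∀ x v, g (ρ x v) = ρ (σ x) (g v))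
    (he : σ e₁ = e₂) (hf : σ f₁ = f₂) :
    g * tripleEquiv he₁ hf₁ = tripleEquiv he₂ hf₂ * g := by
  refine LinearEquiv.ext fun v => ?_
  exact map_tripleExp he₁ hf₁ (g : V →ₗ[k] V) (fun v => (hg e₁ v).trans (by rw [he]; rfl))
    (fun v => (hg f₁ v).trans (by rw [hf]; rfl)) v

lemma symm_τ_neg : P.neg.symm.τ = P.symm.τ := P.symm.τ_neg

lemma braid_two (ha : a = 0) : tripleEquiv he₁ hf₁ * tripleEquiv he₂ hf₂ =
    tripleEquiv he₂ hf₂ * tripleEquiv he₁ hf₁ :=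
  mul_tripleEquiv he₂ hf₂ he₂ hf₂ (P.tripleEquiv_act he₁ hf₁) (P.τ_e_of_zero ha) (by
    have := P.neg.τ_e_of_zero ha
    rwa [P.τ_neg, map_neg, neg_inj] at this)

lemma braid_three (ha : a = -1) (hb : b = -1) :
    tripleEquiv he₁ hf₁ * (tripleEquiv he₂ hf₂ * tripleEquiv he₁ hf₁) =
    tripleEquiv he₂ hf₂ * (tripleEquiv he₁ hf₁ * tripleEquiv he₂ hf₂) := by
  rw [← mul_assoc]
  refine mul_tripleEquiv (σ := P.τ * P.symm.τ) he₁ hf₁ he₂ hf₂ (fun x v => ?_)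
    (P.ττ_e ha hb) ?_
  · simp only [LinearEquiv.mul_apply, P.symm.tripleEquiv_act he₂ hf₂, P.tripleEquiv_act he₁ hf₁]
  · have := P.neg.ττ_e ha hb
    simp only [P.symm_τ_neg, P.τ_neg, map_neg, neg_inj] at this
    exact this

lemma braid_four (ha : a = -2) (hb : b = -1) :
    tripleEquiv he₁ hf₁ * (tripleEquiv he₂ hf₂ * (tripleEquiv he₁ hf₁ * tripleEquiv he₂ hf₂)) =
    tripleEquiv he₂ hf₂ * (tripleEquiv he₁ hf₁ * (tripleEquiv he₂ hf₂ * tripleEquiv he₁ hf₁)) := by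
  have := mul_tripleEquiv (σ := P.τ * (P.symm.τ * P.τ)) (g := tripleEquiv he₁ hf₁ *
    (tripleEquiv he₂ hf₂ * tripleEquiv he₁ hf₁)) he₂ hf₂ he₂ hf₂ (fun x v => ?_)
    (P.τττ_e ha hb) ?_
  · simpa only [mul_assoc] using this
  · simp only [LinearEquiv.mul_apply, P.symm.tripleEquiv_act he₂ hf₂, P.tripleEquiv_act he₁ hf₁]
  · have := P.neg.τττ_e ha hb
    simp only [P.symm_τ_neg, P.τ_neg, map_neg, neg_inj] at this
    exact this

lemma braid_six (ha : a = -3) (hb : b = -1) :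
    tripleEquiv he₁ hf₁ * (tripleEquiv he₂ hf₂ * (tripleEquiv he₁ hf₁ * (tripleEquiv he₂ hf₂ *
      (tripleEquiv he₁ hf₁ * tripleEquiv he₂ hf₂)))) =
    tripleEquiv he₂ hf₂ * (tripleEquiv he₁ hf₁ * (tripleEquiv he₂ hf₂ * (tripleEquiv he₁ hf₁ *
      (tripleEquiv he₂ hf₂ * tripleEquiv he₁ hf₁)))) := by
  have := mul_tripleEquiv (σ := P.τ * (P.symm.τ * (P.τ * (P.symm.τ * P.τ))))
    (g := tripleEquiv he₁ hf₁ * (tripleEquiv he₂ hf₂ * (tripleEquiv he₁ hf₁ *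
      (tripleEquiv he₂ hf₂ * tripleEquiv he₁ hf₁)))) he₂ hf₂ he₂ hf₂ (fun x v => ?_)
    (P.τττττ_e ha hb) ?_
  · simpa only [mul_assoc] using this
  · simp only [LinearEquiv.mul_apply, P.symm.tripleEquiv_act he₂ hf₂, P.tripleEquiv_act he₁ hf₁]
  · have := P.neg.τττττ_e ha hb
    simp only [P.symm_τ_neg, P.τ_neg, map_neg, neg_inj] at this
    exact this

/-- The orders of the products of simple reflections in finite Weyl groups of rank two. -/
inductive _root_.CoxeterDY.IsFiniteRankTwo : ℤ → ℤ → ℕ → Prop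
  | two : IsFiniteRankTwo 0 0 2
  | three : IsFiniteRankTwo (-1) (-1) 3
  | four : IsFiniteRankTwo (-2) (-1) 4
  | four' : IsFiniteRankTwo (-1) (-2) 4
  | six : IsFiniteRankTwo (-3) (-1) 6
  | six' : IsFiniteRankTwo (-1) (-3) 6

lemma altProd_tripleEquiv {p q : ℤ} {m : ℕ} (hm : IsFiniteRankTwo p q m) (ha : a = p)
    (hb : b = q) :
    altProd (tripleEquiv he₁ hf₁) (tripleEquiv he₂ hf₂) m =
      altProd (tripleEquiv he₂ hf₂) (tripleEquiv he₁ hf₁) m := by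
  cases hm <;> push_cast at ha hb <;> simp only [altProd, mul_one]
  · exact P.braid_two he₁ hf₁ he₂ hf₂ ha
  · exact P.braid_three he₁ hf₁ he₂ hf₂ ha hb
  · exact P.braid_four he₁ hf₁ he₂ hf₂ ha hb
  · exact (P.symm.braid_four he₂ hf₂ he₁ hf₁ hb ha).symm
  · exact P.braid_six he₁ hf₁ he₂ hf₂ ha hb
  · exact (P.symm.braid_six he₂ hf₂ he₁ hf₁ hb ha).symm

end IsPair
end Braid

/-! ### Serre relations -/

section Serre

variable {k : Type u} [Field k] [CharZero k] {I : Type v} [DecidableEq I] [Fintype I]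
  {A : Matrix I I ℤ} {L : Type*} [LieRing L] [LieAlgebra k L] {h : Cartan k I →ₗ[k] L}
  {e f : I → L} {d : I → k} {form : LinearMap.BilinForm k (Cartan k I)}
  {Φ : LinearMap.BilinForm k L}

namespace IsChev

variable (C : IsChev A h e f)
include C

lemma isSl2 (hA : IsGCM A) (i : I) : IsSl2 (LieAlgebra.ad k L (e i) : Module.End k L)
    (LieAlgebra.ad k L (f i)) (LieAlgebra.ad k L (h (coroot k i))) where
  ef v := by
    simp only [LieAlgebra.ad_apply]
    rw [leibniz_lie, C.ef, if_pos rfl, add_comm]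
  he v := by
    simp only [LieAlgebra.ad_apply]
    rw [leibniz_lie, C.he, simpleRoot_coroot, hA.diag, smul_lie, add_comm]
    norm_num
  hf v := by
    simp only [LieAlgebra.ad_apply]
    rw [leibniz_lie, C.hf, simpleRoot_coroot, hA.diag, neg_lie, smul_lie]
    norm_num
    abel

/-- A homogeneous element of degree at least two which is annihilated by all `f i` vanishes. -/
lemma eq_zero_of_lie_f (F : IsStdForm h e f d form Φ) {n : ℕ} {x : L}
    (hx : x ∈ chevGr h e f Set.univ (n + 2)) (hx' : ∀ l, ⁅f l, x⁆ = 0) : x = 0 := by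
  refine F.nondeg x fun y => ?_
  have : Φ x = 0 := by
    refine C.hom_ext_gr fun z y hy => ?_
    -- The only degree pairing with x is -(n+2), and it is spanned by brackets [f_l, y] because n +
    -- 2 is at least 2. Moving f_l to x gives zero.
    by_cases hz : z = Int.negSucc (n + 1)
    · subst hz
      refine (wordSpan_succ_le (Q := LinearMap.ker (Φ x)) fun l _ y _ => ?_) hy
      change Φ x ⁅f l, y⁆ = 0
      rw [← F.inv, ← lie_skew, hx' l]
      simp
    · exact C.form_gr_gr F.inv (by omega) hx hy
  rw [this, LinearMap.zero_apply]

lemma ad_pow_mem_gr (i j : I) (n : ℕ) :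
    ((LieAlgebra.ad k L (e i) : Module.End k L) ^ n) (e j) ∈ chevGr h e f Set.univ (n + 1) := by
  induction n with
  | zero => exact e_mem_gr (Set.mem_univ j)
  | succ n ih =>
    rw [pow_succ', Module.End.mul_apply]
    exact apply_mem_wordSpan (T := fun i => LieAlgebra.ad k L (e i)) (Set.mem_univ i) ih

/-- The Serre relations. -/
lemma serre (hA : IsGCM A) (F : IsStdForm h e f d form Φ) {i j : I} (hij : i ≠ j) {n : ℕ}
    (hn : A i j = -n) : ((LieAlgebra.ad k L (e i) : Module.End k L) ^ (n + 1)) (e j) = 0 := by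
  refine C.eq_zero_of_lie_f F (n := n)
    (by simpa [add_assoc] using C.ad_pow_mem_gr i j (n + 1)) fun l => ?_
  by_cases hl : l = i
  · subst hl
    -- e_j is a lowest weight vector of weight -n for the i-th sl₂, and the coefficient (n+1)(-n+n)
    -- vanishes.
    have := (C.isSl2 hA l).f_pow (v := e j) (c := -n)
      (by rw [LieAlgebra.ad_apply, C.fe, if_neg hij])
      (by rw [LieAlgebra.ad_apply, C.he, simpleRoot_coroot, hn]; simp) n
    rw [neg_add_cancel, mul_zero, neg_zero, zero_smul] at this
    exact this
  · have hc : ∀ (m : ℕ) x, ⁅f l, ((LieAlgebra.ad k L (e i) : Module.End k L) ^ m) x⁆ =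
        ((LieAlgebra.ad k L (e i) : Module.End k L) ^ m) ⁅f l, x⁆ := by
      intro m x
      induction m with
      | zero => rfl
      | succ m ih =>
        rw [pow_succ', Module.End.mul_apply, Module.End.mul_apply, ← ih, LieAlgebra.ad_apply,
          leibniz_lie, C.fe, if_neg hl, zero_lie, zero_add]
        rfl
    rw [hc, C.fe]
    split_ifs with hlj
    -- f_j turns e_j into -h_j, and ad e_i turns that into a multiple a_ji of e_i. A second ad e_i
    -- kills it; if there is none, a_ij = 0 and so a_ji = 0.
    · subst hlj
      rw [pow_succ, Module.End.mul_apply, LieAlgebra.ad_apply, lie_neg, C.eh, neg_neg,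
        simpleRoot_coroot, map_smul]
      rcases n with _ | n
      · rw [hA.zero i l (by simpa using hn)]
        simp
      · rw [pow_succ, Module.End.mul_apply, LieAlgebra.ad_apply, lie_self, map_zero, smul_zero]
    · rw [map_zero]

/-- The vectors killed by some power of ad e_i form the Engel subalgebra. It contains the
generators, the e_j by the Serre relations. -/
lemma locallyNilpotent_ad (hA : IsGCM A) (F : IsStdForm h e f d form Φ) (i : I) :
    LocallyNilpotent (LieAlgebra.ad k L (e i) : Module.End k L) := by
  have key : LieSubalgebra.engel k (e i) = ⊤ := by
    rw [eq_top_iff, ← C.gen, LieSubalgebra.lieSpan_le]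
    rintro _ ((⟨x, rfl⟩ | ⟨j, rfl⟩) | ⟨j, rfl⟩)
    · refine (LieSubalgebra.mem_engel_iff k _ _).2 ⟨2, ?_⟩
      simp [pow_succ, C.eh]
    · by_cases hij : i = j
      · subst hij
        exact LieSubalgebra.self_mem_engel k _
      · obtain ⟨n, hn⟩ := Int.exists_eq_neg_ofNat (hA.nonpos i j hij)
        exact (LieSubalgebra.mem_engel_iff k _ _).2 ⟨n + 1, C.serre hA F hij hn⟩
    · refine (LieSubalgebra.mem_engel_iff k _ _).2 ⟨3, ?_⟩
      simp only [pow_succ, pow_zero, one_mul, Module.End.mul_apply, LieAlgebra.ad_apply, C.ef]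
      split_ifs
      · rw [C.eh, lie_neg, lie_smul, lie_self, smul_zero, neg_zero]
      · simp
  intro y
  exact (LieSubalgebra.mem_engel_iff k _ _).1 (key ▸ LieSubalgebra.mem_top y)

end IsChev

namespace KM

variable {B : Set I}

lemma locallyNilpotent_ad_sub {x : KM k A} (hx : x ∈ sub k A B)
    (hn : LocallyNilpotent (LieAlgebra.ad k (KM k A) x : Module.End k (KM k A))) :
    LocallyNilpotent (LieAlgebra.ad k (sub k A B) ⟨x, hx⟩ : Module.End k (sub k A B)) := by
  intro y
  obtain ⟨n, hn⟩ := hn y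
  refine ⟨n, Subtype.ext ?_⟩
  rw [ZeroMemClass.coe_zero, ← hn]
  clear hn
  induction n with
  | zero => rfl
  | succ n ih =>
    rw [pow_succ', pow_succ', Module.End.mul_apply, Module.End.mul_apply, ← ih]
    rfl

/-- The Chevalley generators of the subalgebra corresponding to a subdiagram. -/
lemma isPair (hA : IsGCM A) {Ψ : LinearMap.BilinForm k (KM k A)}
    (F : KM.IsStdForm k A d form Ψ)
    {i j : I} (hij : i ≠ j) (hi : i ∈ B) (hj : j ∈ B) :
    IsPair k (L := sub k A B) ⟨KM.e k A i, e_mem_sub A hi⟩ ⟨KM.f k A i, f_mem_sub hi⟩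
      ⟨KM.h k A (coroot k i), h_mem_sub (coroot_mem hi)⟩ ⟨KM.e k A j, e_mem_sub A hj⟩
      ⟨KM.f k A j, f_mem_sub hj⟩ ⟨KM.h k A (coroot k j), h_mem_sub (coroot_mem hj)⟩
      (A i j) (A j i) := by
  have C := isChev k A
  have e₂ : ((2 : ℤ) : k) = 2 := by norm_num
  exact
  { ef₁ := Subtype.ext (by simp [C.ef])
    ef₂ := Subtype.ext (by simp [C.ef])
    he₁ := Subtype.ext (by simp [C.he, simpleRoot_coroot, hA.diag])
    he₂ := Subtype.ext (by simp [C.he, simpleRoot_coroot, hA.diag])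
    hf₁ := Subtype.ext (by simp [C.hf, simpleRoot_coroot, hA.diag])
    hf₂ := Subtype.ext (by simp [C.hf, simpleRoot_coroot, hA.diag])
    ef₁₂ := Subtype.ext (by simp [C.ef, hij])
    ef₂₁ := Subtype.ext (by simp [C.ef, hij.symm])
    he₁₂ := Subtype.ext (by simp [C.he, simpleRoot_coroot])
    he₂₁ := Subtype.ext (by simp [C.he, simpleRoot_coroot])
    hf₁₂ := Subtype.ext (by simp [C.hf, simpleRoot_coroot])
    hf₂₁ := Subtype.ext (by simp [C.hf, simpleRoot_coroot])
    ne₁ := locallyNilpotent_ad_sub _ (C.locallyNilpotent_ad hA F i)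
    nf₁ := locallyNilpotent_ad_sub _ (C.swap.locallyNilpotent_ad hA F.swap i)
    ne₂ := locallyNilpotent_ad_sub _ (C.locallyNilpotent_ad hA F j)
    nf₂ := locallyNilpotent_ad_sub _ (C.swap.locallyNilpotent_ad hA F.swap j) }

end KM

end Serre

/-! ### Drinfeld-Yetter modules as modules over the Kac-Moody algebra -/

section Contraction

variable {k : Type u} [Field k] {L V : Type*} [LieRing L] [LieAlgebra k L] [AddCommGroup V]
  [Module k V]

lemma contract_contract (c : V →ₗ[k] L ⊗[k] V) (φ ψ : Module.Dual k L) (v : V) :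
    contract c φ (contract c ψ v) = TensorProduct.lid k V (φ.rTensor V (TensorProduct.lid k (L ⊗[k] V)
      (ψ.rTensor (L ⊗[k] V) (c.lTensor L (c v))))) := by
  rw [contract_apply, contract_apply, lid_rTensor_lTensor]

lemma lid_leftComm (φ ψ : Module.Dual k L) (z : L ⊗[k] (L ⊗[k] V)) :
    TensorProduct.lid k V (φ.rTensor V (TensorProduct.lid k (L ⊗[k] V)
      (ψ.rTensor (L ⊗[k] V) (TensorProduct.leftComm k L L V z)))) =
    TensorProduct.lid k V (ψ.rTensor V (TensorProduct.lid k (L ⊗[k] V)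
      (φ.rTensor (L ⊗[k] V) z))) := by
  induction z with
  | zero => simp
  | add s s' hs hs' => simp only [map_add, hs, hs']
  | tmul x t =>
    induction t with
    | zero => simp
    | add s s' hs hs' => simp only [map_add, TensorProduct.tmul_add, hs, hs']
    | tmul y v => simp [smul_smul, mul_comm]

lemma lid_assoc (φ ψ : Module.Dual k L) (z : (L ⊗[k] L) ⊗[k] V) :
    TensorProduct.lid k V (ψ.rTensor V (TensorProduct.lid k (L ⊗[k] V)
      (φ.rTensor (L ⊗[k] V) (TensorProduct.assoc k L L V z)))) =
    TensorProduct.lid k V ((TensorProduct.dualDistrib k L L (φ ⊗ₜ ψ)).rTensor V z) := by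
  induction z with
  | zero => simp
  | add s s' hs hs' => simp only [map_add, hs, hs']
  | tmul t v =>
    induction t with
    | zero => simp
    | add s s' hs hs' => simp only [map_add, TensorProduct.add_tmul, hs, hs']
    | tmul x y => simp [smul_smul]

lemma lid_rTensor_rTensor {L' : Type*} [AddCommGroup L'] [Module k L'] (g : L →ₗ[k] L')
    (φ : Module.Dual k L') (z : L ⊗[k] V) :
    TensorProduct.lid k V (φ.rTensor V (g.rTensor V z)) =
      TensorProduct.lid k V ((φ ∘ₗ g).rTensor V z) := by
  rw [LinearMap.rTensor_comp_apply]

/-- The comodule axiom, evaluated on two linear forms. -/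
lemma comodule_iff_contract {ι : Type*} {χ : ι → Module.Dual k L} (hχ : Separating χ)
    (δ : L →ₗ[k] L ⊗[k] L) (c : V →ₗ[k] L ⊗[k] V) (v : V) :
    (TensorProduct.assoc k L L V (δ.rTensor V (c v)) =
      TensorProduct.leftComm k L L V (c.lTensor L (c v)) - c.lTensor L (c v)) ↔
    ∀ i j, contract c (TensorProduct.dualDistrib k L L (χ i ⊗ₜ χ j) ∘ₗ δ) v =
      contract c (χ i) (contract c (χ j) v) - contract c (χ j) (contract c (χ i) v) := by
  have h₁ : ∀ i j, TensorProduct.lid k V ((χ j).rTensor V (TensorProduct.lid k (L ⊗[k] V)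
      ((χ i).rTensor (L ⊗[k] V) (TensorProduct.assoc k L L V (δ.rTensor V (c v)))))) =
      contract c (TensorProduct.dualDistrib k L L (χ i ⊗ₜ χ j) ∘ₗ δ) v := fun i j => by
    rw [lid_assoc, lid_rTensor_rTensor, contract_apply]
  have h₂ : ∀ i j, TensorProduct.lid k V ((χ j).rTensor V (TensorProduct.lid k (L ⊗[k] V)
      ((χ i).rTensor (L ⊗[k] V) (TensorProduct.leftComm k L L V (c.lTensor L (c v)) -
        c.lTensor L (c v))))) =
      contract c (χ i) (contract c (χ j) v) - contract c (χ j) (contract c (χ i) v) := fun i j => by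
    rw [map_sub, map_sub, map_sub, map_sub, lid_leftComm, contract_contract, contract_contract]
  constructor
  · intro h i j
    rw [← h₁, h, h₂]
  · intro h
    refine hχ.ext fun i => hχ.ext fun j => ?_
    rw [h₁, h₂, h]

/-- The compatibility of the action and the coaction, evaluated on a linear form. -/
lemma compat_iff_contract {ι : Type*} {χ : ι → Module.Dual k L} (hχ : Separating χ)
    (δ : L →ₗ[k] L ⊗[k] L) (a : L →ₗ⁅k⁆ Module.End k V) (c : V →ₗ[k] L ⊗[k] V) (x : L) (v : V) :
    (c (a x v) - (a x).lTensor L (c v) = (LieAlgebra.ad k L x).rTensor V (c v) -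
      ((a : L →ₗ[k] Module.End k V).flip v).lTensor L (δ x)) ↔
    ∀ i, contract c (χ i) (a x v) - a x (contract c (χ i) v) =
      contract c (χ i ∘ₗ LieAlgebra.ad k L x) v -
        a (TensorProduct.lid k L ((χ i).rTensor L (δ x))) v := by
  have h₁ : ∀ i, TensorProduct.lid k V ((χ i).rTensor V (c (a x v) - (a x).lTensor L (c v))) =
      contract c (χ i) (a x v) - a x (contract c (χ i) v) := fun i => by
    rw [map_sub, map_sub, lid_rTensor_lTensor, contract_apply, contract_apply]
  have h₂ : ∀ i, TensorProduct.lid k V ((χ i).rTensor V ((LieAlgebra.ad k L x).rTensor V (c v) -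
      ((a : L →ₗ[k] Module.End k V).flip v).lTensor L (δ x))) =
      contract c (χ i ∘ₗ LieAlgebra.ad k L x) v -
        a (TensorProduct.lid k L ((χ i).rTensor L (δ x))) v := fun i => by
    rw [map_sub, map_sub, lid_rTensor_lTensor, lid_rTensor_rTensor, contract_apply]
    rfl
  constructor
  · intro h i
    rw [← h₁, h, h₂]
  · intro h
    refine hχ.ext fun i => ?_
    rw [h₁, h₂, h]

end Contraction

/-! ### From Drinfeld-Yetter modules to modules over the Kac-Moody algebra -/

section Correspondence

variable {k : Type u} [Field k] [CharZero k] {I : Type v} [DecidableEq I] [Fintype I]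
  {A : Matrix I I ℤ} {d : I → k} {form : LinearMap.BilinForm k (Cartan k I)} {B : Set I}

/-- A cocycle is determined by its values on generators, so the cobracket of any standard structure,
however obtained, is the transpose of the bracket. -/
lemma isCobracket_of_generators {Φ : LinearMap.BilinForm k (KM k A)}
    (F : KM.IsStdForm k A d form Φ) (hf : IsInvariantForm k A d form) (hd : ∀ i, d i ≠ 0)
    (δ : LieBialgebraStructure k (KM.bMinus k A B)) (δ_h : ∀ x, δ.δ (KM.hB k A B x) = 0)
    (δ_f : ∀ i (hi : i ∈ B), δ.δ (KM.fB A hi) = (2 * d i)⁻¹ •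
      (KM.hB k A B ⟨coroot k i, coroot_mem hi⟩ ⊗ₜ KM.fB A hi -
        KM.fB A hi ⊗ₜ KM.hB k A B ⟨coroot k i, coroot_mem hi⟩))
    (x : KM.bMinus k A B) : IsCobracket form Φ B x (δ.δ x) := by
  let Q : LieSubalgebra k (KM.bMinus k A B) :=
    { carrier := {x | IsCobracket form Φ B x (δ.δ x)}
      add_mem' := fun {x y} hx hy => by
        change IsCobracket form Φ B (x + y) _
        rw [map_add]
        exact hx.out.add hy.out
      zero_mem' := by
        change IsCobracket form Φ B 0 _
        rw [map_zero]
        exact IsCobracket.zero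
      smul_mem' := fun c x hx => by
        change IsCobracket form Φ B (c • x) _
        rw [map_smul]
        exact hx.out.smul c
      lie_mem' := fun {x y} hx hy => by
        change IsCobracket form Φ B ⁅x, y⁆ _
        rw [δ.cocycle]
        exact IsCobracket.lie F hf hx.out hy.out }
  refine KM.mem_of_generators_bMinus (Q := Q) (fun x => ?_) (fun i hi => ?_) x
  · change IsCobracket form Φ B _ _
    rw [δ_h]
    exact IsCobracket.hB F hf x
  · change IsCobracket form Φ B _ _
    rw [δ_f i hi]
    exact IsCobracket.fB F hf hd hi

lemma Standard.isCobracket (S : Standard A d form) (hf : IsInvariantForm k A d form)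
    (hd : ∀ i, d i ≠ 0) (x : KM.bMinus k A B) : IsCobracket form S.Φ B x ((S.δ B).δ x) :=
  isCobracket_of_generators S.isStdForm hf hd (S.δ B) (S.δ_h B) (S.δ_f B) x

namespace IsCobracket

variable {Φ : LinearMap.BilinForm k (KM k A)} (F : KM.IsStdForm k A d form Φ)
  (hf : IsInvariantForm k A d form)

include F hf

lemma dualDistrib_comp {δ : KM.bMinus k A B →ₗ[k] KM.bMinus k A B ⊗[k] KM.bMinus k A B}
    (hδ : ∀ x, IsCobracket form Φ B x (δ x)) {y z : KM k A} (hy : y ∈ KM.bPlus k A B)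
    (hz : z ∈ KM.bPlus k A B) : TensorProduct.dualDistrib k _ _
      (pairDual form Φ B y ⊗ₜ pairDual form Φ B z) ∘ₗ δ = pairDual form Φ B ⁅y, z⁆ := by
  refine LinearMap.ext fun x => ?_
  rw [LinearMap.comp_apply, hδ x y hy z hz, pairDual_apply, F.borelPairing_symm hf]

/-- Contracting the cobracket of x with y gives the minus part of [x, y] in the double, since ⟨a, z⟩
= ⟨x, [y, z]⟩ for all z. -/
lemma lid_rTensor {x : KM.bMinus k A B} {t : KM.bMinus k A B ⊗[k] KM.bMinus k A B}
    (ht : IsCobracket form Φ B x t) {y c : KM k A} (hy : y ∈ KM.bPlus k A B)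
    (a : KM.bMinus k A B) (hc : c ∈ KM.bPlus k A B) (hac : ⁅(x : KM k A), y⁆ = a + c)
    (hp : KM.proj k A a = KM.proj k A c) :
    TensorProduct.lid k _ ((pairDual form Φ B y).rTensor _ t) = a := by
  refine sub_eq_zero.1 (F.separating_bPlus hf _ fun z => ?_)
  have e : ∀ s : KM.bMinus k A B ⊗[k] KM.bMinus k A B, pairDual form Φ B z
      (TensorProduct.lid k _ ((pairDual form Φ B y).rTensor _ s)) =
      TensorProduct.dualDistrib k _ _ (pairDual form Φ B y ⊗ₜ pairDual form Φ B z) s := by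
    intro s
    induction s with
    | zero => simp
    | add s s' hs hs' => simp only [map_add, hs, hs']
    | tmul p q => simp
  rw [map_sub, e, ht y hy z z.2, F.borelPairing_lie_right hy z.2 hc hac hp, pairDual_apply,
    F.borelPairing_symm hf, sub_self]

lemma pairDual_comp_ad {x : KM.bMinus k A B} {y a c : KM k A} (ha : a ∈ KM.bMinus k A B)
    (hac : ⁅(x : KM k A), y⁆ = a + c) (hp : KM.proj k A a = KM.proj k A c) :
    pairDual form Φ B y ∘ₗ (LieAlgebra.ad k (KM.bMinus k A B) x : Module.End k _) =
      -pairDual form Φ B c :=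
  LinearMap.ext fun _ => F.pairDual_lie hf ha hac hp

end IsCobracket

namespace KM

variable {V : Type*} [AddCommGroup V] [Module k V]

/-- The subalgebra corresponding to a subdiagram is generated by the negative Borel subalgebra and
the `e_i`. -/
lemma sub_hom_ext {ρ σ : sub k A B →ₗ⁅k⁆ Module.End k V}
    (h : ∀ x : bMinus k A B, ρ ⟨x, bMinus_le_sub B x.2⟩ = σ ⟨x, bMinus_le_sub B x.2⟩)
    (he : ∀ i (hi : i ∈ B), ρ ⟨e k A i, e_mem_sub A hi⟩ = σ ⟨e k A i, e_mem_sub A hi⟩) :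
    ρ = σ := by
  let Q : LieSubalgebra k (sub k A B) :=
    { carrier := {x | ρ x = σ x}
      add_mem' := fun {x y} hx hy => by
        change ρ (x + y) = _
        rw [map_add, map_add, hx.out, hy.out]
      zero_mem' := by
        change ρ 0 = _
        rw [map_zero, map_zero]
      smul_mem' := fun c x hx => by
        change ρ (c • x) = _
        rw [map_smul, map_smul, hx.out]
      lie_mem' := fun {x y} hx hy => by
        change ρ ⁅x, y⁆ = _
        rw [LieHom.map_lie, LieHom.map_lie, hx.out, hy.out] }
  have key : sub k A B ≤ Q.map (sub k A B).incl := by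
    refine LieSubalgebra.lieSpan_le.2 ?_
    rintro _ ⟨i, hi, rfl | rfl | rfl | rfl⟩
    · exact ⟨_, h (hB k A B ⟨_, coroot_mem hi⟩), rfl⟩
    · exact ⟨_, h (hB k A B ⟨_, coweight_mem hi⟩), rfl⟩
    · exact ⟨_, he i hi, rfl⟩
    · exact ⟨_, h (fB A hi), rfl⟩
  refine LieHom.ext fun x => ?_
  obtain ⟨y, hy, hyx⟩ := key x.2
  have : y = x := Subtype.ext hyx
  exact this ▸ hy

/-- Actions of the two Borel subalgebras which combine to an action. -/
lemma exists_sub_hom (α : bMinus k A B →ₗ⁅k⁆ Module.End k V) (β : KM k A →ₗ[k] Module.End k V)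
    (hβ : ∀ y ∈ bPlus k A B, ∀ z ∈ bPlus k A B, β ⁅y, z⁆ = ⁅β y, β z⁆)
    (hh : ∀ u : cartanSub k B, α (hB k A B u) = β (h k A u))
    (hm : ∀ (x : bMinus k A B) (y c : KM k A) (a : bMinus k A B), y ∈ bPlus k A B →
      c ∈ bPlus k A B → ⁅(x : KM k A), y⁆ = a + c → proj k A a = proj k A c →
      ⁅α x, β y⁆ = α a + β c) :
    ∃ ρ : sub k A B →ₗ⁅k⁆ Module.End k V,
      (∀ x : bMinus k A B, ρ ⟨x, bMinus_le_sub B x.2⟩ = α x) ∧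
      ∀ (y : KM k A) (hy : y ∈ bPlus k A B), ρ ⟨y, bPlus_le_sub B hy⟩ = β y := by
  -- The action is defined as a relation, because the decomposition of an element is unique only up
  -- to the Cartan part.
  let R : KM k A → Module.End k V → Prop := fun x T =>
    ∃ (a : bMinus k A B) (c : bPlus k A B), x = a + c ∧ T = α a + β c
  have R_add : ∀ {x y S T}, R x S → R y T → R (x + y) (S + T) := by
    rintro _ _ _ _ ⟨a, c, rfl, rfl⟩ ⟨a', c', rfl, rfl⟩
    refine ⟨a + a', c + c', add_add_add_comm _ _ _ _, ?_⟩
    change _ = α (a + a') + β (c + c')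
    rw [map_add, map_add, add_add_add_comm]
  have R_smul : ∀ {x T} (r : k), R x T → R (r • x) (r • T) := by
    rintro _ _ r ⟨a, c, rfl, rfl⟩
    refine ⟨r • a, r • c, smul_add _ _ _, ?_⟩
    change _ = α (r • a) + β (r • (c : KM k A))
    rw [map_smul, map_smul, smul_add]
  have R_minus : ∀ a : bMinus k A B, R a (α a) := fun a => ⟨a, 0, by simp, by simp⟩
  have R_plus : ∀ c : bPlus k A B, R c (β c) := fun c => ⟨0, c, by simp, by simp⟩
  have R_mixed : ∀ (a : bMinus k A B) (c : bPlus k A B), R ⁅(a : KM k A), (c : KM k A)⁆ ⁅α a, β c⁆ := by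
    intro a c
    obtain ⟨a', ha', c', hc', hac, hp⟩ := exists_split
      (LieSubalgebra.lie_mem _ (bMinus_le_sub B a.2) (bPlus_le_sub B c.2))
    exact ⟨⟨a', ha'⟩, ⟨c', hc'⟩, hac, hm a c c' ⟨a', ha'⟩ c.2 hc' hac hp⟩
  have R_lie : ∀ {x y S T}, R x S → R y T → R ⁅x, y⁆ ⁅S, T⁆ := by
    rintro _ _ _ _ ⟨a, c, rfl, rfl⟩ ⟨a', c', rfl, rfl⟩
    have h := R_add (R_add (R_minus ⁅a, a'⁆) (R_plus ⁅c, c'⁆))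
      (R_add (R_mixed a c') (R_smul (-1) (R_mixed a' c)))
    rw [LieHom.map_lie, LieSubalgebra.coe_bracket, LieSubalgebra.coe_bracket,
      hβ _ c.2 _ c'.2, neg_one_smul, neg_one_smul, lie_skew, lie_skew] at h
    have e₁ : ⁅(a + c : KM k A), (a' + c' : KM k A)⁆ = ⁅(a : KM k A), (a' : KM k A)⁆ +
        ⁅(c : KM k A), (c' : KM k A)⁆ + (⁅(a : KM k A), (c' : KM k A)⁆ + ⁅(c : KM k A), (a' : KM k A)⁆) := by
      rw [add_lie, lie_add, lie_add]; abel
    have e₂ : ⁅α a + β c, α a' + β c'⁆ = ⁅α a, α a'⁆ + ⁅β c, β c'⁆ + (⁅α a, β c'⁆ + ⁅β c, α a'⁆) := by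
      rw [add_lie, lie_add, lie_add]; abel
    rwa [e₁, e₂]
  -- An ambiguity a = -c lies in both Borel subalgebras, hence in the Cartan subalgebra, where the
  -- two actions agree.
  have R_zero : ∀ {T}, R 0 T → T = 0 := by
    rintro _ ⟨a, c, hac, rfl⟩
    have hc : (c : KM k A) = -(a : KM k A) := eq_neg_of_add_eq_zero_right hac.symm
    have ha : (a : KM k A) = h k A (proj k A a) :=
      bMinus_inf_bPlus a.2 (by rw [← neg_mem_iff, ← hc]; exact c.2)
    have ha' : a = hB k A B ⟨proj k A a, proj_bMinus a.2⟩ := Subtype.ext ha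
    have e : α a = β a := (congrArg α ha').trans ((hh _).trans (congrArg β ha.symm))
    rw [hc, map_neg, e, add_neg_cancel]
  have R_unique : ∀ {x S T}, R x S → R x T → S = T := by
    intro x S T hS hT
    have := R_zero (T := S - T) (by
      have := R_add hS (R_smul (-1) hT)
      rwa [neg_one_smul, neg_one_smul, add_neg_cancel, ← sub_eq_add_neg] at this)
    exact sub_eq_zero.1 this
  have R_exists : ∀ x : sub k A B, ∃ T, R x T := fun x => by
    obtain ⟨a, ha, c, hc, hx⟩ := mem_sub.1 x.2
    exact ⟨_, ⟨a, ha⟩, ⟨c, hc⟩, hx, rfl⟩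
  choose ρ hρ using R_exists
  exact ⟨{ toFun := ρ
           map_add' := fun x y => R_unique (hρ (x + y)) (R_add (hρ x) (hρ y))
           map_smul' := fun r x => R_unique (hρ (r • x)) (R_smul r (hρ x))
           map_lie' := fun {x y} => R_unique (hρ ⁅x, y⁆) (R_lie (hρ x) (hρ y)) },
    fun x => R_unique (hρ _) (R_minus x), fun y hy => R_unique (hρ _) (R_plus ⟨y, hy⟩)⟩

end KM

namespace Standard

variable (S : Standard A d form)

/-- The action of the positive Borel subalgebra on a Drinfeld-Yetter module. -/
noncomputable def posAct (X : DY (S.δ B)) : KM k A →ₗ[k] Module.End k X.V :=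
  contract X.coact ∘ₗ pairDual form S.Φ B

variable {S} (hf : IsInvariantForm k A d form) (hd : ∀ i, d i ≠ 0)

lemma pairDual_of_proj {y : KM k A} (hy : KM.proj k A y = 0) :
    pairDual form S.Φ B y = S.dual B y := by
  refine LinearMap.ext fun x => ?_
  rw [pairDual_apply, borelPairing_apply, hy, map_zero, LinearMap.zero_apply, add_zero]
  rfl

lemma posAct_e (X : DY (S.δ B)) (i : I) : S.posAct X (KM.e k A i) = S.dualAct (KM.e k A i) X := by
  change contract X.coact _ = contract X.coact _
  rw [pairDual_of_proj (KM.proj_e i)]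

include hf

/-- The source of the factor 2 in the integrability condition: on Cartan elements the pairing of the
double is twice Φ. -/
lemma pairDual_h (u : Cartan k I) :
    pairDual form S.Φ B (KM.h k A u) = (2 : k) • S.dual B (KM.h k A u) := by
  refine LinearMap.ext fun x => ?_
  have h := S.isStdForm.h_left (KM.isChev k A) hf (x : KM k A) u
  change S.Φ (KM.h k A u) x = form u (KM.proj k A x) at h
  rw [pairDual_apply, borelPairing_apply, KM.proj_h, ← h, ← two_mul]
  rfl

lemma posAct_h (X : DY (S.δ B)) (u : Cartan k I) :
    S.posAct X (KM.h k A u) = (2 : k) • S.dualAct (KM.h k A u) X := by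
  change contract X.coact _ = (2 : k) • contract X.coact _
  rw [pairDual_h hf, map_smul]

include hd

/-- The comodule axiom contracted with two linear forms; the cobracket contracted with them is the
bracket. -/
lemma posAct_lie (X : DY (S.δ B)) {y z : KM k A} (hy : y ∈ KM.bPlus k A B)
    (hz : z ∈ KM.bPlus k A B) : S.posAct X ⁅y, z⁆ = ⁅S.posAct X y, S.posAct X z⁆ := by
  refine LinearMap.ext fun v => ?_
  have := (comodule_iff_contract (S.isStdForm.separating_bPlus hf) (S.δ B).δ X.coact v).1
    (X.str.comodule v) ⟨y, hy⟩ ⟨z, hz⟩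
  rw [IsCobracket.dualDistrib_comp S.isStdForm hf (S.isCobracket hf hd) hy hz] at this
  exact this

/-- The compatibility axiom contracted with one form. Its two right-hand terms are the plus and the
minus part of [x, y] in the double, up to sign. -/
lemma lie_act_posAct (X : DY (S.δ B)) (x : KM.bMinus k A B) (y c : KM k A) (a : KM.bMinus k A B)
    (hy : y ∈ KM.bPlus k A B) (hc : c ∈ KM.bPlus k A B) (hac : ⁅(x : KM k A), y⁆ = a + c)
    (hp : KM.proj k A a = KM.proj k A c) :
    ⁅X.act x, S.posAct X y⁆ = X.act a + S.posAct X c := by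
  refine LinearMap.ext fun v => ?_
  have := (compat_iff_contract (S.isStdForm.separating_bPlus hf) (S.δ B).δ X.act X.coact x v).1
    (X.str.compat x v) ⟨y, hy⟩
  rw [IsCobracket.lid_rTensor S.isStdForm hf (S.isCobracket hf hd x) hy a hc hac hp,
    IsCobracket.pairDual_comp_ad S.isStdForm hf a.2 hac hp, map_neg] at this
  change X.act x (S.posAct X y v) - S.posAct X y (X.act x v) = X.act a v + S.posAct X c v
  have h : S.posAct X y (X.act x v) - X.act x (S.posAct X y v) =
      -S.posAct X c v - X.act a v := this
  rw [← neg_sub, h, neg_sub, sub_neg_eq_add]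

/-- The action of the Kac-Moody algebra on an integrable Drinfeld-Yetter module. -/
lemma IsIntegrable.exists_hom {X : DY (S.δ B)} (hX : S.IsIntegrable X) :
    ∃ ρ : KM.sub k A B →ₗ⁅k⁆ Module.End k X.V, S.Corresponds ρ X.str ∧
      ∀ (y : KM k A) (hy : y ∈ KM.bPlus k A B), ρ ⟨y, KM.bPlus_le_sub B hy⟩ = S.posAct X y := by
  obtain ⟨ρ, h₁, h₂⟩ := KM.exists_sub_hom X.act (S.posAct X)
    (fun y hy z hz => posAct_lie hf hd X hy hz)
    -- The condition on the Cartan part says that the two copies of h in the double act in the same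
    -- way, so that the action descends to g_B.
    (fun u => (hX.cartan u).trans (posAct_h hf X u).symm)
    (fun x y c a => lie_act_posAct hf hd X x y c a)
  refine ⟨ρ, ⟨h₁, fun i hi => ?_⟩, h₂⟩
  exact (h₂ _ (KM.e_mem_bPlus A hi)).trans (posAct_e X i)

omit hf hd in
lemma Corresponds.unique {V : Type u} [AddCommGroup V] [Module k V] {s : DYStructure (S.δ B) V}
    {ρ σ : KM.sub k A B →ₗ⁅k⁆ Module.End k V} (hρ : S.Corresponds ρ s) (hσ : S.Corresponds σ s) :
    ρ = σ :=
  KM.sub_hom_ext (fun x => (hρ.1 x).trans (hσ.1 x).symm)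
    fun i hi => (hρ.2 i hi).trans (hσ.2 i hi).symm

lemma Corresponds.posAct {X : DY (S.δ B)} (hX : S.IsIntegrable X)
    {ρ : KM.sub k A B →ₗ⁅k⁆ Module.End k X.V} (hρ : S.Corresponds ρ X.str) {y : KM k A}
    (hy : y ∈ KM.bPlus k A B) : ρ ⟨y, KM.bPlus_le_sub B hy⟩ = S.posAct X y := by
  obtain ⟨σ, hσ, h⟩ := hX.exists_hom hf hd
  rw [hρ.unique hσ]
  exact h y hy

lemma IsIntegrable.existsUnique_hom {X : DY (S.δ B)} (hX : S.IsIntegrable X) :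
    ∃! ρ : KM.sub k A B →ₗ⁅k⁆ Module.End k X.V, S.Corresponds ρ X.str := by
  obtain ⟨ρ, hρ, -⟩ := hX.exists_hom hf hd
  exact ⟨ρ, hρ, fun σ hσ => Corresponds.unique hσ hρ⟩

omit hf hd in
lemma Corresponds.tensor {X Y : DY (S.δ B)} {ρ : KM.sub k A B →ₗ⁅k⁆ Module.End k X.V}
    {σ : KM.sub k A B →ₗ⁅k⁆ Module.End k Y.V} (hρ : S.Corresponds ρ X.str)
    (hσ : S.Corresponds σ Y.str) : S.Corresponds (DY.tensorAct ρ σ) (X ⊗ Y).str := by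
  refine ⟨fun x => ?_, fun i hi => ?_⟩
  · change (ρ _).rTensor Y.V + (σ _).lTensor X.V = (X.act x).rTensor Y.V + (Y.act x).lTensor X.V
    rw [hρ.1, hσ.1]
  · refine Eq.trans ?_ (dualAct_tensor (KM.e k A i) X Y).symm
    change (ρ _).rTensor Y.V + (σ _).lTensor X.V = _
    rw [hρ.2 i hi, hσ.2 i hi]

/-- The coaction is recovered from the action of the positive Borel subalgebra, as its elements
separate; so linearity over it is the same as compatibility with the coactions. -/
lemma Corresponds.hom_iff {X Y : DY (S.δ B)} {ρ : KM.sub k A B →ₗ⁅k⁆ Module.End k X.V}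
    {σ : KM.sub k A B →ₗ⁅k⁆ Module.End k Y.V} (hX : S.IsIntegrable X) (hY : S.IsIntegrable Y)
    (hρ : S.Corresponds ρ X.str) (hσ : S.Corresponds σ Y.str) (f : X.V →ₗ[k] Y.V) :
    (∃ g : X ⟶ Y, g.lin = f) ↔ ∀ x v, f (ρ x v) = σ x (f v) := by
  constructor
  · rintro ⟨g, rfl⟩ x v
    obtain ⟨a, ha, c, hc, hx⟩ := KM.mem_sub.1 x.2
    have e : x = ⟨a, KM.bMinus_le_sub B ha⟩ + ⟨c, KM.bPlus_le_sub B hc⟩ := Subtype.ext hx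
    rw [e, map_add, map_add, hρ.posAct hf hd hX hc, hσ.posAct hf hd hY hc, hρ.1 ⟨a, ha⟩,
      hσ.1 ⟨a, ha⟩, LinearMap.add_apply, LinearMap.add_apply, map_add]
    congr 1
    · exact g.act_comm _ _
    · change g.lin (contract X.coact _ v) = contract Y.coact _ (g.lin v)
      rw [contract_apply, contract_apply, g.coact_comm, lid_rTensor_lTensor]
  · intro h
    refine ⟨⟨f, fun x v => ?_, fun v => ?_⟩, rfl⟩
    · have := h ⟨x, KM.bMinus_le_sub B x.2⟩ v
      rw [hρ.1, hσ.1] at this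
      exact this
    · refine (S.isStdForm.separating_bPlus hf).ext fun y => ?_
      have := h ⟨y, KM.bPlus_le_sub B y.2⟩ v
      rw [hρ.posAct hf hd hX y.2, hσ.posAct hf hd hY y.2] at this
      rw [lid_rTensor_lTensor]
      exact this.symm

omit hf hd in
lemma Corresponds.cartanAct {X : DY (S.δ B)} {ρ : KM.sub k A B →ₗ⁅k⁆ Module.End k X.V}
    (hρ : S.Corresponds ρ X.str) :
    (ρ : KM.sub k A B →ₗ[k] Module.End k X.V) ∘ₗ KM.hSub k A B = S.cartanAct X :=
  LinearMap.ext fun u => hρ.1 (KM.hB k A B u)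

omit hf hd in
lemma Corresponds.isIntegrableOModule {X : DY (S.δ B)} {ρ : KM.sub k A B →ₗ⁅k⁆ Module.End k X.V}
    (hX : S.IsIntegrableO X) (hρ : S.Corresponds ρ X.str) : IsIntegrableOModule A B ρ where
  diagonalisable := by rw [hρ.cartanAct]; exact hX.diagonalisable
  bounded := by rw [hρ.cartanAct]; exact hX.bounded
  f_nilpotent i hi := by
    have h := hX.f_nilpotent i hi
    have e : ρ ⟨KM.f k A i, KM.f_mem_sub hi⟩ = X.act (KM.fB A hi) := hρ.1 (KM.fB A hi)
    rw [← e] at h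
    exact h

end Standard

end Correspondence

/-! ### Truncated Borel subalgebras -/

section Truncation

variable {k : Type u} [Field k] {I : Type v} [DecidableEq I]
  {A : Matrix I I ℤ} {L : Type*} [LieRing L] [LieAlgebra k L]

/-- The part of the Borel subalgebra of degree at most `N`. -/
noncomputable def truncBorel (h : Cartan k I →ₗ[k] L) (e : I → L) (B : Set I) (N : ℕ) :
    Submodule k L :=
  (cartanSub k B).map h ⊔ ⨆ n : Fin N,
    wordSpan (fun i => LieAlgebra.ad k L (e i)) B (Submodule.span k (e '' B)) n

/-- The part of the Borel subalgebra of degree larger than `N`. -/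
noncomputable def tailBorel (k : Type u) [Field k] {L : Type*} [LieRing L] [LieAlgebra k L]
    (e : I → L) (B : Set I) (N : ℕ) : Submodule k L :=
  ⨆ n : {n // N ≤ n},
    wordSpan (fun i => LieAlgebra.ad k L (e i)) B (Submodule.span k (e '' B)) n

variable {h : Cartan k I →ₗ[k] L} {e f : I → L} {B : Set I} {N : ℕ}

lemma truncBorel_neg : truncBorel (-h) e B N = truncBorel h e B N := by
  have : (cartanSub k B).map (-h) = (cartanSub k B).map h := Submodule.map_neg _ _
  rw [truncBorel, truncBorel, this]

lemma tailBorel_le_nil : tailBorel k e B N ≤ nil k e B :=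
  iSup_le fun n => le_iSup (wordSpan (fun i => LieAlgebra.ad k L (e i)) B _) n.1

lemma truncBorel_le_borel : truncBorel h e B N ≤ borel h e B :=
  sup_le_sup le_rfl (iSup_le fun n =>
    le_iSup (wordSpan (fun i => LieAlgebra.ad k L (e i)) B _) n.1)

lemma borel_le_sup : borel h e B ≤ truncBorel h e B N ⊔ tailBorel k e B N := by
  refine sup_le (le_sup_left.trans le_sup_left) (iSup_le fun n => ?_)
  by_cases hn : n < N
  · exact le_trans (le_iSup (fun n : Fin N => wordSpan (fun i => LieAlgebra.ad k L (e i)) B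
      (Submodule.span k (e '' B)) n) ⟨n, hn⟩) (le_sup_right.trans le_sup_left)
  · exact le_trans (le_iSup (fun n : {n // N ≤ n} => wordSpan (fun i => LieAlgebra.ad k L (e i)) B
      (Submodule.span k (e '' B)) n) ⟨n, not_lt.1 hn⟩) le_sup_right

lemma finiteDimensional_truncBorel [Finite I] : FiniteDimensional k (truncBorel h e B N) := by
  have : FiniteDimensional k (Submodule.span k (e '' B)) :=
    FiniteDimensional.span_of_finite k (Set.toFinite _)
  have h' := fun n : Fin N => finiteDimensional_wordSpan
    (T := fun i => LieAlgebra.ad k L (e i)) (B := B) (W := Submodule.span k (e '' B)) n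
  rw [truncBorel]
  infer_instance

namespace IsStdForm

variable {d : I → k} {form : LinearMap.BilinForm k (Cartan k I)} {Φ : LinearMap.BilinForm k L}
  (F : IsStdForm h e f d form Φ) (C : IsChev A h e f) [Fintype I] [CharZero k]
include F C

/-- One side has degrees up to N and the other only degrees below -N, so these cannot cancel. -/
lemma trunc_tail {x y : L} (hx : x ∈ truncBorel h e B N) (hy : y ∈ tailBorel k f B N) :
    Φ x y + form (C.proj x) (C.proj y) = 0 := by
  have hy₀ : C.proj y = 0 := by
    have := C.swap.proj_nil (tailBorel_le_nil hy)
    rw [C.proj_swap] at this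
    exact neg_eq_zero.1 this
  rw [hy₀, map_zero, add_zero]
  refine (sup_le ?_ (iSup_le fun n => ?_) : _ ≤ LinearMap.ker (Φ.flip y)) hx
  · rintro _ ⟨a, _, rfl⟩
    change Φ (h a) y = 0
    rw [F.symm, F.h_right C, hy₀, map_zero, LinearMap.zero_apply]
  · intro x hx
    change Φ x y = 0
    refine (iSup_le fun m => ?_ : tailBorel k f B N ≤ LinearMap.ker (Φ x)) hy
    intro y hy
    have := n.2
    have := m.2
    exact C.form_gr_gr F.inv (B := B) (B' := B) (z := Int.ofNat ((n : ℕ) + 1)) (z' := Int.negSucc m)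
      (by rw [Int.ofNat_eq_natCast]; omega) hx hy

variable (hf : IsInvariantForm k A d form)
include hf

lemma trunc_nondeg {x : L} (hx : x ∈ truncBorel h e B N)
    (h₀ : ∀ y ∈ truncBorel h f B N, Φ x y + form (C.proj x) (C.proj y) = 0) : x = 0 := by
  refine F.pair_nondeg C hf (truncBorel_le_borel hx) fun y hy => ?_
  obtain ⟨a, ha, b, hb, rfl⟩ := Submodule.mem_sup.1 (borel_le_sup (N := N) hy)
  rw [map_add, map_add, map_add, add_add_add_comm, h₀ a ha, F.trunc_tail C hx hb, add_zero]

/-- The pairing of the truncations is nondegenerate on both sides by `trunc_nondeg`, and in finite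
dimension every linear form is then represented. -/
lemma exists_trunc_dual (φ : Module.Dual k (truncBorel h e B N)) :
    ∃ x ∈ truncBorel h f B N, ∀ y : truncBorel h e B N,
      Φ y x + form (C.proj y) (C.proj x) = φ y := by
  have := finiteDimensional_truncBorel (h := h) (e := e) (B := B) (N := N)
  let p : truncBorel h e B N →ₗ[k] truncBorel h f B N →ₗ[k] k :=
    (Φ + form.compl₁₂ C.proj C.proj).compl₁₂ (Submodule.subtype _) (Submodule.subtype _)
  have hp : p.IsPerfPair := by
    refine LinearMap.IsPerfPair.of_injective ?_ ?_
    · refine (injective_iff_map_eq_zero p).2 fun x hx => Subtype.ext ?_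
      exact F.trunc_nondeg C hf x.2 fun y hy => LinearMap.congr_fun hx ⟨y, hy⟩
    · refine (injective_iff_map_eq_zero p.flip).2 fun x hx => Subtype.ext ?_
      refine F.swap.trunc_nondeg C.swap hf (B := B) (N := N)
        (by rw [truncBorel_neg]; exact x.2) fun y hy => ?_
      rw [truncBorel_neg] at hy
      have h₁ : Φ y x + form (C.proj y) (C.proj x) = 0 := LinearMap.congr_fun hx ⟨y, hy⟩
      rw [C.proj_swap, C.proj_swap, F.symm, map_neg, map_neg, LinearMap.neg_apply, neg_neg,
        hf.symm]
      exact h₁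
  obtain ⟨x, hx⟩ := hp.bijective_right.2 φ
  exact ⟨x, x.2, fun y => LinearMap.congr_fun hx y⟩

end IsStdForm

end Truncation

/-! ### Modules in category `O` as Drinfeld-Yetter modules -/

section CategoryO

variable {k : Type u} [Field k] [CharZero k] {I : Type v} [DecidableEq I] [Fintype I]
  {A : Matrix I I ℤ} {d : I → k} {form : LinearMap.BilinForm k (Cartan k I)} {B : Set I}

open Classical in
/-- The sum of the fundamental coweights of a subdiagram. -/
noncomputable def rhoSub (k : Type u) [Field k] {I : Type v} [Fintype I] (B : Set I) :
    cartanSub k B :=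
  ∑ i : I, if hi : i ∈ B then ⟨coweight k i, coweight_mem hi⟩ else 0

-- Plays the role of ρ^∨ inside `cartanSub k B`, the only Cartan elements that act on a module over
-- the subalgebra of B.
open Classical in
lemma simpleRoot_rhoSub (i : I) :
    simpleRoot k A i (rhoSub k B) = if i ∈ B then 1 else 0 := by
  have : (rhoSub k B : Cartan k I) = ∑ j : I, if j ∈ B then coweight k j else 0 := by
    rw [rhoSub, AddSubmonoidClass.coe_finsetSum]
    refine Finset.sum_congr rfl fun j _ => ?_
    split_ifs <;> rfl
  rw [this, map_sum, Finset.sum_eq_single i]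
  · split_ifs <;> simp [simpleRoot_coweight]
  · intro j _ hj
    split_ifs <;> simp [simpleRoot_coweight, hj]
  · simp

lemma lie_rhoSub_word (n : ℕ) {y : KM k A}
    (hy : y ∈ wordSpan (fun i => LieAlgebra.ad k _ (KM.e k A i)) B
      (Submodule.span k (KM.e k A '' B)) n) :
    ⁅KM.h k A (rhoSub k B), y⁆ = ((n : k) + 1) • y := by
  have C := KM.isChev k A
  have key : ∀ i ∈ B, ⁅KM.h k A (rhoSub k B), KM.e k A i⁆ = KM.e k A i := fun i hi => by
    rw [C.he, simpleRoot_rhoSub, if_pos hi, one_smul]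
  have h : wordSpan (fun i => LieAlgebra.ad k _ (KM.e k A i)) B
      (Submodule.span k (KM.e k A '' B)) n ≤
      Module.End.eigenspace (LieAlgebra.ad k _ (KM.h k A (rhoSub k B))) ((n : k) + 1) := by
    clear hy y
    induction n with
    | zero =>
      refine Submodule.span_le.2 ?_
      rintro _ ⟨i, hi, rfl⟩
      rw [SetLike.mem_coe, Module.End.mem_eigenspace_iff, LieAlgebra.ad_apply, key i hi]
      simp
    | succ n ih =>
      refine wordSpan_succ_le fun i hi y hy => ?_
      have := Module.End.mem_eigenspace_iff.1 (ih hy)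
      rw [LieAlgebra.ad_apply] at this
      rw [Module.End.mem_eigenspace_iff, LieAlgebra.ad_apply, LieAlgebra.ad_apply, leibniz_lie,
        key i hi, this, lie_smul]
      push_cast
      rw [add_smul ((n : k) + 1) 1, one_smul, add_comm]
  exact Module.End.mem_eigenspace_iff.1 (h hy)

section

variable {V : Type*} [AddCommGroup V] [Module k V] {T : cartanSub k B →ₗ[k] Module.End k V}

/-- Restricting to the line through u, the weights are those of the full action evaluated at u. -/
lemma exists_weight_of_eigenvector (hT : IsDiagonalisable T) (u : cartanSub k B) {c : k} {v : V}
    (hv : T u v = c • v) (hv₀ : v ≠ 0) : ∃ χ ∈ weights T, χ u = c := by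
  let j : k →ₗ[k] cartanSub k B := LinearMap.toSpanSingleton k _ u
  have h : LinearMap.toSpanSingleton k k c ∈ weights (T ∘ₗ j) := by
    refine (Submodule.ne_bot_iff _).2 ⟨v, mem_weightSpace.2 fun r => ?_, hv₀⟩
    simp only [j, LinearMap.comp_apply, LinearMap.toSpanSingleton_apply, map_smul,
      LinearMap.smul_apply, hv, smul_smul, smul_eq_mul]
  obtain ⟨χ, hχ, e⟩ := mem_of_iSup_weightSpace_eq_top
    (iSup_weightSpace_comp j (iSup_weights hT)) h
  refine ⟨χ, hχ, ?_⟩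
  have := LinearMap.congr_fun e 1
  simpa [j] using this

/-- A weight l - Σ n_i α_i takes the value l(ρ_B) minus a natural number at ρ_B, and there are
finitely many l. Hence c + n is not an eigenvalue for large n. -/
lemma exists_bound (hT : IsDiagonalisable T) (hb : IsBoundedAbove A B (weights T)) (c : k) :
    ∃ N : ℕ, ∀ n : ℕ, N ≤ n → ∀ v, T (rhoSub k B) v = (c + n) • v → v = 0 := by
  classical
  obtain ⟨Λ, hΛ, h⟩ := hb
  -- The equation fixes n + m in characteristic zero, so one solution bounds all n. If there is
  -- none, N = 0 works vacuously.
  have h₁ : ∀ l : Module.Dual k (cartanSub k B), ∃ N : ℕ, ∀ n m : ℕ,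
      l (rhoSub k B) - m = c + n → n < N := by
    intro l
    by_cases hl : ∃ n m : ℕ, l (rhoSub k B) - m = c + n
    · obtain ⟨n₀, m₀, h₀⟩ := hl
      refine ⟨n₀ + m₀ + 1, fun n m hnm => ?_⟩
      have : ((n + m : ℕ) : k) = (n₀ + m₀ : ℕ) := by
        push_cast
        linear_combination h₀ - hnm
      have := Nat.cast_injective this
      omega
    · exact ⟨0, fun n m hnm => absurd ⟨n, m, hnm⟩ hl⟩
  choose N hN using h₁
  refine ⟨hΛ.toFinset.sup N, fun n hn v hv => ?_⟩
  by_contra hv₀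
  obtain ⟨χ, hχ, e⟩ := exists_weight_of_eigenvector hT _ hv hv₀
  obtain ⟨l, hl, r, rfl⟩ := h χ hχ
  have h₂ : ∀ i, rootRestrict k A B i (rhoSub k B) = ((if i ∈ B then 1 else 0 : ℕ) : k) := by
    intro i
    refine (simpleRoot_rhoSub i).trans ?_
    split_ifs <;> simp
  have := hN l n (∑ i, r i * if i ∈ B then 1 else 0) (by
    rw [← e, LinearMap.sub_apply, LinearMap.sum_apply]
    simp only [LinearMap.smul_apply, h₂]
    push_cast
    simp)
  have h₃ : N l ≤ hΛ.toFinset.sup N := Finset.le_sup (hΛ.mem_toFinset.2 hl)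
  omega

lemma induction_weight (hT : IsDiagonalisable T) {Q : Submodule k V}
    (h : ∀ χ, ∀ v ∈ weightSpace T χ, v ∈ Q) (v : V) : v ∈ Q :=
  (iSup_le fun χ => h χ : _ ≤ Q) (hT ▸ Submodule.mem_top : v ∈ _)

end

end CategoryO

/-! ### The coaction on a module in category O -/

namespace IsIntegrableOModule

variable {k : Type u} [Field k] [CharZero k] {I : Type v} [DecidableEq I] [Fintype I]
  {A : Matrix I I ℤ} {d : I → k} {form : LinearMap.BilinForm k (Cartan k I)} {B : Set I}
  {M : Type u} [AddCommGroup M] [Module k M] {ρ : KM.sub k A B →ₗ⁅k⁆ Module.End k M}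
  (hρ : IsIntegrableOModule A B ρ)

/-- The action of the Cartan subalgebra. -/
noncomputable abbrev cartanOp (ρ : KM.sub k A B →ₗ⁅k⁆ Module.End k M) :
    cartanSub k B →ₗ[k] Module.End k M :=
  (ρ : KM.sub k A B →ₗ[k] Module.End k M) ∘ₗ KM.hSub k A B

lemma cartanOp_rho {y : KM k A} (hy : y ∈ KM.sub k A B) {r c : k}
    (hy' : ⁅KM.h k A (rhoSub k B), y⁆ = r • y) {v : M}
    (hv : cartanOp ρ (rhoSub k B) v = c • v) :
    cartanOp ρ (rhoSub k B) (ρ ⟨y, hy⟩ v) = (c + r) • ρ ⟨y, hy⟩ v := by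
  have e : ⁅KM.hSub k A B (rhoSub k B), (⟨y, hy⟩ : KM.sub k A B)⁆ =
      r • (⟨y, hy⟩ : KM.sub k A B) := Subtype.ext hy'
  have h := LinearMap.congr_fun (congrArg ρ e) v
  rw [LieHom.map_lie, LieRing.of_associative_ring_bracket, map_smul] at h
  change ρ (KM.hSub k A B (rhoSub k B)) (ρ ⟨y, hy⟩ v) -
    ρ ⟨y, hy⟩ (cartanOp ρ (rhoSub k B) v) = r • ρ ⟨y, hy⟩ v at h
  rw [hv, map_smul, sub_eq_iff_eq_add] at h
  rw [add_comm c, add_smul]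
  exact h

include hρ

/-- High degrees of the positive Borel subalgebra would raise v to an eigenvalue that does not
occur, so they kill v. What remains is finite dimensional, and its canonical element applied to v is
the coaction. -/
lemma exists_coact_of_weight (S : Standard A d form) (hf : IsInvariantForm k A d form)
    {χ : Module.Dual k (cartanSub k B)} {v : M} (hv : v ∈ weightSpace (cartanOp ρ) χ) :
    ∃ t : KM.bMinus k A B ⊗[k] M, ∀ (y : KM k A) (hy : y ∈ KM.bPlus k A B),
      TensorProduct.lid k M ((pairDual form S.Φ B y).rTensor M t) =
        ρ ⟨y, KM.bPlus_le_sub B hy⟩ v := by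
  have F := S.isStdForm
  have C := KM.isChev k A
  obtain ⟨N, hN⟩ := exists_bound hρ.diagonalisable hρ.bounded (χ (rhoSub k B))
  let E := truncBorel (KM.h k A) (KM.e k A) B N
  have hE : ∀ y ∈ E, y ∈ KM.bPlus k A B := fun y hy => KM.mem_bPlus.2 (truncBorel_le_borel hy)
  have hK : ∀ y ∈ tailBorel k (KM.e k A) B N, y ∈ KM.bPlus k A B := fun y hy =>
    KM.mem_bPlus.2 (nil_le_borel (tailBorel_le_nil hy))
  let R : KM.sub k A B →ₗ[k] M := (ρ : KM.sub k A B →ₗ[k] Module.End k M).flip v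
  have hR : ∀ y (hy : y ∈ tailBorel k (KM.e k A) B N),
      ρ ⟨y, KM.bPlus_le_sub B (hK y hy)⟩ v = 0 := by
    intro y hy
    have key : tailBorel k (KM.e k A) B N ≤
        (LinearMap.ker R).map (KM.sub k A B).toSubmodule.subtype := by
      refine iSup_le fun n y hy => ?_
      have hy' := hK y (Submodule.mem_iSup_of_mem n hy)
      refine ⟨⟨y, KM.bPlus_le_sub B hy'⟩, ?_, rfl⟩
      -- A word with n further letters has degree n + 1.
      refine hN (n + 1) (by have := n.2; omega) _ ?_
      have := cartanOp_rho (KM.bPlus_le_sub B hy') (lie_rhoSub_word n hy)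
        (mem_weightSpace.1 hv _)
      push_cast
      exact this
    obtain ⟨y', hy', e⟩ := key hy
    have : y' = ⟨y, KM.bPlus_le_sub B (hK y hy)⟩ := Subtype.ext e
    exact this ▸ hy'
  have := finiteDimensional_truncBorel (h := KM.h k A) (e := KM.e k A) (B := B) (N := N)
  let b := Module.finBasis k E
  let RE : E →ₗ[k] M := R ∘ₗ Submodule.inclusion (fun y hy => KM.bPlus_le_sub B (hE y hy) :
    E ≤ (KM.sub k A B).toSubmodule)
  have hx := fun j => CoxeterDY.IsStdForm.exists_trunc_dual F C hf (b.coord j)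
  choose x hx hxb using hx
  let x' : Fin (Module.finrank k E) → KM.bMinus k A B := fun j =>
    ⟨x j, KM.mem_bMinus.2 (truncBorel_le_borel (hx j))⟩
  -- Dual bases of the truncations; the tail of y contributes neither to the pairing with the x_j
  -- nor to its action on v.
  refine ⟨∑ j, x' j ⊗ₜ RE (b j), fun y hy => ?_⟩
  obtain ⟨a, ha, c, hc, rfl⟩ := Submodule.mem_sup.1 (borel_le_sup (N := N) (KM.mem_bPlus.1 hy))
  have h₁ : ∀ j, pairDual form S.Φ B (a + c) (x' j) = b.repr ⟨a, ha⟩ j := by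
    intro j
    have h₂ : borelPairing A form S.Φ a (x j) = b.repr ⟨a, ha⟩ j := hxb j ⟨a, ha⟩
    have h₃ := CoxeterDY.IsStdForm.trunc_tail F.swap C.swap (x := x j) (y := c)
      (by rw [truncBorel_neg]; exact hx j) hc
    rw [C.proj_swap, C.proj_swap, F.symm, map_neg, map_neg, LinearMap.neg_apply, neg_neg,
      hf.symm] at h₃
    have h₄ : borelPairing A form S.Φ c (x j) = 0 := h₃
    rw [pairDual_apply, map_add, LinearMap.add_apply]
    exact (congrArg₂ (· + ·) h₂ h₄).trans (add_zero _)
  rw [map_sum, map_sum]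
  simp only [LinearMap.rTensor_tmul, TensorProduct.lid_tmul, h₁]
  have h₅ : ∑ j, b.repr ⟨a, ha⟩ j • RE (b j) = RE ⟨a, ha⟩ := by
    conv_rhs => rw [← b.sum_repr ⟨a, ha⟩]
    rw [map_sum]
    simp only [map_smul]
  rw [h₅]
  have e : (⟨a + c, KM.bPlus_le_sub B hy⟩ : KM.sub k A B) = ⟨a, KM.bPlus_le_sub B (hE a ha)⟩ +
      ⟨c, KM.bPlus_le_sub B (hK c hc)⟩ := rfl
  rw [e, map_add, LinearMap.add_apply, hR c hc, add_zero]
  rfl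

/-- Values on weight vectors extend by additivity, and separation makes the value unique, hence
linear in v. -/
lemma exists_coact (S : Standard A d form) (hf : IsInvariantForm k A d form) :
    ∃ c : M →ₗ[k] KM.bMinus k A B ⊗[k] M, ∀ (y : KM k A) (hy : y ∈ KM.bPlus k A B),
      contract c (pairDual form S.Φ B y) = ρ ⟨y, KM.bPlus_le_sub B hy⟩ := by
  let R : M → KM.bMinus k A B ⊗[k] M → Prop := fun v t =>
    ∀ (y : KM k A) (hy : y ∈ KM.bPlus k A B),
      TensorProduct.lid k M ((pairDual form S.Φ B y).rTensor M t) =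
        ρ ⟨y, KM.bPlus_le_sub B hy⟩ v
  have R_add : ∀ {v w s t}, R v s → R w t → R (v + w) (s + t) := fun hs ht y hy => by
    rw [map_add, map_add, map_add, hs y hy, ht y hy]
  have R_smul : ∀ {v t} (r : k), R v t → R (r • v) (r • t) := fun r ht y hy => by
    rw [map_smul, map_smul, map_smul, ht y hy]
  have R_unique : ∀ {v s t}, R v s → R v t → s = t := fun hs ht =>
    (S.isStdForm.separating_bPlus hf).ext fun y => (hs y y.2).trans (ht y y.2).symm
  let Q : Submodule k M :=
    { carrier := {v | ∃ t, R v t}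
      add_mem' := fun ⟨s, hs⟩ ⟨t, ht⟩ => ⟨_, R_add hs ht⟩
      zero_mem' := ⟨0, fun y hy => by simp⟩
      smul_mem' := fun r _ ⟨t, ht⟩ => ⟨_, R_smul r ht⟩ }
  have hQ : ∀ v, ∃ t, R v t := induction_weight (Q := Q) hρ.diagonalisable
    fun χ v hv => hρ.exists_coact_of_weight S hf hv
  choose c hc using hQ
  exact ⟨{ toFun := c
           map_add' := fun v w => R_unique (hc (v + w)) (R_add (hc v) (hc w))
           map_smul' := fun r v => R_unique (hc (r • v)) (R_smul r (hc v)) },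
    fun y hy => LinearMap.ext fun v => hc v y hy⟩

lemma e_nilpotent {i : I} (hi : i ∈ B) :
    LocallyNilpotent (ρ ⟨KM.e k A i, KM.e_mem_sub A hi⟩) := by
  let T := ρ ⟨KM.e k A i, KM.e_mem_sub A hi⟩
  let Q : Submodule k M :=
    { carrier := {v | ∃ n : ℕ, (T ^ n) v = 0}
      add_mem' := fun {v w} ⟨m, hm⟩ ⟨n, hn⟩ => ⟨m + n, by
        rw [map_add, pow_apply_eq_zero_of_le T v m _ hm (by omega),
          pow_apply_eq_zero_of_le T w n _ hn (by omega), add_zero]⟩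
      zero_mem' := ⟨0, by simp⟩
      smul_mem' := fun r v ⟨n, hn⟩ => ⟨n, by rw [map_smul, hn, smul_zero]⟩ }
  refine induction_weight (Q := Q) hρ.diagonalisable fun χ v hv => ?_
  obtain ⟨N, hN⟩ := exists_bound hρ.diagonalisable hρ.bounded (χ (rhoSub k B))
  refine ⟨N, hN N le_rfl _ ?_⟩
  have he : ⁅KM.h k A (rhoSub k B), KM.e k A i⁆ = (1 : k) • KM.e k A i := by
    rw [(KM.isChev k A).he, simpleRoot_rhoSub, if_pos hi]
  suffices ∀ n : ℕ, cartanOp ρ (rhoSub k B) ((T ^ n) v) =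
      (χ (rhoSub k B) + n) • (T ^ n) v from this N
  intro n
  induction n with
  | zero => simpa using mem_weightSpace.1 hv (rhoSub k B)
  | succ n ih =>
    rw [pow_succ', Module.End.mul_apply, cartanOp_rho (KM.e_mem_sub A hi) he ih]
    push_cast
    rw [add_assoc]

/-- The axioms, tested on the positive Borel subalgebra, are the commutation relations in g_B read
backwards. -/
lemma existsUnique_str (S : Standard A d form) (hf : IsInvariantForm k A d form)
    (hd : ∀ i, d i ≠ 0) :
    ∃! s : DYStructure (S.δ B) M, S.IsIntegrableO ⟨M, s⟩ ∧ S.Corresponds ρ s := by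
  obtain ⟨c, hc⟩ := hρ.exists_coact S hf
  have hs := S.isStdForm.separating_bPlus hf (B := B)
  let α : KM.bMinus k A B →ₗ⁅k⁆ Module.End k M :=
    ρ.comp (LieSubalgebra.inclusion (KM.bMinus_le_sub B))
  let s : DYStructure (S.δ B) M :=
    { act := α
      coact := c
      comodule := fun v => (comodule_iff_contract hs _ c v).2 fun y z => by
        rw [IsCobracket.dualDistrib_comp S.isStdForm hf (S.isCobracket hf hd) y.2 z.2,
          hc _ y.2, hc _ z.2, hc _ (LieSubalgebra.lie_mem _ y.2 z.2)]
        exact LinearMap.congr_fun (ρ.map_lie ⟨y, KM.bPlus_le_sub B y.2⟩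
          ⟨z, KM.bPlus_le_sub B z.2⟩) v
      compat := fun x v => (compat_iff_contract hs _ α c x v).2 fun y => by
        obtain ⟨a', ha', c', hc', hac, hp⟩ := KM.exists_split (LieSubalgebra.lie_mem _
          (KM.bMinus_le_sub B x.2) (KM.bPlus_le_sub B y.2))
        rw [IsCobracket.lid_rTensor S.isStdForm hf (S.isCobracket hf hd x) y.2 ⟨a', ha'⟩ hc' hac hp,
          IsCobracket.pairDual_comp_ad S.isStdForm hf ha' hac hp, map_neg, hc _ y.2, hc _ hc']
        have e : ⁅(⟨x, KM.bMinus_le_sub B x.2⟩ : KM.sub k A B),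
            (⟨y, KM.bPlus_le_sub B y.2⟩ : KM.sub k A B)⁆ =
            ⟨a', KM.bMinus_le_sub B ha'⟩ + ⟨c', KM.bPlus_le_sub B hc'⟩ := Subtype.ext hac
        have h := LinearMap.congr_fun (congrArg ρ e) v
        rw [LieHom.map_lie, map_add] at h
        change α x (ρ ⟨y, KM.bPlus_le_sub B y.2⟩ v) - ρ ⟨y, KM.bPlus_le_sub B y.2⟩ (α x v) =
          α ⟨a', ha'⟩ v + ρ ⟨c', KM.bPlus_le_sub B hc'⟩ v at h
        rw [LinearMap.neg_apply, ← neg_sub (α x _), h]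
        abel }
  have hpos : ∀ (y : KM k A) (hy : y ∈ KM.bPlus k A B),
      S.posAct ⟨M, s⟩ y = ρ ⟨y, KM.bPlus_le_sub B hy⟩ := hc
  have hcor : S.Corresponds ρ s := ⟨fun x => rfl, fun i hi =>
    (hpos _ (KM.e_mem_bPlus A hi)).symm.trans (Standard.posAct_e (⟨M, s⟩ : DY (S.δ B)) i)⟩
  refine ⟨s, ⟨⟨⟨?_, ?_, ?_, ?_⟩, ?_⟩, hcor⟩, ?_⟩
  · exact hρ.diagonalisable
  · exact hρ.f_nilpotent
  · intro i hi
    rw [← hcor.2 i hi]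
    exact hρ.e_nilpotent hi
  · intro x
    exact (hpos _ (KM.h_mem_bPlus x.2)).symm.trans (Standard.posAct_h hf (⟨M, s⟩ : DY (S.δ B)) x)
  · exact hρ.bounded
  · rintro s' ⟨hs', hcor'⟩
    -- All contractions of a corresponding integrable coaction are given by ρ, and they determine
    -- it.
    refine DYStructure.ext (LieHom.ext fun x => ?_) (LinearMap.ext fun v => hs.ext fun y => ?_)
    · exact (hcor'.1 x).symm.trans (hcor.1 x)
    · have h := Standard.Corresponds.posAct hf hd (X := ⟨M, s'⟩) hs'.toIsIntegrable hcor' y.2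
      exact LinearMap.congr_fun (h.symm.trans (hpos y y.2).symm) v

end IsIntegrableOModule


/-! ### Orders of products of two simple reflections -/

section Weyl

variable {k : Type u} [Field k] {I : Type v} [DecidableEq I] {A : Matrix I I ℤ} {i j : I}

variable (k A i j) in
/-- The product of two simple reflections. -/
noncomputable def coxeterElement : Module.End k (Cartan k I) :=
  Module.preReflection (coroot k i) (simpleRoot k A i) *
    Module.preReflection (coroot k j) (simpleRoot k A j)

/-- The action of a product of two simple reflections on coordinates. -/
def coxeterStep {R : Type*} [CommRing R] (a b u w : R) (x : R × R) : R × R :=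
  (-u - x.1 - b * (a * x.1 + w + x.2) + 2 * b * (a * x.1 + w + x.2), -w - a * x.1 - x.2)

lemma coxeterElement_pow_apply (hA : IsGCM A) (v : Cartan k I) (n : ℕ) :
    (coxeterElement k A i j ^ n) v = v +
      ((coxeterStep (A i j : k) (A j i : k) (simpleRoot k A i v) (simpleRoot k A j v))^[n]
        (0, 0)).1 • coroot k i +
      ((coxeterStep (A i j : k) (A j i : k) (simpleRoot k A i v) (simpleRoot k A j v))^[n]
        (0, 0)).2 • coroot k j := by
  induction n with
  | zero => simp
  | succ n ih =>
    rw [pow_succ', Module.End.mul_apply, ih, Function.iterate_succ_apply']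
    generalize (coxeterStep (A i j : k) (A j i : k) (simpleRoot k A i v)
      (simpleRoot k A j v))^[n] (0, 0) = x
    simp only [coxeterElement, Module.End.mul_apply, Module.preReflection_apply, map_add, map_sub,
      map_smul, simpleRoot_coroot, hA.diag, coxeterStep]
    push_cast
    module

/-- The recursion is linear in the starting data, so the question of the order is reduced to
integers. -/
lemma coxeterStep_iterate (a b : ℤ) (u w : k) (n : ℕ) :
    (coxeterStep (a : k) (b : k) u w)^[n] (0, 0) =
      u • Prod.map Int.cast Int.cast ((coxeterStep a b 1 0)^[n] (0, 0)) +
        w • Prod.map Int.cast Int.cast ((coxeterStep a b 0 1)^[n] (0, 0)) := by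
  induction n with
  | zero => simp
  | succ n ih =>
    simp only [Function.iterate_succ_apply', ih]
    ext <;> simp [coxeterStep] <;> ring

namespace IsFiniteRankTwo

variable {a b : ℤ} {m : ℕ}

lemma symm (h : IsFiniteRankTwo a b m) : IsFiniteRankTwo b a m := by
  cases h
  · exact .two
  · exact .three
  · exact .four'
  · exact .four
  · exact .six'
  · exact .six

lemma two_le (h : IsFiniteRankTwo a b m) : 2 ≤ m := by cases h <;> norm_num

lemma eq_two (h : IsFiniteRankTwo a b m) (ha : a = 0) : m = 2 := by
  cases h <;> first | rfl | exact absurd ha (by norm_num)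

end IsFiniteRankTwo

lemma coxeterElement_pow_eq_one (hA : IsGCM A) {m : ℕ}
    (h : IsFiniteRankTwo (A i j) (A j i) m) : coxeterElement k A i j ^ m = 1 := by
  refine LinearMap.ext fun v => ?_
  rw [coxeterElement_pow_apply hA, coxeterStep_iterate]
  generalize A i j = a at h
  generalize A j i = b at h
  have key : (coxeterStep a b 1 0)^[m] (0, 0) = (0, 0) ∧
      (coxeterStep a b 0 1)^[m] (0, 0) = (0, 0) := by
    -- In each finite type both integral orbits, started at the origin, return there after m steps.
    cases h <;> decide
  rw [key.1, key.2]
  simp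

variable [CharZero k]

/-- The test vector is the fundamental coweight at i, with α_i = 1 and α_j = 0; the coefficient of
h_i in its displacement must vanish. -/
lemma coxeterStep_of_pow_eq_one (hA : IsGCM A) (hij : i ≠ j) {n : ℕ}
    (h : coxeterElement k A i j ^ n = 1) :
    ((coxeterStep (A i j) (A j i) 1 0)^[n] (0, 0)).1 = 0 := by
  have h₁ := congrArg (fun x : Cartan k I => x (Sum.inl i)) ((coxeterElement_pow_apply hA
    (coweight k i) n).symm.trans (LinearMap.congr_fun h (coweight k i)))
  simp only [simpleRoot_coweight, if_true, if_neg hij] at h₁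
  rw [coxeterStep_iterate] at h₁
  simpa [coroot, coweight, hij.symm] using h₁

lemma weylOrder_of_isFiniteRankTwo (hA : IsGCM A) (hij : i ≠ j) {m : ℕ}
    (h : IsFiniteRankTwo (A i j) (A j i) m) : weylOrder k A i j = m := by
  have hm : 0 < m := by have := h.two_le; omega
  refine (orderOf_eq_iff hm).2 ⟨coxeterElement_pow_eq_one hA h, fun n hn hn₀ h' => ?_⟩
  have h₁ := coxeterStep_of_pow_eq_one hA hij h'
  generalize A i j = a at h h₁
  generalize A j i = b at h h₁
  cases h <;> interval_cases n <;> revert h₁ <;> decide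

lemma weylOrder_of_four_le (hA : IsGCM A) (hij : i ≠ j) (h : 4 ≤ A i j * A j i) :
    weylOrder k A i j = 0 := by
  refine orderOf_eq_zero_iff'.2 fun n hn h' => ?_
  have h₁ := coxeterStep_of_pow_eq_one hA hij h'
  have ha : A i j ≤ 0 := hA.nonpos i j hij
  have hb : A j i ≤ 0 := hA.nonpos j i hij.symm
  generalize A i j = a at h h₁ ha
  generalize A j i = b at h h₁ hb
  -- The second inequality is what makes the induction run: with ab ≥ 4 it gives b(ax + y) ≤ 2x, so
  -- the first coordinate strictly decreases and never returns to 0.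
  have key : ∀ n : ℕ, ((coxeterStep a b 1 0)^[n + 1] (0, 0)).1 ≤ -1 ∧
      -2 * ((coxeterStep a b 1 0)^[n + 1] (0, 0)).2 ≤
        a * ((coxeterStep a b 1 0)^[n + 1] (0, 0)).1 := by
    intro n
    induction n with
    | zero =>
      simp [coxeterStep]
      exact ha
    | succ n ih =>
      rw [Function.iterate_succ_apply']
      generalize (coxeterStep a b 1 0)^[n + 1] (0, 0) = x at ih
      obtain ⟨x, y⟩ := x
      obtain ⟨h₂, h₃⟩ := ih
      simp only [coxeterStep] at h₂ h₃ ⊢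
      have h₄ : 0 ≤ a * x := mul_nonneg_of_nonpos_of_nonpos ha (by omega)
      have h₅ : a * x ≤ 2 * (a * x + y) := by linarith
      have h₆ : 0 ≤ (-b) * (2 * (a * x + y) - a * x) := mul_nonneg (by omega) (by omega)
      have h₇ : 0 ≤ (a * b - 4) * (-x) := mul_nonneg (by omega) (by omega)
      have h₈ : 0 ≤ (a * b - 4) * (a * x + y) := mul_nonneg (by omega) (by omega)
      constructor
      · nlinarith
      · nlinarith
  obtain ⟨n, rfl⟩ : ∃ m, n = m + 1 := ⟨n - 1, by omega⟩
  have := (key n).1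
  omega

lemma exists_isFiniteRankTwo (hA : IsGCM A) (hij : i ≠ j) :
    (∃ m, IsFiniteRankTwo (A i j) (A j i) m) ∨ 4 ≤ A i j * A j i := by
  by_cases h : 4 ≤ A i j * A j i
  · exact Or.inr h
  refine Or.inl ?_
  have ha := hA.nonpos i j hij
  have hb := hA.nonpos j i hij.symm
  have h₁ := hA.zero i j
  have h₂ := hA.zero j i
  generalize A i j = a at *
  generalize A j i = b at *
  by_cases ha₀ : a = 0
  · rw [ha₀, h₁ ha₀]
    exact ⟨2, .two⟩
  have hb₀ : b ≠ 0 := fun hb₀ => ha₀ (h₂ hb₀)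
  have ha₁ : -3 ≤ a := by nlinarith [show b ≤ -1 by omega, show a ≤ -1 by omega]
  have hb₁ : -3 ≤ b := by nlinarith [show b ≤ -1 by omega, show a ≤ -1 by omega]
  have ha₂ : a ≤ -1 := by omega
  have hb₂ : b ≤ -1 := by omega
  clear h₁ h₂ ha hb ha₀ hb₀
  interval_cases a <;> interval_cases b
  all_goals first
    | exact ⟨3, .three⟩
    | exact ⟨4, .four⟩
    | exact ⟨4, .four'⟩
    | exact ⟨6, .six⟩
    | exact ⟨6, .six'⟩
    | omega

lemma isLabelling_weylOrder (hA : IsGCM A) : IsLabelling (dynkin A) (weylOrder k A) := by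
  intro i j hij
  rcases exists_isFiniteRankTwo hA hij with ⟨m, hm⟩ | h
  · rw [weylOrder_of_isFiniteRankTwo hA hij hm, weylOrder_of_isFiniteRankTwo hA hij.symm hm.symm]
    refine ⟨by have := hm.two_le; omega, rfl, fun h => ?_⟩
    have h₀ : A i j = 0 := by
      by_contra h₀
      exact h ⟨hij, Or.inl h₀⟩
    exact hm.eq_two h₀
  · rw [weylOrder_of_four_le hA hij h, weylOrder_of_four_le hA hij.symm (by rwa [mul_comm])]
    refine ⟨by norm_num, rfl, fun h' => ?_⟩
    have h₀ : A i j = 0 := by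
      by_contra h₀
      exact h' ⟨hij, Or.inl h₀⟩
    rw [h₀] at h
    norm_num at h

end Weyl

/-! ### Local monodromies -/

lemma map_altProd {G H : Type*} [Group G] [Group H] (φ : G →* H) (a b : G) (n : ℕ) :
    φ (altProd a b n) = altProd (φ a) (φ b) n := by
  induction n generalizing a b with
  | zero => exact map_one φ
  | succ n ih => rw [altProd, altProd, map_mul, ih]

namespace DY

variable {k : Type u} [Field k] {L : Type w} [LieRing L] [LieAlgebra k L]
  {δ : LieBialgebraStructure k L}

/-- The linear equivalence underlying an isomorphism. -/
def linEquiv {X Y : DY δ} (e : X ≅ Y) : X.V ≃ₗ[k] Y.V :=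
  LinearEquiv.ofLinearMap e.hom.lin e.inv.lin (congrArg Hom.lin e.inv_hom_id)
    (congrArg Hom.lin e.hom_inv_id)

/-- Over the zero Lie algebra, every linear equivalence is an isomorphism. -/
def isoOfSubsingleton [Subsingleton L] {X Y : DY δ} (e : X.V ≃ₗ[k] Y.V) : X ≅ Y :=
  haveI : Subsingleton (L ⊗[k] Y.V) := ⟨fun s t => by
    have h : ∀ z : L ⊗[k] Y.V, z = 0 := fun z => by
      induction z with
      | zero => rfl
      | tmul x v => rw [Subsingleton.elim x 0, TensorProduct.zero_tmul]
      | add s t hs ht => rw [hs, ht, add_zero]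
    rw [h s, h t]⟩
  mkIso e (fun x v => by rw [Subsingleton.elim x 0]; simp) fun _ => Subsingleton.elim _ _

end DY

namespace SplitPair

variable {k : Type u} [Field k] {L L' L'' : Type*} [LieRing L] [LieAlgebra k L] [LieRing L']
  [LieAlgebra k L'] [LieRing L''] [LieAlgebra k L''] {δ : LieBialgebraStructure k L}
  {δ' : LieBialgebraStructure k L'} {δ'' : LieBialgebraStructure k L''} (s : SplitPair δ δ')

/-- The operator on a Drinfeld-Yetter module underlying an automorphism of its restriction. -/
def resAut (X : DY δ) : Aut (s.res.obj X) →* (X.V ≃ₗ[k] X.V) where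
  toFun a := DY.linEquiv (X := s.res.obj X) (Y := s.res.obj X) a
  map_one' := rfl
  map_mul' _ _ := rfl

lemma resAut_injective (X : DY δ) : Function.Injective (s.resAut X) := fun _ _ h =>
  Iso.ext (DY.hom_ext (LinearMap.ext fun v => LinearEquiv.congr_fun h v))

variable [Subsingleton L']

/-- An operator on a Drinfeld-Yetter module, as an automorphism of its restriction to zero. -/
def zeroIso (X : DY δ) (e : X.V ≃ₗ[k] X.V) : s.res.obj X ≅ s.res.obj X :=
  DY.isoOfSubsingleton (X := s.res.obj X) (Y := s.res.obj X) e

lemma zeroIso_naturality {X Y : DY δ} (f : X ⟶ Y) {e : X.V ≃ₗ[k] X.V} {e' : Y.V ≃ₗ[k] Y.V}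
    (h : ∀ v, f.lin (e v) = e' (f.lin v)) :
    s.res.map f ≫ (s.zeroIso Y e').hom = (s.zeroIso X e).hom ≫ s.res.map f :=
  DY.hom_ext (LinearMap.ext fun v => (h v).symm)

lemma zeroIso_tensor {X Y : DY δ} {e : X.V ≃ₗ[k] X.V} {e' : Y.V ≃ₗ[k] Y.V}
    {e'' : (X ⊗ Y).V ≃ₗ[k] (X ⊗ Y).V} (h : ∀ v w, e'' (v ⊗ₜ[k] w) = e v ⊗ₜ[k] e' w) :
    ((s.zeroIso X e).hom ⊗ₘ (s.zeroIso Y e').hom) ≫ (β_ (s.res.obj Y) (s.res.obj X)).inv ≫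
        (s.resCore.μIso Y X).hom =
      (s.resCore.μIso X Y).hom ≫ (s.zeroIso (X ⊗ Y) e'').hom ≫ s.res.map (β_ Y X).inv :=
  DY.hom_ext (TensorProduct.ext' fun v w =>
    (congrArg (TensorProduct.comm k X.V Y.V) (h v w)).symm)

/-- Conjugation with the identity does not change the underlying operator. -/
lemma resAut_conj {s₀ : SplitPair δ'' δ} {s : SplitPair δ δ'} {t : SplitPair δ'' δ'}
    (c : IsComp s₀ s t) (X : DY δ'') (e : X.V ≃ₗ[k] X.V) :
    t.resAut X ((compIso c X).symm ≪≫ s.zeroIso (s₀.res.obj X) e ≪≫ compIso c X) = e :=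
  LinearEquiv.ext fun _ => rfl

end SplitPair

namespace KM

variable {k : Type u} [Field k] {I : Type v} [DecidableEq I] (A : Matrix I I ℤ)

/-- Restriction to the empty diagram thus remembers the vector space only, so operators which are
not morphisms over B may serve as local monodromies. -/
instance subsingleton_bMinus_empty : Subsingleton (bMinus k A ∅) := by
  have h : bMinus k A ∅ ≤ ⊥ := LieSubalgebra.lieSpan_le.2 fun x ⟨i, hi, _⟩ => hi.elim
  have h₀ : ∀ x : bMinus k A ∅, x = 0 := fun x =>
    Subtype.ext ((LieSubalgebra.mem_bot _).1 (h x.2))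
  exact ⟨fun x y => (h₀ x).trans (h₀ y).symm⟩

end KM

namespace Standard

variable {k : Type u} [Field k] [CharZero k] {I : Type v} [DecidableEq I] {A : Matrix I I ℤ}
  {d : I → k} {form : LinearMap.BilinForm k (Cartan k I)} {S : Standard A d form} {B : Set I}

lemma dualAct_comm {X Y : DY (S.δ B)} (f : X ⟶ Y) (y : KM k A) (v : X.V) :
    f.lin (S.dualAct y X v) = S.dualAct y Y (f.lin v) := by
  rw [dualAct, dualAct, contract_apply, contract_apply, f.coact_comm, lid_rTensor_lTensor]

/-- The coaction of the restriction is projected by p, which is orthogonal with respect to e_i. -/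
lemma dualAct_res {B' : Set I} (hB : B' ⊆ B) {i : I} (hi : i ∈ B') (X : DY (S.δ B)) :
    S.dualAct (KM.e k A i) ((S.split hB).res.obj X) = S.dualAct (KM.e k A i) X := by
  refine ((S.split hB).contract_res X _).trans ?_
  exact congrArg (contract X.coact) (dual_comp_p hB (KM.e_mem_bPlus A hi))

/-- The triple exponential at `i` on an integrable Drinfeld-Yetter module. -/
noncomputable def IsIntegrable.monodromy {X : DY (S.δ B)} (hX : S.IsIntegrable X) {i : I}
    (hi : i ∈ B) : X.V ≃ₗ[k] X.V :=
  tripleEquiv (hX.e_nilpotent i hi) (hX.f_nilpotent i hi)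

lemma IsIntegrable.monodromy_apply {X : DY (S.δ B)} (hX : S.IsIntegrable X) {i : I} (hi : i ∈ B)
    (v : X.V) : hX.monodromy hi v =
      tripleExp (S.dualAct (KM.e k A i) X) (X.act (KM.fB A hi)) v := rfl

lemma IsIntegrable.monodromy_comm {X Y : DY (S.δ B)} (hX : S.IsIntegrable X)
    (hY : S.IsIntegrable Y) {i : I} (hi : i ∈ B) (f : X ⟶ Y) (v : X.V) :
    f.lin (hX.monodromy hi v) = hY.monodromy hi (f.lin v) :=
  map_tripleExp (hX.e_nilpotent i hi) (hX.f_nilpotent i hi) f.lin (dualAct_comm f _)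
    (f.act_comm _) v

lemma IsIntegrable.monodromy_tensor {X Y : DY (S.δ B)} (hX : S.IsIntegrable X)
    (hY : S.IsIntegrable Y) (hXY : S.IsIntegrable (X ⊗ Y)) {i : I} (hi : i ∈ B) (v : X.V)
    (w : Y.V) : hXY.monodromy hi (v ⊗ₜ[k] w) = hX.monodromy hi v ⊗ₜ[k] hY.monodromy hi w := by
  refine Eq.trans ?_ (tripleExp_tensor (hX.e_nilpotent i hi) (hX.f_nilpotent i hi)
    (hY.e_nilpotent i hi) (hY.f_nilpotent i hi) v w)
  rw [← dualAct_tensor]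
  rfl

lemma IsIntegrable.monodromy_res {B' : Set I} (hB : B' ⊆ B) {X : DY (S.δ B)}
    (hX : S.IsIntegrable X) (hX' : S.IsIntegrable ((S.split hB).res.obj X)) {i : I} (hi : i ∈ B') :
    (hX'.monodromy hi : X.V ≃ₗ[k] X.V) = hX.monodromy (hB hi) := by
  refine LinearEquiv.ext fun v => ?_
  change tripleExp (S.dualAct (KM.e k A i) ((S.split hB).res.obj X)) (X.act (KM.fB A (hB hi))) v =
    tripleExp _ _ v
  rw [dualAct_res hB hi]
  rfl

/-- The local monodromies satisfy the braid relations. -/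
lemma IsIntegrable.monodromy_braid [Fintype I] (hA : IsGCM A) (hf : IsInvariantForm k A d form)
    (hd : ∀ i, d i ≠ 0) {X : DY (S.δ B)} (hX : S.IsIntegrable X) {i j : I} (hij : i ≠ j)
    (hi : i ∈ B) (hj : j ∈ B) :
    altProd (hX.monodromy hi) (hX.monodromy hj) (weylOrder k A i j) =
      altProd (hX.monodromy hj) (hX.monodromy hi) (weylOrder k A i j) := by
  rcases exists_isFiniteRankTwo hA hij with ⟨m, hm⟩ | h
  · rw [weylOrder_of_isFiniteRankTwo hA hij hm]
    obtain ⟨ρ, hρ, -⟩ := hX.exists_hom hf hd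
    have P := KM.isPair (k := k) hA S.isStdForm hij hi hj
    have key : ∀ {l : I} (hl : l ∈ B), ∃ (he : LocallyNilpotent (ρ ⟨KM.e k A l, KM.e_mem_sub A hl⟩))
        (hf : LocallyNilpotent (ρ ⟨KM.f k A l, KM.f_mem_sub hl⟩)),
        hX.monodromy hl = tripleEquiv he hf := by
      intro l hl
      have he := hX.e_nilpotent l hl
      have hf := hX.f_nilpotent l hl
      have e₁ : ρ ⟨KM.e k A l, KM.e_mem_sub A hl⟩ = S.dualAct (KM.e k A l) X := hρ.2 l hl
      have e₂ : ρ ⟨KM.f k A l, KM.f_mem_sub hl⟩ = X.act (KM.fB A hl) := hρ.1 (KM.fB A hl)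
      refine ⟨by rw [e₁]; exact he, by rw [e₂]; exact hf, LinearEquiv.ext fun v => ?_⟩
      rw [tripleEquiv_apply, e₁, e₂, hX.monodromy_apply]
    obtain ⟨he₁, hf₁, h₁⟩ := key hi
    obtain ⟨he₂, hf₂, h₂⟩ := key hj
    rw [h₁, h₂]
    exact P.altProd_tripleEquiv he₁ hf₁ he₂ hf₂ hm rfl rfl
  · rw [weylOrder_of_four_le hA hij h]
    simp only [altProd]

namespace Family

variable (Q : S.Family)

/-- The operator on a module underlying an automorphism of the restriction functor. -/
noncomputable def evalAut {B' : Set I} (hB : B' ⊆ B) (X : (Q.P B).FullSubcategory) :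
    Aut (Q.resFun hB) →* (X.obj.V ≃ₗ[k] X.obj.V) where
  toFun a := (S.split hB).resAut X.obj ((Q.P B').ι.mapIso (a.app X))
  map_one' := rfl
  map_mul' _ _ := rfl

/-- Reduces the braid relations between natural automorphisms to identities of linear operators. -/
lemma evalAut_injective {B' : Set I} (hB : B' ⊆ B) {a b : Aut (Q.resFun hB)}
    (h : ∀ X, Q.evalAut hB X a = Q.evalAut hB X b) : a = b :=
  Iso.ext (NatTrans.ext (funext fun X => ObjectProperty.hom_ext _
    (congrArg Iso.hom ((S.split hB).resAut_injective X.obj (h X)))))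

variable (hQ : ∀ (B : Set I) (X : DY (S.δ B)), Q.P B X → S.IsIntegrable X)
include hQ

/-- The local monodromy at `i`. -/
noncomputable def monodromy (i : I) :
    Q.resFun (Set.empty_subset {i}) ≅ Q.resFun (Set.empty_subset {i}) :=
  NatIso.ofComponents (fun X => (Q.P ∅).isoMk ((S.split (Set.empty_subset {i})).zeroIso X.obj
      ((hQ _ X.obj X.property).monodromy (Set.mem_singleton i))))
    fun {X Y} f => ObjectProperty.hom_ext _ ((S.split (Set.empty_subset {i})).zeroIso_naturality
      f.hom ((hQ _ X.obj X.property).monodromy_comm (hQ _ Y.obj Y.property)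
        (Set.mem_singleton i) f.hom))

/-- The automorphism of the restriction functor given by the local monodromy at `i`. -/
noncomputable def localAut {i : I} (hi : {i} ⊆ B) : Aut (Q.resFun (Set.empty_subset B)) :=
  (Q.resComp hi (Set.empty_subset {i})).symm ≪≫
    Functor.isoWhiskerLeft (Q.resFun hi) (Q.monodromy hQ i) ≪≫
    Q.resComp hi (Set.empty_subset {i})

/-- The associators are identities on vectors, and e_i, f_i act on the restriction as on the module
itself. -/
lemma evalAut_localAut {i : I} (hi : {i} ⊆ B) (X : (Q.P B).FullSubcategory) :
    Q.evalAut (Set.empty_subset B) X (Q.localAut hQ hi) =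
      (hQ _ X.obj X.property).monodromy (hi (Set.mem_singleton i)) := by
  refine Eq.trans ?_ ((hQ _ X.obj X.property).monodromy_res hi
    (hQ _ _ (Q.res hi X.obj X.property)) (Set.mem_singleton i))
  exact SplitPair.resAut_conj (S.isComp_split hi (Set.empty_subset {i})) X.obj _

variable [Fintype I]

lemma localAut_braid (hA : IsGCM A) (hf : IsInvariantForm k A d form) (hd : ∀ i, d i ≠ 0)
    {i j : I} (hi : {i} ⊆ B) (hj : {j} ⊆ B) (hij : i ≠ j) :
    altProd (Q.localAut hQ hi) (Q.localAut hQ hj) (weylOrder k A i j) =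
      altProd (Q.localAut hQ hj) (Q.localAut hQ hi) (weylOrder k A i j) := by
  refine Q.evalAut_injective _ fun X => ?_
  rw [map_altProd, map_altProd, evalAut_localAut, evalAut_localAut]
  exact (hQ _ X.obj X.property).monodromy_braid hA hf hd hij _ _

lemma monodromy_coproduct (i : I) (X Y : (Q.P {i}).FullSubcategory) :
    ((Q.monodromy hQ i).hom.app X ⊗ₘ (Q.monodromy hQ i).hom.app Y) ≫
        (β_ ((Q.resFun (Set.empty_subset {i})).obj Y)
          ((Q.resFun (Set.empty_subset {i})).obj X)).inv ≫
        Functor.LaxMonoidal.μ (Q.resFun (Set.empty_subset {i})) Y X =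
      Functor.LaxMonoidal.μ (Q.resFun (Set.empty_subset {i})) X Y ≫
        (Q.monodromy hQ i).hom.app (X ⊗ Y) ≫
        (Q.resFun (Set.empty_subset {i})).map (β_ Y X).inv :=
  ObjectProperty.hom_ext _ ((S.split (Set.empty_subset {i})).zeroIso_tensor
    ((hQ _ X.obj X.property).monodromy_tensor (hQ _ Y.obj Y.property)
      (hQ _ _ (X ⊗ Y).property) (Set.mem_singleton i)))

/-- The Coxeter structure with the triple exponentials as local monodromies. -/
noncomputable def coxeter (hA : IsGCM A) (hf : IsInvariantForm k A d form) (hd : ∀ i, d i ≠ 0) :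
    BraidedCoxeter Q.data (weylOrder k A) where
  toPreCoxeter := Q.preCoxeter
  S i _ _ := Q.monodromy hQ i
  S_natural i _ _ _ _ := (Iso.refl_trans (Q.monodromy hQ i)).trans
    (Iso.trans_refl (Q.monodromy hQ i)).symm
  braid _ _ _ hi hj hij _ _ _ _ _ := Q.localAut_braid hQ hA hf hd hi hj hij
  coproduct i _ X Y := Q.monodromy_coproduct hQ i X Y

lemma isTripleExp_coxeter (hA : IsGCM A) (hf : IsInvariantForm k A d form) (hd : ∀ i, d i ≠ 0) :
    Q.IsTripleExp (Q.coxeter hQ hA hf hd) := fun _ _ _ _ _ => rfl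

end Family
end Standard
end CoxeterDY

/-! ### The proposition -/

theorem mainTheorem7 {k : Type u} [Field k] [CharZero k] {I : Type v} [Fintype I] [DecidableEq I]
    (A : Matrix I I ℤ) (hA : IsGCM A) (d : I → k) (hd : ∀ i, d i ≠ 0)
    (hAd : ∀ i j, (A i j : k) * d j = A j i * d i)
    (form : LinearMap.BilinForm k (Cartan k I)) (hform : IsInvariantForm k A d form) :
    IsLabelling (dynkin A) (weylOrder k A) ∧
    ∃ S : Standard A d form, (∀ S' : Standard A d form, S' = S) ∧
      -- the pre-Coxeter structure on all Drinfeld-Yetter modules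
      S.all.data.IsSymmetric ∧
      (∃ P : PreCoxeter S.all.data, S.all.IsTrivial P) ∧
      -- the Coxeter structure on integrable Drinfeld-Yetter modules
      S.int.data.IsSymmetric ∧
      (∃ C : BraidedCoxeter S.int.data (weylOrder k A),
        S.int.IsTrivial C.toPreCoxeter ∧ S.int.IsTripleExp C) ∧
      -- the Coxeter structure on integrable category `O_∞`
      S.intO.data.IsSymmetric ∧
      (∃ C : BraidedCoxeter S.intO.data (weylOrder k A),
        S.intO.IsTrivial C.toPreCoxeter ∧ S.intO.IsTripleExp C) ∧
      -- integrable Drinfeld-Yetter modules correspond to modules over the Kac-Moody algebra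
      (∀ (B : Set I) (X : DY (S.δ B)), S.IsIntegrable X →
        ∃! ρ : KM.sub k A B →ₗ⁅k⁆ Module.End k X.V, S.Corresponds ρ X.str) ∧
      (∀ (B : Set I) (X Y : DY (S.δ B)) (ρ : KM.sub k A B →ₗ⁅k⁆ Module.End k X.V)
        (σ : KM.sub k A B →ₗ⁅k⁆ Module.End k Y.V), S.IsIntegrable X → S.IsIntegrable Y →
        S.Corresponds ρ X.str → S.Corresponds σ Y.str →
        S.Corresponds (DY.tensorAct ρ σ) (X ⊗ Y).str ∧
        ∀ f : X.V →ₗ[k] Y.V, (∃ g : X ⟶ Y, g.lin = f) ↔ ∀ x v, f (ρ x v) = σ x (f v)) ∧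
      -- the modules in integrable category `O_∞` are integrable Drinfeld-Yetter modules
      (∀ (B : Set I) (X : DY (S.δ B)) (ρ : KM.sub k A B →ₗ⁅k⁆ Module.End k X.V),
        S.IsIntegrableO X → S.Corresponds ρ X.str → IsIntegrableOModule A B ρ) ∧
      (∀ (B : Set I) (M : Type u) [AddCommGroup M] [Module k M]
        (ρ : KM.sub k A B →ₗ⁅k⁆ Module.End k M), IsIntegrableOModule A B ρ →
        ∃! s : DYStructure (S.δ B) M, S.IsIntegrableO ⟨M, s⟩ ∧ S.Corresponds ρ s) := by
  refine ⟨isLabelling_weylOrder hA, ?_⟩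
  obtain ⟨S⟩ := exists_standard hd hform
  -- The Coxeter structure is built for any stable family of integrable modules, so one construction
  -- serves both categories and restricts from one to the other.
  have hint : ∀ (B : Set I) (X : DY (S.δ B)), S.int.P B X → S.IsIntegrable X := fun _ _ h => h
  have hintO : ∀ (B : Set I) (X : DY (S.δ B)), S.intO.P B X → S.IsIntegrable X :=
    fun _ _ h => Standard.IsIntegrableO.toIsIntegrable h
  exact ⟨S, standard_unique hform S, S.all.isSymmetric_data,
    ⟨S.all.preCoxeter, S.all.isTrivial_preCoxeter⟩, S.int.isSymmetric_data,
    ⟨S.int.coxeter hint hA hform hd, S.int.isTrivial_preCoxeter,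
      S.int.isTripleExp_coxeter hint hA hform hd⟩, S.intO.isSymmetric_data,
    ⟨S.intO.coxeter hintO hA hform hd, S.intO.isTrivial_preCoxeter,
      S.intO.isTripleExp_coxeter hintO hA hform hd⟩,
    fun _ _ hX => hX.existsUnique_hom hform hd,
    fun _ _ _ _ _ hX hY hρ hσ => ⟨hρ.tensor hσ, hρ.hom_iff hform hd hX hY hσ⟩,
    fun _ _ _ hX hρ => hρ.isIntegrableOModule hX,
    fun _ _ _ _ _ hρ => hρ.existsUnique_str S hform hd⟩
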